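/- **Proposition.** Let $(N^6,g_N,J,\omega,\Omega)$ be a (non-empty) nearly Kähler $6$-manifold, i.e. an $\mathrm{SU}(3)$-structure with $\omega=g_N(J\cdot,\cdot)$, $\Omega$ a $(3,0)$-form, $\mathrm{vol}_{g_N}=\tfrac16\omega^3=\tfrac i8\,\Omega\wedge\overline\Omega$, and $d\omega=-3\operatorname{Re}\Omega$, $d\operatorname{Im}\Omega=2\omega^2$. Let $M=(0,\infty)\times N$ with the cone metric $g=dr^2+r^2g_N$, and let $\overline\varphi=r^3\operatorname{Re}\Omega-r^2\,dr\wedge\omega$, $\overline\psi=\star\overline\varphi$ be the corresponding $\mathrm{G}_2$-structure. For a smooth function $f$ and a vector field $X$ on $M$ with $f^2+|X|^2=1$, let $$\varphi=(f^2-|X|^2)\overline\varphi-2f\,X\lrcorner\overline\psi+2X^\flat\wedge(X\lrcorner\overline\varphi)$$ be the associated $\mathrm{G}_2$-structure with the same metric $g$ and orientation, with $\psi=\star\varphi$ and torsion tensor $T$, $\nabla_p\varphi_{ijk}=T_{pq}\psi_{qijk}$. For a vector field $Y$ and $c\in\mathbb R$, the triple $(\varphi,Y,c)$ is an isometric soliton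 if $$\mathcal L_Yg=2c\,g,\qquad \operatorname{div}T=-\tfrac12\operatorname{curl}_\varphi Y+Y\lrcorner T,$$ where $(\operatorname{div}T)_k=\nabla_iT_{ik}$, $(\operatorname{curl}_\varphi Y)_k=\nabla_iY_j\,\varphi_{ijk}$ and $(Y\lrcorner T)_k=Y_pT_{pk}$. (1) Let $X=a(r)\frac{\partial}{\partial r}$ and $Y=b(r)\frac{\partial}{\partial r}$ with $a,b$ smooth on $(0,\infty)$, so $f^2=1-a^2$, and suppose that $(\varphi,Y,c)$ is an isometric soliton. Then $b(r)=cr$ for all $r>0$, and at every point where $f\neq0$ $$a''+\frac{a}{f^2}(a')^2+(6-cr^2)\frac{a'}{r}=6\,\frac{f^2}{r^2}\,a \tag{$*$}$$ and $$\tfrac14|T|^2=\frac{(a')^2}{f^2}+6\,\frac{a^2}{r^2}.$$ (2) For all $c,s\in\mathbb R$ there is exactly one pair of smooth functions $a,f:\mathbb R\to\mathbb R$ with $f^2+a^2=1$, $a(0)=0$, $f(0)=1$, $a'(0)=s$ such that $(*)$ holds at every $r\neq0$ with $f(r)\neq0$. Moreover $a$ is odd and $f$ is even, and $f=f(r)$,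 $X=a(r)\frac{\partial}{\partial r}$, $Y=cr\frac{\partial}{\partial r}$ define an isometric soliton $(\varphi,Y,c)$ on $M$. If $c\le0$, its torsion satisfies $\lim_{r\to\infty}|T|^2=0$; if $c>0$ and $s\neq0$, then $\lim_{r\to\infty}|T|^2=\infty$ (both limits uniformly on $N$). -/

import Mathlib

open scoped Manifold ContDiff Topology

noncomputable section

namespace ConeSoliton

/-! ### Pointwise multilinear algebra -/

/-- The wedge product of a `k`-form and an `l`-form on a vector space (forms being regarded as
functions of `k`, respectively `l`, vectors), with the convention
`(α ∧ β)(v₁, …) = 1 / (k! l!) * ∑_σ sign(σ) α(v_σ(1), …, v_σ(k)) β(v_σ(k+1), …, v_σ(k+l))`. -/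
def wedge {V R : Type*} [Field R] {k l : ℕ} (α : (Fin k → V) → R) (β : (Fin l → V) → R) :
    (Fin (k + l) → V) → R := fun v =>
  ((k.factorial : R) * (l.factorial : R))⁻¹ *
    ∑ σ : Equiv.Perm (Fin (k + l)), ((Equiv.Perm.sign σ : ℤ) : R) *
      (α (fun i => v (σ (Fin.castAdd l i))) * β (fun j => v (σ (Fin.natAdd k j))))

/-! ### Tensor calculus on a manifold

At a point `p`, everything is computed in the preferred chart `extChartAt I p`. Mathlib's tangent
space `TangentSpace I p` is the model space `E`, a tangent vector being identified with its
components in that same chart, so the components at `p` of a tensor in this chart are its values on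
elements of `TangentSpace I p`. -/

section Manifold

variable {E : Type*} [NormedAddCommGroup E] [NormedSpace ℝ E] {H : Type*} [TopologicalSpace H]
  (I : ModelWithCorners ℝ E H) {M : Type*} [TopologicalSpace M] [ChartedSpace H M]

/-- For the chart at `p`, the coordinate isomorphism from the model space to the tangent space at
the point with coordinates `y` (it maps `v` to the vector with constant components `v`). -/
def coordVec (p : M) (y : E) : E →L[ℝ] TangentSpace I ((extChartAt I p).symm y) :=
  mfderivWithin 𝓘(ℝ, E) I (extChartAt I p).symm (Set.range I) y

/-- The expression of a differential form in the chart at `p`. -/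
def formInChart {F : Type*} [NormedAddCommGroup F] [NormedSpace ℝ F] {k : ℕ}
    (α : ∀ q : M, TangentSpace I q [⋀^Fin k]→L[ℝ] F) (p : M) (y : E) : E [⋀^Fin k]→L[ℝ] F :=
  (α ((extChartAt I p).symm y)).compContinuousLinearMap (coordVec I p y)

/-- Smoothness of a differential form: its expression in each preferred chart is smooth. -/
def SmoothForm {F : Type*} [NormedAddCommGroup F] [NormedSpace ℝ F] {k : ℕ}
    (α : ∀ q : M, TangentSpace I q [⋀^Fin k]→L[ℝ] F) : Prop :=
  ∀ p : M, ContDiffOn ℝ ∞ (formInChart I α p) (extChartAt I p).target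

/-- The exterior derivative of a differential form at `p`. -/
def extDerivForm {F : Type*} [NormedAddCommGroup F] [NormedSpace ℝ F] {k : ℕ}
    (α : ∀ q : M, TangentSpace I q [⋀^Fin k]→L[ℝ] F) (p : M) :
    (Fin (k + 1) → TangentSpace I p) → F :=
  fun v => extDeriv (formInChart I α p) (extChartAt I p p) v

variable (M) in
/-- Covariant `k`-tensor fields, regarded as functions of `k` tangent vectors at each point. -/
abbrev Tensor (k : ℕ) := ∀ p : M, (Fin k → TangentSpace I p) → ℝ

variable (M) in
/-- Fields of bilinear forms on the tangent spaces (used for Riemannian metrics). -/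
abbrev Bilinear := ∀ p : M, TangentSpace I p → TangentSpace I p → ℝ

variable (M) in
/-- Vector fields. -/
abbrev VectorField := ∀ p : M, TangentSpace I p

variable {I}

/-- The derivative at `p`, in the direction `u`, of the component `g(v, w)` of the metric in the
chart at `p` (that is `u^i v^j w^k ∂_i g_jk`). -/
def metricDeriv (g : Bilinear I M) (p : M) (u v w : TangentSpace I p) : ℝ :=
  fderiv ℝ (fun y : E => g ((extChartAt I p).symm y) (coordVec I p y v) (coordVec I p y w))
    (extChartAt I p p) u

/-- Orthonormal frames of the tangent space at a point of a `7`-manifold. -/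
def IsOrthonormalFrame (g : Bilinear I M) (p : M) (e : Fin 7 → TangentSpace I p) : Prop :=
  ∀ i j, g p (e i) (e j) = if i = j then 1 else 0

/-- Some orthonormal frame at `p`; it is only used in contractions that do not depend on it. -/
def frame (g : Bilinear I M) (p : M) : Fin 7 → TangentSpace I p :=
  Classical.epsilon (IsOrthonormalFrame g p)

/-- The Christoffel symbols of the Levi-Civita connection in the chart at `p`: the vector
`Γ(u, v)` with `g(Γ(u, v), w) = (∂_u g(v, w) + ∂_v g(u, w) - ∂_w g(u, v)) / 2`. -/
def christoffel (g : Bilinear I M) (p : M) (u v : TangentSpace I p) : TangentSpace I p :=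
  ∑ i, ((metricDeriv g p u v (frame g p i) + metricDeriv g p v u (frame g p i)
    - metricDeriv g p (frame g p i) u v) / 2) • frame g p i

/-- The Levi-Civita covariant derivative `∇A` of a covariant `k`-tensor; the first slot is the
direction of differentiation. -/
def covDeriv (g : Bilinear I M) {k : ℕ} (A : Tensor I M k) : Tensor I M (k + 1) := fun p w =>
  fderiv ℝ (fun y : E => A ((extChartAt I p).symm y) (fun i => coordVec I p y (w i.succ)))
      (extChartAt I p p) (w 0)
    - ∑ i : Fin k, A p (Function.update (fun j => w j.succ) i (christoffel g p (w 0) (w i.succ)))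

/-- The components of a vector field in the chart at `p`. -/
def vectorInChart (Y : VectorField I M) (p : M) (y : E) : E :=
  mfderiv I 𝓘(ℝ, E) (extChartAt I p) ((extChartAt I p).symm y) (Y ((extChartAt I p).symm y))

/-- The Lie derivative of the metric, in components
`(ℒ_Y g)_ij = Y^k ∂_k g_ij + g_kj ∂_i Y^k + g_ik ∂_j Y^k`. -/
def lieDerivMetric (Y : VectorField I M) (g : Bilinear I M) (p : M)
    (u v : TangentSpace I p) : ℝ :=
  metricDeriv g p (Y p) u v
    + g p (fderiv ℝ (vectorInChart Y p) (extChartAt I p p) u : E) v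
    + g p u (fderiv ℝ (vectorInChart Y p) (extChartAt I p p) v : E)

/-- The metric dual `Y♭` of a vector field. -/
def flat (g : Bilinear I M) (Y : VectorField I M) : Tensor I M 1 := fun p w => g p (Y p) (w 0)

/-- The interior product `X ⌟ A`, the contraction with the first slot. -/
def interior (X : VectorField I M) {k : ℕ} (A : Tensor I M (k + 1)) : Tensor I M k :=
  fun p w => A p (Matrix.vecCons (X p) w)

/-- The Hodge star of a `3`-form on a `7`-manifold, with respect to the metric `g` and the
Riemannian volume form `vol` (which fixes the orientation). -/
def hodge (g : Bilinear I M) (vol : Tensor I M 7) (φ : Tensor I M 3) : Tensor I M 4 := fun p w =>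
  (1 / 6) * ∑ i, ∑ j, ∑ k, φ p ![frame g p i, frame g p j, frame g p k] *
    vol p ![frame g p i, frame g p j, frame g p k, w 0, w 1, w 2, w 3]

/-- The full torsion tensor of a `G₂`-structure `φ` with metric `g` and volume form `vol`:
`T_pq = (1/24) ∇_p φ_ijk ψ_qijk` with `ψ = ⋆φ`, which is equivalent to
`∇_p φ_ijk = T_pq ψ_qijk`. -/
def torsion (g : Bilinear I M) (vol : Tensor I M 7) (φ : Tensor I M 3) : Tensor I M 2 :=
  fun p w => (1 / 24) * ∑ i, ∑ j, ∑ k,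
    covDeriv g φ p ![w 0, frame g p i, frame g p j, frame g p k] *
      hodge g vol φ p ![w 1, frame g p i, frame g p j, frame g p k]

/-- The squared norm `|T|² = T_pq T_pq` of a `2`-tensor. -/
def normSq (g : Bilinear I M) (T : Tensor I M 2) (p : M) : ℝ :=
  ∑ i, ∑ j, T p ![frame g p i, frame g p j] ^ 2

/-- The divergence `(div T)_k = ∇_i T_ik` of a `2`-tensor. -/
def divergence (g : Bilinear I M) (T : Tensor I M 2) : Tensor I M 1 := fun p w =>
  ∑ i, covDeriv g T p ![frame g p i, frame g p i, w 0]

/-- The curl `(curl_φ Y)_k = ∇_i Y_j φ_ijk` of a vector field (lowered to a `1`-form). -/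
def curl (g : Bilinear I M) (φ : Tensor I M 3) (Y : VectorField I M) : Tensor I M 1 := fun p w =>
  ∑ i, ∑ j, covDeriv g (flat g Y) p ![frame g p i, frame g p j] *
    φ p ![frame g p i, frame g p j, w 0]

/-- The `G₂`-structure isometric to `φ₀` that is determined by `f` and `X` with `f² + |X|² = 1`:
`φ = (f² - |X|²) φ₀ - 2 f X ⌟ ψ₀ + 2 X♭ ∧ (X ⌟ φ₀)`, where `ψ₀ = ⋆φ₀`. -/
def isometricStructure (g : Bilinear I M) (vol : Tensor I M 7) (φ₀ : Tensor I M 3)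
    (f : M → ℝ) (X : VectorField I M) : Tensor I M 3 := fun p w =>
  (f p ^ 2 - g p (X p) (X p)) * φ₀ p w
    - 2 * f p * interior X (hodge g vol φ₀) p w
    + 2 * wedge (flat g X p) (interior X φ₀ p) w

/-- The isometric soliton system for `(φ, Y, c)`:
`ℒ_Y g = 2 c g` and `div T = - (1/2) curl_φ Y + Y ⌟ T`. -/
def IsIsometricSoliton (g : Bilinear I M) (vol : Tensor I M 7) (φ : Tensor I M 3)
    (Y : VectorField I M) (c : ℝ) : Prop :=
  (∀ p u v, lieDerivMetric Y g p u v = 2 * c * g p u v) ∧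
  (∀ p w, divergence g (torsion g vol φ) p w
    = -(1 / 2) * curl g φ Y p w + interior Y (torsion g vol φ) p w)

end Manifold

/-! ### Nearly Kähler `6`-manifolds -/

/-- The model space of `6`-manifolds. -/
abbrev E6 := EuclideanSpace ℝ (Fin 6)

/-- A nearly Kähler structure on a `6`-manifold: an `SU(3)`-structure
`(metric, J, ω, Ω)`, `ω = kform` and `Ω = hform`, with
`dω = -3 Re Ω` and `d(Im Ω) = 2 ω²`. (Smoothness of `J` follows from that of `g` and `ω`, and `Ω`
vanishes nowhere by the volume condition; `ω³ / 6` is the volume form of `g` for the orientation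
given by `J`.) -/
structure NearlyKahler (N : Type*) [TopologicalSpace N] [ChartedSpace E6 N]
    [IsManifold (𝓡 6) ∞ N] where
  metric : Bundle.ContMDiffRiemannianMetric (𝓡 6) ∞ E6 (fun x : N => TangentSpace (𝓡 6) x)
  J : ∀ x : N, TangentSpace (𝓡 6) x →L[ℝ] TangentSpace (𝓡 6) x
  kform : ∀ x : N, TangentSpace (𝓡 6) x [⋀^Fin 2]→L[ℝ] ℝ
  hform : ∀ x : N, TangentSpace (𝓡 6) x [⋀^Fin 3]→L[ℝ] ℂ
  J_sq : ∀ x v, J x (J x v) = -v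
  J_isometry : ∀ x u v, metric.inner x (J x u) (J x v) = metric.inner x u v
  kform_eq : ∀ x u v, kform x ![u, v] = metric.inner x (J x u) v
  smooth_kform : SmoothForm (𝓡 6) kform
  smooth_hform : SmoothForm (𝓡 6) hform
  /-- `Ω` is of type `(3,0)`. -/
  hform_type : ∀ x u v w, hform x ![J x u, v, w] = Complex.I * hform x ![u, v, w]
  /-- `ω³ / 6 = (i / 8) Ω ∧ Ω̄`. -/
  volume_eq : ∀ x (v : Fin 6 → TangentSpace (𝓡 6) x),
    (((1 / 6) * wedge (wedge (kform x) (kform x)) (kform x) v : ℝ) : ℂ)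
      = Complex.I / 8 * wedge (hform x) (fun w => (starRingEnd ℂ) (hform x w)) v
  d_kform : ∀ x v, extDerivForm (𝓡 6) kform x v = -3 * (hform x v).re
  d_im_hform : ∀ x v,
    extDerivForm (𝓡 6) (fun y => Complex.imCLM.compContinuousAlternatingMap (hform y)) x v
      = 2 * wedge (kform x) (kform x) v

/-! ### The cone -/

/-- The half-line `(0, ∞)`. -/
abbrev HalfLine : TopologicalSpace.Opens ℝ := ⟨Set.Ioi 0, isOpen_Ioi⟩

/-- The manifold `(0, ∞) × N`. -/
abbrev Cone (N : Type*) := HalfLine × N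

/-- The model with corners of the cone. -/
abbrev coneModel := 𝓘(ℝ, ℝ).prod (𝓡 6)

section Cone

variable {N : Type*} [TopologicalSpace N] [ChartedSpace E6 N] [IsManifold (𝓡 6) ∞ N]

/-- The `1`-form `dr` at a point of the cone, as a linear form. -/
def dr (q : Cone N) : TangentSpace coneModel q →L[ℝ] ℝ := ContinuousLinearMap.fst ℝ ℝ E6

/-- The differential of the projection of the cone to `N`. -/
def dπ (q : Cone N) : TangentSpace coneModel q →L[ℝ] TangentSpace (𝓡 6) q.2 :=
  ContinuousLinearMap.snd ℝ ℝ E6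

/-- The radial vector field `a(r) ∂/∂r`. -/
def radialField (N : Type*) [TopologicalSpace N] [ChartedSpace E6 N] (a : ℝ → ℝ) :
    VectorField coneModel (Cone N) := fun q => ((a q.1, 0) : ℝ × E6)

variable (S : NearlyKahler N)

/-- The cone metric `dr² + r² g_N`. -/
def coneMetric : Bilinear coneModel (Cone N) := fun q u v =>
  dr q u * dr q v + (q.1 : ℝ) ^ 2 * S.metric.inner q.2 (dπ q u) (dπ q v)

/-- The `G₂`-structure `r³ Re Ω - r² dr ∧ ω` on the cone. -/
def conePhi : Tensor coneModel (Cone N) 3 := fun q w =>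
  (q.1 : ℝ) ^ 3 * (S.hform q.2 (fun i => dπ q (w i))).re
    - (q.1 : ℝ) ^ 2 * wedge (k := 1) (l := 2) (fun v => dr q (v 0))
        (fun v => S.kform q.2 (fun i => dπ q (v i))) w

/-- The Riemannian volume form `r⁶ dr ∧ ω³ / 6` of the cone metric, for the orientation induced
by the `G₂`-structure. -/
def coneVol : Tensor coneModel (Cone N) 7 := fun q w =>
  (q.1 : ℝ) ^ 6 * wedge (k := 1) (l := 6) (fun v => dr q (v 0))
    (fun v => (1 / 6) *
      wedge (k := 4) (l := 2) (wedge (S.kform q.2) (S.kform q.2)) (S.kform q.2) (fun i => dπ q (v i))) w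

/-- The isometric `G₂`-structure on the cone given by a function `f` and `X = a(r) ∂/∂r`. -/
def solitonPhi (f : Cone N → ℝ) (a : ℝ → ℝ) : Tensor coneModel (Cone N) 3 :=
  isometricStructure (coneMetric S) (coneVol S) (conePhi S) f (radialField N a)

/-- `(f, X, Y, c)`, with `X = a(r) ∂/∂r` and `Y = b(r) ∂/∂r`, is an isometric soliton
on the cone. -/
def IsConeSoliton (f : Cone N → ℝ) (a b : ℝ → ℝ) (c : ℝ) : Prop :=
  IsIsometricSoliton (coneMetric S) (coneVol S) (solitonPhi S f a) (radialField N b) c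

/-- The squared norm `|T|²` of the torsion of the isometric structure given by `(f, a(r) ∂/∂r)`. -/
def torsionNormSq (f : Cone N → ℝ) (a : ℝ → ℝ) (q : Cone N) : ℝ :=
  normSq (coneMetric S) (torsion (coneMetric S) (coneVol S) (solitonPhi S f a)) q

end Cone

/-! ### The soliton equation -/

/-- The equation `a'' + (a / f²) (a')² + (6 - c r²) a' / r = 6 (f² / r²) a` at `r`, where `y` is
the value of `f`. -/
def SolitonODE (c : ℝ) (a : ℝ → ℝ) (r y : ℝ) : Prop :=
  deriv (deriv a) r + a r / y ^ 2 * (deriv a r) ^ 2 + (6 - c * r ^ 2) * (deriv a r / r)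
    = 6 * (y ^ 2 / r ^ 2) * a r

/-- Global smooth solutions `(a, f)` of the soliton equation with `f² + a² = 1`, through the
singular point `r = 0`, with `a(0) = 0`, `f(0) = 1` and `a'(0) = s`. The equation is imposed where
it makes sense, that is where `r ≠ 0` and `f ≠ 0`. -/
structure IsGlobalSolution (c s : ℝ) (a f : ℝ → ℝ) : Prop where
  smooth_a : ContDiff ℝ ∞ a
  smooth_f : ContDiff ℝ ∞ f
  sq_add_sq : ∀ r, f r ^ 2 + a r ^ 2 = 1
  a_zero : a 0 = 0
  f_zero : f 0 = 1
  deriv_zero : deriv a 0 = s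
  ode : ∀ r, r ≠ 0 → f r ≠ 0 → SolitonODE c a r (f r)

end ConeSoliton

end

/-! ### The angle equation: equivalence with the soliton equation, and uniqueness through the
singular point. -/

namespace ConeSoliton

open Real Set Filter

/-! Everything becomes transparent after writing `a = sin θ`, `f = cos θ`. A radial `X` leaves `ω`
alone and only rotates the complex volume form: `φ = r³ Re(c Ω) - r² dr ∧ ω` with phase `c = (f - i
a)² = exp(-2iθ)` (`solitonPhi_eq`). The cone structure itself is parallel, so the torsion comes only
from the rotation: `T = -2θ' dr ⊗ dr + r (Im c · g_N + (Re c - 1) ω)` (`torsion_cone`). Hence `|T|²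
= 4 θ'² + 24 sin²θ / r²`, and `div T` and `Y ⌟ T` are multiples of `dr`. The curl of a radial field
vanishes because `∇Y♭` is symmetric, and `ℒ_Y g = 2cg` forces `b = c r`. The soliton system is then
the single equation `θ'' + (6/r - c r) θ' = 3 sin(2θ) / r²` (`IsLocalAngle.soliton_iff`), which is
`(*)` divided by `cos θ`.

The geometric input is the Levi-Civita derivative of `ω` and `Ω` on the nearly Kähler manifold,
although only `dω` and `d Im Ω` are given. The equation `d Re Ω = 0` follows from `d(dω) = 0`.
Subtracting the expected values `∇ω = -Re Ω` and `∇Ω = h(u,·) ∧ ω` leaves the pointwise data of an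
`SU(3)`-structure with both forms closed, and pure algebra shows that such data vanish
(`IsClosedJet.eq_zero`, `IsNearlyKahlerJet.eq`). The derivative of the norm of `Ω` enters through
the volume condition. Contractions with `ψ` and with the volume form are evaluated in adapted
frames, where all components are integers in finite tables checked by computation.

On the analytic side, `r = 0` is a regular singular point with exponents `1` and `-6`. Uniqueness
(`IsAngleSolution.eq_of_pos`) is a Gronwall estimate in variables that diagonalise the linear part.
For existence, `v = θ / r` satisfies `v'' + 8 v'/r = F(r, v, v')`, an integral equation without
singularity; a modification of the nonlinear term makes it globally Lipschitz, a contraction in a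
weighted sup norm solves it, and an a priori bound removes the modification
(`exists_volterra_solution`, `exists_integral_solution`). Uniqueness and the symmetry `(r, θ) ↦ (-r,
-θ)` give the parities.

For `c ≤ 0` the energy `r² θ'²/2 - 3 sin²θ` does not increase from its value `0` at the origin, so
`θ'² ≤ 6/r²` and the torsion decays (`IsAngleSolution.sq_deriv_le`). For `c > 0` and `s > 0` the
angle must cross `π/2`. Its Wronskian with the explicit solution `1/r² - c/3` of the linearization
at `π/2` shows that this happens only where `c r² > 3`; afterwards the Wronskian stays above a
positive constant, which forces `θ'` to grow like a multiple of `r⁻⁶ exp(c r²/2)` at least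
(`IsAngleSolution.tendsto_deriv`). The case `s < 0` follows by changing the sign of `θ`. -/

/-- The soliton equation in terms of the angle `θ` with `a = sin θ` and `f = cos θ`. -/
def AngleODE (c : ℝ) (θ : ℝ → ℝ) (r : ℝ) : Prop :=
  deriv (deriv θ) r + (6 / r - c * r) * deriv θ r = 3 * sin (2 * θ r) / r ^ 2

/-- Smooth solutions of the soliton equation for the angle through the singular point `0`. -/
structure IsAngleSolution (c s : ℝ) (θ : ℝ → ℝ) : Prop where
  smooth : ContDiff ℝ ∞ θ
  zero : θ 0 = 0
  deriv_zero : deriv θ 0 = s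
  ode : ∀ r, r ≠ 0 → AngleODE c θ r

lemma ContDiff.hasDerivAt_infty {θ : ℝ → ℝ} (h : ContDiff ℝ ∞ θ) (r : ℝ) :
    HasDerivAt θ (deriv θ r) r :=
  ((h.differentiable (by simp)) r).hasDerivAt

lemma ContDiff.deriv_infty {θ : ℝ → ℝ} (h : ContDiff ℝ ∞ θ) : ContDiff ℝ ∞ (deriv θ) :=
  (contDiff_infty_iff_deriv.1 h).2

/-- The pair `(f, a)` is a curve on the unit circle and `θ` is the integral of its angular velocity
`f a' - a f'`. The scalar product of the unit vectors `(f, a)` and `(cos θ, sin θ)` is then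
constant, hence equal to its initial value `1`, and the vectors agree. -/
lemma exists_angle {a f : ℝ → ℝ} (ha : ContDiff ℝ ∞ a) (hf : ContDiff ℝ ∞ f)
    (h : ∀ r, f r ^ 2 + a r ^ 2 = 1) (a0 : a 0 = 0) (f0 : f 0 = 1) :
    ∃ θ : ℝ → ℝ, ContDiff ℝ ∞ θ ∧ θ 0 = 0 ∧ (∀ r, a r = sin (θ r)) ∧ ∀ r, f r = cos (θ r) := by
  have hw : ContDiff ℝ ∞ (fun r => f r * deriv a r - a r * deriv f r) :=
    (hf.mul (ContDiff.deriv_infty ha)).sub (ha.mul (ContDiff.deriv_infty hf))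
  set w : ℝ → ℝ := fun r => f r * deriv a r - a r * deriv f r with hwdef
  set θ : ℝ → ℝ := fun r => ∫ t in (0 : ℝ)..r, w t with hθ
  have hd : ∀ r, HasDerivAt θ (w r) r := fun r =>
    intervalIntegral.integral_hasDerivAt_right (hw.continuous.intervalIntegrable _ _)
      (hw.continuous.stronglyMeasurableAtFilter _ _) hw.continuous.continuousAt
  have hθs : ContDiff ℝ ∞ θ := by
    refine contDiff_infty_iff_deriv.2 ⟨fun r => (hd r).differentiableAt, ?_⟩
    rwa [show deriv θ = w from funext fun r => (hd r).deriv]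
  have hθ0 : θ 0 = 0 := by simp [hθ]
  have hrel : ∀ r, f r * deriv f r + a r * deriv a r = 0 := by
    intro r
    have h1 : HasDerivAt (fun r => f r ^ 2 + a r ^ 2)
        (2 * f r * deriv f r + 2 * a r * deriv a r) r := by
      have := ((ContDiff.hasDerivAt_infty hf r).pow 2).add ((ContDiff.hasDerivAt_infty ha r).pow 2)
      convert! this using 1
      simp
    have h2 : (fun r => f r ^ 2 + a r ^ 2) = fun _ => (1 : ℝ) := funext h
    rw [h2] at h1
    have := h1.unique (hasDerivAt_const r 1)
    linarith
  have hv : ∀ r, f r * cos (θ r) + a r * sin (θ r) = 1 := by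
    have hder : ∀ r, HasDerivAt (fun r => f r * cos (θ r) + a r * sin (θ r)) 0 r := by
      intro r
      have h1 := ((ContDiff.hasDerivAt_infty hf r).mul (hd r).cos).add
        ((ContDiff.hasDerivAt_infty ha r).mul (hd r).sin)
      convert! h1 using 1
      simp only [hwdef]
      have e1 : deriv f r = -a r * w r := by
        simp only [hwdef]; linear_combination (-f r) * hrel r + (-deriv f r) * h r + 2 * f r * hrel r
      have e2 : deriv a r = f r * w r := by
        simp only [hwdef]; linear_combination (-a r) * hrel r + (-deriv a r) * h r + 2 * a r * hrel r
      simp only [hwdef] at e1 e2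
      linear_combination (-cos (θ r)) * e1 - sin (θ r) * e2
    intro r
    have hc := is_const_of_deriv_eq_zero (fun x => (hder x).differentiableAt)
      (fun x => (hder x).deriv) r 0
    simpa [hθ0, a0, f0] using hc
  refine ⟨θ, hθs, hθ0, fun r => ?_, fun r => ?_⟩
  · have := hv r; have := h r; have := sin_sq_add_cos_sq (θ r)
    nlinarith [sq_nonneg (f r - cos (θ r)), sq_nonneg (a r - sin (θ r))]
  · have := hv r; have := h r; have := sin_sq_add_cos_sq (θ r)
    nlinarith [sq_nonneg (f r - cos (θ r)), sq_nonneg (a r - sin (θ r))]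

lemma deriv_sin_comp {θ : ℝ → ℝ} (h : ContDiff ℝ ∞ θ) :
    deriv (fun r => sin (θ r)) = fun r => cos (θ r) * deriv θ r :=
  funext fun r => (ContDiff.hasDerivAt_infty h r).sin.deriv

lemma deriv_cos_comp {θ : ℝ → ℝ} (h : ContDiff ℝ ∞ θ) :
    deriv (fun r => cos (θ r)) = fun r => -sin (θ r) * deriv θ r :=
  funext fun r => (ContDiff.hasDerivAt_infty h r).cos.deriv

lemma deriv_sin_comp_eventuallyEq {θ : ℝ → ℝ} {r : ℝ} (h : ∀ᶠ t in 𝓝 r, DifferentiableAt ℝ θ t) :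
    deriv (fun t => sin (θ t)) =ᶠ[𝓝 r] fun t => cos (θ t) * deriv θ t :=
  h.mono fun _ ht => ht.hasDerivAt.sin.deriv

lemma deriv_deriv_sin_comp {θ : ℝ → ℝ} {r : ℝ} (h : ∀ᶠ t in 𝓝 r, DifferentiableAt ℝ θ t)
    (h' : DifferentiableAt ℝ (deriv θ) r) : deriv (deriv (fun t => sin (θ t))) r
      = cos (θ r) * deriv (deriv θ) r - sin (θ r) * deriv θ r ^ 2 := by
  rw [(deriv_sin_comp_eventuallyEq h).deriv_eq]
  have := h.self_of_nhds.hasDerivAt.cos.mul h'.hasDerivAt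
  refine this.deriv.trans ?_
  ring

/-- For `a = sin θ` the term `-sin θ · θ'²` of `a''` cancels `(a / f²) a'²`; what remains is `cos θ`
times the angle equation. -/
lemma solitonODE_sin_iff_of_eventually {θ : ℝ → ℝ} {r : ℝ} (h : ∀ᶠ t in 𝓝 r, DifferentiableAt ℝ θ t)
    (h' : DifferentiableAt ℝ (deriv θ) r) (c : ℝ) (hr : r ≠ 0) (hc : cos (θ r) ≠ 0) :
    SolitonODE c (fun r => sin (θ r)) r (cos (θ r)) ↔ AngleODE c θ r := by
  unfold SolitonODE AngleODE
  rw [deriv_deriv_sin_comp h h', (deriv_sin_comp_eventuallyEq h).self_of_nhds, sin_two_mul]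
  constructor
  · intro h1
    field_simp at h1 ⊢
    apply mul_left_cancel₀ hc
    linear_combination h1
  · intro h1
    field_simp at h1 ⊢
    linear_combination cos (θ r) * h1

lemma solitonODE_sin_iff {θ : ℝ → ℝ} (h : ContDiff ℝ ∞ θ) (c : ℝ) {r : ℝ} (hr : r ≠ 0)
    (hc : cos (θ r) ≠ 0) :
    SolitonODE c (fun r => sin (θ r)) r (cos (θ r)) ↔ AngleODE c θ r :=
  solitonODE_sin_iff_of_eventually (.of_forall fun t => (ContDiff.hasDerivAt_infty h t).differentiableAt)
    (ContDiff.hasDerivAt_infty (ContDiff.deriv_infty h) r).differentiableAt c hr hc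

/-- Where `f` vanishes, `(*)` says nothing. If zeros of `cos θ` do not fill a neighbourhood of `r`,
the angle equation extends to `r` by continuity. Otherwise `cos θ = 0` near `r`, so `θ` is locally
constant and `sin 2θ = 0`: the equation reads `0 = 0`. -/
lemma angleODE_of_cos_ne_zero {θ : ℝ → ℝ} (h : ContDiff ℝ ∞ θ) (c : ℝ)
    (H : ∀ r, r ≠ 0 → cos (θ r) ≠ 0 → AngleODE c θ r) (r : ℝ) (hr : r ≠ 0) :
    AngleODE c θ r := by
  have c0 := h.continuous
  have c1 := (ContDiff.deriv_infty h).continuous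
  have c2 := (ContDiff.deriv_infty (ContDiff.deriv_infty h)).continuous
  by_cases hfr : ∃ᶠ x in 𝓝 r, cos (θ x) ≠ 0
  · by_contra hne
    have hcont : ContinuousAt (fun x => deriv (deriv θ) x + (6 / x - c * x) * deriv θ x
        - 3 * sin (2 * θ x) / x ^ 2) r := by
      have : r ^ 2 ≠ 0 := pow_ne_zero 2 hr
      fun_prop (disch := assumption)
    have hev := hcont.eventually_ne (show _ ≠ (0 : ℝ) from sub_ne_zero.2 hne)
    obtain ⟨x, hx1, hx2, hx3⟩ := (hfr.and_eventually (hev.and (eventually_ne_nhds hr))).exists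
    exact hx2 (sub_eq_zero.2 (H x hx3 hx1))
  · rw [not_frequently] at hfr
    have hfr : ∀ᶠ x in 𝓝 r, cos (θ x) = 0 := by simpa using hfr
    have hd1 : ∀ᶠ x in 𝓝 r, deriv θ x = 0 := by
      filter_upwards [hfr.eventually_nhds] with x hx
      have h1 : deriv (fun r => cos (θ r)) x = 0 := by
        rw [Filter.EventuallyEq.deriv_eq (f := fun _ => (0 : ℝ)) hx]; simp
      rw [deriv_cos_comp h] at h1
      have h2 := hx.self_of_nhds
      have h3 := sin_sq_add_cos_sq (θ x)
      rw [h2] at h3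
      have h4 : sin (θ x) ≠ 0 := by
        intro h5; rw [h5] at h3; norm_num at h3
      simpa [h4] using h1
    have hd2 : deriv (deriv θ) r = 0 := by
      rw [Filter.EventuallyEq.deriv_eq (f := fun _ => (0 : ℝ)) hd1]; simp
    unfold AngleODE
    rw [hd2, hd1.self_of_nhds, sin_two_mul, hfr.self_of_nhds]
    simp

lemma IsGlobalSolution.exists_angle {c s : ℝ} {a f : ℝ → ℝ} (h : IsGlobalSolution c s a f) :
    ∃ θ, IsAngleSolution c s θ ∧ a = (fun r => sin (θ r)) ∧ f = fun r => cos (θ r) := by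
  obtain ⟨θ, h1, h2, h3, h4⟩ :=
    ConeSoliton.exists_angle h.smooth_a h.smooth_f h.sq_add_sq h.a_zero h.f_zero
  obtain rfl : a = fun r => sin (θ r) := funext h3
  obtain rfl : f = fun r => cos (θ r) := funext h4
  refine ⟨θ, ⟨h1, h2, ?_, ?_⟩, rfl, rfl⟩
  · have := h.deriv_zero
    rw [deriv_sin_comp h1] at this
    simpa [h2] using this
  · exact angleODE_of_cos_ne_zero h1 c fun r hr hc => (solitonODE_sin_iff h1 c hr hc).1 (h.ode r hr hc)

lemma IsAngleSolution.isGlobalSolution {c s : ℝ} {θ : ℝ → ℝ} (h : IsAngleSolution c s θ) :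
    IsGlobalSolution c s (fun r => sin (θ r)) (fun r => cos (θ r)) where
  smooth_a := h.smooth.sin
  smooth_f := h.smooth.cos
  sq_add_sq r := by rw [add_comm]; exact sin_sq_add_cos_sq _
  a_zero := by simp [h.zero]
  f_zero := by simp [h.zero]
  deriv_zero := by rw [deriv_sin_comp h.smooth]; simp [h.zero, h.deriv_zero]
  ode r hr hc := (solitonODE_sin_iff h.smooth c hr hc).2 (h.ode r hr)

/-- This symmetry preserves the slope at `0`, so that uniqueness makes `θ` odd; it also reduces
uniqueness for `r < 0` to `r > 0`. -/
lemma IsAngleSolution.reflect {c s : ℝ} {θ : ℝ → ℝ} (h : IsAngleSolution c s θ) :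
    IsAngleSolution c s (fun r => -θ (-r)) := by
  have h1 : deriv (fun r => -θ (-r)) = fun r => deriv θ (-r) := by
    funext r
    rw [deriv.fun_neg, deriv_comp_neg, neg_neg]
  refine ⟨(h.smooth.comp contDiff_neg).neg, by simp [h.zero], by rw [h1]; simp [h.deriv_zero], ?_⟩
  intro r hr
  have := h.ode (-r) (neg_ne_zero.2 hr)
  unfold AngleODE at this ⊢
  rw [h1, deriv_comp_neg (deriv θ), mul_neg, sin_neg]
  simp only [div_neg, neg_sq, mul_neg] at this ⊢
  linear_combination -this

lemma IsAngleSolution.neg {c s : ℝ} {θ : ℝ → ℝ} (h : IsAngleSolution c s θ) :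
    IsAngleSolution c (-s) (fun r => -θ r) := by
  have h1 : deriv (fun r => -θ r) = fun r => -deriv θ r := by
    funext r
    rw [deriv.fun_neg]
  refine ⟨h.smooth.neg, by simp [h.zero], by rw [h1]; simp [h.deriv_zero], ?_⟩
  intro r hr
  have := h.ode r hr
  unfold AngleODE at this ⊢
  rw [h1, deriv.fun_neg]
  simp only [mul_neg, sin_neg]
  linear_combination -this

/-- The derivative of `3 sin 2x - 6x` is `-12 sin² x`. The quadratic smallness of this Lipschitz
constant near `0` compensates the factor `1 / r²` of the equation. -/
lemma abs_sin_two_mul_sub_le {M x y : ℝ} (hx : |x| ≤ M) (hy : |y| ≤ M) :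
    |(3 * sin (2 * x) - 6 * x) - (3 * sin (2 * y) - 6 * y)| ≤ 12 * M ^ 2 * |x - y| := by
  have hd : ∀ x, HasDerivAt (fun x => 3 * sin (2 * x) - 6 * x) (-(12 * sin x ^ 2)) x := by
    intro x
    have h1 := ((((hasDerivAt_id x).const_mul 2).sin).const_mul 3).sub
      ((hasDerivAt_id x).const_mul 6)
    convert! h1 using 1
    simp only [id, cos_two_mul, cos_sq']
    ring
  have h2 := Convex.norm_image_sub_le_of_norm_hasDerivWithin_le (C := 12 * M ^ 2)
    (s := Icc (-M) M) (fun x _ => (hd x).hasDerivWithinAt) (fun x hx => ?_) (convex_Icc _ _)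
    (abs_le.1 hy) (abs_le.1 hx)
  · simpa [Real.norm_eq_abs] using h2
  · rw [Real.norm_eq_abs, abs_neg, abs_mul, abs_of_pos (by norm_num : (0 : ℝ) < 12)]
    have h1 : |sin x| ≤ M := (abs_sin_le_abs).trans (abs_le.2 hx)
    rw [abs_of_nonneg (sq_nonneg _), ← sq_abs]
    gcongr

lemma IsAngleSolution.exists_abs_le {c s : ℝ} {θ : ℝ → ℝ} (h : IsAngleSolution c s θ) (R : ℝ) :
    ∃ M, 0 ≤ M ∧ ∀ r ∈ Icc 0 R, |θ r| ≤ M * r := by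
  obtain ⟨M, hM⟩ := (isCompact_Icc (a := (0 : ℝ)) (b := R)).exists_bound_of_continuousOn
    (ContDiff.deriv_infty h.smooth).continuous.continuousOn
  refine ⟨max M 0, le_max_right _ _, fun r hr => ?_⟩
  have := Convex.norm_image_sub_le_of_norm_hasDerivWithin_le (C := max M 0) (s := Icc 0 R)
    (fun x _ => (ContDiff.hasDerivAt_infty h.smooth x).hasDerivWithinAt)
    (fun x hx => (hM x hx).trans (le_max_left _ _)) (convex_Icc _ _)
    (left_mem_Icc.2 (hr.1.trans hr.2)) hr
  simpa [h.zero, Real.norm_eq_abs, abs_of_nonneg hr.1] using this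

/-- The difference `d` of two solutions satisfies `d'' + 6 d'/r - 6 d/r² = Q`, where `Q` is
controlled by `r (|d'| + |d/r|)` because both solutions are `O(r)`. A Gronwall argument starts from
`0`, as `d` and `d'` vanish there. -/
lemma IsAngleSolution.eq_of_pos {c s : ℝ} {θ₁ θ₂ : ℝ → ℝ} (h₁ : IsAngleSolution c s θ₁)
    (h₂ : IsAngleSolution c s θ₂) {R : ℝ} (hR : 0 < R) : θ₁ R = θ₂ R := by
  obtain ⟨M₁, hM₁, hb₁⟩ := h₁.exists_abs_le R
  obtain ⟨M₂, hM₂, hb₂⟩ := h₂.exists_abs_le R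
  set M := max M₁ M₂
  set C := |c| + 12 * M ^ 2 with hC
  have hC0 : 0 ≤ C := by positivity
  set d : ℝ → ℝ := fun r => θ₁ r - θ₂ r with hd
  set d' : ℝ → ℝ := fun r => deriv θ₁ r - deriv θ₂ r with hd'
  set Q : ℝ → ℝ := fun r => c * r * d' r + ((3 * sin (2 * θ₁ r) - 6 * θ₁ r)
    - (3 * sin (2 * θ₂ r) - 6 * θ₂ r)) / r ^ 2 with hQ
  have hdd : ∀ r, HasDerivAt d (d' r) r := fun r =>
    (ContDiff.hasDerivAt_infty h₁.smooth r).sub (ContDiff.hasDerivAt_infty h₂.smooth r)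
  have hdd' : ∀ r, r ≠ 0 → HasDerivAt d' (-6 / r * d' r + 6 * d r / r ^ 2 + Q r) r := by
    intro r hr
    have h3 := (ContDiff.hasDerivAt_infty (ContDiff.deriv_infty h₁.smooth) r).sub
      (ContDiff.hasDerivAt_infty (ContDiff.deriv_infty h₂.smooth) r)
    convert! h3 using 1
    have e1 := h₁.ode r hr
    have e2 := h₂.ode r hr
    unfold AngleODE at e1 e2
    simp only [hQ, hd, hd']
    linear_combination e2 - e1
  -- The homogeneous solutions are `r` and `r⁻⁶`: `z` kills the first and `y` kills the second. In
  -- these variables `y' = Q / 7` and `z' = -7 z / r + Q`, and the singular term has the damping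
  -- sign.
  set y : ℝ → ℝ := fun r => (d' r + 6 * (d r / r)) / 7 with hy
  set z : ℝ → ℝ := fun r => d' r - d r / r with hz
  have hyd : ∀ r, r ≠ 0 → HasDerivAt y (Q r / 7) r := by
    intro r hr
    have := ((hdd' r hr).add ((((hdd r).div (hasDerivAt_id r) hr)).const_mul 6)).div_const 7
    convert! this using 1
    simp only [id]
    field_simp
    ring
  have hzd : ∀ r, r ≠ 0 → HasDerivAt z (-7 * z r / r + Q r) r := by
    intro r hr
    have := (hdd' r hr).sub ((hdd r).div (hasDerivAt_id r) hr)
    convert! this using 1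
    simp only [id, hz]
    field_simp
    ring
  have hQb : ∀ r ∈ Ioc 0 R, |Q r| ≤ C * r * (|y r| + |z r|) := by
    intro r hr
    have hr0 := hr.1
    have hrR : r ∈ Icc 0 R := ⟨hr.1.le, hr.2⟩
    have b1 : |θ₁ r| ≤ M * r := (hb₁ r hrR).trans (by gcongr; exact le_max_left _ _)
    have b2 : |θ₂ r| ≤ M * r := (hb₂ r hrR).trans (by gcongr; exact le_max_right _ _)
    have b3 := abs_sin_two_mul_sub_le b1 b2
    have e1 : d' r = y r + 6 / 7 * z r := by simp only [hy, hz]; ring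
    have e2 : d r / r = y r - z r / 7 := by simp only [hy, hz]; ring
    have b4 : |d' r| ≤ |y r| + |z r| := by
      rw [e1]
      refine (abs_add_le _ _).trans ?_
      rw [abs_mul, abs_of_pos (by norm_num : (0 : ℝ) < 6 / 7)]
      linarith [abs_nonneg (z r)]
    have b5 : |d r| / r ≤ |y r| + |z r| := by
      rw [← abs_of_pos hr0, ← abs_div, abs_of_pos hr0, e2]
      refine (abs_sub _ _).trans ?_
      rw [abs_div (z r), abs_of_pos (by norm_num : (0 : ℝ) < 7)]
      linarith [abs_nonneg (z r)]
    calc |Q r| ≤ |c * r * d' r| + |((3 * sin (2 * θ₁ r) - 6 * θ₁ r)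
          - (3 * sin (2 * θ₂ r) - 6 * θ₂ r)) / r ^ 2| := abs_add_le _ _
      _ ≤ |c| * r * |d' r| + 12 * (M * r) ^ 2 * |d r| / r ^ 2 := by
          rw [abs_mul, abs_mul, abs_of_pos hr0, abs_div, abs_of_pos (by positivity : 0 < r ^ 2)]
          gcongr
      _ = |c| * r * |d' r| + 12 * M ^ 2 * r * (|d r| / r) := by field_simp
      _ ≤ |c| * r * (|y r| + |z r|) + 12 * M ^ 2 * r * (|y r| + |z r|) := by gcongr
      _ = C * r * (|y r| + |z r|) := by rw [hC]; ring
  -- The logarithmic derivative `-4 C r` of the weight matches the bound `2 |Q| (|y| + |z|) ≤ 4 C r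
  -- (y² + z²)`.
  set P : ℝ → ℝ := fun r => (y r ^ 2 + z r ^ 2) * exp (-2 * C * r ^ 2) with hP
  have hPd : ∀ r, r ≠ 0 → HasDerivAt P ((2 * y r * (Q r / 7) + 2 * z r * (-7 * z r / r + Q r)
      - 4 * C * r * (y r ^ 2 + z r ^ 2)) * exp (-2 * C * r ^ 2)) r := by
    intro r hr
    have h3 := (((hyd r hr).pow 2).add ((hzd r hr).pow 2)).mul
      (((hasDerivAt_pow 2 r).const_mul (-2 * C)).exp)
    convert! h3 using 1
    simp
    ring
  have hanti : AntitoneOn P (Ioc 0 R) := by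
    refine antitoneOn_of_deriv_nonpos (convex_Ioc 0 R)
      (fun r hr => (hPd r hr.1.ne').continuousAt.continuousWithinAt)
      (fun r hr => ?_) (fun r hr => ?_)
    · rw [interior_Ioc] at hr
      exact (hPd r hr.1.ne').differentiableAt.differentiableWithinAt
    · rw [interior_Ioc] at hr
      rw [(hPd r hr.1.ne').deriv]
      refine mul_nonpos_of_nonpos_of_nonneg ?_ (exp_pos _).le
      have hb := hQb r ⟨hr.1, hr.2.le⟩
      have hr0 := hr.1
      have i1 : y r * Q r ≤ |y r| * (C * r * (|y r| + |z r|)) :=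
        (le_abs_self _).trans (by rw [abs_mul]; gcongr)
      have i2 : z r * Q r ≤ |z r| * (C * r * (|y r| + |z r|)) :=
        (le_abs_self _).trans (by rw [abs_mul]; gcongr)
      have i3 : 0 ≤ |y r| * (C * r * (|y r| + |z r|)) := by positivity
      have i4 : 0 ≤ z r ^ 2 / r := by positivity
      have i5 : (|y r| + |z r|) ^ 2 ≤ 2 * (y r ^ 2 + z r ^ 2) := by
        nlinarith [sq_nonneg (|y r| - |z r|), sq_abs (y r), sq_abs (z r)]
      have i6 : C * r * (|y r| + |z r|) ^ 2 ≤ C * r * (2 * (y r ^ 2 + z r ^ 2)) := by gcongr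
      have i7 : z r * (-7 * z r / r + Q r) = -7 * (z r ^ 2 / r) + z r * Q r := by ring
      nlinarith
  have hPlim : Tendsto P (𝓝[>] 0) (𝓝 0) := by
    have hd0 : d 0 = 0 := by simp [hd, h₁.zero, h₂.zero]
    have hd'0 : d' 0 = 0 := by simp [hd', h₁.deriv_zero, h₂.deriv_zero]
    have l1 : Tendsto (fun r => d r / r) (𝓝[>] 0) (𝓝 0) := by
      have := (hasDerivAt_iff_tendsto_slope.1 (hdd 0)).mono_left
        (nhdsWithin_mono 0 (fun x (hx : 0 < x) => ne_of_gt hx) : 𝓝[>] (0 : ℝ) ≤ 𝓝[≠] 0)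
      rw [hd'0] at this
      refine this.congr fun r => ?_
      simp [slope_def_field, hd0]
    have l2 : Tendsto d' (𝓝[>] 0) (𝓝 0) := by
      have hc : Continuous d' := (ContDiff.deriv_infty h₁.smooth).continuous.sub
        (ContDiff.deriv_infty h₂.smooth).continuous
      have := hc.tendsto 0
      rw [hd'0] at this
      exact this.mono_left nhdsWithin_le_nhds
    have l3 : Tendsto (fun r : ℝ => exp (-2 * C * r ^ 2)) (𝓝[>] 0) (𝓝 (exp (-2 * C * 0 ^ 2))) :=
      (Continuous.tendsto (by fun_prop) 0).mono_left nhdsWithin_le_nhds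
    have := ((((l2.add (l1.const_mul 6)).div_const 7).pow 2).add ((l2.sub l1).pow 2)).mul l3
    simpa [hP, hy, hz] using this
  have hPR : P R ≤ 0 := by
    refine ge_of_tendsto hPlim ?_
    filter_upwards [Ioc_mem_nhdsGT hR] with r hr
    exact hanti hr ⟨hR, le_rfl⟩ hr.2
  have h3 : y R ^ 2 + z R ^ 2 ≤ 0 := by
    by_contra hne
    push Not at hne
    have : 0 < P R := mul_pos hne (exp_pos _)
    linarith
  have hy0 : y R = 0 := by nlinarith [sq_nonneg (y R), sq_nonneg (z R)]
  have hz0 : z R = 0 := by nlinarith [sq_nonneg (y R), sq_nonneg (z R)]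
  have e2 : d R / R = y R - z R / 7 := by simp only [hy, hz]; ring
  rw [hy0, hz0] at e2
  have : d R = 0 := by
    have h5 := (div_eq_iff hR.ne').1 e2
    simpa using h5
  exact sub_eq_zero.1 this

lemma IsAngleSolution.unique {c s : ℝ} {θ₁ θ₂ : ℝ → ℝ} (h₁ : IsAngleSolution c s θ₁)
    (h₂ : IsAngleSolution c s θ₂) : θ₁ = θ₂ := by
  funext r
  rcases lt_trichotomy r 0 with hr | hr | hr
  · have := h₁.reflect.eq_of_pos h₂.reflect (neg_pos.2 hr)
    simpa using this
  · rw [hr, h₁.zero, h₂.zero]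
  · exact h₁.eq_of_pos h₂ hr

lemma IsAngleSolution.odd {c s : ℝ} {θ : ℝ → ℝ} (h : IsAngleSolution c s θ) (r : ℝ) :
    θ (-r) = -θ r := by
  have := congrFun (h.unique h.reflect) r
  linarith

end ConeSoliton

/-! ### Asymptotics of solutions of the angle equation. -/

namespace ConeSoliton

open Real Set Filter

lemma IsAngleSolution.deriv_deriv_eq {c s : ℝ} {θ : ℝ → ℝ} (h : IsAngleSolution c s θ) {r : ℝ}
    (hr : r ≠ 0) :
    deriv (deriv θ) r = 3 * sin (2 * θ r) / r ^ 2 - (6 / r - c * r) * deriv θ r := by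
  have := h.ode r hr
  unfold AngleODE at this
  linarith

/-- The energy `E = r² θ'²/2 - 3 sin²θ` has derivative `-(5 r - c r³) θ'² ≤ 0` and vanishes at `0`,
so that `r² θ'² ≤ 6 sin²θ`. -/
lemma IsAngleSolution.sq_deriv_le {c s : ℝ} {θ : ℝ → ℝ} (h : IsAngleSolution c s θ) (hc : c ≤ 0)
    {r : ℝ} (hr : 0 < r) : deriv θ r ^ 2 ≤ 6 / r ^ 2 := by
  set E : ℝ → ℝ := fun r => r ^ 2 * deriv θ r ^ 2 / 2 - 3 * sin (θ r) ^ 2 with hE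
  have hEd : ∀ r, r ≠ 0 → HasDerivAt E (-(5 * r - c * r ^ 3) * deriv θ r ^ 2) r := by
    intro r hr
    have h1 := ((((hasDerivAt_pow 2 r).mul
      ((ContDiff.hasDerivAt_infty (ContDiff.deriv_infty h.smooth) r).pow 2)).div_const 2)).sub
      (((ContDiff.hasDerivAt_infty h.smooth r).sin.pow 2).const_mul 3)
    convert! h1 using 1
    rw [h.deriv_deriv_eq hr, sin_two_mul]
    field_simp
    simp
    ring
  have hEc : Continuous E := by
    have := (ContDiff.deriv_infty h.smooth).continuous
    have := h.smooth.continuous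
    fun_prop
  have hanti : AntitoneOn E (Icc 0 r) := by
    refine antitoneOn_of_deriv_nonpos (convex_Icc 0 r) hEc.continuousOn
      (fun r hr => ?_) (fun r hr => ?_) <;> rw [interior_Icc] at hr
    · exact (hEd r hr.1.ne').differentiableAt.differentiableWithinAt
    · rw [(hEd r hr.1.ne').deriv]
      have h0 := hr.1
      have : 0 ≤ 5 * r - c * r ^ 3 := by nlinarith [pow_pos h0 3]
      nlinarith [mul_nonneg this (sq_nonneg (deriv θ r))]
  have h1 := hanti (left_mem_Icc.2 hr.le) (right_mem_Icc.2 hr.le) hr.le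
  simp only [hE, h.zero] at h1
  rw [le_div_iff₀ (by positivity)]
  have := sin_sq_le_one (θ r)
  norm_num at h1
  nlinarith

/-- The continuity method behind all crossing arguments: `r` is the first point after `α` at which
`g` fails to be positive, so `g` arrives at zero from above and its slope there cannot be positive.
-/
lemma exists_first_zero {g : ℝ → ℝ} (hg : Continuous g) {α b : ℝ} (hb : α < b) (hgb : g b ≤ 0)
    (hα : ∀ᶠ x in 𝓝[>] α, 0 < g x) :
    ∃ r ∈ Ioc α b, g r = 0 ∧ (∀ x ∈ Ioo α r, 0 < g x) ∧ ∀ g', HasDerivAt g g' r → g' ≤ 0 := by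
  obtain ⟨δ, hδ, hδg⟩ := mem_nhdsGT_iff_exists_Ioo_subset.1 hα
  have hδ : α < δ := hδ
  have hδb : δ ≤ b := by
    by_contra! hlt
    exact absurd (hδg ⟨hb, hlt⟩) (not_lt.2 hgb)
  -- Since `g` is positive on `(α, δ)`, the first zero lies in `[δ, b]`, where compactness provides
  -- it.
  set A := Icc δ b ∩ g ⁻¹' Iic 0 with hA
  have hAc : IsCompact A := isCompact_Icc.inter_right (isClosed_Iic.preimage hg)
  obtain ⟨r, hrA, hrl⟩ := hAc.exists_isLeast ⟨b, ⟨hδb, le_rfl⟩, hgb⟩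
  have hpos : ∀ x ∈ Ioo α r, 0 < g x := by
    intro x hx
    by_cases hxδ : x < δ
    · exact hδg ⟨hx.1, hxδ⟩
    · by_contra! hle
      have := hrl ⟨⟨not_lt.1 hxδ, hx.2.le.trans hrA.1.2⟩, hle⟩
      exact absurd hx.2 (not_lt.2 this)
  have hαr : α < r := hδ.trans_le hrA.1.1
  have h0 : g r = 0 := by
    refine le_antisymm hrA.2 ?_
    refine ge_of_tendsto (hg.continuousAt.continuousWithinAt (s := Iio r)).tendsto ?_
    filter_upwards [Ioo_mem_nhdsLT hαr] with x hx using (hpos x hx).le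
  refine ⟨r, ⟨hαr, hrA.1.2⟩, h0, hpos, fun g' hg' => ?_⟩
  have h1 := (hasDerivWithinAt_iff_tendsto_slope' (s := Iio r) (by simp)).1 hg'.hasDerivWithinAt
  refine le_of_tendsto h1 ?_
  filter_upwards [Ioo_mem_nhdsLT hαr] with x hx
  rw [slope_def_field, h0]
  exact div_nonpos_of_nonneg_of_nonpos (by linarith [hpos x hx]) (by linarith [hx.2])

section Shrinking

variable {c s : ℝ} {θ : ℝ → ℝ}

lemma tendsto_weight (hc : 0 < c) :
    Tendsto (fun r : ℝ => r ^ 6 * exp (-c / 2 * r ^ 2)) atTop (𝓝 0) := by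
  have h1 := (tendsto_pow_mul_exp_neg_atTop_nhds_zero 6).comp tendsto_id
  have h2 : ∀ᶠ r : ℝ in atTop, 2 / c ≤ r := eventually_ge_atTop _
  refine squeeze_zero' (Eventually.of_forall fun r => by positivity) ?_ h1
  filter_upwards [h2, eventually_gt_atTop 0] with r hr hr0
  simp only [Function.comp, id]
  gcongr
  have : 1 ≤ c / 2 * r := by
    rw [div_le_iff₀ hc] at hr; linarith
  nlinarith

/-- The weight `r⁶ exp(-c r²/2)` is the integrating factor for the damping coefficient `6/r - c r`.
-/
lemma IsAngleSolution.hasDerivAt_flux (h : IsAngleSolution c s θ) {r : ℝ} (hr : r ≠ 0) :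
    HasDerivAt (fun r => r ^ 6 * exp (-c / 2 * r ^ 2) * deriv θ r)
      (3 * r ^ 4 * exp (-c / 2 * r ^ 2) * sin (2 * θ r)) r := by
  have h1 := ((hasDerivAt_pow 6 r).mul (((hasDerivAt_pow 2 r).const_mul (-c / 2)).exp)).mul
    (ContDiff.hasDerivAt_infty (ContDiff.deriv_infty h.smooth) r)
  convert! h1 using 1
  rw [h.deriv_deriv_eq hr]
  field_simp
  simp
  ring_nf

lemma IsAngleSolution.eventually_pos (h : IsAngleSolution c s θ) (hs : 0 < s) :
    ∀ᶠ r in 𝓝[>] 0, 0 < θ r := by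
  have h1 := (ContDiff.hasDerivAt_infty h.smooth 0)
  rw [h.deriv_zero] at h1
  have h2 := (hasDerivWithinAt_iff_tendsto_slope' (s := Ioi 0) (by simp)).1 h1.hasDerivWithinAt
  filter_upwards [h2.eventually (lt_mem_nhds hs), self_mem_nhdsWithin] with r hr hr0
  rw [slope_def_field, h.zero, sub_zero, sub_zero] at hr
  exact (div_pos_iff_of_pos_right hr0).1 hr

/-- While `0 < θ < π/2` the derivative of the flux has the sign of `sin 2θ ≥ 0`. The lower bound on
`θ` maintains itself: up to a first return to `0` the flux, hence `θ'`, would be nonnegative, and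
`θ` could not have come back down. -/
lemma IsAngleSolution.monotoneOn_flux (h : IsAngleSolution c s θ) (hs : 0 < s) {b : ℝ}
    (hχ : ∀ r ∈ Ioo 0 b, θ r < π / 2) :
    MonotoneOn (fun r => r ^ 6 * exp (-c / 2 * r ^ 2) * deriv θ r) (Icc 0 b) := by
  have hcont : Continuous (fun r => r ^ 6 * exp (-c / 2 * r ^ 2) * deriv θ r) := by
    have := (ContDiff.deriv_infty h.smooth).continuous
    fun_prop
  have mono : ∀ b', (∀ r ∈ Ioo 0 b', 0 < θ r ∧ θ r < π / 2) →
      MonotoneOn (fun r => r ^ 6 * exp (-c / 2 * r ^ 2) * deriv θ r) (Icc 0 b') := by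
    intro b' hb'
    refine monotoneOn_of_deriv_nonneg (convex_Icc 0 b') hcont.continuousOn
      (fun r hr => ?_) (fun r hr => ?_) <;> rw [interior_Icc] at hr
    · exact (h.hasDerivAt_flux hr.1.ne').differentiableAt.differentiableWithinAt
    · rw [(h.hasDerivAt_flux hr.1.ne').deriv]
      have := sin_nonneg_of_nonneg_of_le_pi (x := 2 * θ r) (by linarith [(hb' r hr).1])
        (by linarith [(hb' r hr).2])
      positivity
  have hpos : ∀ r ∈ Ioo 0 b, 0 < θ r := by
    intro r hr
    by_contra! hle
    obtain ⟨r₀, hr₀, h0, hp, -⟩ := exists_first_zero h.smooth.continuous hr.1 hle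
      (h.eventually_pos hs)
    have hm := mono r₀ fun x hx =>
      ⟨hp x hx, hχ x ⟨hx.1, hx.2.trans_le (hr₀.2.trans hr.2.le)⟩⟩
    have hθ : MonotoneOn θ (Icc 0 r₀) := by
      refine monotoneOn_of_deriv_nonneg (convex_Icc 0 r₀) h.smooth.continuous.continuousOn
        (fun r hr => (ContDiff.hasDerivAt_infty h.smooth r).differentiableAt.differentiableWithinAt)
        (fun r hr => ?_)
      rw [interior_Icc] at hr
      have h3 := hm (left_mem_Icc.2 (hr.1.trans hr.2).le) ⟨hr.1.le, hr.2.le⟩ hr.1.le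
      have h4 : 0 < r ^ 6 * exp (-c / 2 * r ^ 2) := by have := hr.1; positivity
      simp only [ne_eq, OfNat.ofNat_ne_zero, not_false_eq_true, zero_pow, zero_mul] at h3
      exact (mul_nonneg_iff_of_pos_left h4).1 h3
    have h5 := hθ (a := r₀ / 2) ⟨by linarith [hr₀.1], by linarith [hr₀.1]⟩
      (right_mem_Icc.2 hr₀.1.le) (by linarith [hr₀.1])
    have h6 := hp (r₀ / 2) ⟨by linarith [hr₀.1], by linarith [hr₀.1]⟩
    linarith
  exact mono b fun x hx => ⟨hpos x hx, hχ x hx⟩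

lemma IsAngleSolution.eventually_deriv_pos (h : IsAngleSolution c s θ) (hs : 0 < s) :
    ∀ᶠ r in 𝓝[>] 0, 0 < deriv θ r := by
  have : ContinuousAt (deriv θ) 0 := (ContDiff.deriv_infty h.smooth).continuous.continuousAt
  exact (this.eventually (lt_mem_nhds (by rwa [h.deriv_zero]))).filter_mono nhdsWithin_le_nhds

lemma IsAngleSolution.deriv_pos (h : IsAngleSolution c s θ) (hs : 0 < s) {b : ℝ} (hb : 0 < b)
    (hχ : ∀ r ∈ Ioo 0 b, θ r < π / 2) : 0 < deriv θ b := by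
  obtain ⟨δ, hδ1, hδ⟩ := ((h.eventually_deriv_pos hs).and (Ioc_mem_nhdsGT hb)).exists
  have h1 := h.monotoneOn_flux hs hχ ⟨hδ.1.le, hδ.2⟩ (right_mem_Icc.2 hb.le) hδ.2
  have h2 := hδ.1
  have h3 : 0 < δ ^ 6 * exp (-c / 2 * δ ^ 2) * deriv θ δ := by positivity
  have h4 : 0 < b ^ 6 * exp (-c / 2 * b ^ 2) := by positivity
  exact (mul_pos_iff_of_pos_left h4).1 (h3.trans_le h1)

/-- The Wronskian-type quantity comparing `π / 2 - θ` with the solution `1 / r ^ 2 - c / 3` of the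
linearization at `π / 2`. -/
noncomputable def comparison (c : ℝ) (θ : ℝ → ℝ) (r : ℝ) : ℝ :=
  exp (-c / 2 * r ^ 2) *
    (2 * r ^ 3 * (π / 2 - θ r) - r ^ 4 * (1 - c * r ^ 2 / 3) * deriv θ r)

/-- For two solutions of the linearization the weighted Wronskian would be constant. Only the
nonlinear remainder `x - sin x`, with `x = π - 2θ`, survives, times the comparison solution; its
sign is thus known on either side of `θ = π/2` and of `c r² = 3`. -/
lemma IsAngleSolution.hasDerivAt_comparison (h : IsAngleSolution c s θ) {r : ℝ} (hr : r ≠ 0) :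
    HasDerivAt (comparison c θ) (3 * exp (-c / 2 * r ^ 2) * r ^ 2 * (1 - c * r ^ 2 / 3) *
      ((π - 2 * θ r) - sin (π - 2 * θ r))) r := by
  have h1 := (((hasDerivAt_pow 2 r).const_mul (-c / 2)).exp).mul
    ((((hasDerivAt_pow 3 r).const_mul 2).mul
      ((ContDiff.hasDerivAt_infty h.smooth r).const_sub (π / 2))).sub
      (((hasDerivAt_pow 4 r).mul ((((hasDerivAt_pow 2 r).const_mul c).div_const 3).const_sub 1)).mul
    (ContDiff.hasDerivAt_infty (ContDiff.deriv_infty h.smooth) r)))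
  convert! h1 using 1
  rw [h.deriv_deriv_eq hr, sin_pi_sub]
  field_simp
  simp
  ring

lemma IsAngleSolution.continuous_comparison (h : IsAngleSolution c s θ) :
    Continuous (comparison c θ) := by
  have := (ContDiff.deriv_infty h.smooth).continuous
  have := h.smooth.continuous
  unfold comparison
  fun_prop

/-- Up to a first contact with `π/2` at radius `r₀` the Wronskian increases strictly from `0`. At
the contact its first term vanishes and `θ' ≥ 0`, so it would be nonpositive as long as `c r₀² ≤ 3`,
a contradiction. -/
lemma IsAngleSolution.lt_pi_div_two (h : IsAngleSolution c s θ)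
    {r : ℝ} (hr : 0 < r) (hcr : c * r ^ 2 ≤ 3) : θ r < π / 2 := by
  by_contra! hle
  have hnear : ∀ᶠ x in 𝓝[>] 0, 0 < π / 2 - θ x := by
    have : ContinuousAt (fun x => π / 2 - θ x) 0 :=
      (continuous_const.sub h.smooth.continuous).continuousAt
    exact (this.eventually (lt_mem_nhds (by simp [h.zero, pi_pos]))).filter_mono
      nhdsWithin_le_nhds
  obtain ⟨r₀, hr₀, h0, hp, hder⟩ := exists_first_zero
    (g := fun x => π / 2 - θ x) (continuous_const.sub h.smooth.continuous) hr
    (by linarith) hnear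
  have hθ' : 0 ≤ deriv θ r₀ := by
    have := hder _ ((ContDiff.hasDerivAt_infty h.smooth r₀).const_sub (π / 2))
    linarith
  have hcr₀ : c * r₀ ^ 2 ≤ 3 := by
    rcases le_or_gt c 0 with hc | hc
    · nlinarith [sq_nonneg r₀]
    · refine le_trans ?_ hcr
      have := hr₀.1
      gcongr
      exact hr₀.2
  have hm : StrictMonoOn (comparison c θ) (Icc 0 r₀) := by
    refine strictMonoOn_of_deriv_pos (convex_Icc 0 r₀) h.continuous_comparison.continuousOn
      (fun x hx => ?_)
    rw [interior_Icc] at hx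
    rw [(h.hasDerivAt_comparison hx.1.ne').deriv]
    have h1 : 0 < (π - 2 * θ x) - sin (π - 2 * θ x) :=
      sub_pos.2 (sin_lt (by linarith [hp x hx]))
    have h2 : 0 < 1 - c * x ^ 2 / 3 := by
      rcases le_or_gt c 0 with hc | hc
      · nlinarith [sq_nonneg x]
      · have : c * x ^ 2 < c * r₀ ^ 2 := by
          have := hx.1
          gcongr
          exact hx.2
        linarith
    have h3 := hx.1
    positivity
  have h1 := hm (left_mem_Icc.2 hr₀.1.le) (right_mem_Icc.2 hr₀.1.le) hr₀.1
  have h2 : comparison c θ r₀ ≤ 0 := by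
    unfold comparison
    rw [h0]
    have h3 : 0 ≤ 1 - c * r₀ ^ 2 / 3 := by linarith
    have h4 : 0 ≤ r₀ ^ 4 * (1 - c * r₀ ^ 2 / 3) * deriv θ r₀ := by positivity
    exact mul_nonpos_of_nonneg_of_nonpos (exp_pos _).le (by linarith)
  have h3 : comparison c θ 0 = 0 := by simp [comparison]
  linarith

/-- If `θ` stayed below `π/2`, the flux would stay above a positive constant while its weight tends
to `0`. Then eventually `θ' ≥ 1`, and `θ` would be unbounded above. -/
lemma IsAngleSolution.exists_ge_pi_div_two (h : IsAngleSolution c s θ) (hc : 0 < c) (hs : 0 < s) :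
    ∃ r > 0, π / 2 ≤ θ r := by
  by_contra! hlt
  obtain ⟨δ, hδ1, hδ⟩ := ((h.eventually_deriv_pos hs).and self_mem_nhdsWithin).exists
  have hδ : 0 < δ := hδ
  have hk : 0 < δ ^ 6 * exp (-c / 2 * δ ^ 2) * deriv θ δ := by positivity
  set k := δ ^ 6 * exp (-c / 2 * δ ^ 2) * deriv θ δ
  have hkδ : ∀ r, δ ≤ r → k ≤ r ^ 6 * exp (-c / 2 * r ^ 2) * deriv θ r := fun r hr =>
    h.monotoneOn_flux hs (b := r) (fun x hx => hlt x hx.1) ⟨hδ.le, hr⟩ ⟨hδ.le.trans hr, le_rfl⟩ hr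
  obtain ⟨R, hR⟩ := eventually_atTop.1 ((tendsto_weight hc).eventually (gt_mem_nhds hk))
  set R' := max R δ with hR'
  have hR'0 : 0 < R' := hδ.trans_le (le_max_right _ _)
  have hd : ∀ r, R' ≤ r → 1 ≤ deriv θ r := by
    intro r hr
    have h1 := hR r ((le_max_left _ _).trans hr)
    have h2 := hkδ r ((le_max_right _ _).trans hr)
    have h3 : 0 < r ^ 6 * exp (-c / 2 * r ^ 2) := by have := hR'0.trans_le hr; positivity
    by_contra! hlt
    nlinarith
  have h4 : ∀ r, R' ≤ r → r - R' ≤ θ r - θ R' := by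
    intro r hr
    have := (convex_Icc R' r).mul_sub_le_image_sub_of_le_deriv (C := 1)
      h.smooth.continuous.continuousOn
      (fun x _ => (ContDiff.hasDerivAt_infty h.smooth x).differentiableAt.differentiableWithinAt)
      (fun x hx => hd x (interior_subset hx).1) R' (left_mem_Icc.2 hr) r (right_mem_Icc.2 hr) hr
    linarith
  have h5 := h4 (R' + |π / 2 - θ R'|) (by linarith [abs_nonneg (π / 2 - θ R')])
  have h6 := hlt (R' + |π / 2 - θ R'|) (by linarith [abs_nonneg (π / 2 - θ R')])
  have h7 := le_abs_self (π / 2 - θ R')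
  linarith

/-- At the crossing of `π/2` the Wronskian is positive, and beyond it the Wronskian does not
decrease. With `θ > π/2` the Wronskian is at most `(c/3) r⁶ exp(-c r²/2) θ'`, whose weight decays,
so `θ'` must diverge. -/
lemma IsAngleSolution.tendsto_deriv (h : IsAngleSolution c s θ) (hc : 0 < c) (hs : 0 < s) :
    Tendsto (deriv θ) atTop atTop := by
  obtain ⟨b, hb, hθb⟩ := h.exists_ge_pi_div_two hc hs
  have hnear : ∀ᶠ x in 𝓝[>] 0, 0 < π / 2 - θ x := by
    have : ContinuousAt (fun x => π / 2 - θ x) 0 :=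
      (continuous_const.sub h.smooth.continuous).continuousAt
    exact (this.eventually (lt_mem_nhds (by simp [h.zero, pi_pos]))).filter_mono
      nhdsWithin_le_nhds
  obtain ⟨r₀, hr₀, h0, hp, -⟩ := exists_first_zero
    (g := fun x => π / 2 - θ x) (continuous_const.sub h.smooth.continuous) hb
    (by linarith) hnear
  have hr₀p := hr₀.1
  -- Contact with `π/2` is excluded while `c r² ≤ 3`; beyond that radius the comparison solution
  -- `1/r² - c/3` is negative.
  have hc₀ : 3 < c * r₀ ^ 2 := by
    by_contra! hle
    have := h.lt_pi_div_two hr₀p hle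
    linarith
  have hθ₀ : 0 < deriv θ r₀ := h.deriv_pos hs hr₀p fun x hx => by linarith [hp x hx]
  have h0 : θ r₀ = π / 2 := by linarith
  have hcr : ∀ x, r₀ ≤ x → 3 < c * x ^ 2 := fun x hx => hc₀.trans_le (by gcongr)
  -- Both the comparison solution and the remainder `x - sin x` are now nonpositive, so their
  -- product is nonnegative.
  have hmono : ∀ x, (∀ y ∈ Ioo r₀ x, 0 < θ y - π / 2) →
      MonotoneOn (comparison c θ) (Icc r₀ x) := by
    intro x hx
    refine monotoneOn_of_deriv_nonneg (convex_Icc r₀ x) h.continuous_comparison.continuousOn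
      (fun y hy => ?_) (fun y hy => ?_) <;> rw [interior_Icc] at hy
    · exact (h.hasDerivAt_comparison (hr₀p.trans hy.1).ne').differentiableAt.differentiableWithinAt
    · rw [(h.hasDerivAt_comparison (hr₀p.trans hy.1).ne').deriv]
      have h1 : (π - 2 * θ y) - sin (π - 2 * θ y) ≤ 0 :=
        sub_nonpos.2 (lt_sin (by linarith [hx y hy])).le
      have h2 : 1 - c * y ^ 2 / 3 ≤ 0 := by linarith [hcr y hy.1.le]
      have h3 : 0 ≤ 3 * exp (-c / 2 * y ^ 2) * y ^ 2 := by positivity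
      exact mul_nonneg_of_nonpos_of_nonpos (mul_nonpos_of_nonneg_of_nonpos h3 h2) h1
  have hW₀ : 0 < comparison c θ r₀ := by
    unfold comparison
    rw [h0]
    have h1 : 0 < r₀ ^ 4 * (c * r₀ ^ 2 / 3 - 1) * deriv θ r₀ := by
      have : 0 < c * r₀ ^ 2 / 3 - 1 := by linarith
      positivity
    exact mul_pos (exp_pos _) (by linarith)
  -- At a first return to `π/2` one would have `θ' ≤ 0`, which makes the Wronskian nonpositive
  -- although it started positive and did not decrease.
  have hpos : ∀ x, r₀ < x → 0 < θ x - π / 2 := by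
    intro x hx
    by_contra! hle
    have hnear : ∀ᶠ x in 𝓝[>] r₀, 0 < θ x - π / 2 := by
      have h2 := (hasDerivWithinAt_iff_tendsto_slope' (s := Ioi r₀) (by simp)).1
        (ContDiff.hasDerivAt_infty h.smooth r₀).hasDerivWithinAt
      filter_upwards [h2.eventually (lt_mem_nhds hθ₀), self_mem_nhdsWithin] with r hr hr0
      rw [slope_def_field, h0] at hr
      exact (div_pos_iff_of_pos_right (sub_pos.2 hr0)).1 hr
    obtain ⟨r₁, hr₁, h3, h4, h5⟩ := exists_first_zero (g := fun x => θ x - π / 2)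
      (h.smooth.continuous.sub continuous_const) hx hle hnear
    have h6 := h5 _ ((ContDiff.hasDerivAt_infty h.smooth r₁).sub_const (π / 2))
    have h7 := hmono r₁ h4 (left_mem_Icc.2 hr₁.1.le) (right_mem_Icc.2 hr₁.1.le) hr₁.1.le
    have h8 : comparison c θ r₁ ≤ 0 := by
      unfold comparison
      have h9 : 0 < r₁ ^ 4 * (c * r₁ ^ 2 / 3 - 1) := by
        have h10 : 0 < c * r₁ ^ 2 / 3 - 1 := by linarith [hcr r₁ hr₁.1.le]
        have h11 : 0 < r₁ := hr₀p.trans hr₁.1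
        positivity
      rw [show π / 2 - θ r₁ = 0 by linarith]
      refine mul_nonpos_of_nonneg_of_nonpos (exp_pos _).le ?_
      nlinarith
    linarith
  refine tendsto_atTop.2 fun B => ?_
  set k := comparison c θ r₀
  -- Once the weight is below this value, `θ' ≤ |B| + 1` would contradict `k ≤ (c/3) · weight · θ'`.
  have hB : 0 < 3 * k / (c * (|B| + 1)) := by positivity
  filter_upwards [(tendsto_weight hc).eventually (gt_mem_nhds hB), eventually_gt_atTop r₀]
    with r hr hrr
  have h1 : k ≤ comparison c θ r := hmono r (fun y hy => hpos y hy.1) (left_mem_Icc.2 hrr.le)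
    (right_mem_Icc.2 hrr.le) hrr.le
  have hr0 : 0 < r := hr₀p.trans hrr
  set e := exp (-c / 2 * r ^ 2) with he
  have he0 : 0 < e := exp_pos _
  have h2 : comparison c θ r ≤ e * (r ^ 4 * (c * r ^ 2 / 3 - 1) * deriv θ r) := by
    unfold comparison
    rw [← he]
    have h3 : 0 ≤ e * (2 * r ^ 3 * (θ r - π / 2)) := by have := hpos r hrr; positivity
    nlinarith
  have h3 : 0 < c * r ^ 2 / 3 - 1 := by linarith [hcr r hrr.le]
  have h4 : 0 < deriv θ r := by
    have h5 : 0 < e * (r ^ 4 * (c * r ^ 2 / 3 - 1) * deriv θ r) := hW₀.trans_le (h1.trans h2)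
    have h6 : 0 < e * (r ^ 4 * (c * r ^ 2 / 3 - 1)) := by positivity
    rw [← mul_assoc] at h5
    exact (mul_pos_iff_of_pos_left h6).1 h5
  have h5 : k ≤ c / 3 * (r ^ 6 * e) * deriv θ r := by
    have : e * (r ^ 4 * (c * r ^ 2 / 3 - 1) * deriv θ r) ≤ e * (r ^ 4 * (c * r ^ 2 / 3) * deriv θ r) := by
      gcongr
      linarith
    refine (h1.trans h2).trans (this.trans (le_of_eq ?_))
    ring
  have h6 : c / 3 * (r ^ 6 * e) * (|B| + 1) < k := by
    rw [lt_div_iff₀ (by positivity)] at hr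
    linarith
  by_contra! hlt
  have h7 : deriv θ r ≤ |B| + 1 := by linarith [le_abs_self B]
  have h8 : c / 3 * (r ^ 6 * e) * deriv θ r ≤ c / 3 * (r ^ 6 * e) * (|B| + 1) := by gcongr
  linarith

end Shrinking

lemma IsAngleSolution.tendsto_sq_deriv {c s : ℝ} {θ : ℝ → ℝ} (h : IsAngleSolution c s θ)
    (hc : 0 < c) (hs : s ≠ 0) : Tendsto (fun r => deriv θ r ^ 2) atTop atTop := by
  rcases lt_or_gt_of_ne hs with hs | hs
  · have h1 := h.neg.tendsto_deriv hc (neg_pos.2 hs)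
    refine ((tendsto_pow_atTop (two_ne_zero)).comp h1).congr fun r => ?_
    simp
  · exact (tendsto_pow_atTop (two_ne_zero)).comp (h.tendsto_deriv hc hs)

end ConeSoliton

/-! ### Radial means, and the nonlinear term as a smooth function of `(r, θ / r)`. -/

namespace ConeSoliton

open Real Set Filter MeasureTheory

section RadialMean

/-- The mean of `h` over the segment from `0` to `r` with weight `p`. -/
noncomputable def radialMean (p h : ℝ → ℝ) (r : ℝ) : ℝ := ∫ t in (0 : ℝ)..1, p t * h (r * t)

lemma continuous_radialMean {p h : ℝ → ℝ} (hp : Continuous p) (hh : Continuous h) :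
    Continuous (radialMean p h) := by
  unfold radialMean
  refine intervalIntegral.continuous_parametric_intervalIntegral_of_continuous' ?_ 0 1
  fun_prop

lemma hasDerivAt_radialMean {p h : ℝ → ℝ} (hp : Continuous p) (hh : ContDiff ℝ 1 h) (r : ℝ) :
    HasDerivAt (radialMean p h) (radialMean (fun t => p t * t) (deriv h) r) r := by
  have hd : Continuous (deriv h) := hh.continuous_deriv le_rfl
  have hc := hh.continuous
  obtain ⟨C, hC⟩ := (isCompact_Icc (a := -(|r| + 1)) (b := |r| + 1)).exists_bound_of_continuousOn
    hd.continuousOn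
  obtain ⟨D, hD⟩ := (isCompact_Icc (a := (0 : ℝ)) (b := 1)).exists_bound_of_continuousOn
    (f := fun t => p t * t) (by fun_prop)
  have hD0 : 0 ≤ D := (norm_nonneg _).trans (hD 0 (by simp))
  have key := intervalIntegral.hasDerivAt_integral_of_dominated_loc_of_deriv_le
    (μ := volume) (a := 0) (b := 1) (s := Metric.ball r 1) (x₀ := r)
    (F := fun r t => p t * h (r * t)) (F' := fun r t => p t * t * deriv h (r * t))
    (bound := fun _ => D * C) (Metric.ball_mem_nhds r one_pos)
    (Eventually.of_forall fun x => Continuous.aestronglyMeasurable (by fun_prop))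
    (Continuous.intervalIntegrable (by fun_prop) _ _)
    (Continuous.aestronglyMeasurable (by fun_prop)) ?_ (by simp) ?_
  · exact key.2
  · refine Eventually.of_forall fun t ht x hx => ?_
    rw [uIoc_of_le zero_le_one] at ht
    rw [norm_mul]
    have hx' : |x| < |r| + 1 := by
      have h1 : |x - r| < 1 := by simpa [Real.dist_eq] using hx
      have h2 := abs_sub_abs_le_abs_sub x r
      linarith
    have h3 : |x * t| ≤ |r| + 1 := by
      rw [abs_mul, abs_of_pos ht.1]
      nlinarith [abs_nonneg x, ht.1, ht.2]
    exact mul_le_mul (hD t ⟨ht.1.le, ht.2⟩) (hC _ (abs_le.1 h3)) (norm_nonneg _) hD0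
  · refine Eventually.of_forall fun t _ x _ => ?_
    have h1 := (hh.differentiable one_ne_zero (x * t)).hasDerivAt.comp x
      ((hasDerivAt_id x).mul_const t)
    convert! h1.const_mul (p t) using 1
    simp
    ring

/-- The derivative of a radial mean is the radial mean of `h'` with weight `p t * t`, hence the
induction over all weights. Radial means replace quotients such as `r⁻⁸ ∫₀ʳ t⁸ h`, so that
smoothness at `r = 0` costs nothing. -/
lemma contDiff_radialMean (n : ℕ) : ∀ {p h : ℝ → ℝ}, Continuous p → ContDiff ℝ n h →
    ContDiff ℝ n (radialMean p h) := by
  induction n with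
  | zero =>
    intro p h hp hh
    exact contDiff_zero.2 (continuous_radialMean hp (contDiff_zero.1 hh))
  | succ n ih =>
    intro p h hp hh
    have h1 : ContDiff ℝ 1 h := hh.of_le (by simp)
    push_cast at hh ⊢
    rw [contDiff_succ_iff_deriv] at hh ⊢
    refine ⟨fun r => (hasDerivAt_radialMean hp h1 r).differentiableAt, by simp, ?_⟩
    rw [show deriv (radialMean p h) = radialMean (fun t => p t * t) (deriv h) from
      funext fun r => (hasDerivAt_radialMean hp h1 r).deriv]
    exact ih (by fun_prop) hh.2.2

lemma mul_radialMean_one (h : ℝ → ℝ) (r : ℝ) :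
    r * radialMean (fun _ => 1) h r = ∫ t in (0 : ℝ)..r, h t := by
  simp [radialMean]

lemma pow_mul_radialMean (n : ℕ) (h : ℝ → ℝ) (r : ℝ) :
    r ^ (n + 1) * radialMean (fun t => t ^ n) h r = ∫ t in (0 : ℝ)..r, t ^ n * h t := by
  have := intervalIntegral.smul_integral_comp_mul_left (a := 0) (b := 1) (fun t => t ^ n * h t) r
  simp only [mul_zero, mul_one, smul_eq_mul] at this
  rw [← this, pow_succ', mul_assoc, radialMean, ← intervalIntegral.integral_const_mul]
  congr 2
  ext t
  ring

end RadialMean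

section Nonlinearity

/-- The entire function `(3 sin (2 x) - 6 x) / x ^ 3`. -/
noncomputable def cubicQuotient (x : ℝ) : ℝ :=
  radialMean (fun t => -12 * (1 - t) ^ 2) (fun t => cos (2 * t)) x

lemma contDiff_cubicQuotient : ContDiff ℝ ∞ cubicQuotient := by
  refine contDiff_infty.2 fun n => ?_
  exact contDiff_radialMean n (by fun_prop) (contDiff_cos.comp (contDiff_const.mul contDiff_id))

lemma abs_cubicQuotient_le (x : ℝ) : |cubicQuotient x| ≤ 12 := by
  have := intervalIntegral.norm_integral_le_of_norm_le_const (a := 0) (b := 1) (C := 12)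
    (f := fun t => -12 * (1 - t) ^ 2 * cos (2 * (x * t))) (fun t ht => ?_)
  · simpa [cubicQuotient, radialMean] using this
  · rw [uIoc_of_le zero_le_one] at ht
    rw [norm_mul, norm_mul, norm_pow, Real.norm_eq_abs, Real.norm_eq_abs, Real.norm_eq_abs]
    have h1 : |1 - t| ≤ 1 := abs_le.2 ⟨by linarith [ht.2], by linarith [ht.1]⟩
    have h2 : |1 - t| ^ 2 ≤ 1 := pow_le_one₀ (abs_nonneg _) h1
    have h3 := abs_cos_le_one (2 * (x * t))
    calc |(-12 : ℝ)| * |1 - t| ^ 2 * |cos (2 * (x * t))| ≤ |(-12 : ℝ)| * 1 * 1 := by gcongr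
      _ = 12 := by norm_num

/-- Taylor's formula with integral remainder; the antiderivative in `t` comes from integrating by
parts twice. -/
lemma pow_mul_cubicQuotient (x : ℝ) : x ^ 3 * cubicQuotient x = 3 * sin (2 * x) - 6 * x := by
  have hd : ∀ t : ℝ, HasDerivAt (fun t => -6 * (1 - t) ^ 2 * x ^ 2 * sin (2 * (x * t))
      + 6 * (1 - t) * x * cos (2 * (x * t)) + 3 * sin (2 * (x * t)))
      (x ^ 3 * (-12 * (1 - t) ^ 2 * cos (2 * (x * t)))) t := by
    intro t
    have h0 : HasDerivAt (fun t => 2 * (x * t)) (2 * x) t := by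
      simpa using (((hasDerivAt_id t).const_mul x).const_mul 2)
    have h1 : HasDerivAt (fun t : ℝ => 1 - t) (-1) t := (hasDerivAt_id t).const_sub 1
    have h2 := (((((h1.pow 2).const_mul (-6)).mul_const (x ^ 2)).mul h0.sin).add
      (((h1.const_mul 6).mul_const x).mul h0.cos)).add (h0.sin.const_mul 3)
    convert! h2 using 1
    simp
    ring
  have := intervalIntegral.integral_eq_sub_of_hasDerivAt (a := 0) (b := 1) (fun t _ => hd t)
    (Continuous.intervalIntegrable (by fun_prop) _ _)
  rw [intervalIntegral.integral_const_mul] at this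
  rw [cubicQuotient, radialMean, this]
  simp

/-- The nonlinear term `(3 sin (2 r v) - 6 r v) / r ^ 3` of the equation for `v = θ / r`. -/
noncomputable def cubicTerm (r v : ℝ) : ℝ := v ^ 3 * cubicQuotient (r * v)

lemma cubicTerm_mul (r v : ℝ) : r ^ 3 * cubicTerm r v = 3 * sin (2 * (r * v)) - 6 * (r * v) := by
  rw [← pow_mul_cubicQuotient, cubicTerm]
  ring

lemma cubicTerm_eq {r : ℝ} (hr : r ≠ 0) (v : ℝ) :
    cubicTerm r v = (3 * sin (2 * (r * v)) - 6 * (r * v)) / r ^ 3 := by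
  rw [← cubicTerm_mul]
  field_simp

lemma continuous_cubicTerm : Continuous (fun p : ℝ × ℝ => cubicTerm p.1 p.2) := by
  have := contDiff_cubicQuotient.continuous
  unfold cubicTerm
  fun_prop

lemma abs_cubicTerm_le (r v : ℝ) : |cubicTerm r v| ≤ 12 * |v| ^ 3 := by
  rw [cubicTerm, abs_mul, abs_pow, mul_comm]
  gcongr
  exact abs_cubicQuotient_le _

/-- Uniform in `r`, for bounded arguments. For `r ≠ 0` the quadratic smallness of the Lipschitz
constant of `3 sin 2x - 6x` absorbs `1 / r³`; the case `r = 0` follows by continuity. -/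
lemma abs_cubicTerm_sub_le {K r v w : ℝ} (hv : |v| ≤ K) (hw : |w| ≤ K) :
    |cubicTerm r v - cubicTerm r w| ≤ 12 * K ^ 2 * |v - w| := by
  have key : ∀ r : ℝ, r ≠ 0 → |cubicTerm r v - cubicTerm r w| ≤ 12 * K ^ 2 * |v - w| := by
    intro r hr
    have h1 : |r * v| ≤ |r| * K := by rw [abs_mul]; gcongr
    have h2 : |r * w| ≤ |r| * K := by rw [abs_mul]; gcongr
    have h3 := abs_sin_two_mul_sub_le h1 h2
    rw [cubicTerm_eq hr, cubicTerm_eq hr, ← sub_div, abs_div, div_le_iff₀ (by positivity)]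
    refine h3.trans (le_of_eq ?_)
    rw [← mul_sub, abs_mul, abs_pow]
    ring
  refine le_of_tendsto (x := 𝓝[≠] r) (f := fun r => |cubicTerm r v - cubicTerm r w|) ?_ ?_
  · have h1 : Continuous (fun r => |cubicTerm r v - cubicTerm r w|) :=
      ((continuous_cubicTerm.comp (continuous_id.prodMk continuous_const)).sub
        (continuous_cubicTerm.comp (continuous_id.prodMk continuous_const))).abs
    exact h1.continuousAt.tendsto.mono_left nhdsWithin_le_nhds
  · by_cases hr : r = 0
    · subst hr
      filter_upwards [self_mem_nhdsWithin] with x hx using key x hx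
    · have : ∀ᶠ x in 𝓝 r, x ≠ 0 := eventually_ne_nhds hr
      exact (this.filter_mono nhdsWithin_le_nhds).mono fun x hx => key x hx

/-- Complementary to `abs_cubicTerm_sub_le`: no bound on `v`, `w` is needed because the sine is
globally Lipschitz, but the constant degenerates at `r = 0`. -/
lemma abs_cubicTerm_sub_le_div {r : ℝ} (hr : r ≠ 0) (v w : ℝ) :
    |cubicTerm r v - cubicTerm r w| ≤ 12 / r ^ 2 * |v - w| := by
  rw [cubicTerm_eq hr, cubicTerm_eq hr, ← sub_div, abs_div, div_le_iff₀ (by positivity)]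
  have h1 : |sin (2 * (r * v)) - sin (2 * (r * w))| ≤ |2 * (r * v) - 2 * (r * w)| :=
    abs_sin_sub_sin_le _ _
  calc |3 * sin (2 * (r * v)) - 6 * (r * v) - (3 * sin (2 * (r * w)) - 6 * (r * w))|
      = |3 * (sin (2 * (r * v)) - sin (2 * (r * w))) - 6 * (r * (v - w))| := by congr 1; ring
    _ ≤ 3 * |2 * (r * v) - 2 * (r * w)| + 6 * |r * (v - w)| := by
        refine (abs_sub _ _).trans ?_
        rw [abs_mul, abs_mul 6, abs_of_pos (by norm_num : (0 : ℝ) < 3),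
          abs_of_pos (by norm_num : (0 : ℝ) < 6)]
        gcongr
    _ = 12 / r ^ 2 * |v - w| * |r ^ 3| := by
        rw [show 2 * (r * v) - 2 * (r * w) = 2 * (r * (v - w)) by ring, abs_mul 2, abs_mul r,
          abs_pow, abs_of_pos (by norm_num : (0 : ℝ) < 2), ← sq_abs r]
        have : |r| ≠ 0 := by positivity
        field_simp
        ring

end Nonlinearity

end ConeSoliton

/-! ### A globally Lipschitz Volterra system, solved by contraction in a weighted norm. -/

namespace ConeSoliton

open Real Set Filter MeasureTheory

section Volterra

lemma radialMean_sub {p h₁ h₂ : ℝ → ℝ} (hp : Continuous p) (h₁c : Continuous h₁)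
    (h₂c : Continuous h₂) (r : ℝ) :
    radialMean p h₁ r - radialMean p h₂ r = ∫ t in (0 : ℝ)..1, p t * (h₁ (r * t) - h₂ (r * t)) := by
  unfold radialMean
  rw [← intervalIntegral.integral_sub (Continuous.intervalIntegrable (by fun_prop) _ _)
    (Continuous.intervalIntegrable (by fun_prop) _ _)]
  simp only [mul_sub]

/-- The exponent of the weight for which the Volterra operator is a contraction. -/
noncomputable def weightExponent (A r : ℝ) : ℝ := A * (2 * |r| + r ^ 2)

lemma continuous_weightExponent (A : ℝ) : Continuous (weightExponent A) := by
  unfold weightExponent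
  fun_prop

lemma weightExponent_nonneg {A : ℝ} (hA : 0 ≤ A) (r : ℝ) : 0 ≤ weightExponent A r := by
  unfold weightExponent
  positivity

/-- The weight exponent is twice the primitive of `A (1 + |t|)`, so along the segment from `0` to
`r` the integrand is bounded by the derivative of half the weight times `D`. That is the origin of
the contraction factor `1/2`. -/
lemma abs_mul_radialMean_sub_le {A D : ℝ} (_hA : 0 ≤ A) (hD : 0 ≤ D) {p h₁ h₂ : ℝ → ℝ}
    (hp : Continuous p) (hp1 : ∀ t ∈ Ioc (0 : ℝ) 1, |p t| ≤ 1) (h₁c : Continuous h₁)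
    (h₂c : Continuous h₂)
    (h : ∀ t, |h₁ t - h₂ t| ≤ A * (1 + |t|) * (exp (weightExponent A t) * D)) (r : ℝ) :
    |r * radialMean p h₁ r - r * radialMean p h₂ r| ≤ exp (weightExponent A r) * (1 / 2 * D) := by
  rw [← mul_sub, radialMean_sub hp h₁c h₂c, ← intervalIntegral.integral_const_mul]
  have hd : ∀ t : ℝ, HasDerivAt (fun t => exp (A * (2 * |r| * t + r ^ 2 * t ^ 2)) * (1 / 2 * D))
      (|r| * A * (1 + |r| * t) * exp (A * (2 * |r| * t + r ^ 2 * t ^ 2)) * D) t := by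
    intro t
    have h1 := ((((((hasDerivAt_id t).const_mul (2 * |r|)).add
      ((hasDerivAt_pow 2 t).const_mul (r ^ 2))).const_mul A).exp).mul_const (1 / 2 * D))
    convert! h1 using 1
    simp
    rw [← sq_abs r]
    ring
  have hint := intervalIntegral.integral_eq_sub_of_hasDerivAt (a := 0) (b := 1) (fun t _ => hd t)
    (Continuous.intervalIntegrable (by fun_prop) _ _)
  have hle := intervalIntegral.norm_integral_le_of_norm_le (μ := volume) (a := 0) (b := 1)
    zero_le_one
    (f := fun t => r * (p t * (h₁ (r * t) - h₂ (r * t))))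
    (g := fun t => |r| * A * (1 + |r| * t) * exp (A * (2 * |r| * t + r ^ 2 * t ^ 2)) * D)
    (Eventually.of_forall fun t ht => ?_) (Continuous.intervalIntegrable (by fun_prop) _ _)
  · rw [hint] at hle
    refine hle.trans ?_
    simp only [weightExponent, mul_one, one_pow]
    have : 0 ≤ exp (A * (2 * |r| * 0 + r ^ 2 * 0 ^ 2)) * (1 / 2 * D) := by positivity
    linarith
  · rw [Real.norm_eq_abs, abs_mul, abs_mul]
    have h1 := h (r * t)
    rw [weightExponent, abs_mul, abs_of_pos ht.1] at h1
    calc |r| * (|p t| * |h₁ (r * t) - h₂ (r * t)|)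
        ≤ |r| * (1 * (A * (1 + |r| * t) * (exp (A * (2 * (|r| * t) + (r * t) ^ 2)) * D))) := by
          gcongr
          exact hp1 t ht
      _ = _ := by ring_nf

/-- This is the integral form of `v' = w`, `(r⁸ w)' = r⁸ Φ` with `v(0) = s`. In terms of the bounded
functions `exp(-Λ) (v, w)` the integral operator contracts by `1/2` on the whole line at once,
without continuation of local solutions. -/
theorem exists_volterra_solution {Φ : ℝ → ℝ × ℝ → ℝ} (hΦ : Continuous fun p : ℝ × ℝ × ℝ => Φ p.1 p.2)
    (hΦ0 : ∀ t, Φ t 0 = 0) {A : ℝ} (hA : 1 ≤ A)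
    (hLip : ∀ t x y, |Φ t x - Φ t y| ≤ A * (1 + |t|) * ‖x - y‖) (s : ℝ) :
    ∃ v w : ℝ → ℝ, Continuous v ∧ Continuous w ∧
      (∀ r, v r = s + r * radialMean (fun _ => 1) w r) ∧
      ∀ r, w r = r * radialMean (fun t => t ^ 8) (fun t => Φ t (v t, w t)) r := by
  have hA0 : 0 ≤ A := zero_le_one.trans hA
  have hΛ := continuous_weightExponent A
  set Λ := weightExponent A with hΛdef
  let W : BoundedContinuousFunction ℝ (ℝ × ℝ) → ℝ → ℝ × ℝ := fun u t => exp (Λ t) • u t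
  have hW : ∀ u, Continuous (W u) := fun u => by
    have := u.continuous
    fun_prop
  have hΦW : ∀ u, Continuous fun t => Φ t (W u t) := fun u =>
    hΦ.comp (continuous_id.prodMk (hW u))
  let T : BoundedContinuousFunction ℝ (ℝ × ℝ) → ℝ → ℝ × ℝ := fun u r =>
    (s + r * radialMean (fun _ => 1) (fun t => (W u t).2) r,
      r * radialMean (fun t => t ^ 8) (fun t => Φ t (W u t)) r)
  have hT : ∀ u, Continuous (T u) := fun u => by
    refine Continuous.prodMk (continuous_const.add (continuous_id.mul
      (continuous_radialMean continuous_const (continuous_snd.comp (hW u)))))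
      (continuous_id.mul (continuous_radialMean (by fun_prop) (hΦW u)))
  have hWsub : ∀ u₁ u₂ t, ‖W u₁ t - W u₂ t‖ ≤ exp (Λ t) * dist u₁ u₂ := by
    intro u₁ u₂ t
    simp only [W]
    rw [← smul_sub, norm_smul, Real.norm_eq_abs, abs_exp, ← dist_eq_norm]
    gcongr
    exact BoundedContinuousFunction.dist_coe_le_dist t
  have hTsub : ∀ u₁ u₂ r, ‖T u₁ r - T u₂ r‖ ≤ exp (Λ r) * (1 / 2 * dist u₁ u₂) := by
    intro u₁ u₂ r
    rw [Prod.norm_def]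
    refine max_le ?_ ?_
    · simp only [T, Prod.fst_sub, Real.norm_eq_abs, add_sub_add_left_eq_sub]
      refine abs_mul_radialMean_sub_le hA0 dist_nonneg continuous_const (by simp)
        (continuous_snd.comp (hW u₁)) (continuous_snd.comp (hW u₂)) (fun t => ?_) r
      have h1 := (norm_snd_le (W u₁ t - W u₂ t)).trans (hWsub u₁ u₂ t)
      rw [Prod.snd_sub, Real.norm_eq_abs] at h1
      refine h1.trans (le_mul_of_one_le_left (by positivity) ?_)
      nlinarith [abs_nonneg t]
    · simp only [T, Prod.snd_sub, Real.norm_eq_abs]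
      refine abs_mul_radialMean_sub_le hA0 dist_nonneg (by fun_prop) (fun t ht => ?_)
        (hΦW u₁) (hΦW u₂) (fun t => ?_) r
      · rw [abs_of_nonneg (pow_nonneg ht.1.le 8)]
        exact pow_le_one₀ ht.1.le ht.2
      · refine (hLip t _ _).trans ?_
        gcongr
        exact hWsub u₁ u₂ t
  -- As `Φ` vanishes at the origin, the image of `0` is bounded; with the Lipschitz estimate this
  -- keeps every weighted image bounded.
  have hT0 : ∀ r, T 0 r = (s, 0) := by
    intro r
    have : (0 : ℝ × ℝ).2 = 0 := rfl
    simp only [T, W, radialMean, BoundedContinuousFunction.coe_zero, Pi.zero_apply, smul_zero, hΦ0,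
      mul_zero, intervalIntegral.integral_zero, add_zero, Prod.snd_zero]
  have hTb : ∀ u r, ‖exp (-Λ r) • T u r‖ ≤ |s| + 1 / 2 * dist u 0 := by
    intro u r
    have h1 := hTsub u 0 r
    rw [hT0] at h1
    have h2 : ‖T u r‖ ≤ |s| + exp (Λ r) * (1 / 2 * dist u 0) := by
      have h3 := norm_le_norm_add_norm_sub' (T u r) (s, 0)
      have h4 : ‖((s, 0) : ℝ × ℝ)‖ = |s| := by simp [Prod.norm_def]
      linarith
    rw [norm_smul, Real.norm_eq_abs, abs_exp]
    calc exp (-Λ r) * ‖T u r‖ ≤ exp (-Λ r) * (|s| + exp (Λ r) * (1 / 2 * dist u 0)) := by gcongr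
      _ = exp (-Λ r) * |s| + 1 / 2 * dist u 0 := by
        rw [mul_add, ← mul_assoc, ← exp_add]; simp
      _ ≤ 1 * |s| + 1 / 2 * dist u 0 := by
        gcongr
        exact exp_le_one_iff.2 (neg_nonpos.2 (weightExponent_nonneg hA0 r))
      _ = _ := by rw [one_mul]
  let S : BoundedContinuousFunction ℝ (ℝ × ℝ) → BoundedContinuousFunction ℝ (ℝ × ℝ) := fun u =>
    BoundedContinuousFunction.ofNormedAddCommGroup (fun r => exp (-Λ r) • T u r)
      ((continuous_exp.comp hΛ.neg).smul (hT u)) _ (hTb u)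
  have hS : ContractingWith (1 / 2) S := by
    refine ⟨by rw [← NNReal.coe_lt_coe]; norm_num, LipschitzWith.of_dist_le_mul fun u₁ u₂ => ?_⟩
    rw [BoundedContinuousFunction.dist_le (by positivity)]
    intro r
    simp only [S, BoundedContinuousFunction.coe_ofNormedAddCommGroup]
    rw [dist_eq_norm, ← smul_sub, norm_smul, Real.norm_eq_abs, abs_exp]
    calc exp (-Λ r) * ‖T u₁ r - T u₂ r‖ ≤ exp (-Λ r) * (exp (Λ r) * (1 / 2 * dist u₁ u₂)) := by
          gcongr; exact hTsub u₁ u₂ r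
      _ = 1 / 2 * dist u₁ u₂ := by rw [← mul_assoc, ← exp_add]; simp
      _ = _ := by simp
  have hfix := hS.fixedPoint_isFixedPt
  set u := hS.fixedPoint
  have hWT : ∀ r, W u r = T u r := by
    intro r
    have h1 : u r = exp (-Λ r) • T u r := congrArg (fun f => f r) hfix.symm
    simp only [W]
    rw [h1, smul_smul, ← exp_add]
    simp
  refine ⟨fun t => (W u t).1, fun t => (W u t).2, continuous_fst.comp (hW u),
    continuous_snd.comp (hW u), fun r => ?_, fun r => ?_⟩
  · exact congrArg Prod.fst (hWT r)
  · exact congrArg Prod.snd (hWT r)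

end Volterra

end ConeSoliton

/-! ### Existence of smooth solutions through the singular point. -/

namespace ConeSoliton

open Real Set Filter MeasureTheory

section Existence

/-- The projection of the line onto `[-K, K]`. -/
noncomputable def truncate (K v : ℝ) : ℝ := max (-K) (min K v)

lemma abs_truncate_le {K : ℝ} (hK : 0 ≤ K) (v : ℝ) : |truncate K v| ≤ K :=
  abs_le.2 ⟨le_max_left _ _, max_le (by linarith) (min_le_left _ _)⟩

lemma truncate_eq {K v : ℝ} (hv : |v| ≤ K) : truncate K v = v := by
  rw [truncate, min_eq_right (abs_le.1 hv).2, max_eq_right (abs_le.1 hv).1]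

lemma continuous_truncate (K : ℝ) : Continuous (truncate K) := by
  unfold truncate
  fun_prop

lemma abs_truncate_sub_le (K v w : ℝ) : |truncate K v - truncate K w| ≤ |v - w| := by
  have h1 := abs_max_sub_max_le_max (-K) (min K v) (-K) (min K w)
  have h2 := abs_min_sub_min_le_max K v K w
  simp only [sub_self, abs_zero] at h1 h2
  exact (h1.trans (max_le (abs_nonneg _) le_rfl)).trans (h2.trans (max_le (abs_nonneg _) le_rfl))

/-- A continuous function which vanishes for `|t| ≤ δ` and is `1` for `|t| ≥ 2 δ`. -/
noncomputable def cutoff (δ t : ℝ) : ℝ := max 0 (min 1 (|t| / δ - 1))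

lemma continuous_cutoff (δ : ℝ) : Continuous (cutoff δ) := by
  unfold cutoff
  fun_prop

lemma cutoff_nonneg (δ t : ℝ) : 0 ≤ cutoff δ t := le_max_left _ _

lemma cutoff_le_one (δ t : ℝ) : cutoff δ t ≤ 1 := max_le zero_le_one (min_le_left _ _)

lemma cutoff_eq_zero {δ t : ℝ} (hδ : 0 < δ) (ht : |t| ≤ δ) : cutoff δ t = 0 := by
  have : |t| / δ ≤ 1 := (div_le_one hδ).2 ht
  exact max_eq_left ((min_le_right _ _).trans (by linarith))

lemma cutoff_eq_one {δ t : ℝ} (hδ : 0 < δ) (ht : 2 * δ ≤ |t|) : cutoff δ t = 1 := by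
  have : 2 ≤ |t| / δ := (le_div_iff₀ hδ).2 ht
  rw [cutoff, min_eq_left (by linarith)]
  simp

/-- A modification of `cubicTerm` which is Lipschitz in the second variable, uniformly in the
first. -/
noncomputable def truncatedTerm (K δ t v : ℝ) : ℝ :=
  cubicTerm t (truncate K v) + cutoff δ t * (cubicTerm t v - cubicTerm t (truncate K v))

lemma truncatedTerm_eq {K δ t v : ℝ} (hδ : 0 < δ) (h : |v| ≤ K ∨ 2 * δ ≤ |t|) :
    truncatedTerm K δ t v = cubicTerm t v := by
  unfold truncatedTerm
  rcases h with h | h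
  · rw [truncate_eq h]; ring
  · rw [cutoff_eq_one hδ h]; ring

lemma continuous_truncatedTerm (K δ : ℝ) :
    Continuous (fun p : ℝ × ℝ => truncatedTerm K δ p.1 p.2) := by
  have h1 : Continuous fun p : ℝ × ℝ => cubicTerm p.1 (truncate K p.2) :=
    continuous_cubicTerm.comp (continuous_fst.prodMk ((continuous_truncate K).comp continuous_snd))
  exact h1.add (((continuous_cutoff δ).comp continuous_fst).mul (continuous_cubicTerm.sub h1))

/-- For `|t| ≤ δ` only truncated arguments occur and the bound for bounded arguments applies. For
`|t| > δ` the bound `12 / t² ≤ 12 / δ²` is used for the true and for the truncated arguments, whence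
`24 / δ²`. -/
lemma abs_truncatedTerm_sub_le {K δ : ℝ} (hK : 0 ≤ K) (hδ : 0 < δ) (t v w : ℝ) :
    |truncatedTerm K δ t v - truncatedTerm K δ t w|
      ≤ (12 * K ^ 2 + 24 / δ ^ 2) * |v - w| := by
  have h1 : |cubicTerm t (truncate K v) - cubicTerm t (truncate K w)| ≤ 12 * K ^ 2 * |v - w| :=
    (abs_cubicTerm_sub_le (abs_truncate_le hK v) (abs_truncate_le hK w)).trans
      (mul_le_mul_of_nonneg_left (abs_truncate_sub_le _ _ _) (by positivity))
  rcases le_or_gt |t| δ with ht | ht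
  · unfold truncatedTerm
    rw [cutoff_eq_zero hδ ht, zero_mul, zero_mul, add_zero, add_zero]
    refine h1.trans ?_
    gcongr
    have : 0 ≤ 24 / δ ^ 2 := by positivity
    linarith
  · have ht0 : t ≠ 0 := abs_pos.1 (hδ.trans ht)
    have hle : 12 / t ^ 2 ≤ 12 / δ ^ 2 := by
      rw [← sq_abs t]
      gcongr
    have h2 : |cubicTerm t v - cubicTerm t w| ≤ 12 / δ ^ 2 * |v - w| :=
      (abs_cubicTerm_sub_le_div ht0 v w).trans (by gcongr)
    have h3 : |cubicTerm t (truncate K v) - cubicTerm t (truncate K w)| ≤ 12 / δ ^ 2 * |v - w| :=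
      (abs_cubicTerm_sub_le_div ht0 _ _).trans
        (mul_le_mul hle (abs_truncate_sub_le _ _ _) (abs_nonneg _) (by positivity))
    have h4 := cutoff_nonneg δ t
    have h5 := cutoff_le_one δ t
    have e : truncatedTerm K δ t v - truncatedTerm K δ t w =
        (cubicTerm t (truncate K v) - cubicTerm t (truncate K w)) +
        cutoff δ t * ((cubicTerm t v - cubicTerm t w)
          - (cubicTerm t (truncate K v) - cubicTerm t (truncate K w))) := by
      unfold truncatedTerm; ring
    rw [e]
    refine (abs_add_le _ _).trans ?_
    rw [abs_mul, abs_of_nonneg h4]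
    have h6 := (abs_sub (cubicTerm t v - cubicTerm t w)
      (cubicTerm t (truncate K v) - cubicTerm t (truncate K w))).trans (add_le_add h2 h3)
    have h7 := (mul_le_of_le_one_left (abs_nonneg _) h5).trans h6
    have h8 : 24 / δ ^ 2 = 12 / δ ^ 2 + 12 / δ ^ 2 := by ring
    rw [h8]
    linarith

lemma abs_mul_radialMean_le {p h : ℝ → ℝ} {r B : ℝ}
    (hp : ∀ t ∈ Ioc (0 : ℝ) 1, |p t| ≤ 1) (hh : ∀ t ∈ Ioo (0 : ℝ) 1, |h (r * t)| ≤ B) :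
    |r * radialMean p h r| ≤ |r| * B := by
  rw [abs_mul]
  gcongr
  have := intervalIntegral.norm_integral_le_of_norm_le_const_ae (a := 0) (b := 1) (C := B)
    (f := fun t => p t * h (r * t)) ?_
  · simpa [radialMean] using this
  · have h1 : ∀ᵐ t : ℝ, t ≠ 1 := by simp [ae_iff]
    filter_upwards [h1] with t ht1 ht
    rw [uIoc_of_le zero_le_one] at ht
    rw [norm_mul, Real.norm_eq_abs, Real.norm_eq_abs]
    have h2 := hp t ht
    have h3 := hh t ⟨ht.1, lt_of_le_of_ne ht.2 ht1⟩
    calc |p t| * |h (r * t)| ≤ 1 * |h (r * t)| := by gcongr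
      _ ≤ B := by rwa [one_mul]

/-- The right-hand side of the equation `v'' + 8 v' / r = F` for `v = θ / r`. -/
noncomputable def source (c t v w : ℝ) : ℝ := c * t * w + c * v + cubicTerm t v

/-- The truncated system has a global solution. Truncation changes the equation only where both `|t|
< 2δ` and `|v| > K`, and for `δ` small an a priori bound shows that the solution never goes there.
-/
theorem exists_integral_solution (c s : ℝ) : ∃ v w : ℝ → ℝ, Continuous v ∧ Continuous w ∧
    (∀ r, v r = s + r * radialMean (fun _ => 1) w r) ∧
    ∀ r, w r = r * radialMean (fun t => t ^ 8) (fun t => source c t (v t) (w t)) r := by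
  set K := |s| + 1 with hK
  have hK0 : 0 ≤ K := by positivity
  -- A bound for the source when `|t| ≤ 1`, `|v| ≤ K` and `|w| ≤ 1`; the last summand ensures `B ≥
  -- 1`.
  set B := |c| * 1 * 1 + |c| * K + 12 * K ^ 3 + 1 with hB
  have hB1 : 1 ≤ B := by
    have : 0 ≤ |c| * 1 * 1 + |c| * K + 12 * K ^ 3 := by positivity
    linarith
  -- Chosen so that `2 δ B = 1/2`: on `|t| ≤ 2δ` the assumed bounds `1` on `|v - s|` and `|w|`
  -- improve to `1/2`.
  set δ := 1 / (4 * B) with hδ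
  have hδ0 : 0 < δ := by positivity
  have hδB : 2 * δ * B = 1 / 2 := by rw [hδ]; field_simp; ring
  set A := |c| + (12 * K ^ 2 + 24 / δ ^ 2) + 1 with hA
  have hA1 : 1 ≤ A := by
    have : 0 ≤ |c| + (12 * K ^ 2 + 24 / δ ^ 2) := by positivity
    linarith
  obtain ⟨v, w, hv, hw, hvr, hwr⟩ := exists_volterra_solution
    (Φ := fun t x => c * t * x.2 + c * x.1 + truncatedTerm K δ t x.1)
    (by
      have h1 : Continuous fun p : ℝ × ℝ × ℝ => truncatedTerm K δ p.1 p.2.1 :=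
        (continuous_truncatedTerm K δ).comp (continuous_fst.prodMk (continuous_fst.comp continuous_snd))
      fun_prop)
    (by
      intro t
      have : truncate K 0 = 0 := truncate_eq (by simpa using hK0)
      simp [truncatedTerm, this, cubicTerm]) hA1
    (by
      intro t x y
      have h1 : |x.1 - y.1| ≤ ‖x - y‖ := norm_fst_le (x - y)
      have h2 : |x.2 - y.2| ≤ ‖x - y‖ := norm_snd_le (x - y)
      have h3 := abs_truncatedTerm_sub_le hK0 hδ0 t x.1 y.1
      calc |c * t * x.2 + c * x.1 + truncatedTerm K δ t x.1
            - (c * t * y.2 + c * y.1 + truncatedTerm K δ t y.1)|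
          = |c * t * (x.2 - y.2) + c * (x.1 - y.1)
            + (truncatedTerm K δ t x.1 - truncatedTerm K δ t y.1)| := by congr 1; ring
        _ ≤ |c| * |t| * |x.2 - y.2| + |c| * |x.1 - y.1|
            + (12 * K ^ 2 + 24 / δ ^ 2) * |x.1 - y.1| := by
          refine (abs_add_three _ _ _).trans ?_
          rw [abs_mul, abs_mul, abs_mul]
          gcongr
        _ ≤ |c| * |t| * ‖x - y‖ + |c| * ‖x - y‖ + (12 * K ^ 2 + 24 / δ ^ 2) * ‖x - y‖ := by gcongr
        _ ≤ A * (1 + |t|) * ‖x - y‖ := by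
          rw [← add_mul, ← add_mul]
          gcongr
          have : 0 ≤ (12 * K ^ 2 + 24 / δ ^ 2) * |t| := by positivity
          have : 0 ≤ |t| := abs_nonneg t
          rw [hA]
          linarith) s
  -- The sign `ε` selects the side of the origin. At the first radius where `max |v - s| |w|`
  -- reaches `1`, the integral equations bound it by `1/2`, which is absurd.
  have hbound : ∀ ε : ℝ, |ε| = 1 → ∀ ρ, 0 < ρ → ρ ≤ 2 * δ → |v (ε * ρ)| ≤ K := by
    intro ε hε
    have hv0 : v 0 = s := by simpa using hvr 0
    have hw0 : w 0 = 0 := by simpa using hwr 0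
    set g : ℝ → ℝ := fun ρ => 1 - max |v (ε * ρ) - s| |w (ε * ρ)| with hg
    have hgc : Continuous g := by fun_prop
    have hg0 : g 0 = 1 := by simp [hg, hv0, hw0]
    have hgpos : ∀ ρ, 0 < ρ → ρ ≤ 2 * δ → 0 < g ρ := by
      intro ρ hρ hρδ
      by_contra! hle
      obtain ⟨ρ₀, hρ₀, h0, hp, -⟩ := exists_first_zero hgc hρ hle
        ((hgc.continuousAt.eventually (lt_mem_nhds (by rw [hg0]; exact one_pos))).filter_mono
          nhdsWithin_le_nhds)
      have hρ₀p := hρ₀.1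
      have hδ1 : 2 * δ ≤ 1 / 2 := by nlinarith
      have habs : |ε * ρ₀| = ρ₀ := by rw [abs_mul, hε, one_mul, abs_of_pos hρ₀.1]
      have hin : ∀ t ∈ Ioo (0 : ℝ) 1, |v (ε * ρ₀ * t) - s| ≤ 1 ∧ |w (ε * ρ₀ * t)| ≤ 1 := by
        intro t ht
        have h1 := hp (ρ₀ * t) ⟨mul_pos hρ₀.1 ht.1, mul_lt_of_lt_one_right hρ₀.1 ht.2⟩
        simp only [hg, ← mul_assoc] at h1
        exact ⟨by linarith [le_max_left |v (ε * ρ₀ * t) - s| |w (ε * ρ₀ * t)|],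
          by linarith [le_max_right |v (ε * ρ₀ * t) - s| |w (ε * ρ₀ * t)|]⟩
      have h1 : |v (ε * ρ₀) - s| ≤ 1 / 2 := by
        rw [hvr, add_sub_cancel_left]
        have := abs_mul_radialMean_le (p := fun _ => 1) (h := w) (r := ε * ρ₀) (B := 1) (by simp)
          fun t ht => (hin t ht).2
        rw [habs] at this
        linarith [hρ₀.2]
      have h2 : |w (ε * ρ₀)| ≤ 1 / 2 := by
        rw [hwr]
        have := abs_mul_radialMean_le (p := fun t => t ^ 8) (r := ε * ρ₀) (B := B)
          (h := fun t => c * t * (v t, w t).2 + c * (v t, w t).1 + truncatedTerm K δ t (v t, w t).1)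
          (fun t ht => by
            rw [abs_of_nonneg (pow_nonneg ht.1.le 8)]
            exact pow_le_one₀ ht.1.le ht.2) fun t ht => ?_
        · rw [habs] at this
          refine this.trans ?_
          rw [← hδB]
          gcongr
          exact hρ₀.2.trans hρδ
        · obtain ⟨i1, i2⟩ := hin t ht
          have i3 : |v (ε * ρ₀ * t)| ≤ K := by
            have := abs_sub_abs_le_abs_sub (v (ε * ρ₀ * t)) s
            linarith
          have i4 : |ε * ρ₀ * t| ≤ 1 := by
            rw [abs_mul, habs, abs_of_pos ht.1]
            nlinarith [ht.1, ht.2, hρ₀.2]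
          simp only
          rw [truncatedTerm_eq hδ0 (Or.inl i3)]
          refine (abs_add_three _ _ _).trans ?_
          rw [abs_mul (c * (ε * ρ₀ * t)), abs_mul c (ε * ρ₀ * t), abs_mul c]
          have i5 := (abs_cubicTerm_le (ε * ρ₀ * t) (v (ε * ρ₀ * t))).trans
            (by gcongr : 12 * |v (ε * ρ₀ * t)| ^ 3 ≤ 12 * K ^ 3)
          have i6 : |c| * |ε * ρ₀ * t| * |w (ε * ρ₀ * t)| ≤ |c| * 1 * 1 := by gcongr
          have i7 : |c| * |v (ε * ρ₀ * t)| ≤ |c| * K := by gcongr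
          linarith
      have h3 : g ρ₀ ≥ 1 / 2 := by
        have := max_le h1 h2
        simp only [hg]
        linarith
      linarith
    intro ρ hρ hρδ
    have h1 := hgpos ρ hρ hρδ
    simp only [hg] at h1
    have h2 := le_max_left |v (ε * ρ) - s| |w (ε * ρ)|
    have := abs_sub_abs_le_abs_sub (v (ε * ρ)) s
    linarith
  have heq : ∀ t, truncatedTerm K δ t (v t) = cubicTerm t (v t) := by
    intro t
    refine truncatedTerm_eq hδ0 ?_
    rcases le_or_gt (2 * δ) |t| with ht | ht
    · exact Or.inr ht
    · left
      rcases lt_trichotomy t 0 with h0 | h0 | h0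
      · have := hbound (-1) (by simp) |t| (abs_pos.2 h0.ne) ht.le
        rwa [abs_of_neg h0, neg_one_mul, neg_neg] at this
      · rw [h0, hvr]
        simp [hK]
      · have := hbound 1 (by simp) |t| (abs_pos.2 h0.ne') ht.le
        rwa [abs_of_pos h0, one_mul] at this
  refine ⟨v, w, hv, hw, hvr, fun r => ?_⟩
  rw [hwr r]
  simp only [heq, source]

/-- The solution is `θ = r v`. The relations `v' = w` and `w' = H - 8 m`, with `m` a radial mean of
the source `H`, contain no division by `r` and hold at `0` as well, so regularity can be
bootstrapped across the singular point. -/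
theorem exists_isAngleSolution (c s : ℝ) : ∃ θ, IsAngleSolution c s θ := by
  obtain ⟨v, w, hv, hw, hvr, hwr⟩ := exists_integral_solution c s
  set H : ℝ → ℝ := fun t => source c t (v t) (w t) with hH
  have hHc : Continuous H := by
    have : Continuous fun t => cubicTerm t (v t) :=
      continuous_cubicTerm.comp (continuous_id.prodMk hv)
    simp only [hH, source]
    fun_prop
  have hvd : ∀ r, HasDerivAt v (w r) r := by
    intro r
    rw [show v = fun r => s + ∫ t in (0 : ℝ)..r, w t from
      funext fun r => by rw [hvr, mul_radialMean_one]]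
    exact (intervalIntegral.integral_hasDerivAt_right (hw.intervalIntegrable _ _)
      (hw.stronglyMeasurableAtFilter _ _) hw.continuousAt).const_add s
  set m := radialMean (fun t => t ^ 8) H with hm
  have hmc : Continuous m := continuous_radialMean (by fun_prop) hHc
  have hwd : ∀ r, HasDerivAt w (H r - 8 * m r) r := by
    intro r
    by_cases hr : r = 0
    · subst hr
      -- Here `1/9 = ∫₀¹ t⁸ dt`. Since `w = r m`, the slope of `w` at `0` is `m 0`, which this value
      -- identifies with `H 0 - 8 m 0`.
      have hm0 : m 0 = H 0 / 9 := by
        simp only [hm, radialMean, zero_mul, intervalIntegral.integral_mul_const, integral_pow]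
        norm_num
        ring
      rw [show H 0 - 8 * m 0 = m 0 by rw [hm0]; ring, hasDerivAt_iff_tendsto_slope]
      refine (hmc.continuousAt.tendsto.mono_left nhdsWithin_le_nhds).congr' ?_
      filter_upwards [self_mem_nhdsWithin] with x hx
      have hx : x ≠ 0 := hx
      rw [slope_def_field, hwr x, hwr 0]
      field_simp
      simp
    · have h1 : ∀ᶠ x in 𝓝 r, (∫ t in (0 : ℝ)..x, t ^ 8 * H t) / x ^ 8 = w x := by
        filter_upwards [eventually_ne_nhds hr] with x hx
        rw [← pow_mul_radialMean, hwr, ← hm]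
        field_simp
        ring
      refine HasDerivAt.congr_of_eventuallyEq ?_ (h1.mono fun x hx => hx.symm)
      have hc : Continuous fun t => t ^ 8 * H t := by fun_prop
      have h2 := (intervalIntegral.integral_hasDerivAt_right (a := 0) (b := r)
        (hc.intervalIntegrable _ _) (hc.stronglyMeasurableAtFilter _ _) hc.continuousAt).div
        (hasDerivAt_pow 8 r) (pow_ne_zero 8 hr)
      convert! h2 using 1
      rw [← pow_mul_radialMean]
      field_simp
      push_cast
      ring
  -- If `v` and `w` are of class `Cⁿ`, so are `H` and its radial mean `m`, hence `v'` and `w'`.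
  have hsmooth : ∀ n : ℕ, ContDiff ℝ n v ∧ ContDiff ℝ n w := by
    intro n
    induction n with
    | zero => exact ⟨contDiff_zero.2 hv, contDiff_zero.2 hw⟩
    | succ n ih =>
      have hHn : ContDiff ℝ n H := by
        have h1 : ContDiff ℝ n cubicQuotient := contDiff_infty.1 contDiff_cubicQuotient n
        have h2 : ContDiff ℝ n fun t => cubicTerm t (v t) :=
          (ih.1.pow 3).mul (h1.comp (contDiff_id.mul ih.1))
        exact (((contDiff_const.mul contDiff_id).mul ih.2).add (contDiff_const.mul ih.1)).add h2
      have hmn : ContDiff ℝ n m := contDiff_radialMean n (by fun_prop) hHn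
      push_cast
      rw [contDiff_succ_iff_deriv, contDiff_succ_iff_deriv]
      refine ⟨⟨fun r => (hvd r).differentiableAt, by simp, ?_⟩,
        ⟨fun r => (hwd r).differentiableAt, by simp, ?_⟩⟩
      · rw [show deriv v = w from funext fun r => (hvd r).deriv]
        exact ih.2
      · rw [show deriv w = fun r => H r - 8 * m r from funext fun r => (hwd r).deriv]
        exact hHn.sub (contDiff_const.mul hmn)
  have hd1 : ∀ r, HasDerivAt (fun r => r * v r) (v r + r * w r) r := by
    intro r
    have := (hasDerivAt_id r).mul (hvd r)
    convert! this using 1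
    simp
  have hd1' : deriv (fun r => r * v r) = fun r => v r + r * w r := funext fun r => (hd1 r).deriv
  refine ⟨fun r => r * v r, contDiff_id.mul (contDiff_infty.2 fun n => (hsmooth n).1), by simp,
    by simp [hd1', hvr 0], fun r hr => ?_⟩
  unfold AngleODE
  have hd2 : HasDerivAt (fun r => v r + r * w r) (w r + (1 * w r + r * (H r - 8 * m r))) r :=
    (hvd r).add ((hasDerivAt_id r).mul (hwd r))
  rw [hd1', hd2.deriv]
  have h1 : m r = w r / r := by rw [hwr r]; field_simp
  have h2 : H r = c * r * w r + c * v r + (3 * sin (2 * (r * v r)) - 6 * (r * v r)) / r ^ 3 := by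
    rw [← cubicTerm_eq hr]; rfl
  rw [h2, h1]
  field_simp
  ring

theorem existsUnique_isGlobalSolution (c s : ℝ) :
    ∃! af : (ℝ → ℝ) × (ℝ → ℝ), IsGlobalSolution c s af.1 af.2 := by
  obtain ⟨θ, hθ⟩ := exists_isAngleSolution c s
  refine ⟨(fun r => sin (θ r), fun r => cos (θ r)), hθ.isGlobalSolution, ?_⟩
  rintro ⟨a, f⟩ h
  obtain ⟨η, hη, ha, hf⟩ := IsGlobalSolution.exists_angle h
  simp only at ha hf
  rw [ha, hf, hη.unique hθ]

end Existence

end ConeSoliton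

/-! ### Change of charts for tangent vectors and differential forms. -/

namespace ConeSoliton

open Set Filter

section Charts

lemma two_le_infty : (2 : WithTop ℕ∞) ≤ ∞ := by
  exact WithTop.coe_le_coe.2 (le_top : (2 : ℕ∞) ≤ ⊤)

variable {E : Type*} [NormedAddCommGroup E] [NormedSpace ℝ E] {H : Type*} [TopologicalSpace H]
  {I : ModelWithCorners ℝ E H} [I.Boundaryless] {M : Type*} [TopologicalSpace M] [ChartedSpace H M]
  [IsManifold I ∞ M]

/-- The transition map from the chart at `p` to the chart at `q`. -/
noncomputable def transition (I : ModelWithCorners ℝ E H) (p q : M) : E → E :=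
  extChartAt I q ∘ (extChartAt I p).symm

/-- Tangent vectors at a point are represented by components in the preferred chart of that very
point, so `coordVec` is the Jacobian of the transition to that moving chart. -/
lemma coordVec_eq_fderiv (p : M) {y : E} (hy : y ∈ (extChartAt I p).target) :
    coordVec I p y = (fderiv ℝ (transition I p ((extChartAt I p).symm y)) y : E →L[ℝ] E) := by
  have : IsManifold I 1 M := IsManifold.of_le (n := ∞) (by simp)
  refine (mdifferentiableWithinAt_extChartAt_symm hy).mfderivWithin.trans ?_
  change fderivWithin ℝ (writtenInExtChartAt 𝓘(ℝ, E) I y (extChartAt I p).symm) _ _ = _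
  simp only [I.range_eq_univ, fderivWithin_univ, writtenInExtChartAt, extChartAt_model_space_eq_id,
    PartialEquiv.refl_symm, PartialEquiv.refl_coe, Function.comp_id, preimage_univ, univ_inter,
    modelWithCornersSelf_coe, range_id, id, transition]

omit [IsManifold I ∞ M] in
lemma transition_self_eventuallyEq (p : M) {y : E} (hy : y ∈ (extChartAt I p).target) :
    transition I p p =ᶠ[𝓝 y] id := by
  filter_upwards [(isOpen_extChartAt_target (I := I) p).mem_nhds hy] with y hy
  exact (extChartAt I p).right_inv hy

lemma coordVec_self (p : M) :
    coordVec I p (extChartAt I p p) = (ContinuousLinearMap.id ℝ E : E →L[ℝ] E) := by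
  refine (coordVec_eq_fderiv p (mem_extChartAt_target p)).trans ?_
  rw [extChartAt_to_inv, (transition_self_eventuallyEq p (mem_extChartAt_target p)).fderiv_eq,
    fderiv_id]

lemma contDiffAt_transition (p q : M) {y : E} (hy : y ∈ (extChartAt I p).target)
    (hq : (extChartAt I p).symm y ∈ (extChartAt I q).source) :
    ContDiffAt ℝ ∞ (transition I p q) y := by
  have h := contDiffWithinAt_ext_coord_change (n := ∞) (I := I) q p (y := y)
    (by rw [PartialEquiv.trans_source, PartialEquiv.symm_source]; exact ⟨hy, hq⟩)
  rwa [I.range_eq_univ, contDiffWithinAt_univ] at h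

omit [IsManifold I ∞ M] in
lemma eventually_symm_mem_source (p q : M) {y : E} (hy : y ∈ (extChartAt I p).target)
    (hq : (extChartAt I p).symm y ∈ (extChartAt I q).source) :
    ∀ᶠ z in 𝓝 y, z ∈ (extChartAt I p).target ∧ (extChartAt I p).symm z ∈ (extChartAt I q).source := by
  have h1 := (isOpen_extChartAt_target (I := I) p).mem_nhds hy
  have h2 : ContinuousAt (extChartAt I p).symm y := by
    have := continuousOn_extChartAt_symm (I := I) p
    exact this.continuousAt h1
  exact (eventually_mem_set.2 h1).and
    (h2.eventually_mem ((isOpen_extChartAt_source (I := I) q).mem_nhds hq))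

lemma fderiv_transition_comp (p q q' : M) {y : E} (hy : y ∈ (extChartAt I p).target)
    (hq : (extChartAt I p).symm y ∈ (extChartAt I q).source)
    (hq' : (extChartAt I p).symm y ∈ (extChartAt I q').source) :
    fderiv ℝ (transition I p q') y
      = (fderiv ℝ (transition I q q') (transition I p q y)).comp (fderiv ℝ (transition I p q) y) := by
  have hyq : transition I p q y ∈ (extChartAt I q).target := (extChartAt I q).map_source hq
  have hinv : (extChartAt I q).symm (transition I p q y) = (extChartAt I p).symm y :=
    (extChartAt I q).left_inv hq
  rw [← fderiv_comp y
    ((contDiffAt_transition q q' hyq (by rwa [hinv])).differentiableAt (by simp))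
    ((contDiffAt_transition p q hy hq).differentiableAt (by simp))]
  refine Filter.EventuallyEq.fderiv_eq ?_
  filter_upwards [eventually_symm_mem_source p q hy hq] with z hz
  simp only [transition, Function.comp]
  rw [(extChartAt I q).left_inv hz.2]

lemma coordVec_transition (p q : M) {y : E} (hy : y ∈ (extChartAt I p).target)
    (hq : (extChartAt I p).symm y ∈ (extChartAt I q).source) (v : E) :
    (coordVec I p y v : E)
      = (coordVec I q (transition I p q y) (fderiv ℝ (transition I p q) y v) : E) := by
  have hyq : transition I p q y ∈ (extChartAt I q).target := (extChartAt I q).map_source hq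
  have hinv : (extChartAt I q).symm (transition I p q y) = (extChartAt I p).symm y :=
    (extChartAt I q).left_inv hq
  have h1 := congrArg (fun L : E →L[ℝ] E => L v) (coordVec_eq_fderiv p hy)
  have h2 := congrArg (fun L : E →L[ℝ] E => L (fderiv ℝ (transition I p q) y v))
    (coordVec_eq_fderiv q hyq)
  refine h1.trans (Eq.trans ?_ h2.symm)
  simp only [hinv]
  rw [fderiv_transition_comp p q _ hy hq (mem_extChartAt_source _)]
  rfl

/-- With the naturality of the exterior derivative under pullback this permits computing `dω` on a
whole neighbourhood in one chart, while `extDerivForm` uses at each point its own chart. The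
identity `d(dω) = 0` requires the former. -/
lemma formInChart_transition {F : Type*} [NormedAddCommGroup F] [NormedSpace ℝ F] {k : ℕ}
    (α : ∀ q : M, TangentSpace I q [⋀^Fin k]→L[ℝ] F) (p q : M) {y : E}
    (hy : y ∈ (extChartAt I p).target)
    (hq : (extChartAt I p).symm y ∈ (extChartAt I q).source) :
    formInChart I α p y = (formInChart I α q (transition I p q y)).compContinuousLinearMap
      (fderiv ℝ (transition I p q) y) := by
  have hinv : (extChartAt I q).symm (transition I p q y) = (extChartAt I p).symm y :=
    (extChartAt I q).left_inv hq
  have key : ∀ (a b : M) (h : a = b) (v : Fin k → E), (α a : E [⋀^Fin k]→L[ℝ] F) v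
      = (α b : E [⋀^Fin k]→L[ℝ] F) v := by
    rintro a _ rfl v; rfl
  ext v
  change (α _ : E [⋀^Fin k]→L[ℝ] F) (fun i => (coordVec I p y (v i) : E)) =
    (α _ : E [⋀^Fin k]→L[ℝ] F)
      (fun i => (coordVec I q (transition I p q y) (fderiv ℝ (transition I p q) y (v i)) : E))
  refine Eq.trans ?_ (key _ _ hinv.symm _)
  refine congrArg (α _ : E [⋀^Fin k]→L[ℝ] F) ?_
  funext i
  exact coordVec_transition p q hy hq (v i)

/-- The exterior derivative may be computed in any chart. -/
lemma extDeriv_formInChart {F : Type*} [NormedAddCommGroup F] [NormedSpace ℝ F] {k : ℕ}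
    {α : ∀ q : M, TangentSpace I q [⋀^Fin k]→L[ℝ] F} (hα : SmoothForm I α) (p : M) {y : E}
    (hy : y ∈ (extChartAt I p).target) (v : Fin (k + 1) → E) :
    extDeriv (formInChart I α p) y v
      = extDerivForm I α ((extChartAt I p).symm y) (fun i => coordVec I p y (v i)) := by
  set q := (extChartAt I p).symm y with hqdef
  have hq : q ∈ (extChartAt I q).source := mem_extChartAt_source _
  have h1 : formInChart I α p =ᶠ[𝓝 y] fun z =>
      (formInChart I α q (transition I p q z)).compContinuousLinearMap
        (fderiv ℝ (transition I p q) z) := by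
    filter_upwards [eventually_symm_mem_source p q hy hq] with z hz
    exact formInChart_transition α p q hz.1 hz.2
  have h2 : transition I p q y = extChartAt I q q := rfl
  have h3 : ContDiffAt ℝ ∞ (formInChart I α q) (transition I p q y) :=
    (hα q).contDiffAt ((isOpen_extChartAt_target (I := I) q).mem_nhds (mem_extChartAt_target q))
  rw [h1.extDeriv_eq, extDeriv_pullback (r := ∞) (h3.differentiableAt (by simp))
    (contDiffAt_transition p q hy hq) (by rw [minSmoothness_of_isRCLikeNormedField]; exact two_le_infty)]
  have h4 := coordVec_eq_fderiv p hy
  change _ = extDeriv (formInChart I α q) (extChartAt I q q) (fun i => (coordVec I p y (v i) : E))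
  rw [h4]
  rfl

lemma formInChart_self {F : Type*} [NormedAddCommGroup F] [NormedSpace ℝ F] {k : ℕ}
    (α : ∀ q : M, TangentSpace I q [⋀^Fin k]→L[ℝ] F) (p : M) (v : Fin k → E) :
    formInChart I α p (extChartAt I p p) v = (α p : E [⋀^Fin k]→L[ℝ] F) v := by
  have key : ∀ (a b : M) (h : a = b) (v : Fin k → E), (α a : E [⋀^Fin k]→L[ℝ] F) v
      = (α b : E [⋀^Fin k]→L[ℝ] F) v := by
    rintro a _ rfl v; rfl
  change (α _ : E [⋀^Fin k]→L[ℝ] F) (fun i => (coordVec I p (extChartAt I p p) (v i) : E)) = _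
  refine (key _ _ (extChartAt_to_inv (I := I) p) _).trans ?_
  refine congrArg (α p : E [⋀^Fin k]→L[ℝ] F) ?_
  funext i
  exact congrArg (fun L : E →L[ℝ] E => L (v i)) (coordVec_self p)

omit [IsManifold I ∞ M] in
lemma SmoothForm.contDiffAt {F : Type*} [NormedAddCommGroup F] [NormedSpace ℝ F] {k : ℕ}
    {α : ∀ q : M, TangentSpace I q [⋀^Fin k]→L[ℝ] F} (hα : SmoothForm I α) (p : M) {y : E}
    (hy : y ∈ (extChartAt I p).target) : ContDiffAt ℝ ∞ (formInChart I α p) y :=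
  (hα p).contDiffAt ((isOpen_extChartAt_target (I := I) p).mem_nhds hy)

end Charts
end ConeSoliton

/-! ### Smoothness of the components of the metric. -/

namespace ConeSoliton

open Set Filter Bundle

section MetricChart

variable {N : Type*} [TopologicalSpace N] [ChartedSpace E6 N] [IsManifold (𝓡 6) ∞ N]

/-- The metric in the chart at `p`. -/
noncomputable def metricInChart (S : NearlyKahler N) (p : N) (y : E6) (v w : E6) : ℝ :=
  S.metric.inner ((extChartAt (𝓡 6) p).symm y) (coordVec (𝓡 6) p y v) (coordVec (𝓡 6) p y w)

lemma contMDiffOn_coordVec (p : N) (v : E6) :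
    ContMDiffOn 𝓘(ℝ, E6) ((𝓡 6).prod 𝓘(ℝ, E6)) ∞
      (fun y : E6 => TotalSpace.mk' E6 (E := TangentSpace (𝓡 6)) ((extChartAt (𝓡 6) p).symm y)
        (coordVec (𝓡 6) p y v)) (extChartAt (𝓡 6) p).target := by
  have : IsManifold (𝓡 6) 1 N := IsManifold.of_le (n := ∞) (by simp)
  have ho := isOpen_extChartAt_target (I := 𝓡 6) p
  have h1 := (contMDiffOn_extChartAt_symm (I := 𝓡 6) (n := ∞) p).contMDiffOn_tangentMapWithin
    (m := ∞) (by simp) ho.uniqueMDiffOn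
  have h2 : ContMDiff 𝓘(ℝ, E6) (𝓘(ℝ, E6).prod 𝓘(ℝ, E6)) ∞
      (fun y : E6 => TotalSpace.mk' E6 (E := TangentSpace 𝓘(ℝ, E6)) y v) :=
    contMDiff_vectorSpace_iff_contDiff.2 contDiff_const
  have h3 := h1.comp h2.contMDiffOn (s := (extChartAt (𝓡 6) p).target) (fun y hy => hy)
  refine h3.congr fun y hy => ?_
  simp only [Function.comp, tangentMapWithin]
  unfold coordVec
  have : mfderivWithin 𝓘(ℝ, E6) (𝓡 6) (extChartAt (𝓡 6) p).symm (range (𝓡 6)) y =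
    mfderivWithin 𝓘(ℝ, E6) (𝓡 6) (extChartAt (𝓡 6) p).symm (extChartAt (𝓡 6) p).target y := by
    rw [(𝓡 6).range_eq_univ, mfderivWithin_univ, mfderivWithin_of_isOpen ho hy]
  rw [this]
  rfl

lemma contDiffOn_metricInChart (S : NearlyKahler N) (p : N) (v w : E6) :
    ContDiffOn ℝ ∞ (fun y => metricInChart S p y v w) (extChartAt (𝓡 6) p).target := by
  intro y hy
  rw [← contMDiffWithinAt_iff_contDiffWithinAt]
  have hb : ContMDiffWithinAt 𝓘(ℝ, E6) (𝓡 6) ∞ (extChartAt (𝓡 6) p).symm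
    (extChartAt (𝓡 6) p).target y := contMDiffOn_extChartAt_symm (I := 𝓡 6) (n := ∞) p y hy
  have : ContMDiffWithinAt 𝓘(ℝ, E6) ((𝓡 6).prod 𝓘(ℝ)) ∞
      (fun m ↦ TotalSpace.mk' ℝ (E := Bundle.Trivial N ℝ) ((extChartAt (𝓡 6) p).symm m)
        (metricInChart S p m v w)) (extChartAt (𝓡 6) p).target y := by
    apply ContMDiffWithinAt.clm_bundle_apply₂ (F₁ := E6) (F₂ := E6)
    · exact ContMDiffAt.comp_contMDiffWithinAt y S.metric.contMDiff.contMDiffAt hb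
    · exact contMDiffOn_coordVec p v y hy
    · exact contMDiffOn_coordVec p w y hy
  simp only [Bundle.contMDiffWithinAt_totalSpace] at this
  exact this.2

end MetricChart
end ConeSoliton

/-! ### Linear algebra of a Hermitian space with a complex volume form. -/

namespace ConeSoliton

open Complex

/-- A Hermitian structure `(g, J)` together with a `(3, 0)`-form `O` on a real vector space. -/
structure HermitianData (V : Type*) [AddCommGroup V] [Module ℝ V] where
  g : V → V → ℝ
  J : V → V
  O : V → V → V → ℂ
  g_add : ∀ u v w, g (u + v) w = g u w + g v w
  g_smul : ∀ (c : ℝ) u v, g (c • u) v = c * g u v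
  g_symm : ∀ u v, g u v = g v u
  g_pos : ∀ v, v ≠ 0 → 0 < g v v
  J_add : ∀ u v, J (u + v) = J u + J v
  J_smul : ∀ (c : ℝ) v, J (c • v) = c • J v
  J_sq : ∀ v, J (J v) = -v
  g_J : ∀ u v, g (J u) (J v) = g u v
  O_add : ∀ u u' v w, O (u + u') v w = O u v w + O u' v w
  O_smul : ∀ (c : ℝ) u v w, O (c • u) v w = c * O u v w
  O_swap : ∀ u v w, O v u w = -O u v w
  O_swap' : ∀ u v w, O u w v = -O u v w
  O_J : ∀ u v w, O (J u) v w = I * O u v w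

namespace HermitianData

variable {V : Type*} [AddCommGroup V] [Module ℝ V] (D : HermitianData V)

lemma g_add' (u v w : V) : D.g u (v + w) = D.g u v + D.g u w := by
  rw [D.g_symm, D.g_add, D.g_symm v, D.g_symm w]

lemma g_smul' (c : ℝ) (u v : V) : D.g u (c • v) = c * D.g u v := by
  rw [D.g_symm, D.g_smul, D.g_symm]

lemma g_zero (v : V) : D.g 0 v = 0 := by
  simpa using D.g_smul 0 0 v

lemma g_zero' (v : V) : D.g v 0 = 0 := by rw [D.g_symm, g_zero]

lemma g_neg (u v : V) : D.g (-u) v = -D.g u v := by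
  simpa using D.g_smul (-1) u v

lemma g_neg' (u v : V) : D.g u (-v) = -D.g u v := by
  rw [D.g_symm, g_neg, D.g_symm]

lemma g_sub (u v w : V) : D.g (u - v) w = D.g u w - D.g v w := by
  rw [sub_eq_add_neg, D.g_add, g_neg, sub_eq_add_neg]

lemma g_J_left (u v : V) : D.g (D.J u) v = -D.g u (D.J v) := by
  have := D.g_J u (D.J v)
  rw [D.J_sq, g_neg'] at this
  linarith

lemma g_J_self (u : V) : D.g (D.J u) u = 0 := by
  have := D.g_J_left u u
  rw [D.g_symm u] at this
  linarith

lemma eq_zero_of_g {v : V} (h : ∀ w, D.g v w = 0) : v = 0 := by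
  by_contra hv
  exact (D.g_pos v hv).ne' (h v)

lemma eq_of_g {u v : V} (h : ∀ w, D.g u w = D.g v w) : u = v :=
  sub_eq_zero.1 (D.eq_zero_of_g fun w => by rw [g_sub, h, sub_self])

lemma O_add₂ (u v v' w : V) : D.O u (v + v') w = D.O u v w + D.O u v' w := by
  rw [D.O_swap, D.O_add, D.O_swap v, D.O_swap v']; ring

lemma O_add₃ (u v w w' : V) : D.O u v (w + w') = D.O u v w + D.O u v w' := by
  rw [D.O_swap', O_add₂, D.O_swap' u v w, D.O_swap' u v w']; ring

lemma O_smul₂ (c : ℝ) (u v w : V) : D.O u (c • v) w = c * D.O u v w := by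
  rw [D.O_swap, D.O_smul, D.O_swap v]; ring

lemma O_smul₃ (c : ℝ) (u v w : V) : D.O u v (c • w) = c * D.O u v w := by
  rw [D.O_swap', O_smul₂, D.O_swap' u v w]; ring

lemma O_J₂ (u v w : V) : D.O u (D.J v) w = I * D.O u v w := by
  rw [D.O_swap, D.O_J, D.O_swap v]; ring

lemma O_J₃ (u v w : V) : D.O u v (D.J w) = I * D.O u v w := by
  rw [D.O_swap', O_J₂, D.O_swap' u v w]; ring

lemma O_self (u w : V) : D.O u u w = 0 := self_eq_neg.1 (D.O_swap u u w)

lemma O_self' (u w : V) : D.O w u u = 0 := self_eq_neg.1 (D.O_swap' w u u)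

lemma O_self'' (u w : V) : D.O u w u = 0 := by rw [D.O_swap', O_self, neg_zero]

lemma O_zero (v w : V) : D.O 0 v w = 0 := by simpa using D.O_smul 0 0 v w

lemma O_zero₂ (v w : V) : D.O v 0 w = 0 := by simpa using D.O_smul₂ 0 v 0 w

lemma O_zero₃ (v w : V) : D.O v w 0 = 0 := by simpa using D.O_smul₃ 0 v w 0

/-- The Kähler form. -/
def om (u v : V) : ℝ := D.g (D.J u) v

lemma om_swap (u v : V) : D.om v u = -D.om u v := by
  unfold om
  rw [g_J_left, D.g_symm]

lemma om_J (u v : V) : D.om (D.J u) v = -D.g u v := by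
  rw [om, D.J_sq, g_neg]

lemma om_J' (u v : V) : D.om u (D.J v) = D.g u v := D.g_J u v

/-- The Hermitian product, complex linear in the second variable. -/
noncomputable def h (u v : V) : ℂ := D.g u v + I * D.om u v

/-- A unitary frame on which `O` has absolute value `1`. -/
structure IsUnitaryFrame (e : Fin 3 → V) : Prop where
  ortho : ∀ i j, D.g (e i) (e j) = if i = j then 1 else 0
  ortho' : ∀ i j, D.g (D.J (e i)) (e j) = 0
  expand : ∀ v, v = ∑ i, (D.g (e i) v • e i + D.g (D.J (e i)) v • D.J (e i))
  norm_O : Complex.normSq (D.O (e 0) (e 1) (e 2)) = 1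

/-- The determinant of three complex vectors. -/
def det3 (a b c : Fin 3 → ℂ) : ℂ :=
  a 0 * (b 1 * c 2 - b 2 * c 1) - a 1 * (b 0 * c 2 - b 2 * c 0) + a 2 * (b 0 * c 1 - b 1 * c 0)

variable {D} {e : Fin 3 → V} (he : D.IsUnitaryFrame e)

variable (D e) in
/-- The complex components of a vector in a unitary frame. -/
noncomputable def comp (v : V) (i : Fin 3) : ℂ := D.h (e i) v

/-- A complex trilinear alternating form is determined by its value on a unitary frame. -/
lemma form_eq_of_expand
    (he : ∀ v, v = ∑ i, (D.g (e i) v • e i + D.g (D.J (e i)) v • D.J (e i))) {A : V → V → V → ℂ}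
    (A_add : ∀ u u' v w, A (u + u') v w = A u v w + A u' v w)
    (A_smul : ∀ (c : ℝ) u v w, A (c • u) v w = c * A u v w)
    (A_swap : ∀ u v w, A v u w = -A u v w) (A_swap' : ∀ u v w, A u w v = -A u v w)
    (A_J : ∀ u v w, A (D.J u) v w = I * A u v w) (x y z : V) :
    A x y z = A (e 0) (e 1) (e 2) * det3 (D.comp e x) (D.comp e y) (D.comp e z) := by
  have h1 : ∀ x y z, A x y z = ∑ i, D.comp e x i * A (e i) y z := by
    intro x y z
    conv_lhs => rw [he x]
    simp only [Fin.sum_univ_three, A_add, A_smul, A_J, comp, h, om]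
    ring
  have h2 : ∀ x y z, A x y z = ∑ i, D.comp e y i * A x (e i) z := by
    intro x y z
    rw [A_swap, h1 y x z]
    simp only [Fin.sum_univ_three, A_swap x]
    ring
  have h3 : ∀ x y z, A x y z = ∑ i, D.comp e z i * A x y (e i) := by
    intro x y z
    rw [A_swap', h2 x z y]
    simp only [Fin.sum_univ_three, A_swap' x y]
    ring
  have s1 : ∀ u w, A u u w = 0 := fun u w => self_eq_neg.1 (A_swap u u w)
  have s2 : ∀ u w, A w u u = 0 := fun u w => self_eq_neg.1 (A_swap' w u u)
  have s3 : ∀ u w, A u w u = 0 := fun u w => by rw [A_swap', s1, neg_zero]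
  have e1 : A (e 0) (e 2) (e 1) = -A (e 0) (e 1) (e 2) := A_swap' _ _ _
  have e2 : A (e 1) (e 0) (e 2) = -A (e 0) (e 1) (e 2) := A_swap _ _ _
  have e3 : A (e 1) (e 2) (e 0) = A (e 0) (e 1) (e 2) := by rw [A_swap', e2, neg_neg]
  have e4 : A (e 2) (e 1) (e 0) = -A (e 0) (e 1) (e 2) := by rw [A_swap, e3]
  have e5 : A (e 2) (e 0) (e 1) = A (e 0) (e 1) (e 2) := by rw [A_swap, e1, neg_neg]
  rw [h1]
  simp only [h2 (e _) y z, h3 (e _) (e _) z, Fin.sum_univ_three, s1, s2, s3, e1, e2, e3, e4, e5, det3]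
  ring

include he

lemma IsUnitaryFrame.form_eq {A : V → V → V → ℂ}
    (A_add : ∀ u u' v w, A (u + u') v w = A u v w + A u' v w)
    (A_smul : ∀ (c : ℝ) u v w, A (c • u) v w = c * A u v w)
    (A_swap : ∀ u v w, A v u w = -A u v w) (A_swap' : ∀ u v w, A u w v = -A u v w)
    (A_J : ∀ u v w, A (D.J u) v w = I * A u v w) (x y z : V) :
    A x y z = A (e 0) (e 1) (e 2) * det3 (D.comp e x) (D.comp e y) (D.comp e z) :=
  form_eq_of_expand he.expand A_add A_smul A_swap A_swap' A_J x y z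

lemma IsUnitaryFrame.O_eq (x y z : V) :
    D.O x y z = D.O (e 0) (e 1) (e 2) * det3 (D.comp e x) (D.comp e y) (D.comp e z) :=
  he.form_eq D.O_add D.O_smul D.O_swap D.O_swap' D.O_J x y z

lemma IsUnitaryFrame.g_eq (x y : V) : D.g x y =
    ∑ i, (D.g (e i) x * D.g (e i) y + D.g (D.J (e i)) x * D.g (D.J (e i)) y) := by
  conv_lhs => rw [he.expand x]
  simp only [Fin.sum_univ_three, D.g_add, D.g_smul]

lemma IsUnitaryFrame.om_eq (x y : V) : D.om x y =
    ∑ i, (D.g (e i) x * D.g (D.J (e i)) y - D.g (D.J (e i)) x * D.g (e i) y) := by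
  rw [om, he.g_eq]
  congr 1
  funext i
  rw [D.g_J, D.g_symm (e i) (D.J x), D.g_J_left, D.g_symm x (D.J (e i))]
  ring

lemma IsUnitaryFrame.h_eq (x y : V) :
    D.h x y = ∑ i, (starRingEnd ℂ) (D.comp e x i) * D.comp e y i := by
  have h1 := he.g_eq x y
  have h2 := he.om_eq x y
  apply Complex.ext
  · simp [h, comp, h1, om, Fin.sum_univ_three]
  · simp only [om, Fin.sum_univ_three] at h2
    simp [h, comp, h2, om, Fin.sum_univ_three]
    ring

lemma IsUnitaryFrame.g_self_eq (x : V) : D.g x x = ∑ i, Complex.normSq (D.comp e x i) := by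
  rw [he.g_eq]
  congr 1
  funext i
  simp [comp, h, om, Complex.normSq_apply]

lemma IsUnitaryFrame.comp_frame (i j : Fin 3) : D.comp e (e j) i = if i = j then 1 else 0 := by
  simp only [comp, h, om, he.ortho, he.ortho']
  split <;> simp

lemma IsUnitaryFrame.om_frame (i j : Fin 3) : D.om (e i) (e j) = 0 := he.ortho' i j

lemma IsUnitaryFrame.eq_zero_of_comp {v : V} (h0 : ∀ i, D.comp e v i = 0) : v = 0 := by
  have h1 : ∀ i, D.g (e i) v = 0 := fun i => by simpa [comp, h] using congrArg Complex.re (h0 i)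
  have h2 : ∀ i, D.g (D.J (e i)) v = 0 := fun i => by
    simpa [comp, h, om] using congrArg Complex.im (h0 i)
  rw [he.expand v]
  simp [h1, h2]

-- Hadamard's inequality in `ℂ³`, by Lagrange's identity twice: with `p` the cross product of `a`
-- and `b`, the determinant is `p · c`, and both defects are sums of squared moduli.
omit he in
lemma normSq_det3_le (a b c : Fin 3 → ℂ) :
    Complex.normSq (det3 a b c) ≤ (∑ i, Complex.normSq (a i)) * (∑ i, Complex.normSq (b i)) * ∑ i, Complex.normSq (c i) := by
  set p : Fin 3 → ℂ := ![a 1 * b 2 - a 2 * b 1, a 2 * b 0 - a 0 * b 2, a 0 * b 1 - a 1 * b 0] with hp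
  have h1 : (∑ i, Complex.normSq (a i)) * (∑ i, Complex.normSq (b i)) - ∑ i, Complex.normSq (p i)
      = Complex.normSq (∑ i, a i * (starRingEnd ℂ) (b i)) := by
    simp only [hp, Fin.sum_univ_three, Matrix.cons_val_zero, Matrix.cons_val_one, Matrix.cons_val,
      Complex.normSq_apply, mul_re, mul_im, add_re, add_im, sub_re, sub_im, conj_re, conj_im]
    ring
  have h2 : (∑ i, Complex.normSq (p i)) * (∑ i, Complex.normSq (c i)) - Complex.normSq (det3 a b c)
      = Complex.normSq (p 0 * (starRingEnd ℂ) (c 1) - p 1 * (starRingEnd ℂ) (c 0))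
        + Complex.normSq (p 1 * (starRingEnd ℂ) (c 2) - p 2 * (starRingEnd ℂ) (c 1))
        + Complex.normSq (p 2 * (starRingEnd ℂ) (c 0) - p 0 * (starRingEnd ℂ) (c 2)) := by
    have : det3 a b c = p 0 * c 0 + p 1 * c 1 + p 2 * c 2 := by
      simp only [hp, det3, Matrix.cons_val_zero, Matrix.cons_val_one, Matrix.cons_val]
      ring
    rw [this]
    simp only [Fin.sum_univ_three,
      Complex.normSq_apply, mul_re, mul_im, add_re, add_im, sub_re, sub_im, conj_re, conj_im]
    ring
  have h3 : ∑ i, Complex.normSq (p i) ≤ (∑ i, Complex.normSq (a i)) * (∑ i, Complex.normSq (b i)) := by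
    have := Complex.normSq_nonneg (∑ i, a i * (starRingEnd ℂ) (b i))
    linarith
  have h4 : Complex.normSq (det3 a b c) ≤ (∑ i, Complex.normSq (p i)) * (∑ i, Complex.normSq (c i)) := by
    have i1 := Complex.normSq_nonneg (p 0 * (starRingEnd ℂ) (c 1) - p 1 * (starRingEnd ℂ) (c 0))
    have i2 := Complex.normSq_nonneg (p 1 * (starRingEnd ℂ) (c 2) - p 2 * (starRingEnd ℂ) (c 1))
    have i3 := Complex.normSq_nonneg (p 2 * (starRingEnd ℂ) (c 0) - p 0 * (starRingEnd ℂ) (c 2))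
    linarith
  refine h4.trans ?_
  have : 0 ≤ ∑ i, Complex.normSq (c i) := Finset.sum_nonneg fun i _ => Complex.normSq_nonneg _
  gcongr

/-- Equality holds on unitary frames, so the defect has a minimum there. This later yields the
derivative of the norm of `Ω` without differentiating frames. -/
lemma IsUnitaryFrame.normSq_O_le (x y z : V) :
    Complex.normSq (D.O x y z) ≤ D.g x x * D.g y y * D.g z z := by
  rw [he.O_eq, map_mul, he.norm_O, one_mul, he.g_self_eq x, he.g_self_eq y, he.g_self_eq z]
  exact normSq_det3_le _ _ _

/-- The contraction identity for `O` and its conjugate. -/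
lemma IsUnitaryFrame.O_cross {u x p : V} (hp : ∀ z, D.g p z = (D.O u x z).re) (y z : V) :
    D.O p y z = D.h u y * D.h x z - D.h u z * D.h x y := by
  -- The dual vector `p` is the complex cross product of `u` and `x` up to the phase of `O`, which
  -- cancels since `|O(e₀, e₁, e₂)| = 1`.
  have hc : ∀ i, D.comp e p i = (starRingEnd ℂ) (D.O u x (e i)) := by
    intro i
    apply Complex.ext
    · simp [comp, h, D.g_symm (e i) p, hp]
    · simp [comp, h, om, D.g_symm _ p, hp, D.O_J₃]
  have hn : (starRingEnd ℂ) (D.O (e 0) (e 1) (e 2)) * D.O (e 0) (e 1) (e 2) = 1 := by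
    rw [← Complex.normSq_eq_conj_mul_self, he.norm_O]; simp
  have c0 : det3 (D.comp e u) (D.comp e x) (D.comp e (e 0))
      = D.comp e u 1 * D.comp e x 2 - D.comp e u 2 * D.comp e x 1 := by
    simp [det3, he.comp_frame]; ring
  have c1 : det3 (D.comp e u) (D.comp e x) (D.comp e (e 1))
      = D.comp e u 2 * D.comp e x 0 - D.comp e u 0 * D.comp e x 2 := by
    simp [det3, he.comp_frame]; ring
  have c2 : det3 (D.comp e u) (D.comp e x) (D.comp e (e 2))
      = D.comp e u 0 * D.comp e x 1 - D.comp e u 1 * D.comp e x 0 := by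
    simp [det3, he.comp_frame]
  rw [he.O_eq p y z, det3]
  simp only [hc, he.O_eq u x (e _), c0, c1, c2, he.h_eq, Fin.sum_univ_three, map_mul, map_sub]
  linear_combination ((((starRingEnd ℂ) (D.comp e u 1) * (starRingEnd ℂ) (D.comp e x 2) -
    (starRingEnd ℂ) (D.comp e u 2) * (starRingEnd ℂ) (D.comp e x 1)) *
    (D.comp e y 1 * D.comp e z 2 - D.comp e y 2 * D.comp e z 1)) -
    (((starRingEnd ℂ) (D.comp e u 2) * (starRingEnd ℂ) (D.comp e x 0) -
    (starRingEnd ℂ) (D.comp e u 0) * (starRingEnd ℂ) (D.comp e x 2)) *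
    (D.comp e y 0 * D.comp e z 2 - D.comp e y 2 * D.comp e z 0)) +
    (((starRingEnd ℂ) (D.comp e u 0) * (starRingEnd ℂ) (D.comp e x 1) -
    (starRingEnd ℂ) (D.comp e u 1) * (starRingEnd ℂ) (D.comp e x 0)) *
    (D.comp e y 0 * D.comp e z 1 - D.comp e y 1 * D.comp e z 0))) * hn

end HermitianData

end ConeSoliton

/-! ### Closed forms of an `SU(3)`-structure are parallel: the pointwise algebra. -/

namespace ConeSoliton

open Complex

namespace HermitianData

variable {V : Type*} [AddCommGroup V] [Module ℝ V] {D : HermitianData V}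

variable (D) in
/-- The algebraic constraints satisfied by the covariant derivatives `a`, `b` of the Kähler form and
of the `(3, 0)`-form of an `SU(3)`-structure (in the direction of the first argument), apart from
the constancy of the norm, when both forms are closed. -/
structure IsClosedJet (a : V → V → V → ℝ) (b : V → V → V → V → ℂ) : Prop where
  a_add : ∀ u v v' w, a u (v + v') w = a u v w + a u v' w
  a_smul : ∀ (c : ℝ) u v w, a u (c • v) w = c * a u v w
  a_swap : ∀ u v w, a u w v = -a u v w
  a_J : ∀ u v w, a u (D.J v) w = a u v (D.J w)
  a_cyc : ∀ u v w, a u v w + a v w u + a w u v = 0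
  b_add₁ : ∀ u u' x y z, b (u + u') x y z = b u x y z + b u' x y z
  b_smul₁ : ∀ (c : ℝ) u x y z, b (c • u) x y z = c * b u x y z
  b_add : ∀ u x x' y z, b u (x + x') y z = b u x y z + b u x' y z
  b_smul : ∀ (c : ℝ) u x y z, b u (c • x) y z = c * b u x y z
  b_swap : ∀ u x y z, b u y x z = -b u x y z
  b_swap' : ∀ u x y z, b u x z y = -b u x y z
  b_J : ∀ u x, ∃ k, (∀ z, D.g k z = a u x z) ∧
    ∀ y z, b u (D.J x) y z = I * b u x y z - D.O k y z
  b_alt : ∀ u x y z, b u x y z - b x u y z + b y u x z - b z u x y = 0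

variable {a : V → V → V → ℝ} {b : V → V → V → V → ℂ} (H : D.IsClosedJet a b)
  {e : Fin 3 → V} (he : D.IsUnitaryFrame e)

include H

namespace IsClosedJet

lemma a_neg (u v w : V) : a u (-v) w = -a u v w := by simpa using H.a_smul (-1) u v w

/-- The sum `s(v, w, u) = a(v, w, u) + a(Jv, Jw, u)` is symmetric in the first two arguments by
closedness and antisymmetric in the last two. As in the uniqueness of the Levi-Civita connection,
such a trilinear form vanishes. -/
lemma a_J_J (u v w : V) : a (D.J u) (D.J v) w = -a u v w := by
  have c : ∀ u v w, a u (D.J v) (D.J w) = -a u v w := fun u v w => by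
    rw [← H.a_J, D.J_sq, H.a_neg]
  set s : V → V → V → ℝ := fun v w u => a v w u + a (D.J v) (D.J w) u with hs
  have s1 : ∀ v w u, s v w u = s w v u := by
    intro v w u
    have h1 := H.a_cyc u v w
    have h2 := H.a_cyc u (D.J v) (D.J w)
    rw [c] at h2
    have h3 := H.a_swap w v u
    have h4 := H.a_swap (D.J w) (D.J v) u
    simp only [hs]
    linarith
  have s2 : ∀ v w u, s v u w = -s v w u := by
    intro v w u
    simp only [hs]
    rw [H.a_swap v w u, H.a_swap (D.J v) w (D.J u), ← H.a_J]
    ring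
  have h1 := s1 u v w
  have h2 := s2 v w u
  have h3 := s1 v w u
  have h4 := s2 w u v
  have h5 := s1 w u v
  have h6 := s2 u v w
  have : s u v w = 0 := by linarith
  simp only [hs] at this
  linarith

lemma a_J_left (u x w : V) : a (D.J u) x w = a u (D.J x) w := by
  have := H.a_J_J u (D.J x) w
  rw [D.J_sq, H.a_neg] at this
  linarith

include he

/-- Closed forms of constant norm are parallel. -/
theorem eq_zero (hb : ∀ u, ((starRingEnd ℂ) (D.O (e 0) (e 1) (e 2)) * b u (e 0) (e 1) (e 2)).re = 0) :
    (∀ u v w, a u v w = 0) ∧ ∀ u x y z, b u x y z = 0 := by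
  -- For an actual structure `K u x` is `(∇_u J) x`. It is conjugate linear in `x` and, by `a_J_J`,
  -- also in `u`.
  choose K hK hbK using H.b_J
  set o := D.O (e 0) (e 1) (e 2) with ho
  have hn : (starRingEnd ℂ) o * o = 1 := by
    rw [← Complex.normSq_eq_conj_mul_self, he.norm_O]; simp
  have ho0 : o ≠ 0 := fun h0 => by simp [h0] at hn
  have KJ : ∀ u x, K u (D.J x) = -D.J (K u x) := fun u x => D.eq_of_g fun z => by
    rw [hK, g_neg, D.g_J_left, hK, H.a_J, neg_neg]
  have JK : ∀ u x, K (D.J u) x = -D.J (K u x) := fun u x => by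
    rw [← KJ]
    exact D.eq_of_g fun z => by rw [hK, hK, H.a_J_left]
  have Kadd : ∀ u x x', K u (x + x') = K u x + K u x' := fun u x x' => D.eq_of_g fun z => by
    rw [hK, D.g_add, hK, hK, H.a_add]
  have Ksmul : ∀ u (c : ℝ) x, K u (c • x) = c • K u x := fun u c x => D.eq_of_g fun z => by
    rw [hK, D.g_smul, hK, H.a_smul]
  have Oneg : ∀ x y z, D.O (-x) y z = -D.O x y z := fun x y z => by simpa using D.O_smul (-1) x y z
  have Oneg₂ : ∀ x y z, D.O x (-y) z = -D.O x y z := fun x y z => by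
    simpa using D.O_smul₂ (-1) x y z
  have Oneg₃ : ∀ x y z, D.O x y (-z) = -D.O x y z := fun x y z => by
    simpa using D.O_smul₃ (-1) x y z
  set ν : V → ℂ := fun u => (starRingEnd ℂ) o * b u (e 0) (e 1) (e 2) with hν
  have aself : ∀ u x, a u x x = 0 := fun u x => by have := H.a_swap u x x; linarith
  have aJself : ∀ u x, a u x (D.J x) = 0 := fun u x => by
    have h1 := H.a_swap u (D.J x) x
    have h2 := H.a_J u x x
    linarith
  have hcomp : ∀ u i, D.comp e (K u (e i)) i = 0 := by
    intro u i
    simp [comp, h, om, D.g_symm _ (K u (e i)), hK, aself, aJself]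
  -- Complex linearity of `b` in `x` fails by `O(K u x, y, z)`. Adding `i/2` times the sum of the
  -- three terms with `K` repairs this, and the result is a multiple of `O`, with factor read off on
  -- the frame: there the correction vanishes, since `K u eᵢ` has no component along `eᵢ`.
  have hform : ∀ u x y z, b u x y z = ν u * D.O x y z
      - I / 2 * (D.O (K u x) y z + D.O x (K u y) z + D.O x y (K u z)) := by
    intro u x y z
    have h1 := he.form_eq (A := fun x y z => b u x y z
      + I / 2 * (D.O (K u x) y z + D.O x (K u y) z + D.O x y (K u z)))
      (by intro x x' y z; simp only [H.b_add, Kadd, D.O_add]; ring)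
      (by intro c x y z; simp only [H.b_smul, Ksmul, D.O_smul]; ring)
      (by
        intro x y z
        simp only [H.b_swap u x y]
        rw [D.O_swap x (K u y), D.O_swap (K u x) y, D.O_swap x y]; ring)
      (by
        intro x y z
        simp only [H.b_swap' u x y]
        rw [D.O_swap' _ y z, D.O_swap' x y (K u z), D.O_swap' x (K u y) z]; ring)
      (by
        intro x y z
        simp only [hbK, KJ, D.O_J, Oneg]
        linear_combination (-D.O (K u x) y z) * I_sq) x y z
    have h2 : D.O (K u (e 0)) (e 1) (e 2) + D.O (e 0) (K u (e 1)) (e 2)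
        + D.O (e 0) (e 1) (K u (e 2)) = 0 := by
      simp only [he.O_eq (K u _), he.O_eq (e 0) (K u _), he.O_eq (e 0) (e 1) (K u _), det3,
        he.comp_frame, hcomp]
      simp
    simp only [h2] at h1
    rw [he.O_eq x y z]
    linear_combination h1 - b u (e 0) (e 1) (e 2) * det3 (D.comp e x) (D.comp e y) (D.comp e z) * hn
  -- Closedness of the `3`-form on the arguments `u, Ju, y, z`.
  have star : ∀ u y z, (I * ν u - ν (D.J u)) * D.O u y z + (D.O u (K u y) z - D.O u (K y u) z)
      + (D.O u y (K u z) - D.O u y (K z u)) = 0 := by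
    intro u y z
    have h1 := H.b_alt u (D.J u) y z
    simp only [hform, KJ, JK, D.O_J, D.O_J₂, D.O_J₃, Oneg, Oneg₂, Oneg₃, D.O_self] at h1
    rw [D.O_swap u (K y u), D.O_swap u (K z u), D.O_swap' u y (K z u)] at h1
    linear_combination h1 + (D.O u (K u y) z + D.O u y (K u z) - D.O u (K y u) z - D.O u y (K z u)) * I_sq
  -- Replacing `y` by `Jy` multiplies this difference by `-i` and the other terms of `star` by `i`,
  -- which separates them.
  have star2 : ∀ u y z, D.O u (K u y) z - D.O u (K y u) z = 0 := by
    intro u y z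
    have h1 := star u y z
    have h2 := star u (D.J y) z
    simp only [KJ, JK, D.O_J₂, Oneg₂] at h2
    have h3 : (2 * I) * (D.O u (K u y) z - D.O u (K y u) z) = 0 := by
      linear_combination I * h1 - h2
    simpa using h3
  have hcomp2 : ∀ i j, j ≠ i → ∀ v, (∀ z, D.O (e i) v z = 0) → D.comp e v j = 0 := by
    intro i j hij v hv
    have hv' : ∀ z, det3 (D.comp e (e i)) (D.comp e v) (D.comp e z) = 0 := fun z => by
      have := hv z
      rw [he.O_eq] at this
      exact (mul_eq_zero.1 this).resolve_left ho0
    have h0 := hv' (e 0)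
    have h1 := hv' (e 1)
    have h2 := hv' (e 2)
    fin_cases i <;> fin_cases j <;> first
      | exact absurd rfl hij
      | (simp [det3, he.comp_frame] at h0 h1 h2
         first | exact h0 | exact h1 | exact h2)
  -- The contraction of `O` with `eᵢ` annihilates only the complex line of `eᵢ`. The difference lies
  -- in the lines of both `eᵢ` and `eⱼ`, hence is zero.
  have hL : ∀ i j, K (e i) (e j) - K (e j) (e i) = 0 := by
    intro i j
    by_cases hij : i = j
    · rw [hij, sub_self]
    have Osub : ∀ u x y z, D.O u (x - y) z = D.O u x z - D.O u y z := fun u x y z => by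
      rw [sub_eq_add_neg, D.O_add₂, Oneg₂, sub_eq_add_neg]
    have h1 : ∀ z, D.O (e i) (K (e i) (e j) - K (e j) (e i)) z = 0 := fun z => by
      rw [Osub, star2]
    have h2 : ∀ z, D.O (e j) (K (e i) (e j) - K (e j) (e i)) z = 0 := fun z => by
      rw [Osub, ← neg_sub, star2, neg_zero]
    refine he.eq_zero_of_comp fun k => ?_
    by_cases hk : k = i
    · exact hcomp2 j k (fun hkj => hij (hk.symm.trans hkj)) _ h2
    · exact hcomp2 i k hk _ h1
  -- In the cyclic identity for `z, eᵢ, eⱼ` the other two terms cancel by the symmetry `hL`.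
  have a1 : ∀ z i j, a z (e i) (e j) = 0 := by
    intro z i j
    have h1 := congrArg (fun v => D.g v z) (hL i j)
    simp only [g_sub, hK, g_zero] at h1
    have h2 := H.a_cyc z (e i) (e j)
    have h3 := H.a_swap (e j) (e i) z
    linarith
  have a2 : ∀ z i j, a z (D.J (e i)) (e j) = 0 := fun z i j => by rw [← H.a_J_left, a1]
  have a3 : ∀ z i j, a z (D.J (e i)) (D.J (e j)) = 0 := fun z i j => by
    rw [← H.a_J, D.J_sq, H.a_neg, a1, neg_zero]
  have aexp : ∀ z x w, (∀ i, a z (e i) w = 0) → (∀ i, a z (D.J (e i)) w = 0) → a z x w = 0 := by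
    intro z x w h1 h2
    rw [he.expand x]
    simp only [Fin.sum_univ_three, H.a_add, H.a_smul, h1, h2]
    simp
  have a0 : ∀ u v w, a u v w = 0 := by
    intro u v w
    refine aexp _ _ _ (fun i => ?_) fun i => ?_
    · rw [H.a_swap, aexp _ _ _ (fun j => a1 _ _ _) fun j => a2 _ _ _, neg_zero]
    · rw [← neg_eq_zero, ← H.a_swap]
      refine aexp _ _ _ (fun j => ?_) fun j => a3 _ _ _
      rw [← H.a_J, a2]
  refine ⟨a0, ?_⟩
  have K0 : ∀ u x, K u x = 0 := fun u x => D.eq_zero_of_g fun z => by rw [hK, a0]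
  have hform' : ∀ u x y z, b u x y z = ν u * D.O x y z := fun u x y z => by
    rw [hform]; simp [K0, O_zero, O_zero₂, O_zero₃]
  have star3 : ∀ u y z, (I * ν u - ν (D.J u)) * D.O u y z = 0 := fun u y z => by
    have := star u y z
    simpa [K0, O_zero₂, O_zero₃] using this
  have hνe : ∀ i, I * ν (e i) - ν (D.J (e i)) = 0 := by
    have e3 : D.O (e 1) (e 2) (e 0) = o := by
      rw [D.O_swap', D.O_swap, neg_neg]
    have e5 : D.O (e 2) (e 0) (e 1) = o := by rw [D.O_swap, D.O_swap', neg_neg]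
    intro i
    fin_cases i
    · exact (mul_eq_zero.1 (star3 (e 0) (e 1) (e 2))).resolve_right ho0
    · exact (mul_eq_zero.1 (star3 (e 1) (e 2) (e 0))).resolve_right (by rw [e3]; exact ho0)
    · exact (mul_eq_zero.1 (star3 (e 2) (e 0) (e 1))).resolve_right (by rw [e5]; exact ho0)
  -- Constant norm makes `ν` imaginary on both `eᵢ` and `J eᵢ`, while `ν(J eᵢ) = i ν(eᵢ)`.
  have hν1 : ∀ i, ν (e i) = 0 := by
    intro i
    have h1 := hb (e i)
    have h2 := hb (D.J (e i))
    change (ν _).re = 0 at h1 h2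
    rw [← sub_eq_zero.1 (hνe i)] at h2
    apply Complex.ext
    · simpa using h1
    · simpa using h2
  have hν2 : ∀ i, ν (D.J (e i)) = 0 := fun i => by
    rw [← sub_eq_zero.1 (hνe i), hν1, mul_zero]
  intro u x y z
  rw [he.expand u]
  simp only [Fin.sum_univ_three, H.b_add₁, H.b_smul₁]
  simp only [hform', hν1, hν2]
  simp

end IsClosedJet

end HermitianData

/-! ### Covariant derivatives of the forms of a nearly Kähler structure. -/

namespace HermitianData

variable {V : Type*} [AddCommGroup V] [Module ℝ V] (D : HermitianData V)

/-- The algebraic constraints satisfied by the covariant derivatives of the Kähler form and of the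
`(3, 0)`-form of a nearly Kähler structure, apart from the constancy of the norm. -/
structure IsNearlyKahlerJet (a : V → V → V → ℝ) (b : V → V → V → V → ℂ) : Prop where
  a_add : ∀ u v v' w, a u (v + v') w = a u v w + a u v' w
  a_smul : ∀ (c : ℝ) u v w, a u (c • v) w = c * a u v w
  a_swap : ∀ u v w, a u w v = -a u v w
  a_J : ∀ u v w, a u (D.J v) w = a u v (D.J w)
  a_cyc : ∀ u v w, a u v w + a v w u + a w u v = -3 * (D.O u v w).re
  b_add₁ : ∀ u u' x y z, b (u + u') x y z = b u x y z + b u' x y z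
  b_smul₁ : ∀ (c : ℝ) u x y z, b (c • u) x y z = c * b u x y z
  b_add : ∀ u x x' y z, b u (x + x') y z = b u x y z + b u x' y z
  b_smul : ∀ (c : ℝ) u x y z, b u (c • x) y z = c * b u x y z
  b_swap : ∀ u x y z, b u y x z = -b u x y z
  b_swap' : ∀ u x y z, b u x z y = -b u x y z
  b_J : ∀ u x, ∃ k, (∀ z, D.g k z = a u x z) ∧
    ∀ y z, b u (D.J x) y z = I * b u x y z - D.O k y z
  b_alt : ∀ u x y z, b u x y z - b x u y z + b y u x z - b z u x y
    = 4 * I * (D.om u x * D.om y z - D.om u y * D.om x z + D.om u z * D.om x y : ℝ)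

variable {D} {a : V → V → V → ℝ} {b : V → V → V → V → ℂ} (H : D.IsNearlyKahlerJet a b)
  {e : Fin 3 → V} (he : D.IsUnitaryFrame e)

lemma h_add (u v w : V) : D.h u (v + w) = D.h u v + D.h u w := by
  simp [h, om, g_add']; ring

lemma h_smul (c : ℝ) (u v : V) : D.h u (c • v) = c * D.h u v := by
  simp [h, om, g_smul']; ring

lemma h_add_left (u v w : V) : D.h (u + v) w = D.h u w + D.h v w := by
  simp [h, om, D.g_add, D.J_add]; ring

lemma h_smul_left (c : ℝ) (u v : V) : D.h (c • u) v = c * D.h u v := by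
  simp [h, om, D.g_smul, D.J_smul]; ring

lemma om_add (u v w : V) : D.om (u + v) w = D.om u w + D.om v w := by
  simp [om, D.g_add, D.J_add]

lemma om_smul (c : ℝ) (u v : V) : D.om (c • u) v = c * D.om u v := by
  simp [om, D.g_smul, D.J_smul]

lemma om_add_right (u v w : V) : D.om u (v + w) = D.om u v + D.om u w := by
  simp [om, g_add']

lemma om_smul_right (c : ℝ) (u v : V) : D.om u (c • v) = c * D.om u v := by
  simp [om, g_smul']

lemma h_J (u v : V) : D.h u (D.J v) = I * D.h u v := by
  have : D.g u (D.J v) = -D.om u v := by rw [om, g_J_left, neg_neg]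
  simp only [h, om_J', this]
  push_cast
  linear_combination (-(D.om u v : ℂ)) * I_sq

include he in
lemma IsUnitaryFrame.exists_dual {F : V → ℝ} (F_add : ∀ u v, F (u + v) = F u + F v)
    (F_smul : ∀ (c : ℝ) u, F (c • u) = c * F u) : ∃ p, ∀ z, D.g p z = F z := by
  refine ⟨∑ i, (F (e i) • e i + F (D.J (e i)) • D.J (e i)), fun z => ?_⟩
  conv_rhs => rw [he.expand z]
  simp only [Fin.sum_univ_three, F_add, F_smul, D.g_add, D.g_smul]
  ring

include H he in
/-- The covariant derivatives of the Kähler form and of the `(3, 0)`-form of a nearly Kähler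
structure. -/
theorem IsNearlyKahlerJet.eq
    (hb : ∀ u, ((starRingEnd ℂ) (D.O (e 0) (e 1) (e 2)) * b u (e 0) (e 1) (e 2)).re = 0) :
    (∀ u v w, a u v w = -(D.O u v w).re) ∧
    ∀ u x y z, b u x y z = D.h u x * D.om y z + D.h u y * D.om z x + D.h u z * D.om x y := by
  -- The inhomogeneous equations are affine. Subtracting the expected solution leaves homogeneous
  -- data, to which `IsClosedJet.eq_zero` applies.
  have hc : D.IsClosedJet (fun u v w => a u v w + (D.O u v w).re) (fun u x y z => b u x y z -
      (D.h u x * D.om y z + D.h u y * D.om z x + D.h u z * D.om x y)) := by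
    constructor
    · intro u v v' w
      simp only [H.a_add, D.O_add₂, add_re]; ring
    · intro c u v w
      simp only [H.a_smul, D.O_smul₂, re_ofReal_mul]; ring
    · intro u v w
      simp only [H.a_swap u v, D.O_swap' u v, neg_re]; ring
    · intro u v w
      simp only [H.a_J, D.O_J₂, D.O_J₃]
    · intro u v w
      have h1 := H.a_cyc u v w
      have h2 : D.O v w u = D.O u v w := by rw [D.O_swap', D.O_swap, neg_neg]
      have h3 : D.O w u v = D.O u v w := by rw [D.O_swap, D.O_swap', neg_neg]
      simp only [h2, h3]
      linarith
    · intro u u' x y z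
      simp only [H.b_add₁, h_add_left]; ring
    · intro c u x y z
      simp only [H.b_smul₁, h_smul_left]; ring
    · intro u x x' y z
      simp only [H.b_add, h_add, om_add, om_add_right, ofReal_add]; ring
    · intro c u x y z
      simp only [H.b_smul, h_smul, om_smul, om_smul_right, ofReal_mul]; ring
    · intro u x y z
      simp only [H.b_swap u x y]
      rw [D.om_swap y x, D.om_swap x z, D.om_swap z y]
      push_cast; ring
    · intro u x y z
      simp only [H.b_swap' u x y]
      rw [D.om_swap y x, D.om_swap x z, D.om_swap y z]
      push_cast; ring
    · intro u x
      obtain ⟨k, hk, hb⟩ := H.b_J u x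
      -- Subtracting `∇ω = -Re Ω` shifts `(∇_u J) x` by the dual of `Re O(u, x, ·)`; the identity
      -- `O_cross` shows that the candidate for `∇Ω` shifts consistently.
      obtain ⟨p, hp⟩ := he.exists_dual (F := fun z => (D.O u x z).re)
        (fun v w => by simp [O_add₃]) (fun c v => by simp [O_smul₃])
      refine ⟨k + p, fun z => by rw [D.g_add, hk, hp], fun y z => ?_⟩
      have h1 := he.O_cross hp y z
      rw [D.O_add, h1, hb, h_J, om_J, om_J', D.g_symm z x]
      simp only [h, D.om_swap x z]
      push_cast
      ring
    · intro u x y z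
      have h1 := H.b_alt u x y z
      simp only [h, D.om_swap x u, D.om_swap y u, D.om_swap z u, D.om_swap z x, D.om_swap y x,
        D.om_swap z y, D.g_symm x u, D.g_symm y u, D.g_symm z u, D.g_symm z x, D.g_symm y x,
        D.g_symm z y] at h1 ⊢
      push_cast at h1 ⊢
      linear_combination h1
  obtain ⟨h1, h2⟩ := hc.eq_zero he fun u => by
    simpa [he.om_frame] using hb u
  exact ⟨fun u v w => eq_neg_of_add_eq_zero_left (h1 u v w), fun u x y z => sub_eq_zero.1 (h2 u x y z)⟩

end HermitianData

end ConeSoliton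

/-! ### Wedge products as finite recursive sums, and integer tables for `ω` and `Ω`. -/

namespace ConeSoliton

open Complex

/-- The alternating sum of `F` over the rearrangements of `v`, by recursion on the first entry. -/
def altSum {A R : Type*} [CommRing R] : (n : ℕ) → ((Fin n → A) → R) → (Fin n → A) → R
  | 0, F, v => F v
  | n + 1, F, v => ∑ p : Fin (n + 1), (if p = 0 then 1 else -1) *
      altSum n (fun w => F (Fin.cons (v p) w)) (fun i => v (Equiv.swap 0 p i.succ))

/-- A permutation is a choice of the first entry, realised by a transposition with `0`, followed by
a permutation of the rest. The recursive form can be expanded for small `n` and evaluated by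
computation for `n = 6`. -/
lemma sum_perm_eq_altSum {A R : Type*} [CommRing R] (n : ℕ) (F : (Fin n → A) → R) (v : Fin n → A) :
    ∑ σ : Equiv.Perm (Fin n), ((Equiv.Perm.sign σ : ℤ) : R) * F (fun i => v (σ i)) = altSum n F v := by
  induction n with
  | zero =>
    simp only [Finset.univ_unique, Finset.sum_singleton, altSum]
    rw [show (default : Equiv.Perm (Fin 0)) = 1 from rfl]
    simp
  | succ n ih =>
    rw [← Equiv.Perm.decomposeFin.symm.sum_comp, Fintype.sum_prod_type, altSum]
    refine Finset.sum_congr rfl fun p _ => ?_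
    rw [← ih, Finset.mul_sum]
    refine Finset.sum_congr rfl fun τ _ => ?_
    have h1 : (fun i => v ((Equiv.Perm.decomposeFin.symm (p, τ)) i))
        = Fin.cons (v p) (fun i => v (Equiv.swap 0 p (τ i).succ)) := by
      funext i
      refine Fin.cases ?_ (fun i => ?_) i
      · simp
      · simp
    rw [h1, Equiv.Perm.decomposeFin.symm_sign]
    split_ifs <;> simp

lemma altSum_intCast {R : Type*} [CommRing R] (n : ℕ) {A : Type*} (F : (Fin n → A) → ℤ) (v : Fin n → A) :
    altSum n (fun w => (F w : R)) v = (altSum n F v : ℤ) := by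
  induction n with
  | zero => simp [altSum]
  | succ n ih =>
    simp only [altSum, Int.cast_sum, Int.cast_mul, ← ih]
    refine Finset.sum_congr rfl fun p _ => ?_
    split_ifs <;> simp

lemma altSum_comp {R : Type*} [CommRing R] (n : ℕ) {A B : Type*} (F : (Fin n → B) → R) (b : A → B) (v : Fin n → A) :
    altSum n F (fun i => b (v i)) = altSum n (fun w => F (fun i => b (w i))) v := by
  rw [← sum_perm_eq_altSum, ← sum_perm_eq_altSum]

lemma wedge_eq_altSum {V R : Type*} [Field R] {k l : ℕ} (α : (Fin k → V) → R) (β : (Fin l → V) → R)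
    (v : Fin (k + l) → V) : wedge α β v = ((k.factorial : R) * (l.factorial : R))⁻¹ *
      altSum (k + l) (fun w => α (fun i => w (Fin.castAdd l i)) * β (fun j => w (Fin.natAdd k j))) v := by
  rw [wedge, ← sum_perm_eq_altSum]

lemma altSum_one {A R : Type*} [CommRing R] (F : (Fin 1 → A) → R) (v : Fin 1 → A) :
    altSum 1 F v = F v := by
  rw [altSum, Fin.sum_univ_one, if_pos rfl, one_mul, altSum]
  congr 1
  funext i; fin_cases i; rfl

lemma altSum_two {A R : Type*} [CommRing R] (F : (Fin 2 → A) → R) (a b : A) :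
    altSum 2 F ![a, b] = F ![a, b] - F ![b, a] := by
  have s0 : (fun i : Fin 1 => (![a, b] : Fin 2 → A) (Equiv.swap 0 0 i.succ)) = ![b] := by
    funext i; fin_cases i; rfl
  have s1 : (fun i : Fin 1 => (![a, b] : Fin 2 → A) (Equiv.swap 0 1 i.succ)) = ![a] := by
    funext i; fin_cases i; rfl
  rw [altSum, Fin.sum_univ_two, s0, s1, if_pos rfl, if_neg (by decide), one_mul, neg_one_mul,
    ← sub_eq_add_neg, altSum_one, altSum_one]
  rfl

lemma altSum_three {A R : Type*} [CommRing R] (F : (Fin 3 → A) → R) (a b c : A) :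
    altSum 3 F ![a, b, c] = altSum 2 (fun w => F (Fin.cons a w)) ![b, c]
      - altSum 2 (fun w => F (Fin.cons b w)) ![a, c]
      - altSum 2 (fun w => F (Fin.cons c w)) ![b, a] := by
  have s0 : (fun i : Fin 2 => (![a, b, c] : Fin 3 → A) (Equiv.swap 0 0 i.succ)) = ![b, c] := by
    funext i; fin_cases i <;> rfl
  have s1 : (fun i : Fin 2 => (![a, b, c] : Fin 3 → A) (Equiv.swap 0 1 i.succ)) = ![a, c] := by
    funext i; fin_cases i <;> rfl
  have s2 : (fun i : Fin 2 => (![a, b, c] : Fin 3 → A) (Equiv.swap 0 2 i.succ)) = ![b, a] := by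
    funext i; fin_cases i <;> rfl
  rw [altSum, Fin.sum_univ_three, s0, s1, s2, if_pos rfl, if_neg (by decide), if_neg (by decide),
    one_mul, neg_one_mul, neg_one_mul, ← sub_eq_add_neg, ← sub_eq_add_neg]
  rfl

lemma altSum_four {A R : Type*} [CommRing R] (F : (Fin 4 → A) → R) (a b c d : A) :
    altSum 4 F ![a, b, c, d] = altSum 3 (fun w => F (Fin.cons a w)) ![b, c, d]
      - altSum 3 (fun w => F (Fin.cons b w)) ![a, c, d]
      - altSum 3 (fun w => F (Fin.cons c w)) ![b, a, d]
      - altSum 3 (fun w => F (Fin.cons d w)) ![b, c, a] := by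
  have s0 : (fun i : Fin 3 => (![a, b, c, d] : Fin 4 → A) (Equiv.swap 0 0 i.succ)) = ![b, c, d] := by
    funext i; fin_cases i <;> rfl
  have s1 : (fun i : Fin 3 => (![a, b, c, d] : Fin 4 → A) (Equiv.swap 0 1 i.succ)) = ![a, c, d] := by
    funext i; fin_cases i <;> rfl
  have s2 : (fun i : Fin 3 => (![a, b, c, d] : Fin 4 → A) (Equiv.swap 0 2 i.succ)) = ![b, a, d] := by
    funext i; fin_cases i <;> rfl
  have s3 : (fun i : Fin 3 => (![a, b, c, d] : Fin 4 → A) (Equiv.swap 0 3 i.succ)) = ![b, c, a] := by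
    funext i; fin_cases i <;> rfl
  rw [altSum, Fin.sum_univ_four, s0, s1, s2, s3, if_pos rfl, if_neg (by decide), if_neg (by decide),
    if_neg (by decide), one_mul, neg_one_mul, neg_one_mul, neg_one_mul, ← sub_eq_add_neg,
    ← sub_eq_add_neg, ← sub_eq_add_neg]
  rfl

lemma wedge_two_two {V : Type*} (om : (Fin 2 → V) → ℝ) (hom : ∀ u v, om ![v, u] = -om ![u, v])
    (a b c d : V) : wedge om om ![a, b, c, d] =
      2 * (om ![a, b] * om ![c, d] - om ![a, c] * om ![b, d] + om ![a, d] * om ![b, c]) := by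
  have hom' : ∀ w : Fin 2 → V, om w = om ![w 0, w 1] := fun w => by
    congr 1; funext i; fin_cases i <;> rfl
  rw [wedge_eq_altSum]
  have : altSum (2 + 2) (fun w => om (fun i => w (Fin.castAdd 2 i)) * om (fun j => w (Fin.natAdd 2 j)))
      ![a, b, c, d] = altSum 4 (fun w => om ![w 0, w 1] * om ![w 2, w 3]) ![a, b, c, d] := by
    congr 1
    funext w
    rw [hom', hom' fun j => w (Fin.natAdd 2 j)]
    rfl
  rw [this, altSum_four]
  simp only [altSum_three, altSum_two]
  have c1 : ∀ a b c d : V, (Fin.cons a (Fin.cons b ![c, d]) : Fin 4 → V) 1 = b := fun _ _ _ _ => rfl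
  have c2 : ∀ a b c d : V, (Fin.cons a (Fin.cons b ![c, d]) : Fin 4 → V) 2 = c := fun _ _ _ _ => rfl
  have c3 : ∀ a b c d : V, (Fin.cons a (Fin.cons b ![c, d]) : Fin 4 → V) 3 = d := fun _ _ _ _ => rfl
  simp only [Fin.cons_zero, c1, c2, c3]
  rw [hom a b, hom a c, hom a d, hom b c, hom b d, hom c d]
  norm_num [Nat.factorial]
  ring

lemma wedge_perm {V R : Type*} [Field R] {k l : ℕ} (α : (Fin k → V) → R) (β : (Fin l → V) → R)
    (v : Fin (k + l) → V) (τ : Equiv.Perm (Fin (k + l))) :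
    wedge α β (fun i => v (τ i)) = ((Equiv.Perm.sign τ : ℤ) : R) * wedge α β v := by
  have key : ∑ σ : Equiv.Perm (Fin (k + l)), ((Equiv.Perm.sign σ : ℤ) : R) *
      (α (fun i => v (τ (σ (Fin.castAdd l i)))) * β (fun j => v (τ (σ (Fin.natAdd k j)))))
      = ((Equiv.Perm.sign τ : ℤ) : R) * ∑ σ : Equiv.Perm (Fin (k + l)), ((Equiv.Perm.sign σ : ℤ) : R) *
      (α (fun i => v (σ (Fin.castAdd l i))) * β (fun j => v (σ (Fin.natAdd k j)))) := by
    rw [Finset.mul_sum]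
    refine Eq.trans (Finset.sum_congr rfl fun σ _ => ?_) (Equiv.sum_comp (Equiv.mulLeft τ)
      fun σ => ((Equiv.Perm.sign τ : ℤ) : R) * (((Equiv.Perm.sign σ : ℤ) : R) *
        (α (fun i => v (σ (Fin.castAdd l i))) * β (fun j => v (σ (Fin.natAdd k j))))))
    simp only [Equiv.coe_mulLeft, Equiv.Perm.sign_mul, Units.val_mul, Int.cast_mul,
      Equiv.Perm.mul_apply]
    have : ((Equiv.Perm.sign τ : ℤ) : R) * ((Equiv.Perm.sign τ : ℤ) : R) = 1 := by
      rw [← Int.cast_mul, ← Units.val_mul, Int.units_mul_self]; simp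
    linear_combination (-((Equiv.Perm.sign σ : ℤ) : R) *
      (α (fun i => v (τ (σ (Fin.castAdd l i)))) * β (fun i => v (τ (σ (Fin.natAdd k i)))))) * this
  rw [wedge, wedge, key]
  ring

/-- The components of the Kähler form in the real basis of a unitary frame. -/
def kTable (i j : ℕ) : ℤ := bif Nat.beq (i / 2) (j / 2) then (j : ℤ) - i else 0

/-- The components of the complex volume form on a unitary frame, that is the sign of the
arrangement `(i, j, k)` of `(0, 1, 2)`. -/
def eps3 (i j k : ℕ) : ℤ :=
  bif Nat.beq ((j + 3 - i) % 3) 1 && Nat.beq ((k + 3 - j) % 3) 1 then 1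
  else bif Nat.beq ((j + 3 - i) % 3) 2 && Nat.beq ((k + 3 - j) % 3) 2 then -1 else 0

/-- The real part of the components of the complex volume form in a real basis of a unitary frame. -/
def reTable (i j k : ℕ) : ℤ :=
  match i % 2 + j % 2 + k % 2 with
  | 0 => eps3 (i / 2) (j / 2) (k / 2)
  | 2 => -eps3 (i / 2) (j / 2) (k / 2)
  | _ => 0

/-- The imaginary part of the components of the complex volume form. -/
def imTable (i j k : ℕ) : ℤ :=
  match i % 2 + j % 2 + k % 2 with
  | 1 => eps3 (i / 2) (j / 2) (k / 2)
  | 3 => -eps3 (i / 2) (j / 2) (k / 2)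
  | _ => 0

/-- The value is `4! · 2! · 6`, in accordance with `ω³ = 6` on the basis `e₀, Je₀, e₁, Je₁, e₂,
Je₂`. -/
lemma altSum_kTable : altSum 6 (fun f : Fin 6 → Fin 6 =>
    2 * (kTable (f 0) (f 1) * kTable (f 2) (f 3) - kTable (f 0) (f 2) * kTable (f 1) (f 3)
      + kTable (f 0) (f 3) * kTable (f 1) (f 2)) * kTable (f 4) (f 5)) id = 288 := by
  decide +kernel

/-- The imaginary part of `3! · 3! · (Ω ∧ Ω̄)` on the same basis when `Ω(e₀, e₁, e₂) = 1`, that is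
`36 · (-8)`. -/
lemma altSum_hTable : altSum 6 (fun f : Fin 6 → Fin 6 =>
    imTable (f 0) (f 1) (f 2) * reTable (f 3) (f 4) (f 5) -
      reTable (f 0) (f 1) (f 2) * imTable (f 3) (f 4) (f 5)) id = -288 := by
  decide +kernel

end ConeSoliton

/-! ### Unitary frames and bases adapted to a given phase. -/

namespace ConeSoliton

open Complex

namespace HermitianData

variable {V : Type*} [AddCommGroup V] [Module ℝ V] (D : HermitianData V)

/-- The linear form `g(v, ·)`. -/
def gLin (v : V) : V →ₗ[ℝ] ℝ where
  toFun := D.g v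
  map_add' := D.g_add' v
  map_smul' c w := D.g_smul' c v w

/-- The real basis `e₀, J e₀, e₁, J e₁, e₂, J e₂`. -/
def realBasis (e : Fin 3 → V) : Fin 6 → V :=
  ![e 0, D.J (e 0), e 1, D.J (e 1), e 2, D.J (e 2)]

/-- A real basis adapted to the `SU(3)`-structure with complex volume form `c O`. -/
structure IsAdaptedBasis (c : ℂ) (b : Fin 6 → V) : Prop where
  ortho : ∀ i j, D.g (b i) (b j) = if i = j then 1 else 0
  expand : ∀ v, v = ∑ i, D.g (b i) v • b i
  om_eq : ∀ i j, D.om (b i) (b j) = kTable i j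
  O_eq : ∀ i j k, c * D.O (b i) (b j) (b k) = reTable i j k + I * imTable i j k

variable {D}

lemma exists_unit_orthogonal [FiniteDimensional ℝ V] (hV : Module.finrank ℝ V = 6) {n : ℕ}
    (hn : n < 6) (b : Fin n → V) : ∃ v, D.g v v = 1 ∧ ∀ i, D.g (b i) v = 0 := by
  have h1 : Module.finrank ℝ (Fin n → ℝ) < Module.finrank ℝ V := by simp [hV, hn]
  obtain ⟨v, hv, hv0⟩ := (Submodule.ne_bot_iff _).1
    (LinearMap.ker_ne_bot_of_finrank_lt (f := LinearMap.pi fun i => D.gLin (b i)) h1)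
  have hg := D.g_pos v hv0
  refine ⟨(√(D.g v v))⁻¹ • v, ?_, fun i => ?_⟩
  · rw [D.g_smul, D.g_smul', ← mul_assoc, ← mul_inv, Real.mul_self_sqrt hg.le,
      inv_mul_cancel₀ hg.ne']
  · have : D.g (b i) v = 0 := congrFun (LinearMap.mem_ker.1 hv) i
    rw [D.g_smul', this, mul_zero]

lemma expand_of_ortho [FiniteDimensional ℝ V] (hV : Module.finrank ℝ V = 6) {b : Fin 6 → V}
    (hb : ∀ i j, D.g (b i) (b j) = if i = j then 1 else 0) (v : V) : v = ∑ i, D.g (b i) v • b i := by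
  set L : V →ₗ[ℝ] (Fin 6 → ℝ) := LinearMap.pi fun i => D.gLin (b i)
  have hL : ∀ w : Fin 6 → ℝ, L (∑ i, w i • b i) = w := by
    intro w
    funext j
    change D.gLin (b j) (∑ i, w i • b i) = w j
    rw [map_sum]
    simp only [map_smul]
    change ∑ i, w i * D.g (b j) (b i) = w j
    simp [hb]
  have inj : Function.Injective L := (LinearMap.injective_iff_surjective_of_finrank_eq_finrank
    (by simp [hV])).2 fun w => ⟨_, hL w⟩
  exact inj (hL _).symm

lemma g_realBasis {e : Fin 3 → V} (h1 : ∀ i j, D.g (e i) (e j) = if i = j then 1 else 0)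
    (h2 : ∀ i j, D.g (D.J (e i)) (e j) = 0) (i j : Fin 6) :
    D.g (D.realBasis e i) (D.realBasis e j) = if i = j then 1 else 0 := by
  have h3 : ∀ i j, D.g (e i) (D.J (e j)) = 0 := fun i j => by rw [D.g_symm, h2]
  fin_cases i <;> fin_cases j <;> simp [realBasis, h1, h2, h3, D.g_J]

lemma om_realBasis {e : Fin 3 → V} (h1 : ∀ i j, D.g (e i) (e j) = if i = j then 1 else 0)
    (h2 : ∀ i j, D.g (D.J (e i)) (e j) = 0) (i j : Fin 6) :
    D.om (D.realBasis e i) (D.realBasis e j) = kTable i j := by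
  have h3 : ∀ i j, D.om (e i) (e j) = 0 := h2
  have h4 : ∀ i j, D.g (e i) (D.J (e j)) = 0 := fun i j => by rw [D.g_symm, h2]
  fin_cases i <;> fin_cases j <;> simp [realBasis, h1, h3, h4, D.om_J, D.om_J', kTable, cond_eq_ite]

/-- The complex components of the real basis of a unitary frame. -/
def compTable (i : Fin 6) (a : Fin 3) : GaussianInt :=
  if i.val / 2 = a.val then (if i.val % 2 = 0 then 1 else ⟨0, 1⟩) else 0

/-- The complex components of the real basis are `0`, `1` and `i`, so the determinant is a finite
computation in the Gaussian integers. -/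
lemma det3_compTable (i j k : Fin 6) :
    compTable i 0 * (compTable j 1 * compTable k 2 - compTable j 2 * compTable k 1)
      - compTable i 1 * (compTable j 0 * compTable k 2 - compTable j 2 * compTable k 0)
      + compTable i 2 * (compTable j 0 * compTable k 1 - compTable j 1 * compTable k 0)
      = ⟨reTable i j k, imTable i j k⟩ := by
  revert i j k
  decide +kernel

lemma comp_realBasis {e : Fin 3 → V} (h1 : ∀ i j, D.g (e i) (e j) = if i = j then 1 else 0)
    (h2 : ∀ i j, D.g (D.J (e i)) (e j) = 0) (i : Fin 6) (a : Fin 3) :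
    D.comp e (D.realBasis e i) a = GaussianInt.toComplex (compTable i a) := by
  have h3 : ∀ i j, D.om (e i) (e j) = 0 := h2
  have h4 : ∀ i j, D.g (e i) (D.J (e j)) = 0 := fun i j => by rw [D.g_symm, h2]
  fin_cases i <;> fin_cases a <;>
    simp [realBasis, comp, h, h1, h3, h4, D.om_J', compTable, GaussianInt.toComplex_def]

lemma O_realBasis {e : Fin 3 → V} (h1 : ∀ i j, D.g (e i) (e j) = if i = j then 1 else 0)
    (h2 : ∀ i j, D.g (D.J (e i)) (e j) = 0)
    (hO : ∀ x y z, D.O x y z = D.O (e 0) (e 1) (e 2) * det3 (D.comp e x) (D.comp e y) (D.comp e z))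
    (i j k : Fin 6) : D.O (D.realBasis e i) (D.realBasis e j) (D.realBasis e k)
      = D.O (e 0) (e 1) (e 2) * (reTable i j k + I * imTable i j k) := by
  rw [hO, det3]
  simp only [comp_realBasis h1 h2, ← map_mul, ← map_sub, ← map_add, det3_compTable]
  rw [GaussianInt.toComplex_def]
  ring

lemma wedge_om_basis {b : Fin 6 → V} (hb : ∀ i j, D.om (b i) (b j) = kTable i j)
    {om : (Fin 2 → V) → ℝ}
    (hom : ∀ u v, om ![u, v] = D.om u v) : wedge (wedge om om) om b = 6 := by
  have hom' : ∀ w : Fin 2 → V, om w = D.om (w 0) (w 1) := fun w => by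
    rw [← hom]; congr 1; funext i; fin_cases i <;> rfl
  have hw : ∀ w : Fin 4 → V, wedge om om w = 2 * (D.om (w 0) (w 1) * D.om (w 2) (w 3)
      - D.om (w 0) (w 2) * D.om (w 1) (w 3) + D.om (w 0) (w 3) * D.om (w 1) (w 2)) := fun w => by
    rw [show w = ![w 0, w 1, w 2, w 3] by funext i; fin_cases i <;> rfl,
      wedge_two_two om (fun u v => by rw [hom, hom, D.om_swap])]
    simp only [hom]
    rfl
  rw [wedge_eq_altSum]
  have h3 : (fun w : Fin (2 + 2 + 2) → V => wedge om om (fun i => w (Fin.castAdd 2 i)) *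
      om (fun j => w (Fin.natAdd (2 + 2) j))) = fun w : Fin 6 → V =>
      2 * (D.om (w 0) (w 1) * D.om (w 2) (w 3)
    - D.om (w 0) (w 2) * D.om (w 1) (w 3) + D.om (w 0) (w 3) * D.om (w 1) (w 2)) *
      D.om (w 4) (w 5) := by
    funext w
    rw [hw, hom']
    rfl
  have h4 := altSum_comp 6 (fun w : Fin 6 → V =>
      2 * (D.om (w 0) (w 1) * D.om (w 2) (w 3)
    - D.om (w 0) (w 2) * D.om (w 1) (w 3) + D.om (w 0) (w 3) * D.om (w 1) (w 2)) *
      D.om (w 4) (w 5)) b id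
  simp only [hb] at h4
  have h5 := altSum_intCast (R := ℝ) 6 (fun f : Fin 6 → Fin 6 =>
    2 * (kTable (f 0) (f 1) * kTable (f 2) (f 3) - kTable (f 0) (f 2) * kTable (f 1) (f 3)
    + kTable (f 0) (f 3) * kTable (f 1) (f 2)) * kTable (f 4) (f 5)) id
  rw [altSum_kTable] at h5
  push_cast at h5
  rw [h3]
  refine (congrArg (fun t => _ * t) (h4.trans h5)).trans ?_
  norm_num [Nat.factorial]

lemma wedge_O_realBasis {e : Fin 3 → V} (ho : ∀ i j, D.g (e i) (e j) = if i = j then 1 else 0)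
    (ho' : ∀ i j, D.g (D.J (e i)) (e j) = 0)
    (hO' : ∀ x y z, D.O x y z = D.O (e 0) (e 1) (e 2) *
      det3 (D.comp e x) (D.comp e y) (D.comp e z)) {O : (Fin 3 → V) → ℂ}
    (hO : ∀ u v w, O ![u, v, w] = D.O u v w) :
    wedge O (fun w => (starRingEnd ℂ) (O w)) (D.realBasis e)
      = 36⁻¹ * altSum 6 (fun f : Fin 6 → Fin 6 => ((Complex.normSq (D.O (e 0) (e 1) (e 2)) : ℝ) : ℂ) *
        ((reTable (f 0) (f 1) (f 2) + I * imTable (f 0) (f 1) (f 2)) *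
        (reTable (f 3) (f 4) (f 5) - I * imTable (f 3) (f 4) (f 5)))) id := by
  have hO3 : ∀ w : Fin 3 → V, O w = D.O (w 0) (w 1) (w 2) := fun w => by
    rw [← hO]; congr 1; funext i; fin_cases i <;> rfl
  rw [wedge_eq_altSum]
  have h3 : (fun w : Fin (3 + 3) → V => O (fun i => w (Fin.castAdd 3 i)) *
      (starRingEnd ℂ) (O (fun j => w (Fin.natAdd 3 j)))) = fun w : Fin 6 → V =>
      D.O (w 0) (w 1) (w 2) * (starRingEnd ℂ) (D.O (w 3) (w 4) (w 5)) := by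
    funext w
    rw [hO3, hO3]
    rfl
  have h4 := altSum_comp 6 (fun w : Fin 6 → V =>
      D.O (w 0) (w 1) (w 2) * (starRingEnd ℂ) (D.O (w 3) (w 4) (w 5))) (D.realBasis e) id
  rw [h3]
  refine (congrArg (fun t => _ * t) h4).trans ?_
  refine congrArg₂ _ (by norm_num [Nat.factorial]) (congrArg (fun F => altSum 6 F id) ?_)
  · funext f
    simp only [O_realBasis ho ho' hO', map_mul, map_add, conj_I, map_intCast]
    rw [← Complex.mul_conj]
    ring

/-- Hermitian Gram-Schmidt: each new unit vector is orthogonal to the previous ones and to their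
images under `J`. The normalisation `|O(e₀, e₁, e₂)| = 1` is the volume condition evaluated on the
resulting real basis. -/
theorem exists_unitaryFrame [FiniteDimensional ℝ V] (hV : Module.finrank ℝ V = 6)
    {om : (Fin 2 → V) → ℝ} {O : (Fin 3 → V) → ℂ} (hom : ∀ u v, om ![u, v] = D.om u v)
    (hO : ∀ u v w, O ![u, v, w] = D.O u v w)
    (hvol : ∀ v : Fin 6 → V, (((1 / 6) * wedge (wedge om om) om v : ℝ) : ℂ)
      = I / 8 * wedge O (fun w => (starRingEnd ℂ) (O w)) v) :
    ∃ e, D.IsUnitaryFrame e := by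
  obtain ⟨e0, h00, -⟩ := exists_unit_orthogonal (D := D) hV (by norm_num : 0 < 6) ![]
  obtain ⟨e1, h11, h1⟩ := exists_unit_orthogonal (D := D) hV (by norm_num : 2 < 6) ![e0, D.J e0]
  obtain ⟨e2, h22, h2⟩ := exists_unit_orthogonal (D := D) hV (by norm_num : 4 < 6)
    ![e0, D.J e0, e1, D.J e1]
  have k1 : D.g e0 e1 = 0 := h1 0
  have k2 : D.g (D.J e0) e1 = 0 := h1 1
  have k3 : D.g e0 e2 = 0 := h2 0
  have k4 : D.g (D.J e0) e2 = 0 := h2 1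
  have k5 : D.g e1 e2 = 0 := h2 2
  have k6 : D.g (D.J e1) e2 = 0 := h2 3
  set e : Fin 3 → V := ![e0, e1, e2] with he
  have ho : ∀ i j, D.g (e i) (e j) = if i = j then 1 else 0 := by
    intro i j
    fin_cases i <;> fin_cases j <;>
      simp [he, h00, h11, h22, k1, k3, k5, D.g_symm e1 e0, D.g_symm e2 e0, D.g_symm e2 e1]
  have ho' : ∀ i j, D.g (D.J (e i)) (e j) = 0 := by
    have s : ∀ u v, D.g (D.J u) v = 0 → D.g (D.J v) u = 0 := fun u v huv => by
      rw [g_J_left, D.g_symm, huv, neg_zero]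
    intro i j
    fin_cases i <;> fin_cases j <;> simp [he, g_J_self, k2, k4, k6, s]
  have hex := expand_of_ortho hV (g_realBasis ho ho')
  have hex' : ∀ v, v = ∑ i, (D.g (e i) v • e i + D.g (D.J (e i)) v • D.J (e i)) := fun v => by
    conv_lhs => rw [hex v]
    simp [Fin.sum_univ_succ, realBasis]
    abel
  have hO' : ∀ x y z, D.O x y z = D.O (e 0) (e 1) (e 2) *
      det3 (D.comp e x) (D.comp e y) (D.comp e z) :=
    form_eq_of_expand hex' D.O_add D.O_smul D.O_swap D.O_swap' D.O_J
  refine ⟨e, ho, ho', hex', ?_⟩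
  have key := hvol (D.realBasis e)
  rw [wedge_om_basis (om_realBasis ho ho') hom, wedge_O_realBasis ho ho' hO' hO, ← sum_perm_eq_altSum] at key
  have h5 := altSum_intCast (R := ℝ) 6 (fun f : Fin 6 → Fin 6 =>
    imTable (f 0) (f 1) (f 2) * reTable (f 3) (f 4) (f 5) -
      reTable (f 0) (f 1) (f 2) * imTable (f 3) (f 4) (f 5)) id
  rw [altSum_hTable, ← sum_perm_eq_altSum] at h5
  have key2 := congrArg Complex.re key
  have h6 : ∀ z : ℂ, (I / 8 * (36⁻¹ * z)).re = -(z.im / 288) := fun z => by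
    rw [show I / 8 * (36⁻¹ * z) = ((1 / 288 : ℝ) : ℂ) * (I * z) by push_cast; ring, re_ofReal_mul]
    simp; ring
  rw [h6, Complex.im_sum] at key2
  set o := D.O (e 0) (e 1) (e 2)
  have h7 : ∀ σ : Equiv.Perm (Fin 6), (((Equiv.Perm.sign σ : ℤ) : ℂ) * (((Complex.normSq o : ℝ) : ℂ) *
        ((reTable (σ 0) (σ 1) (σ 2) + I * imTable (σ 0) (σ 1) (σ 2)) *
        (reTable (σ 3) (σ 4) (σ 5) - I * imTable (σ 3) (σ 4) (σ 5))))).im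
      = Complex.normSq o * (((Equiv.Perm.sign σ : ℤ) : ℝ) *
        ((imTable (σ 0) (σ 1) (σ 2) * reTable (σ 3) (σ 4) (σ 5) -
        reTable (σ 0) (σ 1) (σ 2) * imTable (σ 3) (σ 4) (σ 5) : ℤ) : ℝ)) := by
    intro σ
    rw [show ((Equiv.Perm.sign σ : ℤ) : ℂ) = (((Equiv.Perm.sign σ : ℤ) : ℝ) : ℂ) by simp,
      im_ofReal_mul, im_ofReal_mul]
    simp
    ring
  simp only [id, h7] at key2 h5
  rw [← Finset.mul_sum, h5] at key2
  simp at key2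
  linarith

/-- A unitary frame can be rotated so as to realize any phase of the complex volume form. -/
theorem IsUnitaryFrame.exists_adaptedBasis {e : Fin 3 → V} (he : D.IsUnitaryFrame e) {c : ℂ}
    (hc : Complex.normSq c = 1) : ∃ b, D.IsAdaptedBasis c b := by
  set z : ℂ := (starRingEnd ℂ) (c * D.O (e 0) (e 1) (e 2)) with hz
  have hz1 : c * D.O (e 0) (e 1) (e 2) * z = 1 := by
    rw [hz, Complex.mul_conj, map_mul, hc, he.norm_O]; simp
  have hz2 : z.re * z.re + z.im * z.im = 1 := by
    rw [← Complex.normSq_apply, hz, Complex.normSq_conj, map_mul, hc, he.norm_O, one_mul]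
  -- Multiplying the first vector by the unit complex number `z`, the conjugate of `c O(e₀, e₁,
  -- e₂)`, makes the value of `c O` on the frame equal to `1`.
  set f : Fin 3 → V := ![z.re • e 0 + z.im • D.J (e 0), e 1, e 2] with hf
  have hO : c * D.O (f 0) (f 1) (f 2) = 1 := by
    rw [← hz1]
    simp only [hf, Matrix.cons_val_zero, Matrix.cons_val_one, Matrix.cons_val, D.O_add, D.O_smul,
      D.O_J]
    conv_rhs => rw [← Complex.re_add_im z]
    ring
  have o1 : ∀ i j, D.g (f i) (f j) = if i = j then 1 else 0 := by
    have h1 := he.ortho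
    have h2 := he.ortho'
    have h3 : ∀ i j, D.g (e i) (D.J (e j)) = 0 := fun i j => by rw [D.g_symm, h2]
    intro i j
    fin_cases i <;> fin_cases j <;>
      simp [hf, D.g_add, D.g_smul, g_add', g_smul', h1, h2, h3, D.g_J, hz2]
  have o2 : ∀ i j, D.g (D.J (f i)) (f j) = 0 := by
    have h1 := he.ortho
    have h2 := he.ortho'
    have h3 : ∀ i j, D.g (e i) (D.J (e j)) = 0 := fun i j => by rw [D.g_symm, h2]
    intro i j
    fin_cases i <;> fin_cases j <;>
      simp [hf, D.g_add, D.g_smul, g_add', g_smul', D.J_add, D.J_smul, h1, h2, h3, D.g_J, D.J_sq,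
        g_neg, mul_comm]
  have ex : ∀ v, v = ∑ i, (D.g (f i) v • f i + D.g (D.J (f i)) v • D.J (f i)) := by
    intro v
    conv_lhs => rw [he.expand v]
    simp only [Fin.sum_univ_three, hf, Matrix.cons_val_zero, Matrix.cons_val_one, Matrix.cons_val,
      D.g_add, D.g_smul, D.J_add, D.J_smul, D.J_sq, g_neg]
    congr 2
    have h1 : z.re * z.re = 1 - z.im * z.im := by linarith
    match_scalars
    · linear_combination (-D.g (e 0) v) * hz2
    · linear_combination (-D.g (D.J (e 0)) v) * hz2
  refine ⟨D.realBasis f, g_realBasis o1 o2, fun v => ?_, om_realBasis o1 o2, fun i j k => ?_⟩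
  · conv_lhs => rw [ex v]
    simp [Fin.sum_univ_succ, realBasis]
    abel
  · rw [O_realBasis o1 o2 (form_eq_of_expand ex D.O_add D.O_smul D.O_swap D.O_swap' D.O_J),
      ← mul_assoc, hO, one_mul]

end HermitianData

end ConeSoliton

/-! ### From partial derivatives in a chart to covariant derivatives. -/

namespace ConeSoliton

open Complex

namespace HermitianData

variable {V : Type*} [AddCommGroup V] [Module ℝ V] (D : HermitianData V)

/-- The first derivatives in a chart of the metric, the Kähler form and the `(3, 0)`-form of a nearly
Kähler structure at a point. -/
structure IsNearlyKahlerChartJet (DG DW : V → V → V → ℝ) (DO : V → V → V → V → ℂ) : Prop where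
  G_add : ∀ u u' v w, DG (u + u') v w = DG u v w + DG u' v w
  G_smul : ∀ (c : ℝ) u v w, DG (c • u) v w = c * DG u v w
  G_add₂ : ∀ u v v' w, DG u (v + v') w = DG u v w + DG u v' w
  G_smul₂ : ∀ (c : ℝ) u v w, DG u (c • v) w = c * DG u v w
  G_symm : ∀ u v w, DG u w v = DG u v w
  W_add₂ : ∀ u v v' w, DW u (v + v') w = DW u v w + DW u v' w
  W_smul₂ : ∀ (c : ℝ) u v w, DW u (c • v) w = c * DW u v w
  W_swap : ∀ u v w, DW u w v = -DW u v w
  O_add : ∀ u u' x y z, DO (u + u') x y z = DO u x y z + DO u' x y z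
  O_smul : ∀ (c : ℝ) u x y z, DO (c • u) x y z = c * DO u x y z
  O_add₂ : ∀ u x x' y z, DO u (x + x') y z = DO u x y z + DO u x' y z
  O_smul₂ : ∀ (c : ℝ) u x y z, DO u (c • x) y z = c * DO u x y z
  O_swap : ∀ u x y z, DO u y x z = -DO u x y z
  O_swap' : ∀ u x y z, DO u x z y = -DO u x y z
  compatible : ∀ u v, ∃ j, (∀ w, DW u v w = DG u (D.J v) w + D.g j w) ∧
    (∀ w, DW u (D.J v) w + D.om j w = -DG u v w) ∧
    ∀ w z, DO u (D.J v) w z + D.O j w z = I * DO u v w z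
  norm : ∀ e, D.IsUnitaryFrame e → ∀ u, DG u (e 0) (e 0) + DG u (e 1) (e 1) + DG u (e 2) (e 2)
    = 2 * ((starRingEnd ℂ) (D.O (e 0) (e 1) (e 2)) * DO u (e 0) (e 1) (e 2)).re
  cyc : ∀ u v w, DW u v w - DW v u w + DW w u v = -3 * (D.O u v w).re
  alt : ∀ u x y z, DO u x y z - DO x u y z + DO y u x z - DO z u x y
    = 4 * I * (D.om u x * D.om y z - D.om u y * D.om x z + D.om u z * D.om x y : ℝ)

/-- A symmetric bilinear map with values in `V` (such as the Christoffel symbols). -/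
structure IsSymmBilinear (Γ : V → V → V) : Prop where
  add : ∀ u v w, Γ u (v + w) = Γ u v + Γ u w
  smul : ∀ (c : ℝ) u v, Γ u (c • v) = c • Γ u v
  symm : ∀ u v, Γ u v = Γ v u

variable {D} {DG DW : V → V → V → ℝ} {DO : V → V → V → V → ℂ}

/-- The derivatives of the tensors of a nearly Kähler structure in a chart, in terms of the
Christoffel symbols. -/
theorem IsNearlyKahlerChartJet.exists_christoffel (H : D.IsNearlyKahlerChartJet DG DW DO)
    {e : Fin 3 → V} (he : D.IsUnitaryFrame e) : ∃ Γ : V → V → V, IsSymmBilinear Γ ∧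
      (∀ u v w, DG u v w = D.g (Γ u v) w + D.g v (Γ u w)) ∧
      (∀ u v w, DW u v w = D.om (Γ u v) w + D.om v (Γ u w) - (D.O u v w).re) ∧
      ∀ u x y z, DO u x y z = D.O (Γ u x) y z + D.O x (Γ u y) z + D.O x y (Γ u z)
        + (D.h u x * D.om y z + D.h u y * D.om z x + D.h u z * D.om x y) := by
  have G_add₃ : ∀ u v w w', DG u v (w + w') = DG u v w + DG u v w' := fun u v w w' => by
    rw [H.G_symm, H.G_add₂, H.G_symm u v w, H.G_symm u v w']
  have G_smul₃ : ∀ (c : ℝ) u v w, DG u v (c • w) = c * DG u v w := fun c u v w => by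
    rw [H.G_symm, H.G_smul₂, H.G_symm u v w]
  -- The Koszul formula defines the Christoffel symbols by duality.
  have hex : ∀ u v, ∃ p, ∀ z, D.g p z = (DG u v z + DG v u z - DG z u v) / 2 := fun u v =>
    he.exists_dual (fun z z' => by rw [G_add₃, G_add₃, H.G_add]; ring)
      (fun c z => by rw [G_smul₃, G_smul₃, H.G_smul]; ring)
  choose Γ hΓ using hex
  have hadd : ∀ u v w, Γ u (v + w) = Γ u v + Γ u w := fun u v w => D.eq_of_g fun z => by
    rw [D.g_add, hΓ, hΓ, hΓ, H.G_add₂, G_add₃, H.G_add]; ring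
  have hsmul : ∀ (c : ℝ) u v, Γ u (c • v) = c • Γ u v := fun c u v => D.eq_of_g fun z => by
    rw [D.g_smul, hΓ, hΓ, H.G_smul₂, G_smul₃, H.G_smul]; ring
  have hsymm : ∀ u v, Γ u v = Γ v u := fun u v => D.eq_of_g fun z => by
    rw [hΓ, hΓ, H.G_symm z]; ring
  have hadd' : ∀ u v w, Γ (v + w) u = Γ v u + Γ w u := fun u v w => by
    rw [hsymm, hadd, hsymm u, hsymm u]
  have hsmul' : ∀ (c : ℝ) u v, Γ (c • v) u = c • Γ v u := fun c u v => by
    rw [hsymm, hsmul, hsymm u]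
  have hDG : ∀ u v w, DG u v w = D.g (Γ u v) w + D.g v (Γ u w) := fun u v w => by
    rw [D.g_symm v, hΓ, hΓ, H.G_symm v w u, H.G_symm w v u, H.G_symm u v w]; ring
  -- Subtracting the `Γ` terms turns partial derivatives into covariant ones; as `Γ` is symmetric it
  -- drops out of the alternating sums that express exterior derivatives.
  have hjet : D.IsNearlyKahlerJet (fun u v w => DW u v w - D.om (Γ u v) w - D.om v (Γ u w))
      (fun u x y z => DO u x y z - D.O (Γ u x) y z - D.O x (Γ u y) z - D.O x y (Γ u z)) := by
    constructor
    · intro u v v' w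
      simp only [H.W_add₂, hadd, om_add]; ring
    · intro c u v w
      simp only [H.W_smul₂, hsmul, om_smul]; ring
    · intro u v w
      simp only [H.W_swap u v w]
      rw [D.om_swap v (Γ u w), D.om_swap (Γ u v) w]; ring
    · intro u v w
      obtain ⟨j, h1, h2, -⟩ := H.compatible u v
      have h3 := h1 (D.J w)
      have h4 := h2 w
      have h5 : D.om j w = -D.g j (D.J w) := by rw [om, g_J_left]
      have h6 : D.om (Γ u (D.J v)) w = -D.g (Γ u (D.J v)) (D.J w) := by rw [om, g_J_left]
      have h7 : D.om v (Γ u (D.J w)) = D.g (D.J v) (Γ u (D.J w)) := rfl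
      simp only [hDG, om_J, om_J'] at h3 h4 ⊢
      linarith
    · intro u v w
      have h1 := H.cyc u v w
      rw [← h1, H.W_swap v u w]
      simp only [hsymm v u, hsymm w u, hsymm w v]
      have h2 := D.om_swap (Γ u v) w
      have h3 := D.om_swap (Γ u w) v
      have h4 := D.om_swap (Γ v w) u
      linarith
    · intro u u' x y z
      simp only [H.O_add, hadd', D.O_add, D.O_add₂, D.O_add₃]; ring
    · intro c u x y z
      simp only [H.O_smul, hsmul', D.O_smul, D.O_smul₂, D.O_smul₃]; ring
    · intro u x x' y z
      simp only [H.O_add₂, hadd, D.O_add]; ring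
    · intro c u x y z
      simp only [H.O_smul₂, hsmul, D.O_smul]; ring
    · intro u x y z
      simp only [H.O_swap u x y z]
      rw [D.O_swap x (Γ u y), D.O_swap (Γ u x) y, D.O_swap x y]; ring
    · intro u x y z
      simp only [H.O_swap' u x y z]
      rw [D.O_swap' _ y z, D.O_swap' x y (Γ u z), D.O_swap' x (Γ u y) z]; ring
    · intro u x
      obtain ⟨j, h1, -, h2⟩ := H.compatible u x
      -- With `j` the partial derivative of `J` applied to `x`, this vector is `(∇_u J) x`.
      refine ⟨j + Γ u (D.J x) + -D.J (Γ u x), fun z => ?_, fun y z => ?_⟩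
      · have h3 := h1 z
        rw [hDG] at h3
        rw [D.g_add, D.g_add, g_neg, h3]
        simp only [om]
        ring
      · have h3 := h2 y z
        have h4 : D.O (-D.J (Γ u x)) y z = -(I * D.O (Γ u x) y z) := by
          rw [← D.O_J]; simpa using D.O_smul (-1) (D.J (Γ u x)) y z
        rw [D.O_add, D.O_add, h4]
        simp only [D.O_J]
        linear_combination h3
    · intro u x y z
      rw [← H.alt u x y z]
      simp only [hsymm x u, hsymm y u, hsymm z u, hsymm y x, hsymm z x, hsymm z y]
      have s1 : ∀ a b c, D.O b c a = D.O a b c := fun a b c => by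
        rw [D.O_swap' b a c, D.O_swap a b c, neg_neg]
      linear_combination (-1) * D.O_swap x (Γ u y) z - s1 (Γ u z) x y + D.O_swap' u (Γ x z) y
  -- The `Γ` terms contribute the complex trace of `Γ u`, whose real part is half the sum of the
  -- derivatives of `g(eᵢ, eᵢ)`; this is the right-hand side of the norm condition.
  have hb : ∀ u, ((starRingEnd ℂ) (D.O (e 0) (e 1) (e 2)) * (DO u (e 0) (e 1) (e 2)
      - D.O (Γ u (e 0)) (e 1) (e 2) - D.O (e 0) (Γ u (e 1)) (e 2)
      - D.O (e 0) (e 1) (Γ u (e 2)))).re = 0 := by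
    intro u
    have h1 := H.norm e he u
    have hn : (starRingEnd ℂ) (D.O (e 0) (e 1) (e 2)) * D.O (e 0) (e 1) (e 2) = 1 := by
      rw [← Complex.normSq_eq_conj_mul_self, he.norm_O]; simp
    have c0 : det3 (D.comp e (Γ u (e 0))) (D.comp e (e 1)) (D.comp e (e 2)) = D.comp e (Γ u (e 0)) 0 := by
      simp [det3, he.comp_frame]
    have c1 : det3 (D.comp e (e 0)) (D.comp e (Γ u (e 1))) (D.comp e (e 2)) = D.comp e (Γ u (e 1)) 1 := by
      simp [det3, he.comp_frame]
    have c2 : det3 (D.comp e (e 0)) (D.comp e (e 1)) (D.comp e (Γ u (e 2))) = D.comp e (Γ u (e 2)) 2 := by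
      simp [det3, he.comp_frame]
    rw [he.O_eq (Γ u (e 0)), he.O_eq (e 0) (Γ u (e 1)), he.O_eq (e 0) (e 1) (Γ u (e 2)), c0, c1, c2]
    have h2 : (starRingEnd ℂ) (D.O (e 0) (e 1) (e 2)) * (DO u (e 0) (e 1) (e 2)
        - D.O (e 0) (e 1) (e 2) * D.comp e (Γ u (e 0)) 0 - D.O (e 0) (e 1) (e 2) * D.comp e (Γ u (e 1)) 1
        - D.O (e 0) (e 1) (e 2) * D.comp e (Γ u (e 2)) 2)
        = (starRingEnd ℂ) (D.O (e 0) (e 1) (e 2)) * DO u (e 0) (e 1) (e 2)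
          - (D.comp e (Γ u (e 0)) 0 + D.comp e (Γ u (e 1)) 1 + D.comp e (Γ u (e 2)) 2) := by
      linear_combination (-(D.comp e (Γ u (e 0)) 0 + D.comp e (Γ u (e 1)) 1
        + D.comp e (Γ u (e 2)) 2)) * hn
    have h3 : ∀ i, (D.comp e (Γ u (e i)) i).re = D.g (e i) (Γ u (e i)) := fun i => by
      simp [comp, h]
    rw [h2, sub_re, add_re, add_re, h3, h3, h3]
    simp only [hDG, D.g_symm (Γ u _) (e _)] at h1
    linarith
  obtain ⟨hα, hβ⟩ := hjet.eq he hb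
  refine ⟨Γ, ⟨hadd, hsmul, hsymm⟩, hDG, fun u v w => ?_, fun u x y z => ?_⟩
  · have := hα u v w
    linarith
  · have := hβ u x y z
    linear_combination this

end HermitianData

end ConeSoliton

/-! ### Calculus of alternating forms, and the Hermitian data at a point of the link. -/

namespace ConeSoliton

open Set Filter

lemma alternating_add {E F : Type*} [NormedAddCommGroup E] [NormedSpace ℝ E] [NormedAddCommGroup F]
    [NormedSpace ℝ F] (α : E [⋀^Fin 3]→L[ℝ] F) (u u' v w : E) :
    α ![u + u', v, w] = α ![u, v, w] + α ![u', v, w] := α.vecCons_add _ _ _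

lemma alternating_smul {E F : Type*} [NormedAddCommGroup E] [NormedSpace ℝ E] [NormedAddCommGroup F]
    [NormedSpace ℝ F] (α : E [⋀^Fin 3]→L[ℝ] F) (c : ℝ) (u v w : E) :
    α ![c • u, v, w] = c • α ![u, v, w] := α.vecCons_smul _ _ _

lemma alternating_swap {E F : Type*} [NormedAddCommGroup E] [NormedSpace ℝ E] [NormedAddCommGroup F]
    [NormedSpace ℝ F] (α : E [⋀^Fin 3]→L[ℝ] F) (u v w : E) : α ![v, u, w] = -α ![u, v, w] := by
  refine Eq.trans (congrArg α ?_) (α.toAlternatingMap.map_swap ![u, v, w] (show (0 : Fin 3) ≠ 1 by decide))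
  funext i; fin_cases i <;> rfl

lemma alternating_swap' {E F : Type*} [NormedAddCommGroup E] [NormedSpace ℝ E] [NormedAddCommGroup F]
    [NormedSpace ℝ F] (α : E [⋀^Fin 3]→L[ℝ] F) (u v w : E) : α ![u, w, v] = -α ![u, v, w] := by
  refine Eq.trans (congrArg α ?_) (α.toAlternatingMap.map_swap ![u, v, w] (show (1 : Fin 3) ≠ 2 by decide))
  funext i; fin_cases i <;> rfl

lemma alternating₂_add {E F : Type*} [NormedAddCommGroup E] [NormedSpace ℝ E] [NormedAddCommGroup F]
    [NormedSpace ℝ F] (α : E [⋀^Fin 2]→L[ℝ] F) (u u' v : E) :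
    α ![u + u', v] = α ![u, v] + α ![u', v] := α.vecCons_add _ _ _

lemma alternating₂_smul {E F : Type*} [NormedAddCommGroup E] [NormedSpace ℝ E] [NormedAddCommGroup F]
    [NormedSpace ℝ F] (α : E [⋀^Fin 2]→L[ℝ] F) (c : ℝ) (u v : E) :
    α ![c • u, v] = c • α ![u, v] := α.vecCons_smul _ _ _

lemma alternating₂_swap {E F : Type*} [NormedAddCommGroup E] [NormedSpace ℝ E] [NormedAddCommGroup F]
    [NormedSpace ℝ F] (α : E [⋀^Fin 2]→L[ℝ] F) (u v : E) : α ![v, u] = -α ![u, v] := by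
  refine Eq.trans (congrArg α ?_) (α.toAlternatingMap.map_swap ![u, v] (show (0 : Fin 2) ≠ 1 by decide))
  funext i; fin_cases i <;> rfl

lemma extDeriv_apply_two {E F : Type*} [NormedAddCommGroup E] [NormedSpace ℝ E]
    [NormedAddCommGroup F] [NormedSpace ℝ F] {α : E → E [⋀^Fin 2]→L[ℝ] F} {x : E}
    (h : DifferentiableAt ℝ α x) (u v w : E) : extDeriv α x ![u, v, w]
      = fderiv ℝ (fun y => α y ![v, w]) x u - fderiv ℝ (fun y => α y ![u, w]) x v
        + fderiv ℝ (fun y => α y ![u, v]) x w := by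
  rw [extDeriv_apply h, Fin.sum_univ_three]
  have h0 : (0 : Fin 3).removeNth ![u, v, w] = ![v, w] := by funext i; fin_cases i <;> rfl
  have h1 : (1 : Fin 3).removeNth ![u, v, w] = ![u, w] := by funext i; fin_cases i <;> rfl
  have h2 : (2 : Fin 3).removeNth ![u, v, w] = ![u, v] := by funext i; fin_cases i <;> rfl
  rw [h0, h1, h2]
  simp [sub_eq_add_neg]

lemma extDeriv_apply_three {E F : Type*} [NormedAddCommGroup E] [NormedSpace ℝ E]
    [NormedAddCommGroup F] [NormedSpace ℝ F] {α : E → E [⋀^Fin 3]→L[ℝ] F} {p : E}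
    (h : DifferentiableAt ℝ α p) (u x y z : E) : extDeriv α p ![u, x, y, z]
      = fderiv ℝ (fun q => α q ![x, y, z]) p u - fderiv ℝ (fun q => α q ![u, y, z]) p x
        + fderiv ℝ (fun q => α q ![u, x, z]) p y - fderiv ℝ (fun q => α q ![u, x, y]) p z := by
  rw [extDeriv_apply h, Fin.sum_univ_four]
  have h0 : (0 : Fin 4).removeNth ![u, x, y, z] = ![x, y, z] := by funext i; fin_cases i <;> rfl
  have h1 : (1 : Fin 4).removeNth ![u, x, y, z] = ![u, y, z] := by funext i; fin_cases i <;> rfl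
  have h2 : (2 : Fin 4).removeNth ![u, x, y, z] = ![u, x, z] := by funext i; fin_cases i <;> rfl
  have h3 : (3 : Fin 4).removeNth ![u, x, y, z] = ![u, x, y] := by funext i; fin_cases i <;> rfl
  rw [h0, h1, h2, h3]
  simp [sub_eq_add_neg, pow_succ]

/-- The product rule for the evaluation of a family of linear maps on a moving vector. -/
lemma fderiv_apply_moving {E F : Type*} [NormedAddCommGroup E] [NormedSpace ℝ E]
    [NormedAddCommGroup F] [NormedSpace ℝ F] {A : E → E6 → F} {j : E → E6} {x : E}
    (A_add : ∀ y v w, A y (v + w) = A y v + A y w) (A_smul : ∀ y (c : ℝ) v, A y (c • v) = c • A y v)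
    (hA : ∀ v, DifferentiableAt ℝ (fun y => A y v) x) (hj : DifferentiableAt ℝ j x) (u : E) :
    fderiv ℝ (fun y => A y (j y)) x u
      = fderiv ℝ (fun y => A y (j x)) x u + A x (fderiv ℝ j x u) := by
  set b := (EuclideanSpace.basisFun (Fin 6) ℝ).toBasis
  have hexp : ∀ y v, A y v = ∑ i, b.repr v i • A y (b i) := fun y v => by
    have h1 : IsLinearMap ℝ (A y) := ⟨A_add y, A_smul y⟩
    have h2 := map_sum (h1.mk' (A y)) (fun i => b.repr v i • b i) Finset.univ
    rw [b.sum_repr v] at h2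
    simpa using h2
  set L : Fin 6 → (E6 →L[ℝ] ℝ) := fun i => LinearMap.toContinuousLinearMap (b.coord i) with hL
  have hLv : ∀ i v, b.repr v i = L i v := fun i v => rfl
  have hf : (fun y => A y (j y)) = fun y => ∑ i, L i (j y) • A y (b i) := by
    funext y; rw [hexp]; rfl
  have hg : (fun y => A y (j x)) = fun y => ∑ i, L i (j x) • A y (b i) := by
    funext y; rw [hexp]; rfl
  have e1 : HasFDerivAt (fun y => ∑ i, L i (j y) • A y (b i)) _ x :=
    HasFDerivAt.fun_sum fun i _ => (((L i).hasFDerivAt.comp x hj.hasFDerivAt).smul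
      (hA (b i)).hasFDerivAt)
  have e2 : HasFDerivAt (fun y => ∑ i, L i (j x) • A y (b i)) _ x :=
    HasFDerivAt.fun_sum fun i _ => ((hA (b i)).hasFDerivAt.const_smul (L i (j x)))
  rw [hf, hg, e1.fderiv, e2.fderiv, hexp x (fderiv ℝ j x u)]
  simp [Finset.sum_add_distrib, hLv]

variable {N : Type*} [TopologicalSpace N] [ChartedSpace E6 N] [IsManifold (𝓡 6) ∞ N]

/-- The Hermitian structure and the `(3, 0)`-form at a point of a nearly Kähler manifold. -/
noncomputable def NearlyKahler.hermitian (S : NearlyKahler N) (x : N) : HermitianData E6 where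
  g u v := S.metric.inner x u v
  J := S.J x
  O u v w := S.hform x ![u, v, w]
  g_add u v w := by
    exact congrArg (fun L : E6 →L[ℝ] ℝ => L w) ((S.metric.inner x).map_add u v)
  g_smul c u v := by
    exact congrArg (fun L : E6 →L[ℝ] ℝ => L v) ((S.metric.inner x).map_smul c u)
  g_symm u v := S.metric.symm x u v
  g_pos v hv := S.metric.pos x v hv
  J_add u v := (S.J x).map_add u v
  J_smul c v := (S.J x).map_smul c v
  J_sq v := S.J_sq x v
  g_J u v := S.J_isometry x u v
  O_add u u' v w := alternating_add (E := E6) (S.hform x) u u' v w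
  O_smul c u v w := by
    exact alternating_smul (E := E6) (S.hform x) c u v w
  O_swap u v w := alternating_swap (E := E6) (S.hform x) u v w
  O_swap' u v w := alternating_swap' (E := E6) (S.hform x) u v w
  O_J u v w := S.hform_type x u v w

lemma NearlyKahler.kform_eq_om (S : NearlyKahler N) (x : N) (u v : E6) :
    (S.kform x : E6 [⋀^Fin 2]→L[ℝ] ℝ) ![u, v] = (S.hermitian x).om u v := S.kform_eq x u v

theorem NearlyKahler.exists_unitaryFrame (S : NearlyKahler N) (x : N) :
    ∃ e, (S.hermitian x).IsUnitaryFrame e :=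
  HermitianData.exists_unitaryFrame (D := S.hermitian x) (by simp) (S.kform_eq_om x)
    (fun _ _ _ => rfl) (S.volume_eq x)

lemma metricInChart_self (S : NearlyKahler N) (p : N) (v w : E6) :
    metricInChart S p (extChartAt (𝓡 6) p p) v w = (S.hermitian p).g v w := by
  have key : ∀ (a b : N) (h : a = b) (v w : E6), (S.hermitian a).g v w = (S.hermitian b).g v w := by
    rintro a _ rfl v w; rfl
  refine Eq.trans ?_ (key _ _ (extChartAt_to_inv (I := 𝓡 6) p) _ _)
  have h := coordVec_self (I := 𝓡 6) p
  exact congrArg (fun L : E6 →L[ℝ] E6 => (S.hermitian _).g (L v) (L w)) h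

end ConeSoliton

/-! ### The tensors of the link in a chart. -/

namespace ConeSoliton

open Set Filter

variable {N : Type*} [TopologicalSpace N] [ChartedSpace E6 N] [IsManifold (𝓡 6) ∞ N]

section Pointwise

variable (S : NearlyKahler N) (p : N) (y : E6)

/-- The coordinate isomorphism `coordVec` as a map between copies of the model space. -/
noncomputable def coordMap : E6 →L[ℝ] E6 := coordVec (𝓡 6) p y

lemma metricInChart_eq (v w : E6) : metricInChart S p y v w =
    (S.hermitian ((extChartAt (𝓡 6) p).symm y)).g (coordMap p y v) (coordMap p y w) :=
  rfl

lemma metricInChart_add (v v' w : E6) :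
    metricInChart S p y (v + v') w = metricInChart S p y v w + metricInChart S p y v' w := by
  rw [metricInChart_eq, metricInChart_eq, metricInChart_eq, ← HermitianData.g_add, map_add]

lemma metricInChart_smul (c : ℝ) (v w : E6) :
    metricInChart S p y (c • v) w = c * metricInChart S p y v w := by
  rw [metricInChart_eq, metricInChart_eq, ← HermitianData.g_smul, map_smul]

lemma metricInChart_symm (v w : E6) : metricInChart S p y v w = metricInChart S p y w v := by
  rw [metricInChart_eq, HermitianData.g_symm]; rfl

lemma kformInChart_eq (v w : E6) : formInChart (𝓡 6) S.kform p y ![v, w] =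
    (S.hermitian ((extChartAt (𝓡 6) p).symm y)).om (coordMap p y v) (coordMap p y w) := by
  rw [← S.kform_eq_om]
  change S.kform _ _ = S.kform _ _
  congr 1
  funext i
  fin_cases i <;> rfl

lemma hformInChart_eq (u v w : E6) : formInChart (𝓡 6) S.hform p y ![u, v, w] =
    (S.hermitian ((extChartAt (𝓡 6) p).symm y)).O (coordMap p y u) (coordMap p y v)
      (coordMap p y w) := by
  change S.hform _ _ = S.hform _ _
  congr 1
  funext i
  fin_cases i <;> rfl

lemma isInvertible_coordMap {y : E6} (hy : y ∈ (extChartAt (𝓡 6) p).target) :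
    (coordMap p y).IsInvertible := by
  have : IsManifold (𝓡 6) 1 N := IsManifold.of_le (n := ∞) (by simp)
  exact isInvertible_mfderivWithin_extChartAt_symm hy

lemma coordMap_surjective {y : E6} (hy : y ∈ (extChartAt (𝓡 6) p).target) (v : E6) :
    ∃ w, coordMap p y w = v := by
  obtain ⟨L, hL⟩ := isInvertible_coordMap p hy
  refine ⟨L.symm v, ?_⟩
  rw [← hL]
  exact L.apply_symm_apply v

lemma metricInChart_pos {y : E6} (hy : y ∈ (extChartAt (𝓡 6) p).target) {v : E6} (hv : v ≠ 0) :
    0 < metricInChart S p y v v := by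
  obtain ⟨L, hL⟩ := isInvertible_coordMap p hy
  refine (S.hermitian _).g_pos _ fun h0 => hv ?_
  have h1 : coordMap p y v = 0 := h0
  rw [← hL] at h1
  exact L.map_eq_zero_iff.1 h1

/-- Compatibility of the structure in a chart. -/
lemma exists_J_inChart {y : E6} (hy : y ∈ (extChartAt (𝓡 6) p).target) (v : E6) : ∃ j : E6,
    (∀ w, metricInChart S p y j w = formInChart (𝓡 6) S.kform p y ![v, w]) ∧
    (∀ w, formInChart (𝓡 6) S.kform p y ![j, w] = -metricInChart S p y v w) ∧
    ∀ w z, formInChart (𝓡 6) S.hform p y ![j, w, z]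
      = Complex.I * formInChart (𝓡 6) S.hform p y ![v, w, z] := by
  set D := S.hermitian ((extChartAt (𝓡 6) p).symm y)
  obtain ⟨j, hj⟩ := coordMap_surjective p hy (D.J (coordMap p y v))
  refine ⟨j, fun w => ?_, fun w => ?_, fun w z => ?_⟩
  · rw [metricInChart_eq, kformInChart_eq, hj]; rfl
  · rw [metricInChart_eq, kformInChart_eq, hj]; exact D.om_J _ _
  · rw [hformInChart_eq, hformInChart_eq, hj]; exact D.O_J _ _ _

/-- The metric in a chart, as a bundled bilinear form. -/
noncomputable def metricCLM : E6 →L[ℝ] E6 →L[ℝ] ℝ :=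
  LinearMap.toContinuousLinearMap
    { toFun := fun v => LinearMap.toContinuousLinearMap
        { toFun := fun w => metricInChart S p y v w
          map_add' := fun w w' => by
            rw [metricInChart_symm, metricInChart_add, metricInChart_symm, metricInChart_symm S p y w']
          map_smul' := fun c w => by
            rw [metricInChart_symm, metricInChart_smul, metricInChart_symm]; rfl }
      map_add' := fun v v' => by
        ext w
        exact metricInChart_add S p y v v' w
      map_smul' := fun c v => by
        ext w
        exact metricInChart_smul S p y c v w }

lemma metricCLM_apply (v w : E6) : metricCLM S p y v w = metricInChart S p y v w := rfl

/-- The Kähler form in a chart, contracted with a vector. -/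
noncomputable def kformCLM (v : E6) : E6 →L[ℝ] ℝ :=
  LinearMap.toContinuousLinearMap
    { toFun := fun w => formInChart (𝓡 6) S.kform p y ![v, w]
      map_add' := fun w w' => by
        rw [alternating₂_swap, alternating₂_add, alternating₂_swap _ w, alternating₂_swap _ w',
          neg_add]
      map_smul' := fun c w => by
        rw [alternating₂_swap, alternating₂_smul, alternating₂_swap _ v w]
        simp }

lemma kformCLM_apply (v w : E6) : kformCLM S p y v w = formInChart (𝓡 6) S.kform p y ![v, w] := rfl

end Pointwise

section Derivatives

variable (S : NearlyKahler N) (p : N)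

lemma differentiableAt_metricInChart {y : E6} (hy : y ∈ (extChartAt (𝓡 6) p).target) (v w : E6) :
    DifferentiableAt ℝ (fun y => metricInChart S p y v w) y :=
  ((contDiffOn_metricInChart S p v w).contDiffAt
    ((isOpen_extChartAt_target (I := 𝓡 6) p).mem_nhds hy)).differentiableAt (by simp)

lemma differentiableAt_kform {y : E6} (hy : y ∈ (extChartAt (𝓡 6) p).target) :
    DifferentiableAt ℝ (formInChart (𝓡 6) S.kform p) y :=
  (S.smooth_kform.contDiffAt p hy).differentiableAt (by simp)

lemma differentiableAt_hform {y : E6} (hy : y ∈ (extChartAt (𝓡 6) p).target) :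
    DifferentiableAt ℝ (formInChart (𝓡 6) S.hform p) y :=
  (S.smooth_hform.contDiffAt p hy).differentiableAt (by simp)

lemma differentiableAt_form_apply {k : ℕ} {F : Type*} [NormedAddCommGroup F] [NormedSpace ℝ F]
    {α : E6 → E6 [⋀^Fin k]→L[ℝ] F} {y : E6} (h : DifferentiableAt ℝ α y) (v : Fin k → E6) :
    DifferentiableAt ℝ (fun y => α y v) y :=
  (ContinuousAlternatingMap.apply ℝ E6 F v).differentiableAt.comp y h

/-- The complex structure in a chart is differentiable. -/
lemma exists_differentiable_J (v : E6) : ∃ j : E6 → E6,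
    DifferentiableAt ℝ j (extChartAt (𝓡 6) p p) ∧ ∀ y ∈ (extChartAt (𝓡 6) p).target,
      (∀ w, metricInChart S p y (j y) w = formInChart (𝓡 6) S.kform p y ![v, w]) ∧
      (∀ w, formInChart (𝓡 6) S.kform p y ![j y, w] = -metricInChart S p y v w) ∧
      ∀ w z, formInChart (𝓡 6) S.hform p y ![j y, w, z]
        = Complex.I * formInChart (𝓡 6) S.hform p y ![v, w, z] := by
  have ht := isOpen_extChartAt_target (I := 𝓡 6) p
  have h0 := mem_extChartAt_target (I := 𝓡 6) p
  have hinv : ∀ y ∈ (extChartAt (𝓡 6) p).target, (metricCLM S p y).IsInvertible := by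
    intro y hy
    have hinj : Function.Injective (metricCLM S p y).toLinearMap := by
      rw [injective_iff_map_eq_zero]
      intro v hv
      by_contra hv0
      have h1 := metricInChart_pos S p hy hv0
      rw [← metricCLM_apply] at h1
      change metricCLM S p y v = 0 at hv
      rw [hv] at h1
      exact lt_irrefl _ h1
    have hdim : Module.finrank ℝ E6 = Module.finrank ℝ (E6 →L[ℝ] ℝ) := by
      rw [← (LinearMap.toContinuousLinearMap (𝕜 := ℝ) (E := E6) (F' := ℝ)).finrank_eq]
      exact (Subspace.dual_finrank_eq (K := ℝ) (V := E6)).symm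
    refine ⟨(LinearMap.linearEquivOfInjective _ hinj hdim).toContinuousLinearEquiv, ?_⟩
    ext v w
    rfl
  have hG : ContDiffOn ℝ ∞ (metricCLM S p) (extChartAt (𝓡 6) p).target := by
    rw [contDiffOn_clm_apply]
    intro v
    rw [contDiffOn_clm_apply]
    exact contDiffOn_metricInChart S p v
  have hk : DifferentiableAt ℝ (fun y => kformCLM S p y v) (extChartAt (𝓡 6) p p) := by
    have : ContDiffOn ℝ ∞ (fun y => kformCLM S p y v) (extChartAt (𝓡 6) p).target := by
      rw [contDiffOn_clm_apply]
      intro w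
      exact (ContinuousAlternatingMap.apply ℝ E6 ℝ ![v, w]).contDiff.comp_contDiffOn (S.smooth_kform p)
    exact (this.contDiffAt (ht.mem_nhds h0)).differentiableAt (by simp)
  -- The vector `J v` is the metric dual of `ω(v, ·)`, so the smoothness of `J` is inherited from
  -- `g` and `ω`.
  refine ⟨fun y => (metricCLM S p y).inverse (kformCLM S p y v), ?_, fun y hy => ?_⟩
  · have h1 : DifferentiableAt ℝ (fun y => (metricCLM S p y).inverse) (extChartAt (𝓡 6) p p) := by
      obtain ⟨L, hL⟩ := hinv _ h0
      have h2 : ContDiffAt ℝ ∞ (ContinuousLinearMap.inverse : (E6 →L[ℝ] E6 →L[ℝ] ℝ) → _)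
          (metricCLM S p (extChartAt (𝓡 6) p p)) := by
        rw [← hL]; exact contDiffAt_map_inverse L
      exact (h2.comp _ (hG.contDiffAt (ht.mem_nhds h0))).differentiableAt (by simp)
    exact h1.clm_apply hk
  · obtain ⟨j, h1, h2, h3⟩ := exists_J_inChart S p hy v
    have : (metricCLM S p y).inverse (kformCLM S p y v) = j := by
      obtain ⟨L, hL⟩ := hinv y hy
      rw [← hL, ContinuousLinearMap.inverse_equiv]
      have h4 : kformCLM S p y v = L j := by
        ext w
        rw [kformCLM_apply, ← h1, ← metricCLM_apply, ← hL]
        rfl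
      rw [h4]
      exact L.symm_apply_apply j
    simp only [this]
    exact ⟨h1, h2, h3⟩

end Derivatives

end ConeSoliton

/-! ### First derivatives of the nearly Kähler structure at a point. -/

namespace ConeSoliton

open Set Filter

variable {N : Type*} [TopologicalSpace N] [ChartedSpace E6 N] [IsManifold (𝓡 6) ∞ N]
  (S : NearlyKahler N) (p : N)

/-- The derivative of the metric in the chart at `p`. -/
noncomputable def metricJet (u v w : E6) : ℝ :=
  fderiv ℝ (fun y => metricInChart S p y v w) (extChartAt (𝓡 6) p p) u

/-- The derivative of the Kähler form in the chart at `p`. -/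
noncomputable def kformJet (u v w : E6) : ℝ :=
  fderiv ℝ (fun y => formInChart (𝓡 6) S.kform p y ![v, w]) (extChartAt (𝓡 6) p p) u

/-- The derivative of the `(3, 0)`-form in the chart at `p`. -/
noncomputable def hformJet (u x y z : E6) : ℂ :=
  fderiv ℝ (fun q => formInChart (𝓡 6) S.hform p q ![x, y, z]) (extChartAt (𝓡 6) p p) u

lemma kformInChart_self (v w : E6) : formInChart (𝓡 6) S.kform p (extChartAt (𝓡 6) p p) ![v, w]
    = (S.hermitian p).om v w := by
  exact (formInChart_self _ _ _).trans (S.kform_eq_om p v w)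

lemma hformInChart_self (u v w : E6) : formInChart (𝓡 6) S.hform p (extChartAt (𝓡 6) p p) ![u, v, w]
    = (S.hermitian p).O u v w := formInChart_self _ _ _

/-- Differentiate `g(Jv, w) = ω(v, w)`, `ω(Jv, w) = -g(v, w)` and `Ω(Jv, w, z) = i Ω(v, w, z)` with
`v`, `w`, `z` constant in the chart; the moving vector `Jv` contributes the same derivative `j` to
all three. -/
lemma jet_compatible (u v : E6) : ∃ j,
    (∀ w, kformJet S p u v w = metricJet S p u ((S.hermitian p).J v) w + (S.hermitian p).g j w) ∧
    (∀ w, kformJet S p u ((S.hermitian p).J v) w + (S.hermitian p).om j w = -metricJet S p u v w) ∧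
    ∀ w z, hformJet S p u ((S.hermitian p).J v) w z + (S.hermitian p).O j w z
      = Complex.I * hformJet S p u v w z := by
  have h0 := mem_extChartAt_target (I := 𝓡 6) p
  have ht := (isOpen_extChartAt_target (I := 𝓡 6) p).mem_nhds h0
  obtain ⟨j, hj, hrel⟩ := exists_differentiable_J S p v
  have hj0 : j (extChartAt (𝓡 6) p p) = (S.hermitian p).J v := by
    refine (S.hermitian p).eq_of_g fun w => ?_
    rw [← metricInChart_self, (hrel _ h0).1 w, kformInChart_self]
    rfl
  refine ⟨fderiv ℝ j (extChartAt (𝓡 6) p p) u, fun w => ?_, fun w => ?_, fun w z => ?_⟩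
  · have h1 := fderiv_apply_moving (A := fun y v => metricInChart S p y v w)
      (fun y v v' => metricInChart_add S p y v v' w) (fun y c v => metricInChart_smul S p y c v w)
      (fun v => differentiableAt_metricInChart S p h0 v w) hj u
    rw [hj0, metricInChart_self] at h1
    rw [metricJet, ← h1, kformJet]
    congr 1
    refine Filter.EventuallyEq.fderiv_eq ?_
    filter_upwards [ht] with y hy
    exact ((hrel y hy).1 w).symm
  · have h1 := fderiv_apply_moving (A := fun y v => formInChart (𝓡 6) S.kform p y ![v, w])
      (fun y v v' => alternating₂_add _ v v' w) (fun y c v => alternating₂_smul _ c v w)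
      (fun v => differentiableAt_form_apply (differentiableAt_kform S p h0) _) hj u
    rw [hj0, kformInChart_self] at h1
    rw [kformJet, ← h1, metricJet, ← neg_apply, ← fderiv_fun_neg]
    congr 1
    refine Filter.EventuallyEq.fderiv_eq ?_
    filter_upwards [ht] with y hy
    exact (hrel y hy).2.1 w
  · have h1 := fderiv_apply_moving (A := fun y v => formInChart (𝓡 6) S.hform p y ![v, w, z])
      (fun y v v' => alternating_add _ v v' w z) (fun y c v => alternating_smul _ c v w z)
      (fun v => differentiableAt_form_apply (differentiableAt_hform S p h0) _) hj u
    rw [hj0, hformInChart_self] at h1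
    have h2 : Complex.I * hformJet S p u v w z = fderiv ℝ (fun q => Complex.I *
        formInChart (𝓡 6) S.hform p q ![v, w, z]) (extChartAt (𝓡 6) p p) u := by
      rw [fderiv_const_mul (differentiableAt_form_apply (differentiableAt_hform S p h0) _)]
      rfl
    rw [hformJet, ← h1, h2]
    congr 1
    refine Filter.EventuallyEq.fderiv_eq ?_
    filter_upwards [ht] with y hy
    exact (hrel y hy).2.2 w z

/-- Keep the unitary frame constant in the chart. By Hadamard's inequality the product of the `g(eᵢ,
eᵢ)` minus `|Ω(e₀, e₁, e₂)|²` is nonnegative at every point and zero at `p`, so its derivative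
vanishes at `p`. -/
lemma jet_norm {e : Fin 3 → E6} (he : (S.hermitian p).IsUnitaryFrame e) (u : E6) :
    metricJet S p u (e 0) (e 0) + metricJet S p u (e 1) (e 1) + metricJet S p u (e 2) (e 2)
    = 2 * ((starRingEnd ℂ) ((S.hermitian p).O (e 0) (e 1) (e 2)) *
      hformJet S p u (e 0) (e 1) (e 2)).re := by
  have h0 := mem_extChartAt_target (I := 𝓡 6) p
  set y₀ := extChartAt (𝓡 6) p p with hy₀
  set Om : E6 → ℂ := fun y => formInChart (𝓡 6) S.hform p y ![e 0, e 1, e 2] with hOm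
  have dg : ∀ i, HasFDerivAt (fun y => metricInChart S p y (e i) (e i))
      (fderiv ℝ (fun y => metricInChart S p y (e i) (e i)) y₀) y₀ := fun i =>
    (differentiableAt_metricInChart S p h0 _ _).hasFDerivAt
  have dO : HasFDerivAt Om (fderiv ℝ Om y₀) y₀ :=
    (differentiableAt_form_apply (differentiableAt_hform S p h0) _).hasFDerivAt
  have dre : HasFDerivAt (fun y => (Om y).re) (Complex.reCLM.comp (fderiv ℝ Om y₀)) y₀ :=
    Complex.reCLM.hasFDerivAt.comp y₀ dO
  have dim : HasFDerivAt (fun y => (Om y).im) (Complex.imCLM.comp (fderiv ℝ Om y₀)) y₀ :=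
    Complex.imCLM.hasFDerivAt.comp y₀ dO
  have hF := (((dg 0).mul (dg 1)).mul (dg 2)).sub ((dre.mul dre).add (dim.mul dim))
  have g1 : ∀ i, metricInChart S p y₀ (e i) (e i) = 1 := fun i => by
    rw [metricInChart_self, he.ortho, if_pos rfl]
  have o1 : (Om y₀).re * (Om y₀).re + (Om y₀).im * (Om y₀).im = 1 := by
    rw [← Complex.normSq_apply, hOm, ← he.norm_O]
    exact congrArg Complex.normSq (hformInChart_self S p _ _ _)
  have hmin : IsLocalMin ((((fun y => metricInChart S p y (e 0) (e 0)) *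
      fun y => metricInChart S p y (e 1) (e 1)) * fun y => metricInChart S p y (e 2) (e 2)) -
      (((fun y => (Om y).re) * fun y => (Om y).re) + (fun y => (Om y).im) * fun y => (Om y).im)) y₀ := by
    filter_upwards with y
    obtain ⟨f, hf⟩ := S.exists_unitaryFrame ((extChartAt (𝓡 6) p).symm y)
    have h1 := hf.normSq_O_le (coordMap p y (e 0)) (coordMap p y (e 1)) (coordMap p y (e 2))
    rw [← hformInChart_eq, ← metricInChart_eq, ← metricInChart_eq, ← metricInChart_eq,
      Complex.normSq_apply] at h1
    simp only [Pi.sub_apply, Pi.mul_apply, Pi.add_apply, g1, o1]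
    have h2 : Om y = formInChart (𝓡 6) S.hform p y ![e 0, e 1, e 2] := rfl
    rw [← h2] at h1
    linarith
  have h1 := congrArg (fun L : E6 →L[ℝ] ℝ => L u) (hmin.hasFDerivAt_eq_zero hF)
  simp only [g1] at h1
  have h2 : (S.hermitian p).O (e 0) (e 1) (e 2) = Om y₀ := (hformInChart_self S p _ _ _).symm
  have h3 : hformJet S p u (e 0) (e 1) (e 2) = fderiv ℝ Om y₀ u := rfl
  rw [h2, h3]
  simp [g1] at h1
  simp only [metricJet, Complex.mul_re, Complex.conj_re, Complex.conj_im]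
  linarith

lemma jet_cyc (u v w : E6) : kformJet S p u v w - kformJet S p v u w + kformJet S p w u v
    = -3 * ((S.hermitian p).O u v w).re := by
  have h0 := mem_extChartAt_target (I := 𝓡 6) p
  have h1 := extDeriv_apply_two (differentiableAt_kform S p h0) u v w
  exact h1.symm.trans (S.d_kform p ![u, v, w])

lemma jet_alt_im (u x y z : E6) : (hformJet S p u x y z - hformJet S p x u y z
    + hformJet S p y u x z - hformJet S p z u x y).im
    = 4 * ((S.hermitian p).om u x * (S.hermitian p).om y z
      - (S.hermitian p).om u y * (S.hermitian p).om x z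
      + (S.hermitian p).om u z * (S.hermitian p).om x y) := by
  have h0 := mem_extChartAt_target (I := 𝓡 6) p
  have hd : DifferentiableAt ℝ (formInChart (𝓡 6)
      (fun y => Complex.imCLM.compContinuousAlternatingMap (S.hform y)) p) (extChartAt (𝓡 6) p p) := by
    exact (ContinuousLinearMap.compContinuousAlternatingMapCLM ℝ E6 ℂ ℝ (Fin 3) Complex.imCLM).differentiableAt.comp _
      (differentiableAt_hform S p h0)
  have h1 := extDeriv_apply_three hd u x y z
  have h2 := S.d_im_hform p ![u, x, y, z]
  have h3 := wedge_two_two (V := E6) (S.kform p) (fun u v => alternating₂_swap (E := E6) (S.kform p) u v) u x y z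
  have h4 : ∀ u x y z : E6, fderiv ℝ (fun q => formInChart (𝓡 6)
      (fun y => Complex.imCLM.compContinuousAlternatingMap (S.hform y)) p q ![x, y, z])
      (extChartAt (𝓡 6) p p) u = (hformJet S p u x y z).im := fun u x y z => by
    have := Complex.imCLM.hasFDerivAt.comp _ (differentiableAt_form_apply (differentiableAt_hform S p h0)
      ![x, y, z]).hasFDerivAt
    exact congrArg (fun L : E6 →L[ℝ] ℝ => L u) this.fderiv
  simp only [h4] at h1
  have h5 : (hformJet S p u x y z).im - (hformJet S p x u y z).im + (hformJet S p y u x z).im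
      - (hformJet S p z u x y).im = 2 * (2 * ((S.hermitian p).om u x * (S.hermitian p).om y z
      - (S.hermitian p).om u y * (S.hermitian p).om x z
      + (S.hermitian p).om u z * (S.hermitian p).om x y)) := by
    refine h1.symm.trans (h2.trans ?_)
    refine (congrArg (fun t => 2 * t) h3).trans ?_
    simp only [← S.kform_eq_om]
    rfl
  simp only [Complex.sub_im, Complex.add_im]
  rw [h5]
  ring

/-- The equation `d Re Ω = 0` is not part of the data; it follows from `-3 Re Ω = dω` and `d(dω) =
0`. -/
lemma jet_alt_re (u x y z : E6) : (hformJet S p u x y z - hformJet S p x u y z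
    + hformJet S p y u x z - hformJet S p z u x y).re = 0 := by
  have h0 := mem_extChartAt_target (I := 𝓡 6) p
  have ht := (isOpen_extChartAt_target (I := 𝓡 6) p).mem_nhds h0
  set R : E6 → E6 [⋀^Fin 3]→L[ℝ] ℝ := fun y =>
    Complex.reCLM.compContinuousAlternatingMap (formInChart (𝓡 6) S.hform p y) with hR
  have hd : DifferentiableAt ℝ R (extChartAt (𝓡 6) p p) :=
    (ContinuousLinearMap.compContinuousAlternatingMapCLM ℝ E6 ℂ ℝ (Fin 3) Complex.reCLM).differentiableAt.comp _
      (differentiableAt_hform S p h0)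
  have h1 := extDeriv_extDeriv_apply (S.smooth_kform.contDiffAt p h0)
    (by rw [minSmoothness_of_isRCLikeNormedField]; exact two_le_infty)
  have h2 : extDeriv (formInChart (𝓡 6) S.kform p) =ᶠ[𝓝 (extChartAt (𝓡 6) p p)] (-3 : ℝ) • R := by
    filter_upwards [ht] with y hy
    ext v
    refine (extDeriv_formInChart S.smooth_kform p hy v).trans ?_
    exact S.d_kform _ _
  rw [h2.extDeriv_eq, extDeriv_smul] at h1
  have h3 : extDeriv R (extChartAt (𝓡 6) p p) ![u, x, y, z] = 0 := by
    have := congrArg (fun α : E6 [⋀^Fin 4]→L[ℝ] ℝ => α ![u, x, y, z]) h1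
    simpa using this
  have h4 : ∀ u x y z : E6, fderiv ℝ (fun q => R q ![x, y, z])
      (extChartAt (𝓡 6) p p) u = (hformJet S p u x y z).re := fun u x y z => by
    have := Complex.reCLM.hasFDerivAt.comp _ (differentiableAt_form_apply (differentiableAt_hform S p h0)
      ![x, y, z]).hasFDerivAt
    exact congrArg (fun L : E6 →L[ℝ] ℝ => L u) this.fderiv
  rw [extDeriv_apply_three hd] at h3
  simpa only [h4, Complex.sub_re, Complex.add_re] using h3

theorem isNearlyKahlerChartJet : (S.hermitian p).IsNearlyKahlerChartJet
    (metricJet S p) (kformJet S p) (hformJet S p) := by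
  have h0 := mem_extChartAt_target (I := 𝓡 6) p
  have dG := differentiableAt_metricInChart S p h0
  have dW : ∀ v w, DifferentiableAt ℝ (fun y => formInChart (𝓡 6) S.kform p y ![v, w]) _ :=
    fun v w => differentiableAt_form_apply (differentiableAt_kform S p h0) _
  have dO : ∀ x y z, DifferentiableAt ℝ (fun q => formInChart (𝓡 6) S.hform p q ![x, y, z]) _ :=
    fun x y z => differentiableAt_form_apply (differentiableAt_hform S p h0) _
  constructor
  · intro u u' v w; simp only [metricJet, map_add]
  · intro c u v w; simp only [metricJet, map_smul, smul_eq_mul]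
  · intro u v v' w
    simp only [metricJet, metricInChart_add]
    rw [fderiv_fun_add (dG _ _) (dG _ _)]; rfl
  · intro c u v w
    simp only [metricJet, metricInChart_smul]
    rw [fderiv_const_mul (dG _ _)]; rfl
  · intro u v w
    simp only [metricJet, metricInChart_symm S p _ w v]
  · intro u v v' w
    simp only [kformJet, alternating₂_add]
    rw [fderiv_fun_add (dW _ _) (dW _ _)]; rfl
  · intro c u v w
    simp only [kformJet, alternating₂_smul]
    rw [fderiv_fun_const_smul (dW _ _)]; rfl
  · intro u v w
    simp only [kformJet, alternating₂_swap _ v w, fderiv_fun_neg]; rfl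
  · intro u u' x y z; simp only [hformJet, map_add]
  · intro c u x y z; simp only [hformJet, map_smul, Complex.real_smul]
  · intro u x x' y z
    simp only [hformJet, alternating_add]
    rw [fderiv_fun_add (dO _ _ _) (dO _ _ _)]; rfl
  · intro c u x y z
    simp only [hformJet, alternating_smul]
    rw [fderiv_fun_const_smul (dO _ _ _)]
    simp
  · intro u x y z
    simp only [hformJet, alternating_swap _ x y, fderiv_fun_neg]; rfl
  · intro u x y z
    simp only [hformJet, alternating_swap' _ x y z, fderiv_fun_neg]; rfl
  · exact jet_compatible S p
  · exact fun e he u => jet_norm S p he u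
  · exact jet_cyc S p
  · intro u x y z
    apply Complex.ext
    · rw [jet_alt_re]; simp
    · rw [jet_alt_im]; simp

/-- The first derivatives of the tensors of a nearly Kähler structure, in terms of the Christoffel
symbols of the chart. -/
theorem exists_christoffel_jet : ∃ Γ : E6 → E6 → E6, HermitianData.IsSymmBilinear Γ ∧
    (∀ u v w, metricJet S p u v w = (S.hermitian p).g (Γ u v) w + (S.hermitian p).g v (Γ u w)) ∧
    (∀ u v w, kformJet S p u v w = (S.hermitian p).om (Γ u v) w + (S.hermitian p).om v (Γ u w)
      - ((S.hermitian p).O u v w).re) ∧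
    ∀ u x y z, hformJet S p u x y z = (S.hermitian p).O (Γ u x) y z + (S.hermitian p).O x (Γ u y) z
      + (S.hermitian p).O x y (Γ u z) + ((S.hermitian p).h u x * (S.hermitian p).om y z
      + (S.hermitian p).h u y * (S.hermitian p).om z x + (S.hermitian p).h u z * (S.hermitian p).om x y) := by
  obtain ⟨e, he⟩ := S.exists_unitaryFrame p
  exact (isNearlyKahlerChartJet S p).exists_christoffel he

end ConeSoliton

/-! ### Multilinear functions, and independence of contractions from the frame. -/

namespace ConeSoliton

section Multilinear

variable {V W : Type*} [AddCommGroup V] [Module ℝ V] [AddCommGroup W] [Module ℝ W]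

/-- Multilinearity of a real function of several vectors. -/
def IsMultilinear {k : ℕ} (A : (Fin k → V) → ℝ) : Prop :=
  ∃ m : MultilinearMap ℝ (fun _ : Fin k => V) ℝ, ∀ v, m v = A v

namespace IsMultilinear

variable {k l : ℕ} {A B : (Fin k → V) → ℝ}

lemma add (hA : IsMultilinear A) (hB : IsMultilinear B) : IsMultilinear (fun v => A v + B v) := by
  obtain ⟨m, hm⟩ := hA
  obtain ⟨n, hn⟩ := hB
  exact ⟨m + n, fun v => by simp [hm, hn]⟩

lemma const_mul (hA : IsMultilinear A) (c : ℝ) : IsMultilinear (fun v => c * A v) := by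
  obtain ⟨m, hm⟩ := hA
  exact ⟨c • m, fun v => by simp [hm]⟩

lemma sub (hA : IsMultilinear A) (hB : IsMultilinear B) : IsMultilinear (fun v => A v - B v) := by
  simpa [sub_eq_add_neg] using hA.add (hB.const_mul (-1))

lemma sum {ι : Type*} (s : Finset ι) {C : ι → (Fin k → V) → ℝ} (hC : ∀ i ∈ s, IsMultilinear (C i)) :
    IsMultilinear (fun v => ∑ i ∈ s, C i v) := by
  classical
  induction s using Finset.induction_on with
  | empty => exact ⟨0, fun v => by simp⟩
  | insert i s hi ih =>
    simp only [Finset.sum_insert hi]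
    exact (hC i (Finset.mem_insert_self i s)).add (ih fun j hj => hC j (Finset.mem_insert_of_mem hj))

lemma wedge {B : (Fin l → V) → ℝ} (hA : IsMultilinear A) (hB : IsMultilinear B) :
    IsMultilinear (wedge A B) := by
  obtain ⟨m, hm⟩ := hA
  obtain ⟨n, hn⟩ := hB
  refine const_mul (sum _ fun σ _ => const_mul ?_ _) _
  refine ⟨((LinearMap.mul' ℝ ℝ).compMultilinearMap (m.domCoprod n)).domDomCongr
    (finSumFinEquiv.trans σ), fun v => ?_⟩
  simp [hm, hn]

lemma comp {A : (Fin k → W) → ℝ} (hA : IsMultilinear A) (L : V →ₗ[ℝ] W) :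
    IsMultilinear (fun v : Fin k → V => A (fun i => L (v i))) := by
  obtain ⟨m, hm⟩ := hA
  exact ⟨m.compLinearMap fun _ => L, fun v => hm _⟩

lemma of_linear (L : V →ₗ[ℝ] ℝ) : IsMultilinear (fun v : Fin 1 → V => L (v 0)) :=
  ⟨(MultilinearMap.ofSubsingleton ℝ V ℝ (0 : Fin 1)) L, fun _ => rfl⟩

lemma update_add (hA : IsMultilinear A) (v : Fin k → V) (i : Fin k) (x y : V) :
    A (Function.update v i (x + y)) = A (Function.update v i x) + A (Function.update v i y) := by
  obtain ⟨m, hm⟩ := hA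
  simp only [← hm, m.map_update_add]

lemma update_smul (hA : IsMultilinear A) (v : Fin k → V) (i : Fin k) (c : ℝ) (x : V) :
    A (Function.update v i (c • x)) = c * A (Function.update v i x) := by
  obtain ⟨m, hm⟩ := hA
  simp only [← hm, m.map_update_smul, smul_eq_mul]

lemma smul_all (hA : IsMultilinear A) (c : ℝ) (v : Fin k → V) :
    A (fun i => c • v i) = c ^ k * A v := by
  obtain ⟨m, hm⟩ := hA
  rw [← hm, ← hm, m.map_smul_univ (fun _ => c) v]
  simp

end IsMultilinear

/-- Trilinearity of a real function of three vectors. -/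
structure IsTrilinear (F : V → V → V → ℝ) : Prop where
  add₁ : ∀ a a' b c, F (a + a') b c = F a b c + F a' b c
  smul₁ : ∀ (t : ℝ) a b c, F (t • a) b c = t * F a b c
  add₂ : ∀ a b b' c, F a (b + b') c = F a b c + F a b' c
  smul₂ : ∀ (t : ℝ) a b c, F a (t • b) c = t * F a b c
  add₃ : ∀ a b c c', F a b (c + c') = F a b c + F a b c'
  smul₃ : ∀ (t : ℝ) a b c, F a b (t • c) = t * F a b c

lemma IsMultilinear.isTrilinear {n : ℕ} {A : (Fin (n + 3) → V) → ℝ} (hA : IsMultilinear A)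
    (w : Fin n → V) : IsTrilinear fun a b c => A (Fin.cons a (Fin.cons b (Fin.cons c w))) := by
  have u0 : ∀ a b c z : V, (Fin.cons z (Fin.cons b (Fin.cons c w)) : Fin (n + 3) → V)
      = Function.update (Fin.cons a (Fin.cons b (Fin.cons c w))) 0 z := fun a b c z => by
    rw [Fin.update_cons_zero]
  have u1 : ∀ a b c z : V, (Fin.cons a (Fin.cons z (Fin.cons c w)) : Fin (n + 3) → V)
      = Function.update (Fin.cons a (Fin.cons b (Fin.cons c w))) (Fin.succ 0) z := fun a b c z => by
    rw [← Fin.cons_update, Fin.update_cons_zero]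
  have u2 : ∀ a b c z : V, (Fin.cons a (Fin.cons b (Fin.cons z w)) : Fin (n + 3) → V)
      = Function.update (Fin.cons a (Fin.cons b (Fin.cons c w))) (Fin.succ (Fin.succ 0)) z :=
    fun a b c z => by
    rw [← Fin.cons_update, ← Fin.cons_update, Fin.update_cons_zero]
  constructor
  · intro a a' b c
    rw [u0 a b c (a + a'), hA.update_add, ← u0, ← u0]
  · intro t a b c
    rw [u0 a b c (t • a), hA.update_smul, ← u0]
  · intro a b b' c
    rw [u1 a b c (b + b'), hA.update_add, ← u1, ← u1]
  · intro t a b c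
    rw [u1 a b c (t • b), hA.update_smul, ← u1]
  · intro a b c c'
    rw [u2 a b c (c + c'), hA.update_add, ← u2, ← u2]
  · intro t a b c
    rw [u2 a b c (t • c), hA.update_smul, ← u2]

/-- An orthonormal basis of a space with a bilinear form, as a family of vectors. -/
structure IsFrame {n : ℕ} (g : V → V → ℝ) (E : Fin n → V) : Prop where
  ortho : ∀ i j, g (E i) (E j) = if i = j then 1 else 0
  expand : ∀ v, v = ∑ i, g (E i) v • E i

/-- The hypotheses on a function of two vectors that make it bilinear. -/
structure IsBilinear (B : V → V → ℝ) : Prop where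
  add₁ : ∀ a a' b, B (a + a') b = B a b + B a' b
  smul₁ : ∀ (t : ℝ) a b, B (t • a) b = t * B a b
  add₂ : ∀ a b b', B a (b + b') = B a b + B a b'
  smul₂ : ∀ (t : ℝ) a b, B a (t • b) = t * B a b

lemma IsBilinear.sum_left {B : V → V → ℝ} (hB : IsBilinear B) {n : ℕ} (c : Fin n → ℝ) (E : Fin n → V)
    (w : V) : B (∑ i, c i • E i) w = ∑ i, c i * B (E i) w := by
  have h : IsLinearMap ℝ (fun v => B v w) := ⟨fun x y => hB.add₁ x y w, fun t x => hB.smul₁ t x w⟩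
  have h1 : B (∑ i, c i • E i) w = ∑ i, B (c i • E i) w := map_sum (h.mk' _) (fun i => c i • E i) _
  simp only [h1, hB.smul₁]

lemma IsBilinear.sum_right {B : V → V → ℝ} (hB : IsBilinear B) {n : ℕ} (c : Fin n → ℝ) (E : Fin n → V)
    (w : V) : B w (∑ i, c i • E i) = ∑ i, c i * B w (E i) := by
  have h : IsLinearMap ℝ (fun v => B w v) := ⟨fun x y => hB.add₂ w x y, fun t x => hB.smul₂ t w x⟩
  have h1 : B w (∑ i, c i • E i) = ∑ i, B w (c i • E i) := map_sum (h.mk' _) (fun i => c i • E i) _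
  simp only [h1, hB.smul₂]

lemma IsBilinear.ext_frame {g : V → V → ℝ} {n : ℕ} {E : Fin n → V} (hE : IsFrame g E) {B C : V → V → ℝ}
    (hB : IsBilinear B) (hC : IsBilinear C) (h : ∀ i j, B (E i) (E j) = C (E i) (E j)) (v w : V) :
    B v w = C v w := by
  rw [hE.expand v, hE.expand w]
  simp only [hB.sum_left, hB.sum_right, hC.sum_left, hC.sum_right, h]

/-- Traces do not depend on the orthonormal frame. -/
lemma IsFrame.sum_eq {g : V → V → ℝ} {n : ℕ} (hg : IsBilinear g) {E e : Fin n → V} (hE : IsFrame g E)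
    (he : ∀ i j, g (e i) (e j) = if i = j then 1 else 0) {B : V → V → ℝ} (hB : IsBilinear B) :
    ∑ i, B (e i) (e i) = ∑ i, B (E i) (E i) := by
  -- The change of frame is orthogonal: orthonormality of `e` gives `O Oᵀ = 1`, whereas the trace
  -- needs `Oᵀ O = 1`.
  set O : Matrix (Fin n) (Fin n) ℝ := Matrix.of fun i j => g (E j) (e i) with hO
  have h1 : O * O.transpose = 1 := by
    ext i j
    rw [Matrix.mul_apply, Matrix.one_apply, ← he, hE.expand (e i), hg.sum_left]
    refine Finset.sum_congr rfl fun k _ => ?_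
    simp only [hO, Matrix.of_apply, Matrix.transpose_apply]
  have h2 : O.transpose * O = 1 := mul_eq_one_comm.1 h1
  have h3 : ∀ j k, ∑ i, O i j * O i k = if j = k then 1 else 0 := fun j k => by
    have := congrFun (congrFun h2 j) k
    rwa [Matrix.mul_apply, Matrix.one_apply] at this
  calc ∑ i, B (e i) (e i) = ∑ i, ∑ j, ∑ k, O i j * (O i k * B (E j) (E k)) := by
        refine Finset.sum_congr rfl fun i _ => ?_
        conv_lhs => rw [hE.expand (e i), hB.sum_left]
        simp only [hB.sum_right, Finset.mul_sum]
        rfl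
    _ = ∑ j, ∑ k, (∑ i, O i j * O i k) * B (E j) (E k) := by
        rw [Finset.sum_comm]
        refine Finset.sum_congr rfl fun j _ => ?_
        rw [Finset.sum_comm]
        simp only [Finset.sum_mul, mul_assoc]
    _ = ∑ i, B (E i) (E i) := by simp [h3]

/-- The frame is exchanged one index at a time, each exchange being a trace of a bilinear form. -/
lemma IsFrame.sum_mul_eq {g : V → V → ℝ} {n : ℕ} (hg : IsBilinear g) {E e : Fin n → V} (hE : IsFrame g E)
    (he : ∀ i j, g (e i) (e j) = if i = j then 1 else 0) {F G : V → V → V → ℝ} (hF : IsTrilinear F)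
    (hG : IsTrilinear G) : ∑ i, ∑ j, ∑ k, F (e i) (e j) (e k) * G (e i) (e j) (e k)
      = ∑ i, ∑ j, ∑ k, F (E i) (E j) (E k) * G (E i) (E j) (E k) := by
  have s1 : ∀ a b, ∑ k, F a b (e k) * G a b (e k) = ∑ k, F a b (E k) * G a b (E k) := fun a b =>
    hE.sum_eq hg he (B := fun v w => F a b v * G a b w)
      ⟨fun x y z => by rw [hF.add₃]; ring, fun t x z => by rw [hF.smul₃]; ring,
        fun x y z => by rw [hG.add₃]; ring, fun t x z => by rw [hG.smul₃]; ring⟩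
  simp only [s1]
  have s2 : ∀ a, ∑ j, ∑ k, F a (e j) (E k) * G a (e j) (E k)
      = ∑ j, ∑ k, F a (E j) (E k) * G a (E j) (E k) := fun a =>
    hE.sum_eq hg he (B := fun v w => ∑ k, F a v (E k) * G a w (E k))
      ⟨fun x y z => by simp only [hF.add₂, add_mul, Finset.sum_add_distrib],
        fun t x z => by simp only [hF.smul₂, Finset.mul_sum, mul_assoc],
        fun x y z => by simp only [hG.add₂, mul_add, Finset.sum_add_distrib],
        fun t x z => by simp only [hG.smul₂, Finset.mul_sum, mul_left_comm]⟩
  simp only [s2]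
  exact hE.sum_eq hg he (B := fun v w => ∑ j, ∑ k, F v (E j) (E k) * G w (E j) (E k))
      ⟨fun x y z => by simp only [hF.add₁, add_mul, Finset.sum_add_distrib],
        fun t x z => by simp only [hF.smul₁, Finset.mul_sum, mul_assoc],
        fun x y z => by simp only [hG.add₁, mul_add, Finset.sum_add_distrib],
        fun t x z => by simp only [hG.smul₁, Finset.mul_sum, mul_left_comm]⟩

end Multilinear

end ConeSoliton

/-! ### Alternating functions, and wedge products with a `1`-form. -/

namespace ConeSoliton

section Alternating

variable {V : Type*}

/-- Functions of several vectors that change by the sign under permutations. -/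
def IsAlternating {k : ℕ} (A : (Fin k → V) → ℝ) : Prop :=
  ∀ (v : Fin k → V) (σ : Equiv.Perm (Fin k)),
    A (fun i => v (σ i)) = ((Equiv.Perm.sign σ : ℤ) : ℝ) * A v

lemma isAlternating_wedge {k l : ℕ} (α : (Fin k → V) → ℝ) (β : (Fin l → V) → ℝ) :
    IsAlternating (wedge α β) := fun v σ => wedge_perm α β v σ

namespace IsAlternating

variable {k : ℕ} {A B : (Fin k → V) → ℝ}

lemma const_mul (hA : IsAlternating A) (c : ℝ) : IsAlternating (fun v => c * A v) :=
  fun v σ => by simp only [hA v σ]; ring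

lemma sub (hA : IsAlternating A) (hB : IsAlternating B) : IsAlternating (fun v => A v - B v) :=
  fun v σ => by simp only [hA v σ, hB v σ]; ring

lemma comp {W : Type*} {A : (Fin k → W) → ℝ} (hA : IsAlternating A) (L : V → W) :
    IsAlternating (fun v : Fin k → V => A (fun i => L (v i))) := fun v σ => hA (fun i => L (v i)) σ

lemma sum {ι : Type*} (s : Finset ι) {C : ι → (Fin k → V) → ℝ} (hC : ∀ i, IsAlternating (C i)) :
    IsAlternating (fun v => ∑ i ∈ s, C i v) := fun v σ => by
  simp only [hC _ v σ, Finset.mul_sum]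

lemma cons {A : (Fin (k + 1) → V) → ℝ} (hA : IsAlternating A) (a : V) :
    IsAlternating (fun v => A (Fin.cons a v)) := by
  intro v σ
  have h1 := hA (Fin.cons a v) (Equiv.Perm.decomposeFin.symm (0, σ))
  rw [Equiv.Perm.decomposeFin.symm_sign, if_pos rfl, one_mul] at h1
  rw [← h1]
  refine congrArg A ?_
  funext i
  refine Fin.cases ?_ (fun i => ?_) i
  · simp
  · simp

lemma eq_zero (hA : IsAlternating A) {v : Fin k → V} (hv : ¬ Function.Injective v) : A v = 0 := by
  obtain ⟨i, j, hij, hne⟩ : ∃ i j, v i = v j ∧ i ≠ j := by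
    simpa [Function.Injective] using hv
  have h1 := hA v (Equiv.swap i j)
  have h2 : (fun l => v (Equiv.swap i j l)) = v := by
    funext l
    rw [Equiv.swap_apply_def]
    split_ifs with h3 h4
    · rw [h3, hij]
    · rw [h4, hij]
    · rfl
  rw [h2, Equiv.Perm.sign_swap hne] at h1
  simp at h1
  linarith

/-- Alternating functions are determined by their values on strictly increasing families. -/
lemma ext_strictMono {ι : Type*} [LinearOrder ι] {E : ι → V} (hA : IsAlternating A)
    (hB : IsAlternating B) (h : ∀ f : Fin k → ι, StrictMono f → A (fun i => E (f i)) = B (fun i => E (f i)))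
    (f : Fin k → ι) : A (fun i => E (f i)) = B (fun i => E (f i)) := by
  have hA' : IsAlternating (fun f : Fin k → ι => A (fun i => E (f i))) := hA.comp E
  have hB' : IsAlternating (fun f : Fin k → ι => B (fun i => E (f i))) := hB.comp E
  by_cases hf : Function.Injective f
  · have h1 := hA' f (Tuple.sort f)
    have h2 := hB' f (Tuple.sort f)
    have h3 : StrictMono (fun i => f (Tuple.sort f i)) :=
      (Tuple.monotone_sort f).strictMono_of_injective (hf.comp (Tuple.sort f).injective)
    have h4 := h _ h3
    simp only at h1 h2
    rw [h1, h2] at h4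
    exact mul_left_cancel₀ (by simp) h4
  · exact (hA'.eq_zero hf).trans (hB'.eq_zero hf).symm

end IsAlternating

lemma altSum_const_mul {A R : Type*} [CommRing R] (n : ℕ) (c : R) (F : (Fin n → A) → R) (v : Fin n → A) :
    altSum n (fun w => c * F w) v = c * altSum n F v := by
  rw [← sum_perm_eq_altSum, ← sum_perm_eq_altSum, Finset.mul_sum]
  exact Finset.sum_congr rfl fun σ _ => by ring

lemma IsAlternating.altSum {n : ℕ} {F : (Fin n → V) → ℝ} (hF : IsAlternating F) (v : Fin n → V) :
    altSum n F v = n.factorial * F v := by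
  rw [← sum_perm_eq_altSum]
  have : ∀ σ : Equiv.Perm (Fin n), ((Equiv.Perm.sign σ : ℤ) : ℝ) * F (fun i => v (σ i)) = F v := by
    intro σ
    rw [hF v σ, ← mul_assoc, ← Int.cast_mul, ← Units.val_mul, Int.units_mul_self]
    simp
  simp [this, Fintype.card_perm]

/-- Only the choice of the argument of `α` matters: the arrangements of the remaining arguments give
equal contributions, counted by `n!`. -/
lemma altSum_mul {n : ℕ} (α : V → ℝ) {β : (Fin n → V) → ℝ} (hβ : IsAlternating β) (v : Fin (n + 1) → V) :
    altSum (n + 1) (fun w => α (w 0) * β (Fin.tail w)) v = n.factorial *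
      ∑ p, (if p = 0 then 1 else -1) * (α (v p) * β (fun i => v (Equiv.swap 0 p i.succ))) := by
  rw [altSum, Finset.mul_sum]
  refine Finset.sum_congr rfl fun p _ => ?_
  simp only [Fin.cons_zero, Fin.tail_cons]
  rw [altSum_const_mul, hβ.altSum]
  ring

lemma wedge_one_two (α : V → ℝ) {β : (Fin 2 → V) → ℝ} (hβ : IsAlternating β) (a b c : V) :
    wedge (k := 1) (l := 2) (fun v => α (v 0)) β ![a, b, c]
      = α a * β ![b, c] + α b * β ![c, a] + α c * β ![a, b] := by
  have h1 := altSum_mul α hβ ![a, b, c]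
  rw [Fin.sum_univ_three, if_pos rfl, if_neg (by decide), if_neg (by decide)] at h1
  have s0 : (fun i : Fin 2 => (![a, b, c] : Fin 3 → V) (Equiv.swap 0 0 i.succ)) = ![b, c] := by
    funext i; fin_cases i <;> rfl
  have s1 : (fun i : Fin 2 => (![a, b, c] : Fin 3 → V) (Equiv.swap 0 1 i.succ)) = ![a, c] := by
    funext i; fin_cases i <;> rfl
  have s2 : (fun i : Fin 2 => (![a, b, c] : Fin 3 → V) (Equiv.swap 0 2 i.succ)) = ![b, a] := by
    funext i; fin_cases i <;> rfl
  have t : ∀ x y : V, β ![y, x] = -β ![x, y] := fun x y => by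
    have := hβ ![x, y] (Equiv.swap 0 1)
    rw [Equiv.Perm.sign_swap (by decide)] at this
    have h2 : (fun i => (![x, y] : Fin 2 → V) (Equiv.swap 0 1 i)) = ![y, x] := by
      funext i; fin_cases i <;> rfl
    rw [h2] at this
    simpa using this
  rw [s0, s1, s2, t c a, t a b] at h1
  have h0 : (fun w : Fin 3 → V => α (w (Fin.castAdd 2 0)) * β (fun j => w (Fin.natAdd 1 j)))
      = fun w : Fin 3 → V => α (w 0) * β (Fin.tail w) := by
    funext w
    refine congrArg₂ _ rfl (congrArg β ?_)
    funext j; fin_cases j <;> rfl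
  rw [← h0] at h1
  rw [wedge_eq_altSum]
  refine (congrArg (fun t : ℝ => (((Nat.factorial 1 : ℕ) : ℝ) * ((Nat.factorial 2 : ℕ) : ℝ))⁻¹ * t) h1).trans ?_
  simp [Nat.factorial]

lemma IsAlternating.swap₀ {β : (Fin 3 → V) → ℝ} (hβ : IsAlternating β) (x y z : V) :
    β ![y, x, z] = -β ![x, y, z] := by
  have := hβ ![x, y, z] (Equiv.swap 0 1)
  rw [Equiv.Perm.sign_swap (by decide)] at this
  have h2 : (fun i => (![x, y, z] : Fin 3 → V) (Equiv.swap 0 1 i)) = ![y, x, z] := by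
    funext i; fin_cases i <;> rfl
  rw [h2] at this
  simpa using this

lemma IsAlternating.swap₁ {β : (Fin 3 → V) → ℝ} (hβ : IsAlternating β) (x y z : V) :
    β ![x, z, y] = -β ![x, y, z] := by
  have := hβ ![x, y, z] (Equiv.swap 1 2)
  rw [Equiv.Perm.sign_swap (by decide)] at this
  have h2 : (fun i => (![x, y, z] : Fin 3 → V) (Equiv.swap 1 2 i)) = ![x, z, y] := by
    funext i; fin_cases i <;> rfl
  rw [h2] at this
  simpa using this

lemma wedge_one_three (α : V → ℝ) {β : (Fin 3 → V) → ℝ} (hβ : IsAlternating β) (a b c d : V) :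
    wedge (k := 1) (l := 3) (fun v => α (v 0)) β ![a, b, c, d]
      = α a * β ![b, c, d] - α b * β ![a, c, d] + α c * β ![a, b, d] - α d * β ![a, b, c] := by
  have h1 := altSum_mul α hβ ![a, b, c, d]
  rw [Fin.sum_univ_four, if_pos rfl, if_neg (by decide), if_neg (by decide), if_neg (by decide)] at h1
  have s0 : (fun i : Fin 3 => (![a, b, c, d] : Fin 4 → V) (Equiv.swap 0 0 i.succ)) = ![b, c, d] := by
    funext i; fin_cases i <;> rfl
  have s1 : (fun i : Fin 3 => (![a, b, c, d] : Fin 4 → V) (Equiv.swap 0 1 i.succ)) = ![a, c, d] := by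
    funext i; fin_cases i <;> rfl
  have s2 : (fun i : Fin 3 => (![a, b, c, d] : Fin 4 → V) (Equiv.swap 0 2 i.succ)) = ![b, a, d] := by
    funext i; fin_cases i <;> rfl
  have s3 : (fun i : Fin 3 => (![a, b, c, d] : Fin 4 → V) (Equiv.swap 0 3 i.succ)) = ![b, c, a] := by
    funext i; fin_cases i <;> rfl
  rw [s0, s1, s2, s3, hβ.swap₀ a b d, hβ.swap₁ b a c, hβ.swap₀ a b c] at h1
  have h0 : (fun w : Fin 4 → V => α (w (Fin.castAdd 3 0)) * β (fun j => w (Fin.natAdd 1 j)))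
      = fun w : Fin 4 → V => α (w 0) * β (Fin.tail w) := by
    funext w
    refine congrArg₂ _ rfl (congrArg β ?_)
    funext j; fin_cases j <;> rfl
  rw [← h0] at h1
  rw [wedge_eq_altSum]
  refine (congrArg (fun t : ℝ => (((Nat.factorial 1 : ℕ) : ℝ) * ((Nat.factorial 3 : ℕ) : ℝ))⁻¹ * t) h1).trans ?_
  simp [Nat.factorial]
  ring

/-- The value of `α ∧ β` on a family all of whose members but the first are annihilated by `α`. -/
lemma wedge_one_six (α : V → ℝ) {β : (Fin 6 → V) → ℝ} (hβ : IsAlternating β) (E : Fin 7 → V)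
    (hE : ∀ i : Fin 6, α (E i.succ) = 0) :
    wedge (k := 1) (l := 6) (fun v => α (v 0)) β E = α (E 0) * β (fun i => E i.succ) := by
  have h1 := altSum_mul α hβ E
  rw [Fin.sum_univ_succ, if_pos rfl] at h1
  simp only [hE, zero_mul, mul_zero, Finset.sum_const_zero, add_zero, one_mul, Equiv.swap_self,
    Equiv.refl_apply] at h1
  have h0 : (fun w : Fin 7 → V => α (w (Fin.castAdd 6 0)) * β (fun j => w (Fin.natAdd 1 j)))
      = fun w : Fin 7 → V => α (w 0) * β (Fin.tail w) := by
    funext w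
    refine congrArg₂ _ rfl (congrArg β ?_)
    funext j; fin_cases j <;> rfl
  rw [← h0] at h1
  rw [wedge_eq_altSum]
  refine (congrArg (fun t : ℝ => (((Nat.factorial 1 : ℕ) : ℝ) * ((Nat.factorial 6 : ℕ) : ℝ))⁻¹ * t) h1).trans ?_
  norm_num [Nat.factorial]
  ring

end Alternating

end ConeSoliton

namespace ConeSoliton

/-! ### The standard `G₂`-structure in an adapted frame -/

/-- The components of the `3`-form of a `G₂`-structure in an adapted frame. -/
def phiTable : ℕ → ℕ → ℕ → ℤ
  | 0, b + 1, c + 1 => -kTable b c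
  | a + 1, 0, c + 1 => -kTable c a
  | a + 1, b + 1, 0 => -kTable a b
  | a + 1, b + 1, c + 1 => reTable a b c
  | _, _, _ => 0

/-- The components of the `4`-form of a `G₂`-structure in an adapted frame. -/
def psiTable : ℕ → ℕ → ℕ → ℕ → ℤ
  | 0, b + 1, c + 1, d + 1 => -imTable b c d
  | a + 1, 0, c + 1, d + 1 => imTable a c d
  | a + 1, b + 1, 0, d + 1 => -imTable a b d
  | a + 1, b + 1, c + 1, 0 => imTable a b c
  | a + 1, b + 1, c + 1, d + 1 =>
    -(kTable a b * kTable c d - kTable a c * kTable b d + kTable a d * kTable b c)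
  | _, _, _, _ => 0

/-- The Vandermonde determinant of seven integers. -/
def vandermonde (i j k l m n o : ℤ) : ℤ :=
  ((j - i) * (k - i) * (k - j)) * ((l - i) * (m - i) * (n - i) * (o - i)) *
    ((l - j) * (m - j) * (n - j) * (o - j)) * ((l - k) * (m - k) * (n - k) * (o - k)) *
    ((m - l) * (n - l) * (o - l) * (n - m) * (o - m) * (o - n))

lemma vandermonde_eq_det (f : Fin 7 → ℤ) :
    (Matrix.vandermonde f).det = vandermonde (f 0) (f 1) (f 2) (f 3) (f 4) (f 5) (f 6) := by
  rw [Matrix.det_vandermonde, vandermonde]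
  have h : ∀ i : Fin 7, ∏ j ∈ Finset.Ioi i, (f j - f i)
      = ∏ j : Fin 7, if i < j then f j - f i else 1 := fun i => by
    rw [← Finset.prod_filter]
    congr 1
    ext j
    simp
  simp only [h, Fin.prod_univ_seven]
  simp [Fin.lt_def]
  ac_rfl

/-- On seven indices the Vandermonde product is the Levi-Civita symbol times `1! 2! 3! 4! 5! 6! =
24883200`. The identity is thus `ψ = ⋆φ` in components, in a form that is cheap to compute. -/
lemma sum_phiTable_mul_vandermonde : ∀ l m n o : Fin 7, l < m → m < n → n < o →
    ∑ i : Fin 7, ∑ j : Fin 7, ∑ k : Fin 7, phiTable i j k *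
      vandermonde i.val j.val k.val l.val m.val n.val o.val = 6 * 24883200 * psiTable l m n o := by
  decide +kernel

/-- This contraction is why the torsion is recovered from `∇φ` with the factor `1/24`. -/
lemma sum_psiTable_mul_psiTable : ∀ m q : Fin 7, ∑ i : Fin 7, ∑ j : Fin 7, ∑ k : Fin 7,
    psiTable m i j k * psiTable q i j k = if m = q then 24 else 0 := by
  decide +kernel

/-- The derivative of the `3`-form when the complex volume form is rotated. -/
def derivTable₁ : ℕ → ℕ → ℕ → ℤ
  | a + 1, b + 1, c + 1 => -imTable a b c
  | _, _, _ => 0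

lemma derivTable₁_eq : ∀ i j k : Fin 7, derivTable₁ i j k = psiTable 0 i j k := by
  decide +kernel

/-- The Kronecker delta. -/
def kDelta (a b : ℕ) : ℤ := bif Nat.beq a b then 1 else 0

/-- The derivative of the `3`-form in the direction of `N`, first term. -/
def derivTable₂ (u : ℕ) : ℕ → ℕ → ℕ → ℤ
  | 0, b + 1, c + 1 => reTable u b c
  | a + 1, 0, c + 1 => reTable u c a
  | a + 1, b + 1, 0 => reTable u a b
  | a + 1, b + 1, c + 1 => kDelta u a * kTable b c + kDelta u b * kTable c a + kDelta u c * kTable a b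
  | _, _, _ => 0

/-- The components of `∇_u φ` have the form `T_uq ψ_q`; here the coefficient is `ω`, whereas
`derivTable₃_eq` contributes the metric of the link. -/
lemma derivTable₂_eq : ∀ u : Fin 6, ∀ i j k : Fin 7, derivTable₂ u i j k
    = ∑ v : Fin 6, kTable u v * psiTable (v.val + 1) i j k := by
  decide +kernel

/-- The derivative of the `3`-form in the direction of `N`, second term. -/
def derivTable₃ (u : ℕ) : ℕ → ℕ → ℕ → ℤ
  | 0, b + 1, c + 1 => imTable u b c
  | a + 1, 0, c + 1 => imTable u c a
  | a + 1, b + 1, 0 => imTable u a b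
  | a + 1, b + 1, c + 1 => -(kTable u a * kTable b c + kTable u b * kTable c a + kTable u c * kTable a b)
  | _, _, _ => 0

lemma derivTable₃_eq : ∀ u : Fin 6, ∀ i j k : Fin 7, derivTable₃ u i j k
    = psiTable (u.val + 1) i j k := by
  decide +kernel

end ConeSoliton

/-! ### The Hodge dual in an adapted frame. -/

namespace ConeSoliton

section Frame

variable {V : Type*} [AddCommGroup V] [Module ℝ V]

lemma IsMultilinear.ext_frame {g : V → V → ℝ} {n k : ℕ} {E : Fin n → V} (hE : IsFrame g E)
    {A B : (Fin k → V) → ℝ} (hA : IsMultilinear A) (hB : IsMultilinear B)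
    (h : ∀ f : Fin k → Fin n, A (fun i => E (f i)) = B (fun i => E (f i))) : A = B := by
  obtain ⟨m, hm⟩ := hA
  obtain ⟨m', hm'⟩ := hB
  funext v
  have hv : v = fun i => ∑ j, g (E j) (v i) • E j := funext fun i => hE.expand (v i)
  rw [← hm, ← hm', hv, MultilinearMap.map_sum, MultilinearMap.map_sum]
  refine Finset.sum_congr rfl fun f _ => ?_
  rw [MultilinearMap.map_smul_univ m (fun i => g (E (f i)) (v i)) (fun i => E (f i)),
    MultilinearMap.map_smul_univ m' (fun i => g (E (f i)) (v i)) (fun i => E (f i)), hm, hm', h]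

lemma IsMultilinear.cons {k : ℕ} {A : (Fin (k + 1) → V) → ℝ} (hA : IsMultilinear A) (a : V) :
    IsMultilinear (fun v => A (Fin.cons a v)) := by
  obtain ⟨m, hm⟩ := hA
  exact ⟨m.curryLeft a, fun v => hm _⟩

omit [AddCommGroup V] [Module ℝ V] in
/-- The components of a volume form in a frame. -/
lemma vandermonde_of_alternating {E : Fin 7 → V} {A : (Fin 7 → V) → ℝ} (hA : IsAlternating A)
    (hE : A E = 1) (f : Fin 7 → Fin 7) : 24883200 * A (fun i => E (f i)) =
      (vandermonde (f 0).val (f 1).val (f 2).val (f 3).val (f 4).val (f 5).val (f 6).val : ℤ) := by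
  have hB : IsAlternating (fun f : Fin 7 → Fin 7 =>
      (((Matrix.vandermonde fun i => ((f i).val : ℤ)).det : ℤ) : ℝ)) := by
    intro v σ
    have : (Matrix.vandermonde fun i => ((v (σ i)).val : ℤ))
        = (Matrix.vandermonde fun i => ((v i).val : ℤ)).submatrix σ id := rfl
    dsimp only
    rw [this, Matrix.det_permute, Int.cast_mul]
    simp
  have := IsAlternating.ext_strictMono (E := fun i : Fin 7 => i)
    ((hA.comp E).const_mul 24883200) hB (fun f hf => ?_) f
  · rw [vandermonde_eq_det] at this
    exact this
  · obtain rfl : f = id := hf.eq_id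
    dsimp only [id]
    rw [hE, vandermonde_eq_det]
    norm_num [vandermonde]

lemma isTrilinear_of_isMultilinear {A : (Fin 3 → V) → ℝ} (hA : IsMultilinear A) :
    IsTrilinear fun a b c => A ![a, b, c] := hA.isTrilinear ![]

lemma isTrilinear_of_isMultilinear' {A : (Fin 7 → V) → ℝ} (hA : IsMultilinear A) (w : Fin 4 → V) :
    IsTrilinear fun a b c => A ![a, b, c, w 0, w 1, w 2, w 3] := by
  have := hA.isTrilinear (n := 4) w
  have hw : ∀ a b c, (Fin.cons a (Fin.cons b (Fin.cons c w)) : Fin 7 → V)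
      = ![a, b, c, w 0, w 1, w 2, w 3] := by
    intro a b c; funext i; fin_cases i <;> rfl
  simpa only [hw] using this

/-- The Hodge dual of a form with the components of a `G₂`-structure. -/
theorem hodge_of_frame {g : V → V → ℝ} (hg : IsBilinear g) {E e : Fin 7 → V} (hE : IsFrame g E)
    (he : ∀ i j, g (e i) (e j) = if i = j then 1 else 0) {A : (Fin 3 → V) → ℝ} {B : (Fin 4 → V) → ℝ}
    {vol : (Fin 7 → V) → ℝ} (hA : IsMultilinear A) (hB : IsMultilinear B) (hB' : IsAlternating B)
    (hv : IsMultilinear vol) (hv' : IsAlternating vol) (hvE : vol E = 1)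
    (hAE : ∀ i j k, A ![E i, E j, E k] = phiTable i j k)
    (hBE : ∀ i j k l, B ![E i, E j, E k, E l] = psiTable i j k l) (w : Fin 4 → V) :
    (1 / 6) * ∑ i, ∑ j, ∑ k, A ![e i, e j, e k] * vol ![e i, e j, e k, w 0, w 1, w 2, w 3] = B w := by
  have h1 : ∀ w : Fin 4 → V, ∑ i, ∑ j, ∑ k, A ![e i, e j, e k] *
      vol ![e i, e j, e k, w 0, w 1, w 2, w 3]
      = ∑ i, ∑ j, ∑ k, A ![E i, E j, E k] * vol ![E i, E j, E k, w 0, w 1, w 2, w 3] := fun w =>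
    hE.sum_mul_eq hg he (isTrilinear_of_isMultilinear hA) (isTrilinear_of_isMultilinear' hv w)
  simp only [h1]
  have hc : ∀ (a b c : V) (w : Fin 4 → V), (Fin.cons a (Fin.cons b (Fin.cons c w)) : Fin 7 → V)
      = ![a, b, c, w 0, w 1, w 2, w 3] := by
    intro a b c w; funext i; fin_cases i <;> rfl
  have m : IsMultilinear fun w : Fin 4 → V => (1 / 6 : ℝ) * ∑ i, ∑ j, ∑ k, A ![E i, E j, E k] *
      vol ![E i, E j, E k, w 0, w 1, w 2, w 3] := by
    refine IsMultilinear.const_mul (.sum _ fun i _ => .sum _ fun j _ => .sum _ fun k _ =>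
      .const_mul ?_ _) _
    simp only [← hc]
    exact ((hv.cons _).cons _).cons _
  have al : IsAlternating fun w : Fin 4 → V => (1 / 6 : ℝ) * ∑ i, ∑ j, ∑ k, A ![E i, E j, E k] *
      vol ![E i, E j, E k, w 0, w 1, w 2, w 3] := by
    refine IsAlternating.const_mul (.sum _ fun i => .sum _ fun j => .sum _ fun k =>
      .const_mul ?_ _) _
    simp only [← hc]
    exact ((hv'.cons _).cons _).cons _
  -- Both sides are multilinear and alternating, so increasing quadruples of frame vectors suffice.
  refine congrFun (m.ext_frame hE hB (IsAlternating.ext_strictMono al hB' fun f hf => ?_)) w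
  have hv2 : ∀ i j k : Fin 7, vol ![E i, E j, E k, E (f 0), E (f 1), E (f 2), E (f 3)] =
      (vandermonde i.val j.val k.val (f 0).val (f 1).val (f 2).val (f 3).val : ℤ) / 24883200 := by
    intro i j k
    rw [eq_div_iff (by norm_num), mul_comm]
    have h3 := vandermonde_of_alternating hv' hvE ![i, j, k, f 0, f 1, f 2, f 3]
    have h4 : (fun l => E ((![i, j, k, f 0, f 1, f 2, f 3] : Fin 7 → Fin 7) l))
        = ![E i, E j, E k, E (f 0), E (f 1), E (f 2), E (f 3)] := by
      funext l; fin_cases l <;> rfl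
    rw [h4] at h3
    exact h3
  have h5 : (fun i => E (f i)) = ![E (f 0), E (f 1), E (f 2), E (f 3)] := by
    funext l; fin_cases l <;> rfl
  have h6 := sum_phiTable_mul_vandermonde (f 0) (f 1) (f 2) (f 3) (hf (by decide)) (hf (by decide))
    (hf (by decide))
  have h7 := congrArg (Int.cast : ℤ → ℝ) h6
  push_cast at h7
  simp only [hAE, hv2, h5, hBE, ← mul_div_assoc, ← Finset.sum_div]
  rw [h7]
  ring

end Frame

end ConeSoliton

namespace ConeSoliton

lemma IsMultilinear.isAlternating {V : Type*} [AddCommGroup V] [Module ℝ V] {k : ℕ}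
    {A : (Fin k → V) → ℝ} (hA : IsMultilinear A)
    (h : ∀ v i j, v i = v j → i ≠ j → A v = 0) : IsAlternating A := by
  obtain ⟨m, hm⟩ := hA
  intro v σ
  let a : V [⋀^Fin k]→ₗ[ℝ] ℝ := { m with
    map_eq_zero_of_eq' := fun v i j hv hij => (hm v).trans (h v i j hv hij) }
  have h1 := a.map_perm v σ
  have h2 : ∀ v, a v = A v := hm
  rw [h2, h2] at h1
  refine h1.trans ?_
  rw [Units.smul_def, zsmul_eq_mul]

namespace HermitianData

variable {V : Type*} [AddCommGroup V] [Module ℝ V] (D : HermitianData V)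

/-! ### The algebra of the cone over a `6`-dimensional space, at radius `r` -/

/-- The Kähler form as an alternating function. -/
def kform (w : Fin 2 → V) : ℝ := D.om (w 0) (w 1)

/-- The real part of a multiple of the complex volume form. -/
def reForm (c : ℂ) (w : Fin 3 → V) : ℝ := (c * D.O (w 0) (w 1) (w 2)).re

lemma isMultilinear_kform : IsMultilinear D.kform := by
  refine ⟨⟨D.kform, fun {inst} m i x y => ?_, fun {inst} m i c x => ?_⟩, fun v => rfl⟩ <;>
    obtain rfl := Subsingleton.elim inst (instDecidableEqFin 2) <;> fin_cases i <;>
    simp [kform, om_add, om_smul, om_add_right, om_smul_right]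

lemma isMultilinear_reForm (c : ℂ) : IsMultilinear (D.reForm c) := by
  refine ⟨⟨D.reForm c, fun {inst} m i x y => ?_, fun {inst} m i t x => ?_⟩, fun v => rfl⟩ <;>
    obtain rfl := Subsingleton.elim inst (instDecidableEqFin 3) <;> fin_cases i <;>
    simp [reForm, D.O_add, D.O_smul, D.O_add₂, D.O_smul₂, D.O_add₃, D.O_smul₃, -Complex.mul_re,
      mul_add] <;> simp <;> ring

lemma om_zero (v : V) : D.om 0 v = 0 := by simpa using D.om_smul 0 0 v

lemma om_zero_right (v : V) : D.om v 0 = 0 := by simpa using D.om_smul_right 0 v 0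

lemma isAlternating_kform : IsAlternating D.kform :=
  D.isMultilinear_kform.isAlternating fun v i j h hne => by
    have h1 : ∀ u, D.om u u = 0 := fun u => self_eq_neg.1 (D.om_swap u u)
    fin_cases i <;> fin_cases j <;> simp_all [kform]

lemma isAlternating_reForm (c : ℂ) : IsAlternating (D.reForm c) :=
  (D.isMultilinear_reForm c).isAlternating fun v i j h hne => by
    fin_cases i <;> fin_cases j <;>
      simp_all [reForm, -Complex.mul_re, D.O_self, D.O_self', D.O_self'']

/-- The cone metric. -/
noncomputable def coneG (r : ℝ) (u v : ℝ × V) : ℝ := u.1 * v.1 + r ^ 2 * D.g u.2 v.2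

/-- The `3`-form of the `G₂`-structure of the cone, with complex volume form `c O`. -/
noncomputable def cone₃ (r : ℝ) (c : ℂ) (w : Fin 3 → ℝ × V) : ℝ :=
  r ^ 3 * D.reForm c (fun i => (w i).2)
    - r ^ 2 * wedge (k := 1) (l := 2) (fun v => (v 0).1) (fun v => D.kform (fun i => (v i).2)) w

/-- The dual `4`-form. -/
noncomputable def cone₄ (r : ℝ) (c : ℂ) (w : Fin 4 → ℝ × V) : ℝ :=
  r ^ 3 * wedge (k := 1) (l := 3) (fun v => (v 0).1)
      (fun v => D.reForm (Complex.I * c) (fun i => (v i).2)) w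
    - r ^ 4 * ((1 / 2) * wedge D.kform D.kform (fun i => (w i).2))

/-- The volume form. -/
noncomputable def cone₇ (r : ℝ) (w : Fin 7 → ℝ × V) : ℝ :=
  r ^ 6 * wedge (k := 1) (l := 6) (fun v => (v 0).1)
    (fun v => (1 / 6) * wedge (wedge D.kform D.kform) D.kform (fun i => (v i).2)) w

/-- The frame of the cone given by a frame of the link. -/
noncomputable def coneFrame (r : ℝ) (b : Fin 6 → V) : Fin 7 → ℝ × V := Fin.cons (1, 0) fun i => (0, r⁻¹ • b i)

variable {D} {r : ℝ} {c : ℂ}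

lemma isBilinear_coneG : IsBilinear (D.coneG r) := by
  constructor <;> intros <;> simp [coneG, D.g_add, D.g_smul, D.g_add', D.g_smul'] <;> ring

lemma isMultilinear_cone₃ : IsMultilinear (D.cone₃ r c) :=
  .sub (.const_mul ((D.isMultilinear_reForm c).comp (LinearMap.snd ℝ ℝ V)) _)
    (.const_mul (.wedge (.of_linear (LinearMap.fst ℝ ℝ V))
      (D.isMultilinear_kform.comp (LinearMap.snd ℝ ℝ V))) _)

lemma isMultilinear_cone₄ : IsMultilinear (D.cone₄ r c) :=
  .sub (.const_mul (.wedge (.of_linear (LinearMap.fst ℝ ℝ V))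
      ((D.isMultilinear_reForm _).comp (LinearMap.snd ℝ ℝ V))) _)
    (.const_mul (.const_mul ((D.isMultilinear_kform.wedge D.isMultilinear_kform).comp
      (LinearMap.snd ℝ ℝ V)) _) _)

lemma isMultilinear_cone₇ : IsMultilinear (D.cone₇ r) :=
  .const_mul (.wedge (.of_linear (LinearMap.fst ℝ ℝ V))
    (.const_mul (((D.isMultilinear_kform.wedge D.isMultilinear_kform).wedge
      D.isMultilinear_kform).comp (LinearMap.snd ℝ ℝ V)) _)) _

lemma isAlternating_cone₃ : IsAlternating (D.cone₃ r c) :=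
  .sub (.const_mul ((D.isAlternating_reForm c).comp Prod.snd) _)
    (.const_mul (isAlternating_wedge (k := 1) (l := 2) _ _) _)

lemma isAlternating_cone₄ : IsAlternating (D.cone₄ r c) :=
  .sub (.const_mul (isAlternating_wedge (k := 1) (l := 3) _ _) _)
    (.const_mul (.const_mul ((isAlternating_wedge (k := 2) (l := 2) _ _).comp Prod.snd) _) _)

lemma isAlternating_cone₇ : IsAlternating (D.cone₇ r) :=
  .const_mul (isAlternating_wedge (k := 1) (l := 6) _ _) _

lemma cone₃_apply (u v w : ℝ × V) : D.cone₃ r c ![u, v, w] = r ^ 3 * (c * D.O u.2 v.2 w.2).re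
    - r ^ 2 * (u.1 * D.om v.2 w.2 + v.1 * D.om w.2 u.2 + w.1 * D.om u.2 v.2) := by
  unfold cone₃
  rw [wedge_one_two _ (D.isAlternating_kform.comp Prod.snd)]
  rfl

lemma cone₄_apply (u v w x : ℝ × V) : D.cone₄ r c ![u, v, w, x] =
    r ^ 3 * (u.1 * (Complex.I * c * D.O v.2 w.2 x.2).re - v.1 * (Complex.I * c * D.O u.2 w.2 x.2).re
      + w.1 * (Complex.I * c * D.O u.2 v.2 x.2).re - x.1 * (Complex.I * c * D.O u.2 v.2 w.2).re)
    - r ^ 4 * (D.om u.2 v.2 * D.om w.2 x.2 - D.om u.2 w.2 * D.om v.2 x.2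
      + D.om u.2 x.2 * D.om v.2 w.2) := by
  unfold cone₄
  rw [wedge_one_three _ ((D.isAlternating_reForm _).comp Prod.snd)]
  have h : (fun i : Fin 4 => ((![u, v, w, x] : Fin 4 → ℝ × V) i).2) = ![u.2, v.2, w.2, x.2] := by
    funext i; fin_cases i <;> rfl
  rw [h, wedge_two_two _ (fun u v => D.om_swap u v)]
  simp only [kform, reForm]
  simp

section Frame

variable {b : Fin 6 → V} (hb : D.IsAdaptedBasis c b) (hr : r ≠ 0)

include hb hr

lemma isFrame_coneFrame : IsFrame (D.coneG r) (coneFrame r b) := by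
  constructor
  · intro i j
    refine Fin.cases ?_ (fun i => ?_) i <;> refine Fin.cases ?_ (fun j => ?_) j
    · simp [coneFrame, coneG, D.g_zero]
    · simp [coneFrame, coneG, D.g_zero, (Fin.succ_ne_zero j).symm]
    · simp [coneFrame, coneG, D.g_zero', (Fin.succ_ne_zero i)]
    · simp only [coneFrame, Fin.cons_succ, coneG, D.g_smul, D.g_smul', hb.ortho, Fin.succ_inj]
      split_ifs <;> field_simp <;> simp
  · intro v
    rw [Fin.sum_univ_succ]
    have h1 := hb.expand v.2
    refine Prod.ext ?_ ?_
    · simp [coneFrame, coneG, D.g_zero, Prod.fst_sum]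
    · simp only [coneFrame, coneG, Fin.cons_zero, Fin.cons_succ, Prod.snd_add, Prod.smul_snd,
        smul_zero, zero_add, Prod.snd_sum, zero_mul, D.g_smul, smul_smul]
      conv_lhs => rw [h1]
      refine Finset.sum_congr rfl fun i _ => ?_
      congr 1
      field_simp

omit hr in
lemma O_coneFrame (i j k : Fin 6) : c * D.O (r⁻¹ • b i) (r⁻¹ • b j) (r⁻¹ • b k)
    = (r⁻¹ ^ 3 : ℝ) * (reTable i j k + Complex.I * imTable i j k) := by
  rw [← hb.O_eq, D.O_smul, D.O_smul₂, D.O_smul₃]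
  push_cast
  ring

omit hr in
lemma re_O_coneFrame (i j k : Fin 6) : (c * D.O (r⁻¹ • b i) (r⁻¹ • b j) (r⁻¹ • b k)).re
    = r⁻¹ ^ 3 * reTable i j k := by
  rw [O_coneFrame hb, Complex.re_ofReal_mul]
  simp

omit hr in
lemma re_I_O_coneFrame (i j k : Fin 6) :
    (Complex.I * c * D.O (r⁻¹ • b i) (r⁻¹ • b j) (r⁻¹ • b k)).re = -(r⁻¹ ^ 3 * imTable i j k) := by
  rw [mul_assoc, O_coneFrame hb, mul_left_comm, Complex.re_ofReal_mul]
  simp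

lemma cone₃_coneFrame (i j k : Fin 7) :
    D.cone₃ r c ![coneFrame r b i, coneFrame r b j, coneFrame r b k] = phiTable i j k := by
  rw [cone₃_apply]
  refine Fin.cases ?_ (fun i => ?_) i <;> refine Fin.cases ?_ (fun j => ?_) j <;>
    refine Fin.cases ?_ (fun k => ?_) k <;>
    simp only [coneFrame, Fin.cons_zero, Fin.cons_succ, D.O_zero, D.O_zero₂, D.O_zero₃, D.om_smul,
      D.om_smul_right, hb.om_eq, Fin.val_zero, Fin.val_succ, phiTable, D.om_zero, D.om_zero_right,
      re_O_coneFrame hb, mul_zero, Complex.zero_re, zero_mul, add_zero, zero_add, sub_zero, one_mul,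
      Int.cast_zero, Int.cast_neg, zero_sub] <;> field_simp

lemma cone₄_coneFrame (i j k l : Fin 7) :
    D.cone₄ r c ![coneFrame r b i, coneFrame r b j, coneFrame r b k, coneFrame r b l]
      = psiTable i j k l := by
  rw [cone₄_apply]
  refine Fin.cases ?_ (fun i => ?_) i <;> refine Fin.cases ?_ (fun j => ?_) j <;>
    refine Fin.cases ?_ (fun k => ?_) k <;> refine Fin.cases ?_ (fun l => ?_) l <;>
    simp only [coneFrame, Fin.cons_zero, Fin.cons_succ, D.O_zero, D.O_zero₂, D.O_zero₃, D.om_smul,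
      D.om_smul_right, hb.om_eq, Fin.val_zero, Fin.val_succ, psiTable, D.om_zero, D.om_zero_right,
      re_I_O_coneFrame hb, mul_zero, Complex.zero_re, zero_mul, add_zero, zero_add, sub_zero, one_mul,
      Int.cast_zero, Int.cast_neg, zero_sub, Int.cast_mul, Int.cast_add, Int.cast_sub, neg_neg] <;>
    field_simp

omit hr in
lemma cone₇_coneFrame (hr : r ≠ 0) : D.cone₇ r (coneFrame r b) = 1 := by
  unfold cone₇
  rw [wedge_one_six]
  · have h1 : IsMultilinear (wedge (wedge D.kform D.kform) D.kform) :=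
      (D.isMultilinear_kform.wedge D.isMultilinear_kform).wedge D.isMultilinear_kform
    simp only [coneFrame, Fin.cons_zero, Fin.cons_succ]
    rw [h1.smul_all, wedge_om_basis hb.om_eq (fun _ _ => rfl)]
    simp only [Nat.reduceAdd]
    field_simp
  · exact .const_mul ((isAlternating_wedge (k := 4) (l := 2) _ _).comp Prod.snd) _
  · intro i; rfl

theorem hodge_cone₃ {e : Fin 7 → ℝ × V} (he : ∀ i j, D.coneG r (e i) (e j) = if i = j then 1 else 0)
    (w : Fin 4 → ℝ × V) : (1 / 6) * ∑ i, ∑ j, ∑ k, D.cone₃ r c ![e i, e j, e k] *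
      D.cone₇ r ![e i, e j, e k, w 0, w 1, w 2, w 3] = D.cone₄ r c w :=
  hodge_of_frame isBilinear_coneG (isFrame_coneFrame hb hr) he isMultilinear_cone₃ isMultilinear_cone₄
    isAlternating_cone₄ isMultilinear_cone₇ isAlternating_cone₇ (cone₇_coneFrame hb hr)
    (cone₃_coneFrame hb hr) (cone₄_coneFrame hb hr) w

end Frame

end HermitianData

end ConeSoliton

/-! ### Algebraic form of `∇φ` on the cone, and its contraction to the torsion. -/

namespace ConeSoliton

namespace HermitianData

variable {V : Type*} [AddCommGroup V] [Module ℝ V] (D : HermitianData V)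

/-- The covariant derivative of the `3`-form of the cone over a nearly Kähler manifold, when the
phase `c` of the complex volume form varies in the radial direction with angular velocity `k`. -/
noncomputable def coneDeriv (r : ℝ) (c : ℂ) (k : ℝ) (u x y z : ℝ × V) : ℝ :=
  k * u.1 * (r ^ 3 * (Complex.I * c * D.O x.2 y.2 z.2).re)
    + r ^ 3 * (((c.re - 1) * D.g u.2 x.2 - c.im * D.om u.2 x.2) * D.om y.2 z.2
      + ((c.re - 1) * D.g u.2 y.2 - c.im * D.om u.2 y.2) * D.om z.2 x.2
      + ((c.re - 1) * D.g u.2 z.2 - c.im * D.om u.2 z.2) * D.om x.2 y.2)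
    + r ^ 2 * (x.1 * ((1 - c) * D.O u.2 y.2 z.2).re + y.1 * ((1 - c) * D.O u.2 z.2 x.2).re
      + z.1 * ((1 - c) * D.O u.2 x.2 y.2).re)

/-- The torsion of the cone. -/
noncomputable def coneTorsion (r : ℝ) (c : ℂ) (k : ℝ) (u w : ℝ × V) : ℝ :=
  k * (u.1 * w.1) + r * (c.im * D.g u.2 w.2 + (c.re - 1) * D.om u.2 w.2)

variable {D} {r : ℝ} {c : ℂ} {k : ℝ}

lemma isBilinear_coneTorsion : IsBilinear (D.coneTorsion r c k) := by
  constructor <;> intros <;>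
    simp [coneTorsion, D.g_add, D.g_smul, D.g_add', D.g_smul', om_add, om_smul, om_add_right,
      om_smul_right] <;> ring

lemma isTrilinear_coneDeriv (u : ℝ × V) : IsTrilinear (D.coneDeriv r c k u) := by
  constructor <;> intros <;>
    simp [coneDeriv, D.g_add', D.g_smul', om_add, om_smul, om_add_right,
      om_smul_right, D.O_add, D.O_smul, D.O_add₂, D.O_smul₂, D.O_add₃, D.O_smul₃] <;> ring

lemma coneDeriv_add (u u' x y z : ℝ × V) :
    D.coneDeriv r c k (u + u') x y z = D.coneDeriv r c k u x y z + D.coneDeriv r c k u' x y z := by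
  simp [coneDeriv, D.g_add, om_add, D.O_add]; ring

lemma coneDeriv_smul (t : ℝ) (u x y z : ℝ × V) :
    D.coneDeriv r c k (t • u) x y z = t * D.coneDeriv r c k u x y z := by
  simp [coneDeriv, D.g_smul, om_smul, D.O_smul]; ring

lemma cone₄_cons_add (u u' x y z : ℝ × V) : D.cone₄ r c ![u + u', x, y, z]
    = D.cone₄ r c ![u, x, y, z] + D.cone₄ r c ![u', x, y, z] := by
  simp [cone₄_apply, om_add, D.O_add]; ring

lemma cone₄_cons_smul (t : ℝ) (u x y z : ℝ × V) : D.cone₄ r c ![t • u, x, y, z]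
    = t * D.cone₄ r c ![u, x, y, z] := by
  simp [cone₄_apply, om_smul, D.O_smul]; ring

section Frame

variable {b : Fin 6 → V} (hb : D.IsAdaptedBasis c b) (hr : r ≠ 0)

include hb hr

lemma coneDeriv_coneFrame_zero (i j l : Fin 7) : D.coneDeriv r c k (coneFrame r b 0)
    (coneFrame r b i) (coneFrame r b j) (coneFrame r b l) = k * derivTable₁ i j l := by
  unfold coneDeriv
  refine Fin.cases ?_ (fun i => ?_) i <;> refine Fin.cases ?_ (fun j => ?_) j <;>
    refine Fin.cases ?_ (fun l => ?_) l <;>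
    simp only [coneFrame, Fin.cons_zero, Fin.cons_succ, D.O_zero, D.O_zero₂, D.O_zero₃,
      Fin.val_zero, Fin.val_succ, derivTable₁, D.om_zero, D.om_zero_right,
      re_I_O_coneFrame hb, mul_zero, Complex.zero_re, zero_mul, add_zero, sub_zero, mul_one,
      Int.cast_zero, Int.cast_neg, D.g_zero]
  all_goals field_simp

lemma coneDeriv_coneFrame_succ (hc : Complex.normSq c = 1) (u : Fin 6) (i j l : Fin 7) :
    D.coneDeriv r c k (coneFrame r b u.succ) (coneFrame r b i) (coneFrame r b j) (coneFrame r b l)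
      = r⁻¹ * ((c.re - 1) * derivTable₂ u i j l + c.im * derivTable₃ u i j l) := by
  have hO : ∀ i j k, ((1 - c) * D.O (r⁻¹ • b i) (r⁻¹ • b j) (r⁻¹ • b k)).re
      = r⁻¹ ^ 3 * ((c.re - 1) * reTable i j k + c.im * imTable i j k) := fun i j k => by
    have h1 : (starRingEnd ℂ) c * c = 1 := by rw [mul_comm, Complex.mul_conj, hc]; simp
    -- The basis is adapted to `c O`, not to `O`; as `|c| = 1`, the factor `1 - c` equals `(c̄ - 1)
    -- c`.
    have h2 : (1 - c) * D.O (r⁻¹ • b i) (r⁻¹ • b j) (r⁻¹ • b k) = ((starRingEnd ℂ) c - 1) *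
        (c * D.O (r⁻¹ • b i) (r⁻¹ • b j) (r⁻¹ • b k)) := by
      linear_combination -D.O (r⁻¹ • b i) (r⁻¹ • b j) (r⁻¹ • b k) * h1
    rw [h2, O_coneFrame hb, mul_left_comm, Complex.re_ofReal_mul]
    congr 1
    simp
  have hg : ∀ i j : Fin 6, D.g (b i) (b j) = kDelta i j := fun i j => by
    rw [hb.ortho]
    simp [kDelta, cond_eq_ite, Fin.ext_iff]
  unfold coneDeriv
  refine Fin.cases ?_ (fun i => ?_) i <;> refine Fin.cases ?_ (fun j => ?_) j <;>
    refine Fin.cases ?_ (fun l => ?_) l <;>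
    simp only [coneFrame, Fin.cons_zero, Fin.cons_succ, D.O_zero, D.O_zero₂, D.O_zero₃,
      Fin.val_zero, Fin.val_succ, derivTable₂, derivTable₃, D.om_zero, D.om_zero_right, D.om_smul,
      D.om_smul_right, hb.om_eq, D.g_smul, D.g_smul', hg, D.g_zero', hO, mul_zero, Complex.zero_re,
      zero_mul, add_zero, zero_add, sub_zero, one_mul,
      Int.cast_zero, Int.cast_neg, Int.cast_add, Int.cast_mul]
  all_goals field_simp
  all_goals ring

/-- In the adapted frame the three tables write `∇_m φ` as a combination of the contractions of `ψ`
with frame vectors, and `ψ_mijk ψ_qijk = 24 δ_mq` extracts the coefficients. -/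
theorem torsion_contraction (hc : Complex.normSq c = 1) {e : Fin 7 → ℝ × V}
    (he : ∀ i j, D.coneG r (e i) (e j) = if i = j then 1 else 0) (u w : ℝ × V) :
    (1 / 24) * ∑ i, ∑ j, ∑ l, D.coneDeriv r c k u (e i) (e j) (e l) *
      D.cone₄ r c ![w, e i, e j, e l] = D.coneTorsion r c k u w := by
  have h4 : ∀ w : ℝ × V, IsTrilinear fun x y z => D.cone₄ r c ![w, x, y, z] := fun w =>
    isTrilinear_of_isMultilinear (isMultilinear_cone₄.cons w)
  have hE := isFrame_coneFrame hb hr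
  rw [hE.sum_mul_eq isBilinear_coneG he (isTrilinear_coneDeriv u) (h4 w)]
  refine IsBilinear.ext_frame (B := fun u w => (1 / 24) * ∑ i, ∑ j, ∑ l,
    D.coneDeriv r c k u (coneFrame r b i) (coneFrame r b j) (coneFrame r b l) *
      D.cone₄ r c ![w, coneFrame r b i, coneFrame r b j, coneFrame r b l]) hE ?_
    isBilinear_coneTorsion (fun m q => ?_) u w
  · constructor <;> intros <;>
      simp only [coneDeriv_add, coneDeriv_smul, cone₄_cons_add, cone₄_cons_smul, add_mul, mul_add,
        Finset.sum_add_distrib, mul_assoc, mul_left_comm (coneDeriv _ _ _ _ _ _ _ _),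
        ← Finset.mul_sum]
    all_goals ring
  · have key : ∀ m q : Fin 7, ∑ i : Fin 7, ∑ j : Fin 7, ∑ l : Fin 7,
        (psiTable m i j l : ℝ) * psiTable q i j l = if m = q then 24 else 0 := fun m q => by
      exact_mod_cast sum_psiTable_mul_psiTable m q
    refine Fin.cases ?_ (fun m => ?_) m
    · simp only [coneDeriv_coneFrame_zero hb hr, cone₄_coneFrame hb hr, derivTable₁_eq, mul_assoc,
        ← Finset.mul_sum]
      have h0 := key 0 q
      simp only [Fin.val_zero] at h0
      simp only [h0]
      refine Fin.cases ?_ (fun q => ?_) q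
      · simp [coneTorsion, coneFrame, D.g_zero, D.om_zero]; ring
      · simp [coneTorsion, coneFrame, D.g_zero, D.om_zero, (Fin.succ_ne_zero q).symm]
    · simp only [coneDeriv_coneFrame_succ hb hr hc, cone₄_coneFrame hb hr, derivTable₂_eq,
        derivTable₃_eq]
      have sc : ∀ F : Fin 7 → Fin 7 → Fin 7 → Fin 6 → ℝ,
          ∑ i, ∑ j, ∑ l, ∑ v, F i j l v = ∑ v, ∑ i, ∑ j, ∑ l, F i j l v := fun F => by
        simp only [Fin.sum_univ_six, Finset.sum_add_distrib]
      have h1 : ∀ i j l : Fin 7, r⁻¹ * ((c.re - 1) * ((∑ v : Fin 6, kTable m v *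
          psiTable (v.val + 1) i j l : ℤ) : ℝ) + c.im * (psiTable (m.val + 1) i j l : ℤ)) *
          (psiTable q i j l : ℝ) = ∑ v : Fin 6, r⁻¹ * (c.re - 1) * kTable m v *
            ((psiTable v.succ i j l : ℝ) * psiTable q i j l)
            + r⁻¹ * c.im * ((psiTable m.succ i j l : ℝ) * psiTable q i j l) := fun i j l => by
        simp only [Fin.val_succ]
        push_cast
        simp only [add_mul, mul_add, Finset.mul_sum, Finset.sum_mul]
        congr 1
        · exact Finset.sum_congr rfl fun v _ => by ring
        · ring
      simp only [h1, Finset.sum_add_distrib, sc, ← Finset.mul_sum, key]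
      refine Fin.cases ?_ (fun q => ?_) q
      · simp [coneTorsion, coneFrame, D.g_zero', D.om_zero_right]
      · simp only [Fin.succ_inj, coneTorsion, coneFrame, Fin.cons_succ, D.g_smul, D.g_smul', hb.ortho,
          om_smul, om_smul_right, hb.om_eq, mul_ite, mul_zero, Finset.sum_ite_eq', Finset.mem_univ,
          if_true]
        split_ifs <;> field_simp <;> ring

end Frame

end HermitianData

end ConeSoliton

/-! ### Charts of the cone and directional derivatives. -/

namespace ConeSoliton

open Set Filter

section ConeChart

variable {N : Type*} [TopologicalSpace N] [ChartedSpace E6 N]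

lemma extChartAt_halfLine_source (t : HalfLine) : (extChartAt 𝓘(ℝ, ℝ) t).source = univ := by
  rw [extChartAt_source]
  ext x
  simp [chartAt, ChartedSpace.chartAt]

lemma extChartAt_halfLine_symm (t : HalfLine) {y : ℝ} (hy : 0 < y) :
    (extChartAt 𝓘(ℝ, ℝ) t).symm y = ⟨y, hy⟩ := by
  have := (extChartAt 𝓘(ℝ, ℝ) t).left_inv (x := ⟨y, hy⟩) (by
    rw [extChartAt_halfLine_source]; trivial)
  exact this

lemma extChartAt_cone_coe (p q : Cone N) :
    extChartAt coneModel p q = ((q.1 : ℝ), extChartAt (𝓡 6) p.2 q.2) := by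
  rw [extChartAt_prod]
  rfl

lemma extChartAt_cone_symm (p : Cone N) {y : ℝ × E6} (hy : 0 < y.1) :
    (extChartAt coneModel p).symm y = (⟨y.1, hy⟩, (extChartAt (𝓡 6) p.2).symm y.2) := by
  rw [extChartAt_prod, PartialEquiv.prod_symm]
  exact Prod.ext (extChartAt_halfLine_symm p.1 hy) rfl

lemma mem_extChartAt_cone_target (p : Cone N) {y : ℝ × E6} (hy : 0 < y.1)
    (hy2 : y.2 ∈ (extChartAt (𝓡 6) p.2).target) : y ∈ (extChartAt coneModel p).target := by
  rw [extChartAt_prod, PartialEquiv.prod_target]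
  refine ⟨?_, hy2⟩
  have h := (extChartAt 𝓘(ℝ, ℝ) p.1).map_source (x := ⟨y.1, hy⟩) (by
    rw [extChartAt_halfLine_source]; trivial)
  exact h

/-- The coordinates of a point of the cone near `p` that correspond to points of the cone. -/
lemma eventually_cone_target (p : Cone N) : ∀ᶠ y in 𝓝 (extChartAt coneModel p p),
    0 < y.1 ∧ y.2 ∈ (extChartAt (𝓡 6) p.2).target := by
  rw [extChartAt_cone_coe]
  have h1 : ∀ᶠ t in 𝓝 ((p.1 : ℝ)), 0 < t := Ioi_mem_nhds p.1.2
  have h2 : ∀ᶠ t in 𝓝 (extChartAt (𝓡 6) p.2 p.2), t ∈ (extChartAt (𝓡 6) p.2).target :=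
    extChartAt_target_mem_nhds p.2
  exact (continuousAt_fst.eventually h1).and (continuousAt_snd.eventually h2)

variable [IsManifold (𝓡 6) ∞ N]

/-- The chart of the half-line is the inclusion into `ℝ`, so the coordinate isomorphism is block
diagonal with identity radial block. -/
lemma coordVec_cone (p : Cone N) {y : ℝ × E6} (hy : 0 < y.1)
    (hy2 : y.2 ∈ (extChartAt (𝓡 6) p.2).target) (v : ℝ × E6) :
    (coordVec coneModel p y v : ℝ × E6) = (v.1, coordMap p.2 y.2 v.2) := by
  have hy' := mem_extChartAt_cone_target p hy hy2
  have h1 := congrArg (fun L : ℝ × E6 →L[ℝ] ℝ × E6 => L v) (coordVec_eq_fderiv p hy')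
  refine h1.trans ?_
  set q := (extChartAt coneModel p).symm y with hq
  have hq2 : q.2 = (extChartAt (𝓡 6) p.2).symm y.2 := by rw [hq, extChartAt_cone_symm p hy]
  have h3 : transition coneModel p q =ᶠ[𝓝 y]
      fun z => (z.1, transition (𝓡 6) p.2 q.2 z.2) := by
    filter_upwards [continuousAt_fst.eventually (Ioi_mem_nhds hy)] with z hz
    rw [transition, Function.comp, extChartAt_cone_symm p hz, extChartAt_cone_coe]
    rfl
  have h4 : DifferentiableAt ℝ (transition (𝓡 6) p.2 q.2) y.2 :=
    (contDiffAt_transition p.2 q.2 hy2 (by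
      rw [← hq2]; exact mem_extChartAt_source _)).differentiableAt (by simp)
  have h5 : HasFDerivAt (fun z : ℝ × E6 => (z.1, transition (𝓡 6) p.2 q.2 z.2))
      ((ContinuousLinearMap.fst ℝ ℝ E6).prod
        ((fderiv ℝ (transition (𝓡 6) p.2 q.2) y.2).comp (ContinuousLinearMap.snd ℝ ℝ E6))) y :=
    hasFDerivAt_fst.prodMk (h4.hasFDerivAt.comp y hasFDerivAt_snd)
  rw [h3.fderiv_eq, h5.fderiv]
  refine Prod.ext rfl ?_
  have h6 := congrArg (fun L : E6 →L[ℝ] E6 => L v.2) (coordVec_eq_fderiv p.2 hy2)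
  rw [hq2]
  exact h6.symm

/-- The derivative in the direction `u` of a differentiable function. -/
def HasDirDeriv (F : ℝ × E6 → ℝ) (x u : ℝ × E6) (d : ℝ) : Prop :=
  ∃ L : ℝ × E6 →L[ℝ] ℝ, HasFDerivAt F L x ∧ L u = d

namespace HasDirDeriv

variable {F G : ℝ × E6 → ℝ} {x u : ℝ × E6} {d e : ℝ}

lemma fderiv_eq (h : HasDirDeriv F x u d) : fderiv ℝ F x u = d := by
  obtain ⟨L, hL, rfl⟩ := h
  rw [hL.fderiv]

lemma congr (h : HasDirDeriv F x u d) (hG : G =ᶠ[𝓝 x] F) : HasDirDeriv G x u d := by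
  obtain ⟨L, hL, hd⟩ := h
  exact ⟨L, hL.congr_of_eventuallyEq hG, hd⟩

lemma add (hF : HasDirDeriv F x u d) (hG : HasDirDeriv G x u e) :
    HasDirDeriv (fun y => F y + G y) x u (d + e) := by
  obtain ⟨L, hL, rfl⟩ := hF
  obtain ⟨K, hK, rfl⟩ := hG
  exact ⟨L + K, hL.add hK, rfl⟩

lemma sub (hF : HasDirDeriv F x u d) (hG : HasDirDeriv G x u e) :
    HasDirDeriv (fun y => F y - G y) x u (d - e) := by
  obtain ⟨L, hL, rfl⟩ := hF
  obtain ⟨K, hK, rfl⟩ := hG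
  exact ⟨L - K, hL.sub hK, rfl⟩

lemma mul (hF : HasDirDeriv F x u d) (hG : HasDirDeriv G x u e) :
    HasDirDeriv (fun y => F y * G y) x u (d * G x + F x * e) := by
  obtain ⟨L, hL, rfl⟩ := hF
  obtain ⟨K, hK, rfl⟩ := hG
  refine ⟨_, hL.mul hK, ?_⟩
  simp
  ring

lemma const (c : ℝ) : HasDirDeriv (fun _ => c) x u 0 := ⟨0, hasFDerivAt_const c x, rfl⟩

lemma of_fst {f : ℝ → ℝ} {f' : ℝ} (hf : HasDerivAt f f' x.1) :
    HasDirDeriv (fun y => f y.1) x u (u.1 * f') :=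
  ⟨_, hf.hasFDerivAt.comp x hasFDerivAt_fst, by simp⟩

lemma of_snd {f : E6 → ℝ} (hf : DifferentiableAt ℝ f x.2) :
    HasDirDeriv (fun y => f y.2) x u (fderiv ℝ f x.2 u.2) :=
  ⟨_, hf.hasFDerivAt.comp x hasFDerivAt_snd, by simp⟩

end HasDirDeriv

end ConeChart

end ConeSoliton

/-! ### The tensors of the cone at a point, and the deformed structure as a rotation of phase. -/

namespace ConeSoliton

open Set Filter

/-- An orthonormal family of the right length is a frame. -/
lemma IsFrame.of_ortho {V : Type*} [AddCommGroup V] [Module ℝ V] {g : V → V → ℝ} {n : ℕ}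
    (hg : IsBilinear g) (hsymm : ∀ u v, g u v = g v u) {E e : Fin n → V} (hE : IsFrame g E)
    (he : ∀ i j, g (e i) (e j) = if i = j then 1 else 0) : IsFrame g e := by
  refine ⟨he, fun v => ?_⟩
  have h1 : ∀ w, g (∑ i, g (e i) v • e i) w = g v w := fun w => by
    rw [hg.sum_left, hE.sum_eq hg he (B := fun a b => g a v * g b w)
      ⟨fun x y z => by rw [hg.add₁]; ring, fun t x z => by rw [hg.smul₁]; ring,
        fun x y z => by rw [hg.add₁]; ring, fun t x z => by rw [hg.smul₁]; ring⟩, ← hg.sum_left]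
    congr 1
    exact (hE.expand v).symm
  rw [hE.expand v, hE.expand (∑ i, g (e i) (∑ i, g (E i) v • E i) • e i)]
  refine Finset.sum_congr rfl fun i _ => ?_
  rw [← hE.expand v, hsymm (E i) v, ← h1 (E i), hsymm]

section ConeGeometry

variable {N : Type*} [TopologicalSpace N] [ChartedSpace E6 N] [IsManifold (𝓡 6) ∞ N]
  (S : NearlyKahler N)

lemma NearlyKahler.kform_eq_kform (x : N) : (S.kform x : (Fin 2 → E6) → ℝ) = (S.hermitian x).kform := by
  funext w
  have h := S.kform_eq_om x (w 0) (w 1)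
  have hw : (w : Fin 2 → E6) = ![w 0, w 1] := by funext i; fin_cases i <;> rfl
  conv_lhs => rw [hw]
  exact h

lemma NearlyKahler.hform_eq (x : N) (w : Fin 3 → E6) :
    S.hform x w = (S.hermitian x).O (w 0) (w 1) (w 2) := by
  have hw : (w : Fin 3 → E6) = ![w 0, w 1, w 2] := by funext i; fin_cases i <;> rfl
  conv_lhs => rw [hw]
  rfl

lemma coneMetric_eq (q : Cone N) (u v : ℝ × E6) :
    coneMetric S q u v = (S.hermitian q.2).coneG q.1 u v := rfl

lemma coneVol_eq (q : Cone N) (w : Fin 7 → ℝ × E6) :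
    coneVol S q w = (S.hermitian q.2).cone₇ q.1 w := by
  have h := S.kform_eq_kform q.2
  change (q.1 : ℝ) ^ 6 * wedge (k := 1) (l := 6) (fun v : Fin 1 → ℝ × E6 => (v 0).1)
    (fun v => (1 / 6) * wedge (k := 4) (l := 2) (wedge (S.kform q.2 : (Fin 2 → E6) → ℝ)
      (S.kform q.2 : (Fin 2 → E6) → ℝ)) (S.kform q.2 : (Fin 2 → E6) → ℝ) (fun i => (v i).2)) w = _
  rw [h]
  rfl

lemma conePhi_eq (q : Cone N) (w : Fin 3 → ℝ × E6) :
    conePhi S q w = (S.hermitian q.2).cone₃ q.1 1 w := by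
  have h := S.kform_eq_kform q.2
  have h2 := S.hform_eq q.2 (fun i => (w i).2)
  change (q.1 : ℝ) ^ 3 * ((S.hform q.2 : (Fin 3 → E6) → ℂ) (fun i => (w i).2)).re
    - (q.1 : ℝ) ^ 2 * wedge (k := 1) (l := 2) (fun v : Fin 1 → ℝ × E6 => (v 0).1)
        (fun v => (S.kform q.2 : (Fin 2 → E6) → ℝ) (fun i => (v i).2)) w = _
  rw [h, HermitianData.cone₃, HermitianData.reForm, one_mul]
  exact congrArg (fun z : ℂ => (q.1 : ℝ) ^ 3 * z.re - _) h2

lemma NearlyKahler.exists_adaptedBasis (x : N) {c : ℂ} (hc : Complex.normSq c = 1) :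
    ∃ b, (S.hermitian x).IsAdaptedBasis c b := by
  obtain ⟨e, he⟩ := S.exists_unitaryFrame x
  exact he.exists_adaptedBasis hc

/-- The frame of the cone metric used in contractions, as vectors of the model space. -/
noncomputable def coneE (q : Cone N) : Fin 7 → ℝ × E6 := frame (coneMetric S) q

omit [TopologicalSpace N] [ChartedSpace E6 N] [IsManifold (𝓡 6) ∞ N] in
lemma cone_r_ne_zero (q : Cone N) : (q.1 : ℝ) ≠ 0 := (show (0 : ℝ) < q.1 from q.1.2).ne'

/-- The chosen frame is arbitrary; it is orthonormal because an orthonormal frame exists, namely one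
built from an adapted basis. -/
lemma coneE_ortho (q : Cone N) (i j : Fin 7) :
    (S.hermitian q.2).coneG q.1 (coneE S q i) (coneE S q j) = if i = j then 1 else 0 := by
  obtain ⟨b, hb⟩ := S.exists_adaptedBasis q.2 (c := 1) (by simp)
  have h : ∃ e, IsOrthonormalFrame (coneMetric S) q e :=
    ⟨HermitianData.coneFrame (q.1 : ℝ) b, (HermitianData.isFrame_coneFrame hb (cone_r_ne_zero q)).ortho⟩
  exact Classical.epsilon_spec h i j

lemma coneG_symm (q : Cone N) (u v : ℝ × E6) :
    (S.hermitian q.2).coneG q.1 u v = (S.hermitian q.2).coneG q.1 v u := by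
  simp only [HermitianData.coneG, (S.hermitian q.2).g_symm u.2]
  ring

lemma isFrame_coneE (q : Cone N) : IsFrame ((S.hermitian q.2).coneG q.1) (coneE S q) := by
  obtain ⟨b, hb⟩ := S.exists_adaptedBasis q.2 (c := 1) (by simp)
  exact .of_ortho HermitianData.isBilinear_coneG (coneG_symm S q)
    (HermitianData.isFrame_coneFrame hb (cone_r_ne_zero q)) (coneE_ortho S q)

lemma hodge_cone (q : Cone N) {c : ℂ} (hc : Complex.normSq c = 1) {A : Tensor coneModel (Cone N) 3}
    (hA : ∀ w : Fin 3 → ℝ × E6, A q w = (S.hermitian q.2).cone₃ q.1 c w) (w : Fin 4 → ℝ × E6) :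
    hodge (coneMetric S) (coneVol S) A q w = (S.hermitian q.2).cone₄ q.1 c w := by
  obtain ⟨b, hb⟩ := S.exists_adaptedBasis q.2 hc
  rw [← HermitianData.hodge_cone₃ hb (cone_r_ne_zero q) (coneE_ortho S q) w]
  refine congrArg (fun t : ℝ => 1 / 6 * t) ?_
  refine Finset.sum_congr rfl fun i _ => Finset.sum_congr rfl fun j _ => Finset.sum_congr rfl fun k _ => ?_
  exact congrArg₂ (· * ·) (hA _) (coneVol_eq S q _)

/-- The phase of the complex volume form of the isometric structure given by `f` and `a ∂/∂r`. -/
noncomputable def conePhase (f a : ℝ) : ℂ := ⟨f ^ 2 - a ^ 2, -(2 * f * a)⟩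

/-- Contraction of `ψ₀` with `a ∂/∂r` produces `-a r³ Im Ω`, which rotates `Ω` by the phase `(f - i
a)²`. The coefficient of `-r² dr ∧ ω` becomes `(f² - a²) + 2 a² = 1`, so `ω` is unchanged. -/
lemma solitonPhi_eq {f : Cone N → ℝ} {a : ℝ → ℝ} {q : Cone N} (h : f q ^ 2 + a q.1 ^ 2 = 1)
    (w : Fin 3 → ℝ × E6) : solitonPhi S f a q w
      = (S.hermitian q.2).cone₃ q.1 (conePhase (f q) (a q.1)) w := by
  obtain ⟨x, y, z, rfl⟩ : ∃ x y z, w = ![x, y, z] :=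
    ⟨w 0, w 1, w 2, by funext i; fin_cases i <;> rfl⟩
  set D := S.hermitian q.2 with hD
  set X : ℝ × E6 := (a q.1, 0) with hX
  have h1 : interior (radialField N a) (hodge (coneMetric S) (coneVol S) (conePhi S)) q ![x, y, z]
      = D.cone₄ q.1 1 ![X, x, y, z] := hodge_cone S q (by simp) (conePhi_eq S q) _
  have h2 : ∀ v : Fin 2 → ℝ × E6, interior (radialField N a) (conePhi S) q v
      = D.cone₃ q.1 1 (Matrix.vecCons X v) := fun v => conePhi_eq S q _
  have h3 : wedge (k := 1) (l := 2) (flat (coneMetric S) (radialField N a) q)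
      (interior (radialField N a) (conePhi S) q) ![x, y, z] =
      wedge (k := 1) (l := 2) (fun v : Fin 1 → ℝ × E6 => D.coneG q.1 X (v 0))
        (fun v => D.cone₃ q.1 1 (Fin.cons X v)) ![x, y, z] := by
    refine congrArg (fun t => wedge (k := 1) (l := 2)
      (fun v : Fin 1 → ℝ × E6 => D.coneG q.1 X (v 0)) t ![x, y, z]) (funext h2)
  have h4 : coneMetric S q (radialField N a q) (radialField N a q) = a q.1 ^ 2 := by
    change D.coneG q.1 X X = _
    simp [HermitianData.coneG, hX, D.g_zero]
    ring
  change (f q ^ 2 - coneMetric S q (radialField N a q) (radialField N a q)) * conePhi S q ![x, y, z]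
    - 2 * f q * interior (radialField N a) (hodge (coneMetric S) (coneVol S) (conePhi S)) q ![x, y, z]
    + 2 * wedge (k := 1) (l := 2) (flat (coneMetric S) (radialField N a) q)
      (interior (radialField N a) (conePhi S) q) ![x, y, z] = _
  rw [h1, h3, h4, wedge_one_two _ (HermitianData.isAlternating_cone₃.cons X)]
  have h5 : ∀ u v : ℝ × E6, (Fin.cons X ![u, v] : Fin 3 → ℝ × E6) = ![X, u, v] := fun u v => rfl
  have h6 := conePhi_eq S q ![x, y, z]
  refine (congrArg (fun t => (f q ^ 2 - a q.1 ^ 2) * t - _ + _) h6).trans ?_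
  simp only [h5]
  simp only [HermitianData.cone₃_apply, HermitianData.cone₄_apply, HermitianData.coneG, hX,
    D.O_zero, D.om_zero, D.om_zero_right, D.g_zero, conePhase, ← hD]
  simp
  linear_combination (-(q.1 : ℝ) ^ 2 * (x.1 * D.om y.2 z.2 + y.1 * D.om z.2 x.2 + z.1 * D.om x.2 y.2)) * h

end ConeGeometry

end ConeSoliton

/-! ### The Levi-Civita connection of the cone. -/

namespace ConeSoliton

open Set Filter

section ConeConnection

variable {N : Type*} [TopologicalSpace N] [ChartedSpace E6 N] [IsManifold (𝓡 6) ∞ N]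
  (S : NearlyKahler N)

/-- The point of the cone over the chart at `p` with coordinates `y`. -/
noncomputable def chartPoint (p : Cone N) (y : ℝ × E6) : Cone N := (extChartAt coneModel p).symm y

omit [IsManifold (𝓡 6) ∞ N] in
lemma chartPoint_self (p : Cone N) : chartPoint p (extChartAt coneModel p p) = p :=
  extChartAt_to_inv (I := coneModel) p

lemma tensor_chartPoint {k : ℕ} (A : Tensor coneModel (Cone N) k) (p : Cone N) {y : ℝ × E6}
    (hy : 0 < y.1) (hy2 : y.2 ∈ (extChartAt (𝓡 6) p.2).target) (v : Fin k → ℝ × E6) :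
    A (chartPoint p y) (fun i => coordVec coneModel p y (v i))
      = A (⟨y.1, hy⟩, (extChartAt (𝓡 6) p.2).symm y.2)
        (fun i => (((v i).1, coordMap p.2 y.2 (v i).2) : ℝ × E6)) := by
  have key : ∀ (a b : Cone N) (h : a = b) (w : Fin k → ℝ × E6), A a w = A b w := by
    rintro a _ rfl w; rfl
  refine (key _ _ (extChartAt_cone_symm p hy) _).trans ?_
  refine congrArg (A _) ?_
  funext i
  exact coordVec_cone p hy hy2 (v i)

/-- The properties of the Levi-Civita connection of a nearly Kähler manifold at `x`, in terms of its
Christoffel symbols. -/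
structure IsLinkConnection (x : N) (Γ : E6 → E6 → E6) : Prop extends
    HermitianData.IsSymmBilinear Γ where
  metric : ∀ u v w, metricJet S x u v w = (S.hermitian x).g (Γ u v) w + (S.hermitian x).g v (Γ u w)
  kform : ∀ u v w, kformJet S x u v w = (S.hermitian x).om (Γ u v) w + (S.hermitian x).om v (Γ u w)
      - ((S.hermitian x).O u v w).re
  hform : ∀ u v w z, hformJet S x u v w z = (S.hermitian x).O (Γ u v) w z
      + (S.hermitian x).O v (Γ u w) z + (S.hermitian x).O v w (Γ u z)
      + ((S.hermitian x).h u v * (S.hermitian x).om w z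
      + (S.hermitian x).h u w * (S.hermitian x).om z v + (S.hermitian x).h u z * (S.hermitian x).om v w)

lemma exists_linkConnection (x : N) : ∃ Γ, IsLinkConnection S x Γ := by
  obtain ⟨Γ, h1, h2, h3, h4⟩ := exists_christoffel_jet S x
  exact ⟨Γ, h1, h2, h3, h4⟩

/-- The Christoffel symbols of the cone. -/
noncomputable def HermitianData.coneGamma (D : HermitianData E6) (r : ℝ) (Γ : E6 → E6 → E6)
    (u v : ℝ × E6) : ℝ × E6 :=
  (-r * D.g u.2 v.2, Γ u.2 v.2 + r⁻¹ • (u.1 • v.2 + v.1 • u.2))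

variable {S} {p : Cone N}

lemma hasDirDeriv_metricInChart (u : ℝ × E6) (v w : E6) :
    HasDirDeriv (fun y : ℝ × E6 => metricInChart S p.2 y.2 v w) (extChartAt coneModel p p) u
      (metricJet S p.2 u.2 v w) :=
  HasDirDeriv.of_snd (x := extChartAt coneModel p p) (f := fun y => metricInChart S p.2 y v w)
    (by rw [extChartAt_cone_coe]
        exact differentiableAt_metricInChart S p.2 (mem_extChartAt_target p.2) v w)

lemma hasDirDeriv_kformInChart (u : ℝ × E6) (v w : E6) :
    HasDirDeriv (fun y : ℝ × E6 => formInChart (𝓡 6) S.kform p.2 y.2 ![v, w])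
      (extChartAt coneModel p p) u (kformJet S p.2 u.2 v w) :=
  HasDirDeriv.of_snd (x := extChartAt coneModel p p)
    (f := fun y => formInChart (𝓡 6) S.kform p.2 y ![v, w])
    (by rw [extChartAt_cone_coe]
        exact differentiableAt_form_apply (differentiableAt_kform S p.2 (mem_extChartAt_target p.2)) _)

lemma hasDirDeriv_hformInChart (u : ℝ × E6) (v w z : E6) (L : ℂ →L[ℝ] ℝ) :
    HasDirDeriv (fun y : ℝ × E6 => L (formInChart (𝓡 6) S.hform p.2 y.2 ![v, w, z]))
      (extChartAt coneModel p p) u (L (hformJet S p.2 u.2 v w z)) := by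
  have h1 : DifferentiableAt ℝ (fun y => formInChart (𝓡 6) S.hform p.2 y ![v, w, z])
      (extChartAt coneModel p p).2 := by
    rw [extChartAt_cone_coe]
    exact differentiableAt_form_apply (differentiableAt_hform S p.2 (mem_extChartAt_target p.2)) _
  have h2 := L.hasFDerivAt.comp _ h1.hasFDerivAt
  have h3 := HasDirDeriv.of_snd (x := extChartAt coneModel p p) (u := u) h2.differentiableAt
  rw [h2.fderiv] at h3
  exact h3

omit [IsManifold (𝓡 6) ∞ N] in
lemma hasDirDeriv_fst (u : ℝ × E6) {f : ℝ → ℝ} {f' : ℝ} (hf : HasDerivAt f f' p.1) :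
    HasDirDeriv (fun y : ℝ × E6 => f y.1) (extChartAt coneModel p p) u (u.1 * f') :=
  HasDirDeriv.of_fst (by rw [extChartAt_cone_coe]; exact hf)

lemma metricDeriv_cone (u v w : ℝ × E6) : metricDeriv (coneMetric S) p u v w =
    2 * p.1 * u.1 * (S.hermitian p.2).g v.2 w.2 + (p.1 : ℝ) ^ 2 * metricJet S p.2 u.2 v.2 w.2 := by
  have h1 : HasDirDeriv (fun y : ℝ × E6 => v.1 * w.1 + y.1 ^ 2 * metricInChart S p.2 y.2 v.2 w.2)
      (extChartAt coneModel p p) u _ :=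
    (HasDirDeriv.const (v.1 * w.1)).add ((hasDirDeriv_fst u (f := fun t => t ^ 2)
      (hasDerivAt_pow 2 (p.1 : ℝ))).mul (hasDirDeriv_metricInChart (S := S) u v.2 w.2))
  have h2 := h1.congr (G := fun y => coneMetric S (chartPoint p y) (coordVec coneModel p y v)
    (coordVec coneModel p y w)) (by
      filter_upwards [eventually_cone_target p] with y hy
      exact tensor_chartPoint (fun q w => coneMetric S q (w 0) (w 1)) p hy.1 hy.2 ![v, w])
  refine h2.fderiv_eq.trans ?_
  rw [extChartAt_cone_coe, metricInChart_self]
  simp only [Nat.cast_ofNat]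
  ring

variable {Γ : E6 → E6 → E6} (hΓ : IsLinkConnection S p.2 Γ)

include hΓ

/-- The scalar products of the Christoffel vector with the frame are computed from the derivatives
of `dr² + r² g_N`; expansion in the frame then identifies the vector. -/
lemma christoffel_cone (u v : ℝ × E6) : (christoffel (coneMetric S) p u v : ℝ × E6)
    = (S.hermitian p.2).coneGamma p.1 Γ u v := by
  have hr := cone_r_ne_zero p
  set D := S.hermitian p.2 with hD
  have h1 : ∀ w : ℝ × E6, (metricDeriv (coneMetric S) p u v w + metricDeriv (coneMetric S) p v u w
      - metricDeriv (coneMetric S) p w u v) / 2 = D.coneG p.1 w (D.coneGamma p.1 Γ u v) := by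
    intro w
    rw [metricDeriv_cone, metricDeriv_cone, metricDeriv_cone, hΓ.metric, hΓ.metric, hΓ.metric,
      HermitianData.coneG, HermitianData.coneGamma, hΓ.symm v.2 u.2, hΓ.symm w.2 u.2,
      hΓ.symm w.2 v.2]
    simp only [D.g_add', D.g_smul', ← hD]
    rw [D.g_symm w.2 (Γ u.2 v.2), D.g_symm w.2 v.2, D.g_symm w.2 u.2,
      D.g_symm v.2 (Γ u.2 w.2)]
    field_simp
    ring
  have h2 := (isFrame_coneE S p).expand (D.coneGamma p.1 Γ u v)
  rw [h2]
  exact Finset.sum_congr rfl fun i _ => congrArg (· • coneE S p i) (h1 _)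

lemma covDeriv_cone {k : ℕ} {A : Tensor coneModel (Cone N) k} (u : ℝ × E6) (w : Fin k → ℝ × E6) {d : ℝ}
    {F : (Fin k → ℝ × E6) → ℝ} (hF : ∀ w : Fin k → ℝ × E6, A p w = F w)
    (hd : HasDirDeriv (fun y => A (chartPoint p y) (fun i => coordVec coneModel p y (w i)))
      (extChartAt coneModel p p) u d) :
    covDeriv (coneMetric S) A p (Matrix.vecCons u w : Fin (k + 1) → ℝ × E6) = d
      - ∑ i, F (Function.update w i ((S.hermitian p.2).coneGamma p.1 Γ u (w i))) := by
  refine congrArg₂ (· - ·) hd.fderiv_eq (Finset.sum_congr rfl fun i _ => ?_)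
  exact (congrArg (fun z => A p (Function.update w i z)) (christoffel_cone hΓ u (w i))).trans (hF _)

/-- The hypotheses on `g₁`, `g₂` say that the phase `c = g₁ + i g₂` satisfies `c' = i k c` at the
radius in question. The Christoffel symbols of the link cancel. For `c = 1` and `k = 0` the result
is zero: the cone structure is parallel. -/
theorem covDeriv_cone₃ {A : Tensor coneModel (Cone N) 3} {g₁ g₂ : ℝ → ℝ} {k : ℝ}
    (hA : ∀ᶠ q in 𝓝 p, ∀ w : Fin 3 → ℝ × E6,
      A q w = (S.hermitian q.2).cone₃ q.1 ⟨g₁ q.1, g₂ q.1⟩ w)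
    (h₁ : HasDerivAt g₁ (-k * g₂ p.1) p.1) (h₂ : HasDerivAt g₂ (k * g₁ p.1) p.1) (u x y z : ℝ × E6) :
    covDeriv (coneMetric S) A p ![u, x, y, z]
      = (S.hermitian p.2).coneDeriv p.1 ⟨g₁ p.1, g₂ p.1⟩ k u x y z := by
  have hr := cone_r_ne_zero p
  set D := S.hermitian p.2 with hD
  have hc : ContinuousAt (chartPoint p) (extChartAt coneModel p p) :=
    continuousAt_extChartAt_symm (I := coneModel) p
  have hA' := hc.eventually (by rw [chartPoint_self]; exact hA)
  have e1 := hasDirDeriv_hformInChart (S := S) (p := p) u x.2 y.2 z.2 Complex.reCLM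
  have e2 := hasDirDeriv_hformInChart (S := S) (p := p) u x.2 y.2 z.2 Complex.imCLM
  have e3 := hasDirDeriv_fst (p := p) u (f := fun t => t ^ 3) (hasDerivAt_pow 3 (p.1 : ℝ))
  have e4 := hasDirDeriv_fst (p := p) u (f := fun t => t ^ 2) (hasDerivAt_pow 2 (p.1 : ℝ))
  have ek := fun v w => hasDirDeriv_kformInChart (S := S) (p := p) u v w
  have e5 := (e3.mul (((hasDirDeriv_fst u h₁).mul e1).sub ((hasDirDeriv_fst u h₂).mul e2))).sub
    (e4.mul ((((HasDirDeriv.const x.1).mul (ek y.2 z.2)).add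
      ((HasDirDeriv.const y.1).mul (ek z.2 x.2))).add ((HasDirDeriv.const z.1).mul (ek x.2 y.2))))
  have h2 := e5.congr (G := fun t => A (chartPoint p t) (fun i => coordVec coneModel p t
      ((![x, y, z] : Fin 3 → ℝ × E6) i))) (by
    filter_upwards [eventually_cone_target p, hA'] with t ht hAt
    refine (tensor_chartPoint A p ht.1 ht.2 _).trans ?_
    rw [chartPoint, extChartAt_cone_symm p ht.1] at hAt
    refine (hAt _).trans ?_
    have h3 : (fun i => (((![x, y, z] : Fin 3 → ℝ × E6) i).1, coordMap p.2 t.2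
        ((![x, y, z] : Fin 3 → ℝ × E6) i).2)) = ![(x.1, coordMap p.2 t.2 x.2),
          (y.1, coordMap p.2 t.2 y.2), (z.1, coordMap p.2 t.2 z.2)] := by
      funext i; fin_cases i <;> rfl
    rw [h3, HermitianData.cone₃_apply, kformInChart_eq, kformInChart_eq, kformInChart_eq,
      hformInChart_eq]
    simp)
  have hAp : ∀ w : Fin 3 → ℝ × E6, A p w = D.cone₃ p.1 ⟨g₁ p.1, g₂ p.1⟩ w := hA.self_of_nhds
  refine (covDeriv_cone hΓ u ![x, y, z] hAp h2).trans ?_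
  have u0 : ∀ v, Function.update (![x, y, z] : Fin 3 → ℝ × E6) 0 v = ![v, y, z] := fun v => by
    funext i; fin_cases i <;> rfl
  have u1 : ∀ v, Function.update (![x, y, z] : Fin 3 → ℝ × E6) 1 v = ![x, v, z] := fun v => by
    funext i; fin_cases i <;> rfl
  have u2 : ∀ v, Function.update (![x, y, z] : Fin 3 → ℝ × E6) 2 v = ![x, y, v] := fun v => by
    funext i; fin_cases i <;> rfl
  rw [Fin.sum_univ_three, u0, u1, u2]
  rw [extChartAt_cone_coe, kformInChart_self, kformInChart_self, kformInChart_self,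
    hformInChart_self, hΓ.kform, hΓ.kform, hΓ.kform, hΓ.hform]
  simp only [HermitianData.cone₃_apply, HermitianData.coneDeriv, HermitianData.coneGamma, ← hD,
    Matrix.cons_val_zero, Matrix.cons_val_one, Matrix.cons_val]
  simp [D.O_add, D.O_add₂, D.O_add₃, D.O_smul, D.O_smul₂, D.O_smul₃, D.om_add, D.om_add_right,
    D.om_smul, D.om_smul_right, HermitianData.h]
  field_simp
  rw [D.O_swap u.2 x.2 z.2, D.O_swap' u.2 z.2 x.2, D.O_swap' x.2 u.2 y.2, D.O_swap u.2 x.2 y.2,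
    D.om_swap u.2 x.2, D.om_swap u.2 y.2, D.om_swap u.2 z.2]
  simp only [Complex.neg_re, Complex.neg_im]
  ring

end ConeConnection

end ConeSoliton

/-! ### Torsion, divergence, curl and Lie derivative for radial data on the cone. -/

namespace ConeSoliton

open Set Filter

section ConeTorsion

variable {N : Type*} [TopologicalSpace N] [ChartedSpace E6 N] [IsManifold (𝓡 6) ∞ N]
  {S : NearlyKahler N} {p : Cone N}

theorem torsion_cone {A : Tensor coneModel (Cone N) 3} {g₁ g₂ : ℝ → ℝ} {k : ℝ}
    (hA : ∀ᶠ q in 𝓝 p, ∀ w : Fin 3 → ℝ × E6,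
      A q w = (S.hermitian q.2).cone₃ q.1 ⟨g₁ q.1, g₂ q.1⟩ w)
    (hc : Complex.normSq ⟨g₁ p.1, g₂ p.1⟩ = 1)
    (h₁ : HasDerivAt g₁ (-k * g₂ p.1) p.1) (h₂ : HasDerivAt g₂ (k * g₁ p.1) p.1)
    (w : Fin 2 → ℝ × E6) : torsion (coneMetric S) (coneVol S) A p w
      = (S.hermitian p.2).coneTorsion p.1 ⟨g₁ p.1, g₂ p.1⟩ k (w 0) (w 1) := by
  obtain ⟨Γ, hΓ⟩ := exists_linkConnection S p.2
  obtain ⟨b, hb⟩ := S.exists_adaptedBasis p.2 hc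
  rw [← HermitianData.torsion_contraction hb (cone_r_ne_zero p) hc (coneE_ortho S p)]
  refine congrArg (fun t : ℝ => 1 / 24 * t) ?_
  refine Finset.sum_congr rfl fun i _ => Finset.sum_congr rfl fun j _ => Finset.sum_congr rfl fun l _ => ?_
  exact congrArg₂ (· * ·) (covDeriv_cone₃ hΓ hA h₁ h₂ _ _ _ _) (hodge_cone S p hc hA.self_of_nhds _)

/-- The components along `dr ⊗ dr`, `g_N` and `ω` are mutually orthogonal; on the six directions of
the link `g_N` and `ω` each contribute a factor `6`. -/
theorem normSq_torsion_cone {T : Tensor coneModel (Cone N) 2} {c : ℂ} {k : ℝ}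
    (hT : ∀ w : Fin 2 → ℝ × E6, T p w = (S.hermitian p.2).coneTorsion p.1 c k (w 0) (w 1)) :
    normSq (coneMetric S) T p = k ^ 2 + 6 * (c.im ^ 2 + (c.re - 1) ^ 2) / (p.1 : ℝ) ^ 2 := by
  have hr := cone_r_ne_zero p
  obtain ⟨b, hb⟩ := S.exists_adaptedBasis p.2 (c := 1) (by simp)
  set D := S.hermitian p.2 with hD
  set B := D.coneTorsion p.1 c k with hB
  have hBb : IsBilinear B := HermitianData.isBilinear_coneTorsion
  set e := coneE S p
  set E := HermitianData.coneFrame (p.1 : ℝ) b with hE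
  have hF : IsFrame (D.coneG p.1) E := HermitianData.isFrame_coneFrame hb hr
  have h1 : normSq (coneMetric S) T p = ∑ i, ∑ j, B (e i) (e j) ^ 2 :=
    Finset.sum_congr rfl fun i _ => Finset.sum_congr rfl fun j _ => congrArg (· ^ 2) (hT _)
  have h2 : ∀ u, ∑ j, B u (e j) ^ 2 = ∑ j, B u (E j) ^ 2 := fun u => by
    simp only [pow_two]
    exact hF.sum_eq HermitianData.isBilinear_coneG (coneE_ortho S p) (B := fun v w => B u v * B u w)
      ⟨fun x y z => by rw [hBb.add₂]; ring, fun t x z => by rw [hBb.smul₂]; ring,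
        fun x y z => by rw [hBb.add₂]; ring, fun t x z => by rw [hBb.smul₂]; ring⟩
  have h3 : ∑ i, ∑ j, B (e i) (E j) ^ 2 = ∑ i, ∑ j, B (E i) (E j) ^ 2 := by
    simp only [pow_two]
    exact hF.sum_eq HermitianData.isBilinear_coneG (coneE_ortho S p)
      (B := fun v w => ∑ j, B v (E j) * B w (E j))
      ⟨fun x y z => by simp only [hBb.add₁, add_mul, Finset.sum_add_distrib],
        fun t x z => by simp only [hBb.smul₁, Finset.mul_sum, mul_assoc],
        fun x y z => by simp only [hBb.add₁, mul_add, Finset.sum_add_distrib],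
        fun t x z => by simp only [hBb.smul₁, Finset.mul_sum, mul_left_comm]⟩
  rw [h1, Finset.sum_congr rfl fun i _ => h2 (e i), h3]
  simp only [Fin.sum_univ_succ (n := 6), hE, HermitianData.coneFrame, Fin.cons_zero, Fin.cons_succ,
    hB, HermitianData.coneTorsion, D.g_smul, D.g_smul', D.om_smul, D.om_smul_right, D.g_zero,
    D.g_zero', D.om_zero, D.om_zero_right, hb.ortho, hb.om_eq]
  simp only [Fin.sum_univ_six]
  simp [kTable, cond_eq_ite]
  field_simp
  ring

variable {Γ : E6 → E6 → E6} (hΓ : IsLinkConnection S p.2 Γ)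

/-- The covariant derivative of the torsion of the cone. -/
noncomputable def HermitianData.coneTorsionDeriv (D : HermitianData E6) (r k g₁ g₂ k' g₁' g₂' : ℝ)
    (u x z : ℝ × E6) : ℝ :=
  u.1 * k' * (x.1 * z.1) + k * r * (D.g u.2 x.2 * z.1 + D.g u.2 z.2 * x.1)
    + u.1 * (g₂ + r * g₂') * D.g x.2 z.2
    - g₂ * (2 * u.1 * D.g x.2 z.2 + x.1 * D.g u.2 z.2 + z.1 * D.g x.2 u.2)
    + u.1 * (g₁ - 1 + r * g₁') * D.om x.2 z.2 - r * (g₁ - 1) * (D.O u.2 x.2 z.2).re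
    - (g₁ - 1) * (2 * u.1 * D.om x.2 z.2 + x.1 * D.om u.2 z.2 + z.1 * D.om x.2 u.2)

include hΓ in
theorem covDeriv_torsion_cone {T : Tensor coneModel (Cone N) 2} {g₁ g₂ k : ℝ → ℝ} {g₁' g₂' k' : ℝ}
    (hT : ∀ᶠ q in 𝓝 p, ∀ w : Fin 2 → ℝ × E6, T q w =
      (S.hermitian q.2).coneTorsion q.1 ⟨g₁ q.1, g₂ q.1⟩ (k q.1) (w 0) (w 1))
    (h₁ : HasDerivAt g₁ g₁' p.1) (h₂ : HasDerivAt g₂ g₂' p.1) (hk : HasDerivAt k k' p.1)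
    (u x z : ℝ × E6) : covDeriv (coneMetric S) T p ![u, x, z]
      = (S.hermitian p.2).coneTorsionDeriv p.1 (k p.1) (g₁ p.1) (g₂ p.1) k' g₁' g₂' u x z := by
  have hr := cone_r_ne_zero p
  set D := S.hermitian p.2 with hD
  have hc : ContinuousAt (chartPoint p) (extChartAt coneModel p p) :=
    continuousAt_extChartAt_symm (I := coneModel) p
  have hT' := hc.eventually (by rw [chartPoint_self]; exact hT)
  have e0 := hasDirDeriv_fst (p := p) u (f := fun t => t) (hasDerivAt_id (p.1 : ℝ))
  have e5 := ((hasDirDeriv_fst u hk).mul (HasDirDeriv.const (x.1 * z.1))).add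
    (e0.mul (((hasDirDeriv_fst u h₂).mul (hasDirDeriv_metricInChart (S := S) u x.2 z.2)).add
      (((hasDirDeriv_fst u h₁).sub (HasDirDeriv.const 1)).mul
        (hasDirDeriv_kformInChart (S := S) u x.2 z.2))))
  have h2 := e5.congr (G := fun t => T (chartPoint p t) (fun i => coordVec coneModel p t
      ((![x, z] : Fin 2 → ℝ × E6) i))) (by
    filter_upwards [eventually_cone_target p, hT'] with t ht hTt
    refine (tensor_chartPoint T p ht.1 ht.2 _).trans ?_
    rw [chartPoint, extChartAt_cone_symm p ht.1] at hTt
    refine (hTt _).trans ?_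
    rw [kformInChart_eq]
    rfl)
  refine (covDeriv_cone hΓ u ![x, z] hT.self_of_nhds h2).trans ?_
  rw [Fin.sum_univ_two, extChartAt_cone_coe, kformInChart_self, metricInChart_self, hΓ.kform,
    hΓ.metric]
  simp only [HermitianData.coneTorsion, HermitianData.coneTorsionDeriv, HermitianData.coneGamma, ← hD,
    Matrix.cons_val_zero, Matrix.cons_val_one, Function.update_self, ne_eq, zero_ne_one, one_ne_zero,
    not_false_eq_true, Function.update_of_ne, D.om_add, D.om_add_right,
    D.om_smul, D.om_smul_right, D.g_add, D.g_add', D.g_smul, D.g_smul']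
  field_simp
  ring

/-- In the trace over the first two slots the `ω` and `Re Ω` terms drop out by antisymmetry. The
radial part gives `k' + 6 k / r`, the second fundamental form of the spheres `r = const` paired with
the `g_N` part gives `-6 g₂ / r²`. -/
theorem divergence_torsion_cone {T : Tensor coneModel (Cone N) 2} {g₁ g₂ k : ℝ → ℝ} {g₁' g₂' k' : ℝ}
    (hT : ∀ᶠ q in 𝓝 p, ∀ w : Fin 2 → ℝ × E6, T q w =
      (S.hermitian q.2).coneTorsion q.1 ⟨g₁ q.1, g₂ q.1⟩ (k q.1) (w 0) (w 1))
    (h₁ : HasDerivAt g₁ g₁' p.1) (h₂ : HasDerivAt g₂ g₂' p.1) (hk : HasDerivAt k k' p.1)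
    (w : Fin 1 → ℝ × E6) : divergence (coneMetric S) T p w
      = (k' + 6 * k p.1 / p.1 - 6 * g₂ p.1 / (p.1 : ℝ) ^ 2) * (w 0).1 := by
  have hr := cone_r_ne_zero p
  obtain ⟨Γ, hΓ⟩ := exists_linkConnection S p.2
  obtain ⟨b, hb⟩ := S.exists_adaptedBasis p.2 (c := 1) (by simp)
  set D := S.hermitian p.2 with hD
  set B : ℝ × E6 → ℝ × E6 → ℝ := fun u x =>
    D.coneTorsionDeriv p.1 (k p.1) (g₁ p.1) (g₂ p.1) k' g₁' g₂' u x (w 0) with hB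
  have h1 : divergence (coneMetric S) T p w = ∑ i, B (coneE S p i) (coneE S p i) :=
    Finset.sum_congr rfl fun i _ => covDeriv_torsion_cone hΓ hT h₁ h₂ hk _ _ _
  have hBb : IsBilinear B := by
    constructor <;> intros <;>
      simp [hB, HermitianData.coneTorsionDeriv, D.om_add, D.om_add_right, D.om_smul, D.om_smul_right,
        D.g_add, D.g_add', D.g_smul, D.g_smul', D.O_add, D.O_add₂, D.O_smul, D.O_smul₂] <;> ring
  have hF : IsFrame (D.coneG p.1) (HermitianData.coneFrame (p.1 : ℝ) b) :=
    HermitianData.isFrame_coneFrame hb hr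
  have ho : ∀ u, D.om u u = 0 := fun u => self_eq_neg.1 (D.om_swap u u)
  rw [h1, hF.sum_eq HermitianData.isBilinear_coneG (coneE_ortho S p) hBb]
  simp only [hB, HermitianData.coneTorsionDeriv, HermitianData.coneFrame, Fin.sum_univ_succ (n := 6),
    Fin.cons_zero, Fin.cons_succ, D.O_self, D.om_zero, D.g_zero, ho, D.g_smul, D.g_smul',
    D.om_smul, hb.ortho]
  simp
  field_simp
  ring

include hΓ in
lemma covDeriv_flat_radialField {b : ℝ → ℝ} {b' : ℝ} (hb : HasDerivAt b b' p.1) (u v : ℝ × E6) :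
    covDeriv (coneMetric S) (flat (coneMetric S) (radialField N b)) p ![u, v]
      = b' * (u.1 * v.1) + b p.1 * p.1 * (S.hermitian p.2).g u.2 v.2 := by
  have hF : ∀ q : Cone N, ∀ w : Fin 1 → ℝ × E6,
      flat (coneMetric S) (radialField N b) q w = b q.1 * (w 0).1 := fun q w => by
    change (S.hermitian q.2).coneG q.1 (b q.1, 0) (w 0) = _
    simp [HermitianData.coneG, HermitianData.g_zero]
  have h1 := ((hasDirDeriv_fst u hb).mul (HasDirDeriv.const v.1)).congr
    (G := fun t => flat (coneMetric S) (radialField N b) (chartPoint p t)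
      (fun i => coordVec coneModel p t ((![v] : Fin 1 → ℝ × E6) i))) (by
    filter_upwards [eventually_cone_target p] with t ht
    refine (tensor_chartPoint _ p ht.1 ht.2 _).trans ((hF _ _).trans rfl))
  refine (covDeriv_cone hΓ u ![v] (hF p) h1).trans ?_
  rw [extChartAt_cone_coe]
  simp [HermitianData.coneGamma]
  ring

/-- The curl of a radial field vanishes. -/
lemma curl_radialField {A : Tensor coneModel (Cone N) 3} {c : ℂ}
    (hA : ∀ w : Fin 3 → ℝ × E6, A p w = (S.hermitian p.2).cone₃ p.1 c w) {b : ℝ → ℝ} {b' : ℝ}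
    (hb : HasDerivAt b b' p.1) (w : Fin 1 → ℝ × E6) :
    curl (coneMetric S) A (radialField N b) p w = 0 := by
  obtain ⟨Γ, hΓ⟩ := exists_linkConnection S p.2
  set D := S.hermitian p.2 with hD
  set e := coneE S p
  set F : Fin 7 → Fin 7 → ℝ := fun i j => (b' * ((e i).1 * (e j).1) + b p.1 * p.1 * D.g (e i).2 (e j).2)
    * D.cone₃ p.1 c ![e i, e j, w 0] with hF
  have h1 : curl (coneMetric S) A (radialField N b) p w = ∑ i, ∑ j, F i j :=
    Finset.sum_congr rfl fun i _ => Finset.sum_congr rfl fun j _ =>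
      congrArg₂ (· * ·) (covDeriv_flat_radialField hΓ hb _ _) (hA _)
  -- The covariant derivative of `b dr` is symmetric, while `φ` is alternating.
  have h2 : ∀ i j, F j i = -F i j := fun i j => by
    simp only [hF]
    rw [HermitianData.isAlternating_cone₃.swap₀, D.g_symm (e j).2]
    ring
  have h3 : ∑ i, ∑ j, F i j = -∑ i, ∑ j, F i j := by
    conv_lhs => rw [Finset.sum_comm]
    rw [← Finset.sum_neg_distrib]
    refine Finset.sum_congr rfl fun i _ => ?_
    rw [← Finset.sum_neg_distrib]
    exact Finset.sum_congr rfl fun j _ => h2 i j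
  rw [h1]
  exact self_eq_neg.1 h3

lemma vectorInChart_radialField (b : ℝ → ℝ) {y : ℝ × E6}
    (hy : 0 < y.1) (hy2 : y.2 ∈ (extChartAt (𝓡 6) p.2).target) :
    vectorInChart (radialField N b) p y = ((b y.1, 0) : ℝ × E6) := by
  have : IsManifold coneModel 1 (Cone N) := IsManifold.of_le (n := ∞) (by simp)
  have h1 := coordVec_cone p hy hy2 (b y.1, 0)
  rw [map_zero] at h1
  have h2 := mfderiv_extChartAt_comp_mfderivWithin_extChartAt_symm (I := coneModel)
    (mem_extChartAt_cone_target p hy hy2)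
  have h3 := congrArg (fun L : ℝ × E6 →L[ℝ] ℝ × E6 => L (b y.1, 0)) h2
  refine Eq.trans ?_ h3
  refine congrArg (mfderiv coneModel 𝓘(ℝ, ℝ × E6) (extChartAt coneModel p)
    ((extChartAt coneModel p).symm y)) ?_
  refine Eq.trans ?_ h1.symm
  have h4 := extChartAt_cone_symm p hy
  have key : ∀ (a c : Cone N) (h : a = c), (radialField N b a : ℝ × E6) = radialField N b c := by
    rintro a _ rfl; rfl
  exact key _ _ h4

lemma lieDerivMetric_radialField {b : ℝ → ℝ} {b' : ℝ} (hb : HasDerivAt b b' p.1) (u v : ℝ × E6) :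
    lieDerivMetric (radialField N b) (coneMetric S) p u v
      = 2 * b' * (u.1 * v.1) + 2 * b p.1 * p.1 * (S.hermitian p.2).g u.2 v.2 := by
  set D := S.hermitian p.2 with hD
  have h1 : HasFDerivAt (vectorInChart (radialField N b) p)
      ((((ContinuousLinearMap.toSpanSingleton ℝ b').comp (ContinuousLinearMap.fst ℝ ℝ E6)).prod 0 :
        ℝ × E6 →L[ℝ] ℝ × E6)) (extChartAt coneModel p p) := by
    have h2 : HasFDerivAt (fun y : ℝ × E6 => ((b y.1, 0) : ℝ × E6))
        (((ContinuousLinearMap.toSpanSingleton ℝ b').comp (ContinuousLinearMap.fst ℝ ℝ E6)).prod 0)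
        (extChartAt coneModel p p) := by
      refine HasFDerivAt.prodMk ?_ (hasFDerivAt_const _ _)
      refine HasFDerivAt.comp _ ?_ hasFDerivAt_fst
      rw [extChartAt_cone_coe]
      exact hb.hasFDerivAt
    refine h2.congr_of_eventuallyEq ?_
    filter_upwards [eventually_cone_target p] with y hy
    exact vectorInChart_radialField b hy.1 hy.2
  have h3 : lieDerivMetric (radialField N b) (coneMetric S) p u v =
    metricDeriv (coneMetric S) p ((b p.1, 0) : ℝ × E6) u v
      + D.coneG p.1 (fderiv ℝ (vectorInChart (radialField N b) p) (extChartAt coneModel p p) u) v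
      + D.coneG p.1 u (fderiv ℝ (vectorInChart (radialField N b) p) (extChartAt coneModel p p) v) := rfl
  have h4 : metricJet S p.2 0 u.2 v.2 = 0 := by simp [metricJet]
  rw [h3, metricDeriv_cone, h1.fderiv, h4]
  simp [HermitianData.coneG, D.g_zero, D.g_zero', ← hD]
  ring

end ConeTorsion

end ConeSoliton

/-! ### Reduction of the soliton system to the angle equation. -/

namespace ConeSoliton

open Set Filter

section SolitonSystem

variable {N : Type*} [TopologicalSpace N] [ChartedSpace E6 N] [IsManifold (𝓡 6) ∞ N]
  (S : NearlyKahler N)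

/-- Near `p` the isometric structure is given by `a = sin θ` and `f = cos θ`, where `θ` depends only on
the radius. -/
structure IsLocalAngle (f : Cone N → ℝ) (a θ : ℝ → ℝ) (p : Cone N) : Prop where
  differentiableAt : ∀ᶠ t in 𝓝 (p.1 : ℝ), DifferentiableAt ℝ θ t
  differentiableAt_deriv : DifferentiableAt ℝ (deriv θ) (p.1 : ℝ)
  eq_sin : ∀ᶠ t in 𝓝 (p.1 : ℝ), a t = Real.sin (θ t)
  eq_cos : ∀ᶠ q in 𝓝 p, f q = Real.cos (θ q.1)

namespace IsLocalAngle

omit [ChartedSpace E6 N] [IsManifold (𝓡 6) ∞ N] in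
lemma tendsto_radius (p : Cone N) : Tendsto (fun q : Cone N => (q.1 : ℝ)) (𝓝 p) (𝓝 (p.1 : ℝ)) :=
  (continuous_subtype_val.comp continuous_fst).continuousAt

variable {f : Cone N → ℝ} {a θ : ℝ → ℝ} {p : Cone N} (h : IsLocalAngle f a θ p)

include h

lemma solitonPhi : ∀ᶠ q in 𝓝 p, ∀ w : Fin 3 → ℝ × E6, solitonPhi S f a q w
    = (S.hermitian q.2).cone₃ q.1 ⟨Real.cos (2 * θ q.1), -Real.sin (2 * θ q.1)⟩ w := by
  filter_upwards [h.eq_cos, (tendsto_radius p).eventually h.eq_sin] with q hc hs w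
  rw [solitonPhi_eq S (by rw [hc, hs, Real.cos_sq_add_sin_sq]), hc, hs, conePhase]
  congr 2
  · rw [Real.cos_two_mul']
  · rw [Real.sin_two_mul]; ring

/-- The phase is `exp(-2iθ)`, so its angular velocity is `-2 θ'`. The formula is needed on a
neighbourhood because the divergence differentiates it. -/
lemma torsion : ∀ᶠ q in 𝓝 p, ∀ w : Fin 2 → ℝ × E6,
    torsion (coneMetric S) (coneVol S) (ConeSoliton.solitonPhi S f a) q w
    = (S.hermitian q.2).coneTorsion q.1 ⟨Real.cos (2 * θ q.1), -Real.sin (2 * θ q.1)⟩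
      (-2 * deriv θ q.1) (w 0) (w 1) := by
  filter_upwards [(h.solitonPhi S).eventually_nhds,
    (tendsto_radius p).eventually h.differentiableAt] with q hq hd w
  have h1 := hd.hasDerivAt.const_mul 2
  refine torsion_cone (g₁ := fun t => Real.cos (2 * θ t)) (g₂ := fun t => -Real.sin (2 * θ t)) hq
    ?_ ?_ ?_ w
  · rw [Complex.normSq_apply]
    nlinarith [Real.sin_sq_add_cos_sq (2 * θ q.1)]
  · refine h1.cos.congr_deriv ?_
    ring
  · refine h1.sin.neg.congr_deriv ?_
    ring

/-- Here `|exp(-2iθ) - 1|² = 4 sin²θ`. -/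
lemma torsionNormSq : torsionNormSq S f a p
    = 4 * deriv θ p.1 ^ 2 + 24 * Real.sin (θ p.1) ^ 2 / (p.1 : ℝ) ^ 2 := by
  refine (normSq_torsion_cone (h.torsion S).self_of_nhds).trans ?_
  have h1 : (-Real.sin (2 * θ p.1)) ^ 2 + (Real.cos (2 * θ p.1) - 1) ^ 2
      = 4 * Real.sin (θ p.1) ^ 2 := by
    linear_combination Real.sin_sq_add_cos_sq (2 * θ p.1) - 2 * Real.cos_two_mul (θ p.1)
      - 4 * Real.sin_sq_add_cos_sq (θ p.1)
  rw [h1]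
  ring

lemma divergence (w : Fin 1 → ℝ × E6) : divergence (coneMetric S)
    (ConeSoliton.torsion (coneMetric S) (coneVol S) (ConeSoliton.solitonPhi S f a)) p w
      = (-2 * deriv (deriv θ) p.1 - 12 * deriv θ p.1 / p.1
        + 6 * Real.sin (2 * θ p.1) / (p.1 : ℝ) ^ 2) * (w 0).1 := by
  have h1 := h.differentiableAt.self_of_nhds.hasDerivAt.const_mul 2
  rw [divergence_torsion_cone (g₁ := fun t => Real.cos (2 * θ t)) (g₂ := fun t => -Real.sin (2 * θ t))
    (k := fun t => -2 * deriv θ t) (h.torsion S) h1.cos h1.sin.neg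
    (h.differentiableAt_deriv.hasDerivAt.const_mul (-2))]
  ring

lemma curl {b : ℝ → ℝ} {b' : ℝ} (hb : HasDerivAt b b' p.1) (w : Fin 1 → ℝ × E6) :
    curl (coneMetric S) (ConeSoliton.solitonPhi S f a) (radialField N b) p w = 0 :=
  curl_radialField (h.solitonPhi S).self_of_nhds hb w

lemma interior_torsion (b : ℝ → ℝ) (w : Fin 1 → ℝ × E6) : interior (radialField N b)
    (ConeSoliton.torsion (coneMetric S) (coneVol S) (ConeSoliton.solitonPhi S f a)) p w
      = -2 * deriv θ p.1 * b p.1 * (w 0).1 := by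
  refine ((h.torsion S).self_of_nhds (Matrix.vecCons ((b p.1, 0) : ℝ × E6) w)).trans ?_
  simp [HermitianData.coneTorsion, HermitianData.g_zero, HermitianData.om_zero]
  ring

/-- The soliton equation for the torsion at a point, for the vector field `c r ∂/∂r`. -/
theorem soliton_iff {b : ℝ → ℝ} {c : ℝ} (hb : ∀ᶠ t in 𝓝 (p.1 : ℝ), b t = c * t) :
    (∀ w : Fin 1 → ℝ × E6, ConeSoliton.divergence (coneMetric S)
      (ConeSoliton.torsion (coneMetric S) (coneVol S) (ConeSoliton.solitonPhi S f a)) p w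
      = -(1 / 2) * ConeSoliton.curl (coneMetric S) (ConeSoliton.solitonPhi S f a) (radialField N b) p w
        + interior (radialField N b)
          (ConeSoliton.torsion (coneMetric S) (coneVol S) (ConeSoliton.solitonPhi S f a)) p w)
    ↔ AngleODE c θ p.1 := by
  have hr := cone_r_ne_zero p
  have hb' : HasDerivAt b c p.1 := by
    have := ((hasDerivAt_id (p.1 : ℝ)).const_mul c).congr_of_eventuallyEq hb
    simpa using this
  have h2 : ∀ w : Fin 1 → ℝ × E6, (ConeSoliton.divergence (coneMetric S)
      (ConeSoliton.torsion (coneMetric S) (coneVol S) (ConeSoliton.solitonPhi S f a)) p w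
      = -(1 / 2) * ConeSoliton.curl (coneMetric S) (ConeSoliton.solitonPhi S f a) (radialField N b) p w
        + interior (radialField N b)
          (ConeSoliton.torsion (coneMetric S) (coneVol S) (ConeSoliton.solitonPhi S f a)) p w) ↔
      (deriv (deriv θ) p.1 + (6 / p.1 - c * p.1) * deriv θ p.1 - 3 * Real.sin (2 * θ p.1) / (p.1 : ℝ) ^ 2)
        * (w 0).1 = 0 := fun w => by
    rw [h.divergence S w, h.curl S hb' w, h.interior_torsion S b w, hb.self_of_nhds]
    constructor
    · intro h3
      linear_combination (-1 / 2) * h3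
    · intro h3
      linear_combination (-2) * h3
  constructor
  · intro H
    have h3 := (h2 (fun _ => (1, 0))).1 (H _)
    rw [mul_one] at h3
    exact sub_eq_zero.1 h3
  · intro H w
    refine (h2 w).2 ?_
    rw [sub_eq_zero.2 H, zero_mul]

end IsLocalAngle

/-- The Lie derivative is `2 b' dr² + 2 b r g_N`; testing on `∂/∂r` and on a unit vector of the link
gives the two conditions. -/
theorem lieDerivMetric_radialField_iff (p : Cone N) {b : ℝ → ℝ} (c : ℝ) {b' : ℝ}
    (hb : HasDerivAt b b' p.1) : (∀ u v : ℝ × E6, lieDerivMetric (radialField N b) (coneMetric S) p u v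
      = 2 * c * coneMetric S p u v) ↔ b' = c ∧ b p.1 = c * p.1 := by
  have hr := cone_r_ne_zero p
  obtain ⟨e, he⟩ := S.exists_adaptedBasis p.2 (c := 1) (by simp)
  constructor
  · intro h
    have h1 := h ((1, 0) : ℝ × E6) ((1, 0) : ℝ × E6)
    have h2 := h ((0, e 0) : ℝ × E6) ((0, e 0) : ℝ × E6)
    rw [lieDerivMetric_radialField hb, coneMetric_eq, HermitianData.coneG] at h1 h2
    rw [HermitianData.g_zero] at h1
    rw [he.ortho] at h2
    refine ⟨by linarith, ?_⟩
    apply mul_left_cancel₀ hr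
    simp only [if_true] at h2
    linear_combination h2 / 2
  · rintro ⟨rfl, h2⟩ u v
    rw [lieDerivMetric_radialField hb, coneMetric_eq, HermitianData.coneG, h2]
    ring

end SolitonSystem

end ConeSoliton

/-! ### Local angles for arbitrary solitons, and the limits of the torsion. -/

namespace ConeSoliton

open Set Filter

lemma ContDiffAt.differentiableAt_two {θ : ℝ → ℝ} {r : ℝ} (h : ContDiffAt ℝ 2 θ r) :
    (∀ᶠ t in 𝓝 r, DifferentiableAt ℝ θ t) ∧ DifferentiableAt ℝ (deriv θ) r := by
  refine ⟨(h.eventually (by decide)).mono fun t ht => ht.differentiableAt (by simp), ?_⟩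
  have h1 : ContDiffAt ℝ 1 (fun t => fderiv ℝ θ t 1) r :=
    (h.fderiv_right (m := 1) (by norm_num)).clm_apply contDiffAt_const
  exact h1.differentiableAt (by simp)

section Angle

variable {N : Type*} [TopologicalSpace N] [ChartedSpace E6 N] [IsManifold (𝓡 6) ∞ N]

-- Where `f ≠ 0` one has `|a| < 1`, so `arcsin a` is smooth. It has nonnegative cosine, hence `θ =
-- arcsin a` if `f > 0` and `θ = π - arcsin a` if `f < 0`; continuity fixes the sign of `f` nearby,
-- also in the directions of the link.
omit [ChartedSpace E6 N] [IsManifold (𝓡 6) ∞ N] in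
lemma exists_isLocalAngle {f : Cone N → ℝ} {a : ℝ → ℝ} (hf : Continuous f)
    (ha : ContDiffOn ℝ ∞ a (Ioi 0)) (h : ∀ q : Cone N, f q ^ 2 + a q.1 ^ 2 = 1) {p : Cone N}
    (hp : f p ≠ 0) : ∃ θ, IsLocalAngle f a θ p := by
  have hr : (0 : ℝ) < p.1 := p.1.2
  have ha' : ContDiffAt ℝ 2 a p.1 := (ha.contDiffAt (Ioi_mem_nhds hr)).of_le two_le_infty
  have h1 : ∀ q : Cone N, f q ≠ 0 → a q.1 ∈ Ioo (-1 : ℝ) 1 := fun q hq => by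
    have := h q
    have h2 : 0 < f q ^ 2 := by positivity
    exact abs_lt.1 (by rw [← sq_lt_one_iff_abs_lt_one]; linarith)
  have h3 : ContDiffAt ℝ 2 (fun t => Real.arcsin (a t)) p.1 :=
    (Real.contDiffAt_arcsin (h1 p hp).1.ne' (h1 p hp).2.ne).comp _ ha'
  have h4 : ∀ᶠ t in 𝓝 (p.1 : ℝ), Real.sin (Real.arcsin (a t)) = a t := by
    filter_upwards [ha'.continuousAt.eventually (Ioo_mem_nhds (h1 p hp).1 (h1 p hp).2)] with t ht
    exact Real.sin_arcsin ht.1.le ht.2.le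
  have h5 : ∀ q : Cone N, Real.cos (Real.arcsin (a q.1)) = |f q| := fun q => by
    rw [Real.cos_arcsin, ← Real.sqrt_sq_eq_abs, ← h q, add_sub_cancel_right]
  rcases lt_or_gt_of_ne hp with hlt | hgt
  · have h6 : ContDiffAt ℝ 2 (fun t => Real.pi - Real.arcsin (a t)) p.1 := contDiffAt_const.sub h3
    obtain ⟨h7, h8⟩ := ContDiffAt.differentiableAt_two h6
    refine ⟨_, h7, h8, ?_, ?_⟩
    · filter_upwards [h4] with t ht
      rw [Real.sin_pi_sub, ht]
    · filter_upwards [hf.continuousAt.eventually (Iio_mem_nhds hlt)] with q hq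
      rw [Real.cos_pi_sub, h5, abs_of_neg hq, neg_neg]
  · obtain ⟨h7, h8⟩ := ContDiffAt.differentiableAt_two h3
    refine ⟨_, h7, h8, ?_, ?_⟩
    · filter_upwards [h4] with t ht
      rw [ht]
    · filter_upwards [hf.continuousAt.eventually (Ioi_mem_nhds hgt)] with q hq
      rw [h5, abs_of_pos hq]

lemma SolitonODE.congr {c r y : ℝ} {a b : ℝ → ℝ} (h : a =ᶠ[𝓝 r] b) (hb : SolitonODE c b r y) :
    SolitonODE c a r y := by
  unfold SolitonODE at hb ⊢
  rw [h.deriv.deriv_eq, h.deriv_eq, h.self_of_nhds]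
  exact hb

variable (S : NearlyKahler N)

theorem eq_mul_of_isConeSoliton [Nonempty N] {f : Cone N → ℝ} {a b : ℝ → ℝ} {c : ℝ}
    (hb : ContDiffOn ℝ ∞ b (Ioi 0)) (H : IsConeSoliton S f a b c) {r : ℝ} (hr : 0 < r) :
    b r = c * r := by
  obtain ⟨x⟩ := ‹Nonempty N›
  have h1 : HasDerivAt b (deriv b r) r :=
    ((hb.contDiffAt (Ioi_mem_nhds hr)).differentiableAt (by simp)).hasDerivAt
  exact ((lieDerivMetric_radialField_iff S (⟨⟨r, hr⟩, x⟩ : Cone N) c h1).1 (H.1 _)).2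

theorem IsConeSoliton.angleODE [Nonempty N] {f : Cone N → ℝ} {a b : ℝ → ℝ} {c : ℝ}
    (hb : ContDiffOn ℝ ∞ b (Ioi 0)) (H : IsConeSoliton S f a b c) {p : Cone N} {θ : ℝ → ℝ}
    (hθ : IsLocalAngle f a θ p) : AngleODE c θ p.1 :=
  (hθ.soliton_iff S (by
    filter_upwards [Ioi_mem_nhds (show (0 : ℝ) < p.1 from p.1.2)] with t ht
    exact eq_mul_of_isConeSoliton S hb H ht)).1 (H.2 p)

omit [ChartedSpace E6 N] [IsManifold (𝓡 6) ∞ N] in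
theorem IsLocalAngle.solitonODE {f : Cone N → ℝ} {a θ : ℝ → ℝ} {c : ℝ} {p : Cone N}
    (hθ : IsLocalAngle f a θ p) (hp : f p ≠ 0) (h : AngleODE c θ p.1) : SolitonODE c a p.1 (f p) := by
  rw [hθ.eq_cos.self_of_nhds] at hp ⊢
  exact .congr hθ.eq_sin ((solitonODE_sin_iff_of_eventually hθ.differentiableAt
    hθ.differentiableAt_deriv c (cone_r_ne_zero p) hp).2 h)

theorem IsLocalAngle.torsionNormSq_eq {f : Cone N → ℝ} {a θ : ℝ → ℝ} {p : Cone N}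
    (hθ : IsLocalAngle f a θ p) (hp : f p ≠ 0) :
    (1 / 4) * ConeSoliton.torsionNormSq S f a p
      = deriv a p.1 ^ 2 / f p ^ 2 + 6 * a p.1 ^ 2 / (p.1 : ℝ) ^ 2 := by
  have ha : a =ᶠ[𝓝 (p.1 : ℝ)] fun t => Real.sin (θ t) := hθ.eq_sin
  rw [hθ.torsionNormSq S, ha.deriv_eq, hθ.eq_sin.self_of_nhds,
    hθ.differentiableAt.self_of_nhds.hasDerivAt.sin.deriv]
  rw [hθ.eq_cos.self_of_nhds] at hp ⊢
  field_simp
  ring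

variable {S} {c s : ℝ} {θ : ℝ → ℝ}

omit [ChartedSpace E6 N] [IsManifold (𝓡 6) ∞ N] in
lemma IsAngleSolution.isLocalAngle (h : IsAngleSolution c s θ) (p : Cone N) :
    IsLocalAngle (fun q : Cone N => Real.cos (θ q.1)) (fun r => Real.sin (θ r)) θ p where
  differentiableAt := .of_forall fun t => (ContDiff.hasDerivAt_infty h.smooth t).differentiableAt
  differentiableAt_deriv :=
    (ContDiff.hasDerivAt_infty (ContDiff.deriv_infty h.smooth) _).differentiableAt
  eq_sin := .of_forall fun _ => rfl
  eq_cos := .of_forall fun _ => rfl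

theorem IsAngleSolution.isConeSoliton (h : IsAngleSolution c s θ) :
    IsConeSoliton S (fun q => Real.cos (θ q.1)) (fun r => Real.sin (θ r)) (fun r => c * r) c := by
  refine ⟨fun p => ?_, fun p => ?_⟩
  · exact (lieDerivMetric_radialField_iff S p c (b := fun r => c * r) (b' := c)
      (by simpa using (hasDerivAt_id (p.1 : ℝ)).const_mul c)).2 ⟨rfl, rfl⟩
  · exact ((h.isLocalAngle p).soliton_iff S (.of_forall fun _ => rfl)).2 (h.ode _ (cone_r_ne_zero p))

/-- The norm of the torsion depends on the radius alone, and it is squeezed by `4 · 6/r² + 24/r²`.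
The limit is taken along the preimage of the filter at infinity in the radius, which expresses
uniformity on the link. -/
theorem IsAngleSolution.tendsto_torsion_zero (h : IsAngleSolution c s θ) (hc : c ≤ 0) :
    Tendsto (torsionNormSq S (fun q => Real.cos (θ q.1)) (fun r => Real.sin (θ r)))
      (comap (fun q : Cone N => (q.1 : ℝ)) atTop) (𝓝 0) := by
  have h1 : Tendsto (fun r : ℝ => 48 / r ^ 2) atTop (𝓝 0) :=
    tendsto_const_nhds.div_atTop (tendsto_pow_atTop two_ne_zero)
  refine squeeze_zero (g := fun q : Cone N => 48 / (q.1 : ℝ) ^ 2) (fun q => ?_) (fun q => ?_)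
    (h1.comp tendsto_comap)
  · rw [(h.isLocalAngle q).torsionNormSq S]
    positivity
  · rw [(h.isLocalAngle q).torsionNormSq S]
    have hr : (0 : ℝ) < q.1 := q.1.2
    have h2 := h.sq_deriv_le hc hr
    have h3 : Real.sin (θ q.1) ^ 2 / (q.1 : ℝ) ^ 2 ≤ 1 / (q.1 : ℝ) ^ 2 := by
      gcongr
      exact Real.sin_sq_le_one _
    calc _ = 4 * deriv θ q.1 ^ 2 + 24 * (Real.sin (θ q.1) ^ 2 / (q.1 : ℝ) ^ 2) := by ring
      _ ≤ 4 * (6 / (q.1 : ℝ) ^ 2) + 24 * (1 / (q.1 : ℝ) ^ 2) := by gcongr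
      _ = 48 / (q.1 : ℝ) ^ 2 := by ring

theorem IsAngleSolution.tendsto_torsion_atTop (h : IsAngleSolution c s θ) (hc : 0 < c) (hs : s ≠ 0) :
    Tendsto (torsionNormSq S (fun q => Real.cos (θ q.1)) (fun r => Real.sin (θ r)))
      (comap (fun q : Cone N => (q.1 : ℝ)) atTop) atTop := by
  refine tendsto_atTop_mono (f := fun q : Cone N => deriv θ q.1 ^ 2) (fun q => ?_)
    ((h.tendsto_sq_deriv hc hs).comp tendsto_comap)
  rw [(h.isLocalAngle q).torsionNormSq S]
  have : 0 ≤ 24 * Real.sin (θ q.1) ^ 2 / (q.1 : ℝ) ^ 2 := by positivity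
  nlinarith [sq_nonneg (deriv θ q.1)]

end Angle

end ConeSoliton

theorem proposition4p3 {N : Type*} [TopologicalSpace N] [ChartedSpace ConeSoliton.E6 N]
    [IsManifold (𝓡 6) ∞ N] [Nonempty N] (S : ConeSoliton.NearlyKahler N) :
    -- every radially dependent isometric soliton on the cone
    (∀ (f : ConeSoliton.Cone N → ℝ) (a b : ℝ → ℝ) (c : ℝ),
      ContMDiff ConeSoliton.coneModel 𝓘(ℝ, ℝ) ∞ f →
      ContDiffOn ℝ ∞ a (Set.Ioi 0) → ContDiffOn ℝ ∞ b (Set.Ioi 0) →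
      (∀ q : ConeSoliton.Cone N, f q ^ 2 + a q.1 ^ 2 = 1) →
      ConeSoliton.IsConeSoliton S f a b c →
        (∀ r : ℝ, 0 < r → b r = c * r) ∧
        (∀ q : ConeSoliton.Cone N, f q ≠ 0 → ConeSoliton.SolitonODE c a q.1 (f q)) ∧
        (∀ q : ConeSoliton.Cone N, f q ≠ 0 →
          (1 / 4) * ConeSoliton.torsionNormSq S f a q
            = (deriv a q.1) ^ 2 / f q ^ 2 + 6 * a q.1 ^ 2 / (q.1 : ℝ) ^ 2)) ∧
    -- existence and uniqueness of the one-parameter families of global solutions of the equation,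
    -- which give solitons, and the asymptotics of their torsion
    (∀ c s : ℝ,
      (∃! af : (ℝ → ℝ) × (ℝ → ℝ), ConeSoliton.IsGlobalSolution c s af.1 af.2) ∧
      (∀ a f : ℝ → ℝ, ConeSoliton.IsGlobalSolution c s a f →
        (∀ r, a (-r) = -a r) ∧ (∀ r, f (-r) = f r) ∧
        ConeSoliton.IsConeSoliton S (fun q => f q.1) a (fun r => c * r) c ∧
        (c ≤ 0 → Filter.Tendsto (ConeSoliton.torsionNormSq S (fun q => f q.1) a)
          (Filter.comap (fun q : ConeSoliton.Cone N => (q.1 : ℝ)) Filter.atTop) (𝓝 0)) ∧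
        (0 < c → s ≠ 0 → Filter.Tendsto (ConeSoliton.torsionNormSq S (fun q => f q.1) a)
          (Filter.comap (fun q : ConeSoliton.Cone N => (q.1 : ℝ)) Filter.atTop)
          Filter.atTop))) := by
  refine ⟨fun f a b c hf ha hb hfa H => ⟨fun r hr => ConeSoliton.eq_mul_of_isConeSoliton S hb H hr,
    fun q hq => ?_, fun q hq => ?_⟩, fun c s => ⟨ConeSoliton.existsUnique_isGlobalSolution c s,
    fun a f h => ?_⟩⟩
  · obtain ⟨θ, hθ⟩ := ConeSoliton.exists_isLocalAngle hf.continuous ha hfa hq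
    exact hθ.solitonODE hq (H.angleODE S hb hθ)
  · obtain ⟨θ, hθ⟩ := ConeSoliton.exists_isLocalAngle hf.continuous ha hfa hq
    exact hθ.torsionNormSq_eq S hq
  -- Any global solution is `(sin θ, cos θ)` for a solution `θ` of the angle equation, so its
  -- parity, the soliton property and the asymptotics are statements about `θ`.
  · obtain ⟨θ, hθ, rfl, rfl⟩ := h.exists_angle
    refine ⟨fun r => ?_, fun r => ?_, hθ.isConeSoliton, hθ.tendsto_torsion_zero,
      hθ.tendsto_torsion_atTop⟩
    · simp only [hθ.odd, Real.sin_neg]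
    · simp only [hθ.odd, Real.cos_neg]
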